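/- Let $n\in\mathbb N$, $\alpha>0$, $b>0$ and $r_0=\frac{nb}{2\alpha}>1$. Let $(q,p,r_0)$ be a generalized admissible triplet, that is, $$\frac1q=\frac n{2\alpha}\Big(\frac1{r_0}-\frac1p\Big),\qquad 1<r_0\le p<\begin{cases}\frac{nr_0}{n-2\alpha r_0},& n>2\alpha r_0,\\ \infty,& n\le 2\alpha r_0,\end{cases}$$ (with $q=\infty$ if $p=r_0$), and assume that $b+1<p<r_0(b+1)$. Let $\sigma=\frac{2\alpha}b-\frac np$. Let $S_\alpha(t)=e^{-t(-\Delta)^\alpha}$, $t>0$, be the convolution operator with Fourier symbol $e^{-t|\xi|^{2\alpha}}$. For real- or complex-valued functions, a mild solution on $[0,\infty)$ of $$u_t+(-\Delta)^\alpha u=\pm|u|^bu,\qquad u(0)=\varphi,$$ is a function $u$ with $u(0)=\varphi$ and, for every $t>0$ and almost every $x$, $$u(t)=S_\alpha(t)\varphi\pm\int_0^tS_\alpha(t-\tau)\big(|u(\tau)|^bu(\tau)\big)\,d\tau,$$ the integral in $\tau$ being absolutely convergent. Let $\mathcal C_q([0,\infty);L^p)$ be the set of $u$ that are continuous from $(0,\infty)$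 to $L^p(\mathbb R^n)$ with $\sup_{t>0}t^{1/q}\|u(t)\|_p<\infty$, and $\dot{\mathcal C}_q([0,\infty);L^p)$ the set of those that moreover satisfy $\lim_{t\to0^+}t^{1/q}\|u(t)\|_p=0$. Fix a smooth radial function $\chi$ on $\mathbb R^n$ with $0\le\chi\le1$, $\chi(\xi)=1$ for $|\xi|\le1$ and $\chi(\xi)=0$ for $|\xi|\ge2$, let $\Delta_j$, $j\in\mathbb Z$, be the convolution operator with Fourier symbol $\chi(2^{-j}\xi)-\chi(2^{1-j}\xi)$, and put $\|\varphi\|_{\dot B^{-\sigma}_{p,\infty}}=\sup_{j\in\mathbb Z}2^{-j\sigma}\|\Delta_j\varphi\|_p$. Then there is $\varepsilon>0$, depending only on $n,\alpha,b,p$ and $\chi$ (and not on $\varphi$ or $\|\varphi\|_{L^{r_0}}$), such that for each of the two signs and every $\varphi\in L^{r_0}(\mathbb R^n)$ with $\|\varphi\|_{\dot B^{-\sigma}_{p,\infty}}\le\varepsilon$ the problem has a mild solution $$u\in C\big([0,\infty);L^{r_0}(\mathbb R^n)\big)\cap\mathcal C_q\big([0,\infty);L^p(\mathbb R^n)\big),$$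 and it is the only mild solution in this class. If moreover $p>r_0$ (that is, $q<\infty$), then $u\in\dot{\mathcal C}_q([0,\infty);L^p(\mathbb R^n))$. -/

import Mathlib

open MeasureTheory Filter Topology
open scoped ENNReal FourierTransform Convolution

noncomputable section

/-- The convolution kernel of the Fourier multiplier with the real, even symbol `m`, that is
`x ↦ (2π)⁻ⁿ ∫ exp (i x · ξ) m ξ dξ`, so that convolution with it multiplies the Fourier transform
by `m`. Mathlib's inverse Fourier transform is
`𝓕⁻ g x = ∫ exp (2 π i x · η) g η dη`; the substitution `ξ = 2 π η` gives this form.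
The value is real since `m` is even, see `coe_multiplierKernel`. -/
def multiplierKernel {n : ℕ} (m : EuclideanSpace ℝ (Fin n) → ℝ)
    (x : EuclideanSpace ℝ (Fin n)) : ℝ :=
  (𝓕⁻ (fun η : EuclideanSpace ℝ (Fin n) => ((m ((2 * Real.pi) • η) : ℝ) : ℂ)) x).re

/-- For an even symbol the inverse Fourier transform is real valued, so that taking the real part
in `multiplierKernel` loses nothing. -/
theorem coe_multiplierKernel {n : ℕ} (m : EuclideanSpace ℝ (Fin n) → ℝ)
    (hm : ∀ ξ, m (-ξ) = m ξ) (x : EuclideanSpace ℝ (Fin n)) :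
    ((multiplierKernel m x : ℝ) : ℂ) =
      𝓕⁻ (fun η : EuclideanSpace ℝ (Fin n) => ((m ((2 * Real.pi) • η) : ℝ) : ℂ)) x := by
  unfold multiplierKernel
  rw [← Complex.conj_eq_iff_re, Real.fourierInv_eq', ← integral_conj,
    ← integral_neg_eq_self (μ := volume)]
  refine integral_congr_ae (Eventually.of_forall fun η => ?_)
  simp [← Complex.exp_conj, hm, Complex.conj_ofNat]

/-- Convolution with the kernel of the symbol `m`. -/
def multiplierConv {𝕜 : Type*} [RCLike 𝕜] {n : ℕ} (m : EuclideanSpace ℝ (Fin n) → ℝ)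
    (f : EuclideanSpace ℝ (Fin n) → 𝕜) : EuclideanSpace ℝ (Fin n) → 𝕜 :=
  multiplierKernel m ⋆[ContinuousLinearMap.lsmul ℝ ℝ, volume] f

/-- The semigroup `S_α(t) f = exp (-t (-Δ)^α) f = K_t * f`, for `t > 0`. -/
def fracSemigroup {𝕜 : Type*} [RCLike 𝕜] {n : ℕ} (α t : ℝ)
    (f : EuclideanSpace ℝ (Fin n) → 𝕜) : EuclideanSpace ℝ (Fin n) → 𝕜 :=
  multiplierConv (fun ξ => Real.exp (-t * ‖ξ‖ ^ (2 * α))) f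

/-- The bump functions from which Littlewood-Paley decompositions are built: smooth, radial,
with values in `[0, 1]`, equal to `1` for `|ξ| ≤ 1` and to `0` for `|ξ| ≥ 2`. -/
structure IsLittlewoodPaleyBump {n : ℕ} (χ : EuclideanSpace ℝ (Fin n) → ℝ) : Prop where
  smooth : ContDiff ℝ ((⊤ : ℕ∞) : WithTop ℕ∞) χ
  radial : ∀ ξ η, ‖ξ‖ = ‖η‖ → χ ξ = χ η
  nonneg : ∀ ξ, 0 ≤ χ ξ
  le_one : ∀ ξ, χ ξ ≤ 1
  eq_one : ∀ ξ, ‖ξ‖ ≤ 1 → χ ξ = 1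
  eq_zero : ∀ ξ, 2 ≤ ‖ξ‖ → χ ξ = 0

/-- The dyadic block `Δ_j f = φ_j * f`, where the Fourier symbol of `φ_j` is
`χ (2⁻ʲ ξ) - χ (2 · 2⁻ʲ ξ)`. -/
def dyadicBlock {𝕜 : Type*} [RCLike 𝕜] {n : ℕ} (χ : EuclideanSpace ℝ (Fin n) → ℝ) (j : ℤ)
    (f : EuclideanSpace ℝ (Fin n) → 𝕜) : EuclideanSpace ℝ (Fin n) → 𝕜 :=
  multiplierConv (fun ξ => χ ((2 : ℝ) ^ (-j) • ξ) - χ ((2 * (2 : ℝ) ^ (-j)) • ξ)) f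

/-- The norm of the homogeneous Besov space with indices `s`, `p`, `∞`, that is
`sup_j 2^(j s) ‖Δ_j f‖_p`, for a function `f` in some Lebesgue space `L^r`, `1 ≤ r < ∞`
(such a space contains no polynomial but `0`). -/
def besovNorm {𝕜 : Type*} [RCLike 𝕜] {n : ℕ} (χ : EuclideanSpace ℝ (Fin n) → ℝ) (s p : ℝ)
    (f : EuclideanSpace ℝ (Fin n) → 𝕜) : ℝ≥0∞ :=
  ⨆ j : ℤ, ENNReal.ofReal ((2 : ℝ) ^ ((j : ℝ) * s)) *
    eLpNorm (dyadicBlock χ j f) (ENNReal.ofReal p) volume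

/-- Generalized admissible triplets `(q, p, r)`; the exponent `q` may be `∞`, namely for `p = r`. -/
def IsGeneralizedAdmissible (n : ℕ) (α : ℝ) (q : ℝ≥0∞) (p r : ℝ) : Prop :=
  q⁻¹ = ENNReal.ofReal (n / (2 * α) * (1 / r - 1 / p)) ∧ 1 < r ∧ r ≤ p ∧
    (2 * r * α < n → p < n * r / (n - 2 * α * r))

/-- The critical exponent `r₀ = n b / (2 α)`. -/
def critExponent (n : ℕ) (α b : ℝ) : ℝ := n * b / (2 * α)

/-- `u ∈ C(I; L^r)`. -/
def ContinuousInLp {𝕜 : Type*} [RCLike 𝕜] {n : ℕ} (I : Set ℝ) (r : ℝ)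
    (u : ℝ → (EuclideanSpace ℝ (Fin n) →ₘ[volume] 𝕜)) : Prop :=
  (∀ t ∈ I, MemLp (u t) (ENNReal.ofReal r) volume) ∧
    ∀ t₀ ∈ I, Tendsto (fun t => eLpNorm (u t - u t₀) (ENNReal.ofReal r) volume)
      (𝓝[I] t₀) (𝓝 0)

/-- The weighted norm `t^(1/q) ‖u(t)‖_p`, with `1/q = 0` for `q = ∞`. -/
def weightedNorm {𝕜 : Type*} [RCLike 𝕜] {n : ℕ} (q : ℝ≥0∞) (p : ℝ)
    (u : ℝ → (EuclideanSpace ℝ (Fin n) →ₘ[volume] 𝕜)) (t : ℝ) : ℝ≥0∞ :=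
  ENNReal.ofReal (t ^ (q⁻¹).toReal) * eLpNorm (u t) (ENNReal.ofReal p) volume

/-- The time-weighted space `𝒞_q([0,∞); L^p)`: continuity with values in `L^p` for `t > 0`, and
`sup_{t > 0} t^(1/q) ‖u(t)‖_p < ∞`. -/
def InWeighted {𝕜 : Type*} [RCLike 𝕜] {n : ℕ} (q : ℝ≥0∞) (p : ℝ)
    (u : ℝ → (EuclideanSpace ℝ (Fin n) →ₘ[volume] 𝕜)) : Prop :=
  ContinuousInLp (Set.Ioi 0) p u ∧ (⨆ t ∈ Set.Ioi (0 : ℝ), weightedNorm q p u t) < ⊤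

/-- The homogeneous time-weighted space: moreover `t^(1/q) ‖u(t)‖_p → 0` as `t → 0+`. -/
def InWeightedDot {𝕜 : Type*} [RCLike 𝕜] {n : ℕ} (q : ℝ≥0∞) (p : ℝ)
    (u : ℝ → (EuclideanSpace ℝ (Fin n) →ₘ[volume] 𝕜)) : Prop :=
  InWeighted q p u ∧ Tendsto (weightedNorm q p u) (𝓝[>] 0) (𝓝 0)

/-- The nonlinearity `f(u) = κ |u|^b u`, where `κ = ±1`. -/
def powerNonlinearity {𝕜 : Type*} [RCLike 𝕜] (κ b : ℝ) (z : 𝕜) : 𝕜 := (κ * ‖z‖ ^ b) • z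

/-- Mild solutions on `[0, ∞)` of `u_t + (-Δ)^α u = κ |u|^b u`, `u(0) = φ`, that is, solutions of
`u(t) = S_α(t) φ + ∫_0^t S_α(t-τ) f(u(τ)) dτ`, an identity of functions of `x` which holds almost
everywhere for every `t`; the integral is required to converge absolutely. -/
def IsMildSolution {𝕜 : Type*} [RCLike 𝕜] {n : ℕ} (α b κ : ℝ)
    (φ : EuclideanSpace ℝ (Fin n) → 𝕜)
    (u : ℝ → (EuclideanSpace ℝ (Fin n) →ₘ[volume] 𝕜)) : Prop :=
  (u 0 =ᵐ[volume] φ) ∧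
    ∀ t : ℝ, 0 < t → ∀ᵐ x ∂(volume : Measure (EuclideanSpace ℝ (Fin n))),
      IntervalIntegrable
        (fun τ => fracSemigroup α (t - τ) (fun y => powerNonlinearity κ b (u τ y)) x)
        volume 0 t ∧
      u t x = fracSemigroup α t φ x +
        ∫ τ in (0 : ℝ)..t,
          fracSemigroup α (t - τ) (fun y => powerNonlinearity κ b (u τ y)) x

end

/-! Existence is a contraction argument at critical scaling. Take P with max(r₀, b + 1) < P < r₀(b +
1) and θ = n/(2α)(1/r₀ - 1/P). If t^θ ‖u(t)‖_P ≤ M, then |u|^b u has norm O(M^{b+1} τ^{-θ(b+1)}) in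
L^{P/(b+1)}, and the semigroup pays (t-τ)^{-nb/(2αP)} to return to L^P. Both exponents are below 1,
and the resulting Beta integral is a multiple of t^{-θ}; with target L^{r₀} it is bounded uniformly
in t. No power of t is left over, so smallness has to come from sup_t t^θ ‖S(t)φ‖_P
(`SubcriticalExponent.exists_duhamelBounds`, `SubcriticalExponent.exists_fixedPoint`).

The Besov norm controls this supremum: the block of S(t)φ at frequency 2^j is bounded in L^P by a
multiple of (1 + t 2^{2αj})^{-1} 2^{jn(1/p-1/P)} ‖Δ_j φ‖_p, and since 0 < θ < 1 the sum over j is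
O(t^{-θ}) (`IsLittlewoodPaleyBump.exists_eLpNorm_fracSemigroup_le_besovNorm`). For p > r₀ one takes
P = p. For p = r₀ the weight would be trivial, so an auxiliary P > p is used, and the passage from p
to P is part of the block estimate. The L^{r₀} norm of φ enters only qualitatively: by density t^θ
‖S(t)φ‖_P → 0 as t → 0, the fixed point inherits this (`SubcriticalExponent.weight_le_of_free_le`),
and therefore the Duhamel term tends to 0 in L^{r₀}.

The uniqueness class contains no smallness, so smallness is produced locally in time and uniqueness
is continued from T to T + δ (`ContinuousInLp.eq_of_local`). For p > r₀, interpolation between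
continuity in L^{r₀} and the bounded weighted L^p norm makes the weighted norm of an intermediate
exponent small near the starting time (`SubcriticalExponent.eq_of_isMildSolution`). For p = r₀ > b +
1 only continuity in L^{r₀} is available, and the strong Duhamel estimate diverges logarithmically.
The difference is then measured in weak L^{r₀}, where the time integral converges at the endpoint
(`HeatBounds.hasWeakBound_duhamel`); the nonlinearity is split by a bounded approximation of the
solution at time T into a part with small critical coefficient and a part that gains a factor of
time (`eq_of_isMildSolution_of_add_one_lt`).

Since α > 0 is arbitrary, the heat kernel need not be positive and its symbol need not be smooth at
the origin. Its integrability is obtained by a dyadic decomposition in frequency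
(`IsLittlewoodPaleyBump.exists_decay_heatKernel_one`). -/

open MeasureTheory Filter Topology
open scoped ENNReal FourierTransform Convolution

/-! ### Decay of inverse Fourier transforms of a e^{-sρ}, uniformly in s. -/

section Symbols

variable {V : Type*} [NormedAddCommGroup V] [InnerProductSpace ℝ V] [FiniteDimensional ℝ V]
  [MeasurableSpace V] [BorelSpace V]

/-- Smooth compactly supported amplitudes `a` such that the phase `ρ` is smooth and at least `c`
near the support of `a`. -/
structure AdmissibleSymbol (ρ : V → ℝ) (c : ℝ) (a : V → ℂ) : Prop where
  smooth : ContDiff ℝ ((⊤ : ℕ∞) : WithTop ℕ∞) a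
  compact : HasCompactSupport a
  le : ∀ η ∈ tsupport a, c ≤ ρ η
  smoothAt : ∀ η ∈ tsupport a, ContDiffAt ℝ ((⊤ : ℕ∞) : WithTop ℕ∞) ρ η

theorem contDiff_of_forall_mem_tsupport {F : Type*} [NormedAddCommGroup F] [NormedSpace ℝ F]
    {k : WithTop ℕ∞} {f : V → F} (h : ∀ x ∈ tsupport f, ContDiffAt ℝ k f x) : ContDiff ℝ k f := by
  rw [contDiff_iff_contDiffAt]
  intro x
  by_cases hx : x ∈ tsupport f
  · exact h x hx
  · exact contDiffAt_const.congr_of_eventuallyEq (notMem_tsupport_iff_eventuallyEq.1 hx)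

variable {ρ : V → ℝ} {c : ℝ} {a : V → ℂ}

namespace AdmissibleSymbol

theorem mul (h : AdmissibleSymbol ρ c a) {g : V → ℂ}
    (hg : ∀ η ∈ tsupport a, ContDiffAt ℝ ((⊤ : ℕ∞) : WithTop ℕ∞) g η) :
    AdmissibleSymbol ρ c (fun η => a η * g η) := by
  have hs : tsupport (fun η => a η * g η) ⊆ tsupport a := tsupport_mul_subset_left
  refine ⟨contDiff_of_forall_mem_tsupport fun x hx => ?_, h.compact.mul_right,
    fun η hη => h.le η (hs hη), fun η hη => h.smoothAt η (hs hη)⟩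
  exact h.smooth.contDiffAt.mul (hg x (hs hx))

theorem fderiv_apply (h : AdmissibleSymbol ρ c a) (v : V) :
    AdmissibleSymbol ρ c (fun η => fderiv ℝ a η v) := by
  have hs : tsupport (fun η => fderiv ℝ a η v) ⊆ tsupport a := tsupport_fderiv_apply_subset ℝ v
  refine ⟨?_, h.compact.fderiv_apply ℝ v, fun η hη => h.le η (hs hη),
    fun η hη => h.smoothAt η (hs hη)⟩
  exact (h.smooth.fderiv_right (m := ((⊤ : ℕ∞) : WithTop ℕ∞)) (by simp)).clm_apply contDiff_const

theorem mul_fderiv (h : AdmissibleSymbol ρ c a) (v : V) :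
    AdmissibleSymbol ρ c (fun η => a η * ((fderiv ℝ ρ η v : ℝ) : ℂ)) := by
  refine h.mul fun η hη => ?_
  have h1 := (h.smoothAt η hη).fderiv_right (m := ((⊤ : ℕ∞) : WithTop ℕ∞)) (by simp)
  exact Complex.ofRealCLM.contDiff.contDiffAt.comp η (h1.clm_apply contDiffAt_const)

theorem exp_contDiffAt (h : AdmissibleSymbol ρ c a) (s : ℝ) {η : V} (hη : η ∈ tsupport a) :
    ContDiffAt ℝ ((⊤ : ℕ∞) : WithTop ℕ∞) (fun η => ((Real.exp (-(s * ρ η)) : ℝ) : ℂ)) η :=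
  Complex.ofRealCLM.contDiff.contDiffAt.comp η
    (contDiffAt_const.mul (h.smoothAt η hη)).neg.exp

theorem mul_exp (h : AdmissibleSymbol ρ c a) (s : ℝ) :
    AdmissibleSymbol ρ c (fun η => a η * ((Real.exp (-(s * ρ η)) : ℝ) : ℂ)) :=
  h.mul fun _ hη => h.exp_contDiffAt s hη

theorem mul_exp_sub_one (h : AdmissibleSymbol ρ c a) (s : ℝ) :
    AdmissibleSymbol ρ c (fun η => a η * ((Real.exp (-(s * ρ η)) - 1 : ℝ) : ℂ)) := by
  refine h.mul fun η hη => ?_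
  simpa using (h.exp_contDiffAt s hη).sub (contDiffAt_const (c := (1 : ℂ)))

theorem integrable (h : AdmissibleSymbol ρ c a) : Integrable a :=
  h.smooth.continuous.integrable_of_hasCompactSupport h.compact

/-- A derivative stays within the family of symbols: the amplitude becomes ∂a or a ∂ρ, and each ∂ρ
costs a factor s. The values r = 0 and r = 1 treat e^{-sρ} and e^{-sρ} - 1 together. -/
theorem fderiv_mul_exp_add (h : AdmissibleSymbol ρ c a) (s r : ℝ) (v η : V) :
    fderiv ℝ (fun η => a η * ((Real.exp (-(s * ρ η)) - r : ℝ) : ℂ)) η v =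
      fderiv ℝ a η v * ((Real.exp (-(s * ρ η)) - r : ℝ) : ℂ) -
        s * (a η * ((fderiv ℝ ρ η v : ℝ) : ℂ) * ((Real.exp (-(s * ρ η)) : ℝ) : ℂ)) := by
  by_cases hη : η ∈ tsupport a
  · have h1 : HasFDerivAt a (fderiv ℝ a η) η :=
      (h.smooth.differentiable (by simp) η).hasFDerivAt
    have h2 : HasFDerivAt ρ (fderiv ℝ ρ η) η :=
      ((h.smoothAt η hη).differentiableAt (by simp)).hasFDerivAt
    have h3 : HasFDerivAt (fun η => Real.exp (-(s * ρ η)) - r) _ η :=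
      ((h2.const_mul s).neg.exp).sub_const r
    have h4 := h1.mul (Complex.ofRealCLM.hasFDerivAt.comp η h3)
    have h5 := h4.fderiv
    simp only [Function.comp_def, Complex.ofRealCLM_apply] at h5
    have h6 := congrArg (fun L => L v) h5
    refine Eq.trans (by simp only [Pi.mul_def]) (h6.trans ?_)
    simp
    ring
  · have h0 : a =ᶠ[𝓝 η] 0 := notMem_tsupport_iff_eventuallyEq.1 hη
    have h1 : (fun η => a η * ((Real.exp (-(s * ρ η)) - r : ℝ) : ℂ)) =ᶠ[𝓝 η] fun _ => 0 := by
      filter_upwards [h0] with y hy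
      simp [hy]
    rw [h1.fderiv_eq, h0.fderiv_eq, h0.eq_of_nhds]
    simp

end AdmissibleSymbol

theorem norm_fourierInv_le (f : V → ℂ) (x : V) : ‖𝓕⁻ f x‖ ≤ ∫ η, ‖f η‖ := by
  rw [Real.fourierInv_eq_fourier_neg]
  exact VectorFourier.norm_fourierIntegral_le_integral_norm _ _ _ _ _

theorem norm_inner_mul_fourierInv_le {f : V → ℂ} (hf : ContDiff ℝ 1 f)
    (hc : HasCompactSupport f) (v x : V) :
    |inner ℝ v x| * ‖𝓕⁻ f x‖ ≤ ‖𝓕⁻ (fun η => fderiv ℝ f η v) x‖ := by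
  have hf' : Integrable (fderiv ℝ f) :=
    (hf.continuous_fderiv (by simp)).integrable_of_hasCompactSupport (hc.fderiv ℝ)
  have h := Real.fourier_fderiv (hf.continuous.integrable_of_hasCompactSupport hc)
    (hf.differentiable (by simp)) hf'
  have h2 := congrArg (fun g => g (-x) v) h
  simp only [VectorFourier.fourierSMulRight_apply] at h2
  rw [Real.fourier_continuousLinearMap_apply hf'] at h2
  rw [Real.fourierInv_eq_fourier_neg, Real.fourierInv_eq_fourier_neg, h2]
  simp only [norm_smul, norm_neg, norm_mul, Complex.norm_I, Complex.norm_real, Real.norm_eq_abs,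
    neg_apply]
  simp only [mul_one, Complex.norm_ofNat, abs_of_pos Real.pi_pos]
  have hv : |innerSL ℝ (-x) v| = |inner ℝ v x| := by
    rw [innerSL_apply_apply, inner_neg_left, abs_neg, real_inner_comm]
  rw [hv]
  nlinarith [mul_nonneg (abs_nonneg (inner ℝ v x)) (norm_nonneg (𝓕 f (-x))), Real.pi_gt_three]

theorem fourierInv_sub_apply {f g : V → ℂ} (hf : Integrable f) (hg : Integrable g) (x : V) :
    𝓕⁻ (fun η => f η - g η) x = 𝓕⁻ f x - 𝓕⁻ g x := by
  have h1 := (Real.fourierIntegral_convergent_iff (-x)).2 hf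
  have h2 := (Real.fourierIntegral_convergent_iff (-x)).2 hg
  simp only [Real.fourierInv_eq_fourier_neg, Real.fourier_eq, smul_sub]
  exact integral_sub h1 h2

theorem fourierInv_const_mul_apply (r : ℂ) (f : V → ℂ) (x : V) :
    𝓕⁻ (fun η => r * f η) x = r * 𝓕⁻ f x := by
  simp only [Real.fourierInv_eq', smul_eq_mul, ← integral_const_mul]
  refine integral_congr_ae (Eventually.of_forall fun η => ?_)
  simp only
  ring

/-- Each factor ⟨v, x⟩ is traded for a frequency derivative. The induction is over all amplitudes
simultaneously because the derivative replaces a by ∂a and a ∂ρ; a step costs at most 1 + s, and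
e^{-cs} comes from ρ ≥ c on the support. -/
theorem abs_inner_pow_mul_fourierInv_mul_exp_le (N : ℕ) (v : V) :
    ∀ a : V → ℂ, AdmissibleSymbol ρ c a → ∃ C : ℝ, 0 ≤ C ∧ ∀ s : ℝ, 0 ≤ s → ∀ x : V,
      |inner ℝ v x| ^ N * ‖𝓕⁻ (fun η => a η * ((Real.exp (-(s * ρ η)) : ℝ) : ℂ)) x‖ ≤
        C * ((1 + s) ^ N * Real.exp (-(c * s))) := by
  induction N with
  | zero =>
    intro a h
    refine ⟨∫ η, ‖a η‖, integral_nonneg fun _ => norm_nonneg _, fun s hs x => ?_⟩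
    simp only [pow_zero, one_mul]
    refine (norm_fourierInv_le _ x).trans ?_
    rw [← integral_mul_const]
    refine integral_mono (h.mul_exp s).integrable.norm (h.integrable.norm.mul_const _) fun η => ?_
    simp only [norm_mul, Complex.norm_real, Real.norm_eq_abs, Real.abs_exp]
    by_cases hη : η ∈ tsupport a
    · have := h.le η hη
      rw [mul_comm c s]
      gcongr
    · simp [image_eq_zero_of_notMem_tsupport hη]
  | succ N ih =>
    intro a h
    obtain ⟨C₁, h₁, H₁⟩ := ih _ (h.fderiv_apply v)
    obtain ⟨C₂, h₂, H₂⟩ := ih _ (h.mul_fderiv v)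
    refine ⟨C₁ + C₂, by positivity, fun s hs x => ?_⟩
    have key := norm_inner_mul_fourierInv_le
      ((h.mul_exp s).smooth.of_le (by simp)) (h.mul_exp s).compact v x
    have hd : (fun η => fderiv ℝ (fun η => a η * ((Real.exp (-(s * ρ η)) : ℝ) : ℂ)) η v) =
        fun η => fderiv ℝ a η v * ((Real.exp (-(s * ρ η)) : ℝ) : ℂ) -
        (s : ℂ) * (a η * ((fderiv ℝ ρ η v : ℝ) : ℂ) * ((Real.exp (-(s * ρ η)) : ℝ) : ℂ)) := by
      ext η
      simpa using h.fderiv_mul_exp_add s 0 v η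
    rw [hd, fourierInv_sub_apply ((h.fderiv_apply v).mul_exp s).integrable
      (((h.mul_fderiv v).mul_exp s).integrable.const_mul _), fourierInv_const_mul_apply] at key
    calc |inner ℝ v x| ^ (N + 1) * ‖𝓕⁻ (fun η => a η * ((Real.exp (-(s * ρ η)) : ℝ) : ℂ)) x‖
        = |inner ℝ v x| ^ N * (|inner ℝ v x| *
          ‖𝓕⁻ (fun η => a η * ((Real.exp (-(s * ρ η)) : ℝ) : ℂ)) x‖) := by ring
      _ ≤ |inner ℝ v x| ^ N * (‖𝓕⁻ (fun η => fderiv ℝ a η v *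
            ((Real.exp (-(s * ρ η)) : ℝ) : ℂ)) x‖ +
          s * ‖𝓕⁻ (fun η => a η * ((fderiv ℝ ρ η v : ℝ) : ℂ) *
          ((Real.exp (-(s * ρ η)) : ℝ) : ℂ)) x‖) := by
        gcongr
        refine key.trans ((norm_sub_le _ _).trans ?_)
        rw [norm_mul, Complex.norm_real, Real.norm_eq_abs, abs_of_nonneg hs]
      _ ≤ C₁ * ((1 + s) ^ N * Real.exp (-(c * s))) +
          s * (C₂ * ((1 + s) ^ N * Real.exp (-(c * s)))) := by
        rw [mul_add, mul_left_comm]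
        exact add_le_add (H₁ s hs x) (mul_le_mul_of_nonneg_left (H₂ s hs x) hs)
      _ ≤ (C₁ + C₂) * ((1 + s) ^ (N + 1) * Real.exp (-(c * s))) := by
        have : 0 ≤ (1 + s) ^ N * Real.exp (-(c * s)) := by positivity
        rw [pow_succ]
        nlinarith [mul_nonneg h₁ hs, mul_nonneg (mul_nonneg h₁ hs) this, mul_nonneg h₂ this]

/-- The gain s has two sources: 1 - e^{-sρ} ≤ sρ when the exponential is not differentiated, and the
explicit factor s when it is. In the second case the remaining symbol is of the previous kind and is
bounded for s ≤ 1. -/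
theorem abs_inner_pow_mul_fourierInv_mul_exp_sub_one_le (hc : 0 ≤ c) (N : ℕ) (v : V) :
    ∀ a : V → ℂ, AdmissibleSymbol ρ c a → ∃ C : ℝ, 0 ≤ C ∧ ∀ s : ℝ, 0 ≤ s → s ≤ 1 → ∀ x : V,
      |inner ℝ v x| ^ N * ‖𝓕⁻ (fun η => a η * ((Real.exp (-(s * ρ η)) - 1 : ℝ) : ℂ)) x‖ ≤
        C * s := by
  induction N with
  | zero =>
    intro a h
    have hint : Integrable (fun η => a η * (ρ η : ℂ)) := (h.mul fun η hη =>
      Complex.ofRealCLM.contDiff.contDiffAt.comp η (h.smoothAt η hη)).integrable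
    refine ⟨∫ η, ‖a η * (ρ η : ℂ)‖, integral_nonneg fun _ => norm_nonneg _, fun s hs _ x => ?_⟩
    simp only [pow_zero, one_mul]
    refine (norm_fourierInv_le _ x).trans ?_
    rw [← integral_mul_const]
    refine integral_mono (h.mul_exp_sub_one s).integrable.norm (hint.norm.mul_const _) fun η => ?_
    simp only [norm_mul, Complex.norm_real, Real.norm_eq_abs]
    by_cases hη : η ∈ tsupport a
    · have h0 : 0 ≤ ρ η := hc.trans (h.le η hη)
      rw [mul_assoc, abs_of_nonneg h0, abs_sub_comm, abs_of_nonneg]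
      · gcongr
        nlinarith [Real.add_one_le_exp (-(s * ρ η))]
      · have : Real.exp (-(s * ρ η)) ≤ 1 := Real.exp_le_one_iff.2 (by nlinarith)
        linarith
    · simp [image_eq_zero_of_notMem_tsupport hη]
  | succ N ih =>
    intro a h
    obtain ⟨C₁, h₁, H₁⟩ := ih _ (h.fderiv_apply v)
    obtain ⟨C₂, h₂, H₂⟩ := abs_inner_pow_mul_fourierInv_mul_exp_le N v _ (h.mul_fderiv v)
    refine ⟨C₁ + C₂ * 2 ^ N, by positivity, fun s hs hs1 x => ?_⟩
    have key := norm_inner_mul_fourierInv_le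
      ((h.mul_exp_sub_one s).smooth.of_le (by simp)) (h.mul_exp_sub_one s).compact v x
    have hd : (fun η => fderiv ℝ (fun η => a η * ((Real.exp (-(s * ρ η)) - 1 : ℝ) : ℂ)) η v) =
        fun η => fderiv ℝ a η v * ((Real.exp (-(s * ρ η)) - 1 : ℝ) : ℂ) -
        (s : ℂ) * (a η * ((fderiv ℝ ρ η v : ℝ) : ℂ) * ((Real.exp (-(s * ρ η)) : ℝ) : ℂ)) := by
      ext η
      exact h.fderiv_mul_exp_add s 1 v η
    rw [hd, fourierInv_sub_apply ((h.fderiv_apply v).mul_exp_sub_one s).integrable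
      (((h.mul_fderiv v).mul_exp s).integrable.const_mul _), fourierInv_const_mul_apply] at key
    have e2 : (1 + s) ^ N * Real.exp (-(c * s)) ≤ 2 ^ N := by
      have e3 : Real.exp (-(c * s)) ≤ 1 := Real.exp_le_one_iff.2 (by nlinarith)
      have e4 : (1 + s) ^ N ≤ 2 ^ N := by gcongr; linarith
      calc (1 + s) ^ N * Real.exp (-(c * s)) ≤ 2 ^ N * 1 := by gcongr
        _ = _ := mul_one _
    calc |inner ℝ v x| ^ (N + 1) *
          ‖𝓕⁻ (fun η => a η * ((Real.exp (-(s * ρ η)) - 1 : ℝ) : ℂ)) x‖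
        = |inner ℝ v x| ^ N * (|inner ℝ v x| *
          ‖𝓕⁻ (fun η => a η * ((Real.exp (-(s * ρ η)) - 1 : ℝ) : ℂ)) x‖) := by ring
      _ ≤ |inner ℝ v x| ^ N * (‖𝓕⁻ (fun η => fderiv ℝ a η v *
            ((Real.exp (-(s * ρ η)) - 1 : ℝ) : ℂ)) x‖ +
          s * ‖𝓕⁻ (fun η => a η * ((fderiv ℝ ρ η v : ℝ) : ℂ) *
          ((Real.exp (-(s * ρ η)) : ℝ) : ℂ)) x‖) := by
        gcongr
        refine key.trans ((norm_sub_le _ _).trans ?_)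
        rw [norm_mul, Complex.norm_real, Real.norm_eq_abs, abs_of_nonneg hs]
      _ ≤ C₁ * s + s * (C₂ * ((1 + s) ^ N * Real.exp (-(c * s)))) := by
        rw [mul_add, mul_left_comm]
        exact add_le_add (H₁ s hs hs1 x) (mul_le_mul_of_nonneg_left (H₂ s hs x) hs)
      _ ≤ C₁ * s + s * (C₂ * 2 ^ N) := by gcongr
      _ = (C₁ + C₂ * 2 ^ N) * s := by ring

theorem one_add_norm_pow_le_sum_inner {ι : Type*} [Fintype ι] (e : OrthonormalBasis ι ℝ V) (N : ℕ) :
    ∃ C : ℝ, 0 ≤ C ∧ ∀ x : V, (1 + ‖x‖) ^ N ≤ C * (1 + ∑ i, |inner ℝ (e i) x| ^ N) := by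
  refine ⟨(1 + Fintype.card ι) ^ N, by positivity, fun x => ?_⟩
  have hle : ‖x‖ ≤ ∑ i, |inner ℝ (e i) x| := by
    conv_lhs => rw [← e.sum_repr x]
    refine (norm_sum_le _ _).trans (Finset.sum_le_sum fun i _ => ?_)
    rw [norm_smul, e.norm_eq_one, mul_one, e.repr_apply_apply, Real.norm_eq_abs]
  set S : ℝ := ∑ i, |inner ℝ (e i) x| ^ N
  have hS : 0 ≤ S := Finset.sum_nonneg fun i _ => by positivity
  -- m is the largest coordinate in absolute value, or 1 if all coordinates are below 1; this avoids
  -- expanding the power of a sum.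
  obtain ⟨m, hm1, hm2, hm3⟩ : ∃ m : ℝ, 1 ≤ m ∧ (∀ i, |inner ℝ (e i) x| ≤ m) ∧ m ^ N ≤ 1 + S := by
    by_cases hN : ∃ i, 1 ≤ |inner ℝ (e i) x|
    · obtain ⟨i₀, h₀⟩ := hN
      obtain ⟨i, -, hi⟩ := Finset.exists_max_image Finset.univ (fun i => |inner ℝ (e i) x|)
        ⟨i₀, Finset.mem_univ _⟩
      refine ⟨|inner ℝ (e i) x|, h₀.trans (hi i₀ (Finset.mem_univ _)),
        fun j => hi j (Finset.mem_univ _), ?_⟩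
      have := Finset.single_le_sum (f := fun i => |inner ℝ (e i) x| ^ N)
        (fun i _ => by positivity) (Finset.mem_univ i)
      exact this.trans (le_add_of_nonneg_left zero_le_one)
    · push Not at hN
      exact ⟨1, le_rfl, fun i => (hN i).le, by simpa using hS⟩
  have h1 : 1 + ‖x‖ ≤ (1 + Fintype.card ι) * m := by
    have : ∑ i, |inner ℝ (e i) x| ≤ Fintype.card ι * m := by
      refine (Finset.sum_le_card_nsmul _ _ m fun i _ => hm2 i).trans ?_
      simp
    nlinarith
  calc (1 + ‖x‖) ^ N ≤ ((1 + Fintype.card ι) * m) ^ N := by gcongr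
    _ = (1 + Fintype.card ι) ^ N * m ^ N := mul_pow _ _ _
    _ ≤ _ := by gcongr

theorem one_add_norm_pow_mul_le {P : V → ℝ} {B : ℝ} (N : ℕ)
    (h0 : ∀ x, P x ≤ B)
    {ι : Type*} [Fintype ι] (e : OrthonormalBasis ι ℝ V)
    (h : ∀ i, ∀ x, |inner ℝ (e i) x| ^ N * P x ≤ B) :
    ∀ x, (1 + ∑ i, |inner ℝ (e i) x| ^ N) * P x ≤ (1 + Fintype.card ι) * B := by
  intro x
  rw [add_mul, one_mul, add_mul, one_mul, Finset.sum_mul]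
  refine add_le_add (h0 x) ((Finset.sum_le_card_nsmul _ _ B fun i _ => h i x).trans ?_)
  simp

/-- Uniform decay of the kernels of `a e^{-s ρ}`. -/
theorem exists_decay_fourierInv_mul_exp (hc : 0 < c) (ha : AdmissibleSymbol ρ c a) (N M : ℕ) :
    ∃ C : ℝ, 0 ≤ C ∧ ∀ s : ℝ, 0 ≤ s → ∀ x : V,
      (1 + ‖x‖) ^ N * ‖𝓕⁻ (fun η => a η * ((Real.exp (-(s * ρ η)) : ℝ) : ℂ)) x‖ ≤
        C * ((1 + s) ^ M)⁻¹ := by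
  set e := stdOrthonormalBasis ℝ V
  obtain ⟨C₀, h₀, H₀⟩ := one_add_norm_pow_le_sum_inner e N
  obtain ⟨C₁, h₁, H₁⟩ := abs_inner_pow_mul_fourierInv_mul_exp_le 0 (0 : V) a ha
  choose C₂ h₂ H₂ using fun i => abs_inner_pow_mul_fourierInv_mul_exp_le N (e i) a ha
  set B : ℝ := C₁ + ∑ i, C₂ i
  have hB1 : C₁ ≤ B := le_add_of_nonneg_right (Finset.sum_nonneg fun i _ => h₂ i)
  have hB2 : ∀ i, C₂ i ≤ B := fun i =>
    (Finset.single_le_sum (fun j _ => h₂ j) (Finset.mem_univ i)).trans (le_add_of_nonneg_left h₁)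
  have hB : 0 ≤ B := h₁.trans hB1
  -- The polynomial (1 + s)^{N+M} is absorbed by e^{c(1+s)}, one term of the exponential series
  -- being enough; the shift from s to 1 + s produces the factor e^c.
  set D : ℝ := (N + M).factorial / c ^ (N + M) * Real.exp c
  have hD : ∀ s : ℝ, 0 ≤ s → (1 + s) ^ N * Real.exp (-(c * s)) ≤ D * ((1 + s) ^ M)⁻¹ := by
    intro s hs
    rw [← div_eq_mul_inv, le_div_iff₀ (by positivity)]
    have := Real.pow_div_factorial_le_exp (c * (1 + s)) (by positivity) (N + M)
    rw [div_le_iff₀ (by positivity), mul_pow] at this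
    have h3 : Real.exp (c * (1 + s)) * Real.exp (-(c * s)) = Real.exp c := by
      rw [← Real.exp_add]; congr 1; ring
    have h4 : (1 + s) ^ (N + M) ≤ (N + M).factorial / c ^ (N + M) * Real.exp (c * (1 + s)) := by
      rw [div_mul_eq_mul_div, le_div_iff₀ (by positivity)]
      linarith
    calc (1 + s) ^ N * Real.exp (-(c * s)) * (1 + s) ^ M
        = (1 + s) ^ (N + M) * Real.exp (-(c * s)) := by ring
      _ ≤ (N + M).factorial / c ^ (N + M) * Real.exp (c * (1 + s)) * Real.exp (-(c * s)) := by
        gcongr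
      _ = D := by rw [mul_assoc, h3]
  refine ⟨C₀ * ((1 + Fintype.card (Fin (Module.finrank ℝ V))) * (B * D)), by positivity,
    fun s hs x => ?_⟩
  have key := one_add_norm_pow_mul_le (B := B * D * ((1 + s) ^ M)⁻¹)
    (P := fun x => ‖𝓕⁻ (fun η => a η * ((Real.exp (-(s * ρ η)) : ℝ) : ℂ)) x‖) N
    (fun x => ?_) e (fun i x => ?_) x
  · calc _ ≤ C₀ * (1 + ∑ i, |inner ℝ (e i) x| ^ N) *
          ‖𝓕⁻ (fun η => a η * ((Real.exp (-(s * ρ η)) : ℝ) : ℂ)) x‖ := by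
          gcongr
          exact H₀ x
      _ ≤ _ := by
          rw [mul_assoc, mul_assoc]
          refine mul_le_mul_of_nonneg_left (key.trans (le_of_eq ?_)) h₀
          ring
  · have h5 := H₁ s hs x
    simp only [pow_zero, one_mul] at h5
    refine h5.trans ?_
    rw [mul_assoc]
    refine mul_le_mul hB1 ((le_mul_of_one_le_left (Real.exp_nonneg _) ?_).trans (hD s hs))
      (Real.exp_nonneg _) hB
    exact one_le_pow₀ (by linarith)
  · refine (H₂ i s hs x).trans ?_
    rw [mul_assoc]
    exact mul_le_mul (hB2 i) (hD s hs) (by positivity) hB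

/-- Uniform decay of the kernels of `a (e^{-s ρ} - 1)` for `s ≤ 1`. -/
theorem exists_decay_fourierInv_mul_exp_sub_one (hc : 0 ≤ c) (ha : AdmissibleSymbol ρ c a)
    (N : ℕ) :
    ∃ C : ℝ, 0 ≤ C ∧ ∀ s : ℝ, 0 ≤ s → s ≤ 1 → ∀ x : V,
      (1 + ‖x‖) ^ N * ‖𝓕⁻ (fun η => a η * ((Real.exp (-(s * ρ η)) - 1 : ℝ) : ℂ)) x‖ ≤
        C * s := by
  set e := stdOrthonormalBasis ℝ V
  obtain ⟨C₀, h₀, H₀⟩ := one_add_norm_pow_le_sum_inner e N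
  obtain ⟨C₁, h₁, H₁⟩ := abs_inner_pow_mul_fourierInv_mul_exp_sub_one_le hc 0 (0 : V) a ha
  choose C₂ h₂ H₂ using fun i =>
    abs_inner_pow_mul_fourierInv_mul_exp_sub_one_le hc N (e i) a ha
  set B : ℝ := C₁ + ∑ i, C₂ i
  have hB1 : C₁ ≤ B := le_add_of_nonneg_right (Finset.sum_nonneg fun i _ => h₂ i)
  have hB2 : ∀ i, C₂ i ≤ B := fun i =>
    (Finset.single_le_sum (fun j _ => h₂ j) (Finset.mem_univ i)).trans (le_add_of_nonneg_left h₁)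
  have hB : 0 ≤ B := h₁.trans hB1
  refine ⟨C₀ * ((1 + Fintype.card (Fin (Module.finrank ℝ V))) * B), by positivity,
    fun s hs hs1 x => ?_⟩
  have key := one_add_norm_pow_mul_le (B := B * s)
    (P := fun x => ‖𝓕⁻ (fun η => a η * ((Real.exp (-(s * ρ η)) - 1 : ℝ) : ℂ)) x‖) N
    (fun x => ?_) e (fun i x => ?_) x
  · calc _ ≤ C₀ * (1 + ∑ i, |inner ℝ (e i) x| ^ N) *
          ‖𝓕⁻ (fun η => a η * ((Real.exp (-(s * ρ η)) - 1 : ℝ) : ℂ)) x‖ := by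
          gcongr
          exact H₀ x
      _ ≤ _ := by
          rw [mul_assoc, mul_assoc]
          refine mul_le_mul_of_nonneg_left (key.trans (le_of_eq ?_)) h₀
          ring
  · have h5 := H₁ s hs hs1 x
    simp only [pow_zero, one_mul] at h5
    exact h5.trans (by gcongr)
  · exact (H₂ i s hs hs1 x).trans (by gcongr; exact hB2 i)

end Symbols

/-! ### Elementary properties of multiplier kernels: scaling, additivity, continuity. -/

section MultiplierKernels

variable {n : ℕ}

theorem abs_multiplierKernel_le (m : EuclideanSpace ℝ (Fin n) → ℝ)
    (x : EuclideanSpace ℝ (Fin n)) :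
    |multiplierKernel m x| ≤
      ‖𝓕⁻ (fun η : EuclideanSpace ℝ (Fin n) => ((m ((2 * Real.pi) • η) : ℝ) : ℂ)) x‖ :=
  Complex.abs_re_le_norm _

theorem multiplierKernel_comp_smul (m : EuclideanSpace ℝ (Fin n) → ℝ) {l : ℝ} (hl : 0 < l)
    (x : EuclideanSpace ℝ (Fin n)) :
    multiplierKernel (fun ξ => m (l • ξ)) x = (l ^ n)⁻¹ * multiplierKernel m (l⁻¹ • x) := by
  unfold multiplierKernel
  rw [← Complex.re_ofReal_mul]
  congr 1
  simp only [Real.fourierInv_eq']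
  have h := Measure.integral_comp_smul (volume : Measure (EuclideanSpace ℝ (Fin n)))
    (fun w => Complex.exp (((2 * Real.pi * inner ℝ w (l⁻¹ • x) : ℝ) : ℂ) * Complex.I) •
      ((m ((2 * Real.pi) • w) : ℝ) : ℂ)) l
  rw [finrank_euclideanSpace_fin, abs_of_pos (by positivity)] at h
  rw [← Complex.real_smul, ← h]
  refine integral_congr_ae (Eventually.of_forall fun v => ?_)
  simp only [real_inner_smul_left, real_inner_smul_right, smul_smul]
  rw [inv_mul_cancel_left₀ hl.ne', mul_comm l]

theorem integrable_comp_two_pi_smul {m : EuclideanSpace ℝ (Fin n) → ℝ} (hm : Integrable m) :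
    Integrable (fun η : EuclideanSpace ℝ (Fin n) => ((m ((2 * Real.pi) • η) : ℝ) : ℂ)) :=
  (hm.comp_smul (R := 2 * Real.pi) (by positivity)).ofReal

theorem multiplierKernel_add {m₁ m₂ : EuclideanSpace ℝ (Fin n) → ℝ} (h₁ : Integrable m₁)
    (h₂ : Integrable m₂) (x : EuclideanSpace ℝ (Fin n)) :
    multiplierKernel (fun ξ => m₁ ξ + m₂ ξ) x = multiplierKernel m₁ x + multiplierKernel m₂ x := by
  unfold multiplierKernel
  rw [← Complex.add_re]
  congr 1
  have h1 := (Real.fourierIntegral_convergent_iff (-x)).2 (integrable_comp_two_pi_smul h₁)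
  have h2 := (Real.fourierIntegral_convergent_iff (-x)).2 (integrable_comp_two_pi_smul h₂)
  simp only [Real.fourierInv_eq_fourier_neg, Real.fourier_eq, Complex.ofReal_add, smul_add]
  exact integral_add h1 h2

theorem multiplierKernel_sum {ι : Type*} (s : Finset ι) {m : ι → EuclideanSpace ℝ (Fin n) → ℝ}
    (h : ∀ i ∈ s, Integrable (m i)) (x : EuclideanSpace ℝ (Fin n)) :
    multiplierKernel (fun ξ => ∑ i ∈ s, m i ξ) x = ∑ i ∈ s, multiplierKernel (m i) x := by
  classical
  induction s using Finset.induction_on with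
  | empty => simp [multiplierKernel, Real.fourierInv_eq']
  | insert i s hi ih =>
    simp only [Finset.sum_insert hi]
    rw [multiplierKernel_add (h i (Finset.mem_insert_self i s))
      (integrable_finsetSum _ fun j hj => h j (Finset.mem_insert_of_mem hj)),
      ih fun j hj => h j (Finset.mem_insert_of_mem hj)]

theorem abs_multiplierKernel_le_integral {m : EuclideanSpace ℝ (Fin n) → ℝ}
    (x : EuclideanSpace ℝ (Fin n)) :
    |multiplierKernel m x| ≤ ∫ ξ, |m ξ| := by
  refine (abs_multiplierKernel_le m x).trans ((norm_fourierInv_le _ x).trans ?_)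
  have h := Measure.integral_comp_smul (volume : Measure (EuclideanSpace ℝ (Fin n)))
    (fun ξ => |m ξ|) (2 * Real.pi)
  simp only [Complex.norm_real, Real.norm_eq_abs]
  rw [h, finrank_euclideanSpace_fin, abs_of_pos (by positivity), smul_eq_mul]
  refine mul_le_of_le_one_left (integral_nonneg fun _ => abs_nonneg _) (inv_le_one_of_one_le₀ ?_)
  exact one_le_pow₀ (by linarith [Real.pi_gt_three])

theorem continuous_multiplierKernel {m : EuclideanSpace ℝ (Fin n) → ℝ} (hm : Integrable m) :
    Continuous (multiplierKernel m) := by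
  unfold multiplierKernel
  have := VectorFourier.fourierIntegral_continuous Real.continuous_fourierChar
    (L := innerₗ (EuclideanSpace ℝ (Fin n))) (by exact continuous_inner)
    (integrable_comp_two_pi_smul hm)
  have h2 : Continuous (𝓕 (fun η : EuclideanSpace ℝ (Fin n) =>
    ((m ((2 * Real.pi) • η) : ℝ) : ℂ))) := this
  simp only [Real.fourierInv_eq_fourier_neg]
  exact Complex.continuous_re.comp (h2.comp continuous_neg)

theorem tendsto_multiplierKernel {m : ℕ → EuclideanSpace ℝ (Fin n) → ℝ}
    {m₀ g : EuclideanSpace ℝ (Fin n) → ℝ} (hg : Integrable g)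
    (hm : ∀ i, Integrable (m i)) (hb : ∀ i ξ, |m i ξ| ≤ g ξ)
    (hlim : ∀ ξ, Tendsto (fun i => m i ξ) atTop (𝓝 (m₀ ξ))) (x : EuclideanSpace ℝ (Fin n)) :
    Tendsto (fun i => multiplierKernel (m i) x) atTop (𝓝 (multiplierKernel m₀ x)) := by
  unfold multiplierKernel
  refine (Complex.continuous_re.tendsto _).comp ?_
  simp only [Real.fourierInv_eq_fourier_neg, Real.fourier_eq]
  refine tendsto_integral_of_dominated_convergence (fun η => g ((2 * Real.pi) • η))
    (fun i => ((Real.fourierIntegral_convergent_iff (-x)).2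
      (integrable_comp_two_pi_smul (hm i))).aestronglyMeasurable)
    (hg.comp_smul (R := 2 * Real.pi) (by positivity)) (fun i => Eventually.of_forall fun η => ?_)
    (Eventually.of_forall fun η => ?_)
  · simpa using hb i _
  · exact ((Complex.continuous_ofReal.tendsto _).comp (hlim _)).const_smul _

end MultiplierKernels

/-! ### The heat symbol, its self-similarity, and frequency-localized kernels. -/

section HeatKernel

variable {n : ℕ} {α : ℝ} {χ : EuclideanSpace ℝ (Fin n) → ℝ}

/-- The kernel of `exp (-t (-Δ)^α)`. -/
noncomputable def heatKernel {n : ℕ} (α t : ℝ) : EuclideanSpace ℝ (Fin n) → ℝ :=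
  multiplierKernel (fun ξ => Real.exp (-t * ‖ξ‖ ^ (2 * α)))

theorem continuous_heatSymbol (hα : 0 < α) (t : ℝ) :
    Continuous fun ξ : EuclideanSpace ℝ (Fin n) => Real.exp (-t * ‖ξ‖ ^ (2 * α)) :=
  Real.continuous_exp.comp (continuous_const.mul
    (continuous_norm.rpow_const fun _ => Or.inr (by positivity)))

theorem integrable_heatSymbol (hn : 0 < n) (hα : 0 < α) {t : ℝ} (ht : 0 < t) :
    Integrable fun ξ : EuclideanSpace ℝ (Fin n) => Real.exp (-t * ‖ξ‖ ^ (2 * α)) := by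
  have : Nontrivial (EuclideanSpace ℝ (Fin n)) := by
    have : NeZero n := ⟨hn.ne'⟩
    infer_instance
  refine (integrable_fun_norm_addHaar (volume : Measure (EuclideanSpace ℝ (Fin n)))
    (f := fun y => Real.exp (-t * y ^ (2 * α)))).2 ?_
  refine (integrableOn_rpow_mul_exp_neg_mul_rpow (p := 2 * α) (s := ((n - 1 : ℕ) : ℝ)) (b := t)
    (by linarith [(Nat.cast_nonneg (n - 1) : (0 : ℝ) ≤ ((n - 1 : ℕ) : ℝ))])
    (by positivity) ht).congr_fun (fun y hy => ?_) measurableSet_Ioi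
  simp [Real.rpow_natCast]

theorem heatKernel_eq_smul (hα : 0 < α) {t : ℝ} (ht : 0 < t) (x : EuclideanSpace ℝ (Fin n)) :
    heatKernel α t x =
      t ^ (-(n / (2 * α))) * heatKernel α 1 (t ^ (-(1 / (2 * α))) • x) := by
  have hl : 0 < t ^ (1 / (2 * α)) := Real.rpow_pos_of_pos ht _
  have h := multiplierKernel_comp_smul
    (fun ξ : EuclideanSpace ℝ (Fin n) => Real.exp (-1 * ‖ξ‖ ^ (2 * α))) hl x
  have e : (fun ξ : EuclideanSpace ℝ (Fin n) =>
      Real.exp (-1 * ‖(t ^ (1 / (2 * α))) • ξ‖ ^ (2 * α))) =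
      fun ξ => Real.exp (-t * ‖ξ‖ ^ (2 * α)) := by
    ext ξ
    rw [norm_smul, Real.norm_eq_abs, abs_of_pos hl, Real.mul_rpow hl.le (norm_nonneg _),
      ← Real.rpow_mul ht.le, one_div, inv_mul_cancel₀ (by positivity), Real.rpow_one]
    ring_nf
  rw [e] at h
  unfold heatKernel
  rw [h, ← Real.rpow_neg ht.le, ← Real.rpow_natCast, ← Real.rpow_mul ht.le, ← Real.rpow_neg ht.le]
  congr 2
  ring

theorem phase_smul (α : ℝ) {l : ℝ} (hl : 0 < l) (ξ : EuclideanSpace ℝ (Fin n)) :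
    ‖l • ξ‖ ^ (2 * α) = l ^ (2 * α) * ‖ξ‖ ^ (2 * α) := by
  rw [norm_smul, Real.norm_eq_abs, abs_of_pos hl, Real.mul_rpow hl.le (norm_nonneg _)]

theorem contDiffAt_norm_two_pi_smul_rpow {η : EuclideanSpace ℝ (Fin n)} (hη : η ≠ 0) (p : ℝ) :
    ContDiffAt ℝ ((⊤ : ℕ∞) : WithTop ℕ∞)
      (fun η : EuclideanSpace ℝ (Fin n) => ‖(2 * Real.pi) • η‖ ^ p) η := by
  have h0 : (2 * Real.pi) • η ≠ 0 := smul_ne_zero (by positivity) hη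
  refine ContDiffAt.rpow_const_of_ne ?_ (norm_ne_zero_iff.2 h0)
  exact (contDiffAt_norm ℝ h0).comp η (contDiff_const_smul _).contDiffAt

namespace IsLittlewoodPaleyBump

theorem hasCompactSupport (hχ : IsLittlewoodPaleyBump χ) : HasCompactSupport χ :=
  HasCompactSupport.intro (isCompact_closedBall 0 2) fun ξ hξ => hχ.eq_zero ξ (by
    simp only [Metric.mem_closedBall, dist_zero_right, not_le] at hξ
    exact hξ.le)

/-- Both cutoffs equal 1 for |ξ| ≤ 1/R, so their difference lives away from the origin, the only
point where |ξ|^{2α} may fail to be smooth, and there the phase is at least R^{-2α}. -/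
theorem admissibleSymbol_annulus (hχ : IsLittlewoodPaleyBump χ) (α : ℝ) (hα : 0 < α) {r R : ℝ}
    (hr : 0 < r) (hR : r ≤ R) :
    AdmissibleSymbol (fun η : EuclideanSpace ℝ (Fin n) => ‖(2 * Real.pi) • η‖ ^ (2 * α))
      ((R⁻¹) ^ (2 * α))
      (fun η => ((χ (r • ((2 * Real.pi) • η)) - χ (R • ((2 * Real.pi) • η)) : ℝ) : ℂ)) := by
  have hR0 : 0 < R := hr.trans_le hR
  have hsub : tsupport (fun η : EuclideanSpace ℝ (Fin n) =>
      ((χ (r • ((2 * Real.pi) • η)) - χ (R • ((2 * Real.pi) • η)) : ℝ) : ℂ)) ⊆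
      {η | R⁻¹ ≤ ‖(2 * Real.pi) • η‖} := by
    refine closure_minimal (fun η hη => ?_)
      (isClosed_le continuous_const (continuous_const_smul _).norm)
    by_contra hlt
    simp only [Set.mem_ofPred_eq, not_le] at hlt
    have h1 : ‖R • ((2 * Real.pi) • η)‖ ≤ 1 := by
      rw [norm_smul, Real.norm_eq_abs, abs_of_pos hR0]
      have := mul_le_mul_of_nonneg_left hlt.le hR0.le
      rwa [mul_inv_cancel₀ hR0.ne'] at this
    have h2 : ‖r • ((2 * Real.pi) • η)‖ ≤ 1 := by
      refine le_trans ?_ h1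
      rw [norm_smul, norm_smul R, Real.norm_eq_abs, Real.norm_eq_abs, abs_of_pos hr, abs_of_pos hR0]
      gcongr
    exact hη (by simp [hχ.eq_one _ h1, hχ.eq_one _ h2])
  have hc : ∀ l : ℝ, 0 < l → HasCompactSupport
      (fun η : EuclideanSpace ℝ (Fin n) => χ (l • ((2 * Real.pi) • η))) := fun l hl => by
    have := hχ.hasCompactSupport.comp_smul (c := l * (2 * Real.pi)) (by positivity)
    simpa [mul_smul] using this
  have hs : ∀ l : ℝ, ContDiff ℝ ((⊤ : ℕ∞) : WithTop ℕ∞)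
      (fun η : EuclideanSpace ℝ (Fin n) => χ (l • ((2 * Real.pi) • η))) := fun l =>
    hχ.smooth.comp ((contDiff_const_smul _).comp (contDiff_const_smul _))
  refine ⟨Complex.ofRealCLM.contDiff.comp ((hs r).sub (hs R)),
    ((hc r hr).sub (hc R hR0)).comp_left (g := fun x : ℝ => (x : ℂ)) (by simp),
    fun η hη => ?_, fun η hη => ?_⟩
  · exact Real.rpow_le_rpow (by positivity) (hsub hη) (by positivity)
  · refine contDiffAt_norm_two_pi_smul_rpow (fun h0 => ?_) _
    have := hsub hη
    simp only [Set.mem_ofPred_eq, h0, smul_zero, norm_zero] at this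
    exact absurd this (not_le.2 (by positivity))

theorem exists_decay_annulus (hχ : IsLittlewoodPaleyBump χ) (hα : 0 < α) {r R : ℝ}
    (hr : 0 < r) (hR : r ≤ R) (N M : ℕ) :
    ∃ C : ℝ, 0 ≤ C ∧ ∀ s : ℝ, 0 ≤ s → ∀ x : EuclideanSpace ℝ (Fin n),
      (1 + ‖x‖) ^ N * |multiplierKernel
        (fun ξ => (χ (r • ξ) - χ (R • ξ)) * Real.exp (-s * ‖ξ‖ ^ (2 * α))) x| ≤
        C * ((1 + s) ^ M)⁻¹ := by
  have hR0 : 0 < R := hr.trans_le hR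
  obtain ⟨C, hC, H⟩ := exists_decay_fourierInv_mul_exp
    (Real.rpow_pos_of_pos (inv_pos.2 hR0) (2 * α)) (hχ.admissibleSymbol_annulus α hα hr hR) N M
  refine ⟨C, hC, fun s hs x => le_trans ?_ (H s hs x)⟩
  gcongr
  refine (abs_multiplierKernel_le _ x).trans (le_of_eq ?_)
  simp [neg_mul]

theorem exists_decay_annulus_sub_one (hχ : IsLittlewoodPaleyBump χ) (hα : 0 < α) {r R : ℝ}
    (hr : 0 < r) (hR : r ≤ R) (N : ℕ) :
    ∃ C : ℝ, 0 ≤ C ∧ ∀ s : ℝ, 0 ≤ s → s ≤ 1 → ∀ x : EuclideanSpace ℝ (Fin n),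
      (1 + ‖x‖) ^ N * |multiplierKernel
        (fun ξ => (χ (r • ξ) - χ (R • ξ)) * (Real.exp (-s * ‖ξ‖ ^ (2 * α)) - 1)) x| ≤ C * s := by
  have hR0 : 0 < R := hr.trans_le hR
  obtain ⟨C, hC, H⟩ := exists_decay_fourierInv_mul_exp_sub_one
    (Real.rpow_nonneg (inv_pos.2 hR0).le (2 * α)) (hχ.admissibleSymbol_annulus α hα hr hR) N
  refine ⟨C, hC, fun s hs hs1 x => le_trans ?_ (H s hs hs1 x)⟩
  gcongr
  refine (abs_multiplierKernel_le _ x).trans (le_of_eq ?_)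
  simp [neg_mul]

theorem exists_decay (hχ : IsLittlewoodPaleyBump χ) (N : ℕ) :
    ∃ C : ℝ, 0 ≤ C ∧ ∀ x : EuclideanSpace ℝ (Fin n),
      (1 + ‖x‖) ^ N * |multiplierKernel χ x| ≤ C := by
  -- With the constant phase 1 and s = 0 the general decay lemma covers the cutoff itself, whose
  -- support contains the origin.
  have ha : AdmissibleSymbol (fun _ : EuclideanSpace ℝ (Fin n) => (1 : ℝ)) 1
      (fun η => ((χ ((2 * Real.pi) • η) : ℝ) : ℂ)) :=
    ⟨Complex.ofRealCLM.contDiff.comp (hχ.smooth.comp (contDiff_const_smul _)),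
      (hχ.hasCompactSupport.comp_smul (c := 2 * Real.pi) (by positivity)).comp_left
        (g := fun x : ℝ => (x : ℂ)) (by simp), fun _ _ => le_rfl, fun _ _ => contDiffAt_const⟩
  obtain ⟨C, hC, H⟩ := exists_decay_fourierInv_mul_exp one_pos ha N 0
  refine ⟨C, hC, fun x => ?_⟩
  have := H 0 le_rfl x
  simp only [neg_zero, Real.exp_zero, Complex.ofReal_one, mul_one, pow_zero,
    inv_one] at this
  exact le_trans (by gcongr; exact abs_multiplierKernel_le _ x) this

theorem integrable_comp_smul_mul (hχ : IsLittlewoodPaleyBump χ) {l : ℝ} (hl : 0 < l)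
    {g : EuclideanSpace ℝ (Fin n) → ℝ} (hg : Continuous g) :
    Integrable fun ξ => χ (l • ξ) * g ξ :=
  ((hχ.smooth.continuous.comp (continuous_const_smul l)).mul hg).integrable_of_hasCompactSupport
    (hχ.hasCompactSupport.comp_smul hl.ne').mul_right

end IsLittlewoodPaleyBump

end HeatKernel

/-! ### Pointwise decay of the heat kernel at time 1. -/

section HeatKernelDecay

variable {n : ℕ} {α : ℝ} {χ : EuclideanSpace ℝ (Fin n) → ℝ}

namespace IsLittlewoodPaleyBump

/-- Rescaling by l = 2^i moves the block to a fixed annulus and replaces the time 1 by s = l^{-2α},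
so that e^{-s|ξ|^{2α}} - 1 contributes a factor s. Scaling back, the weight of order n + min(α, 1)
costs l^{min(α,1)} beyond the Jacobian l^{-n}, and min(α, 1) - 2α ≤ -α leaves a geometric series. -/
theorem exists_decay_low_frequency (hχ : IsLittlewoodPaleyBump χ) (hα : 0 < α) :
    ∃ C : ℝ, 0 ≤ C ∧ ∀ (i : ℕ) (x : EuclideanSpace ℝ (Fin n)),
      (1 + ‖x‖) ^ ((n : ℝ) + min α 1) * |multiplierKernel
        (fun ξ => (χ ((2 : ℝ) ^ i • ξ) - χ ((2 : ℝ) ^ (i + 1) • ξ)) *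
          (Real.exp (-1 * ‖ξ‖ ^ (2 * α)) - 1)) x| ≤ C * ((2 : ℝ) ^ (-α)) ^ i := by
  obtain ⟨C, hC, H⟩ := hχ.exists_decay_annulus_sub_one hα one_pos one_le_two (n + 1)
  refine ⟨C, hC, fun i x => ?_⟩
  set l : ℝ := 2 ^ i with hl
  have hl1 : 1 ≤ l := one_le_pow₀ one_le_two
  have hl0 : 0 < l := one_pos.trans_le hl1
  set s : ℝ := l ^ (-(2 * α)) with hs
  have hs0 : 0 ≤ s := Real.rpow_nonneg hl0.le _
  have hs1 : s ≤ 1 := Real.rpow_le_one_of_one_le_of_nonpos hl1 (by linarith)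
  obtain ⟨g, hg⟩ : ∃ g : EuclideanSpace ℝ (Fin n) → ℝ, g = fun ξ =>
    (χ ((1 : ℝ) • ξ) - χ ((2 : ℝ) • ξ)) * (Real.exp (-s * ‖ξ‖ ^ (2 * α)) - 1) := ⟨_, rfl⟩
  have e : (fun ξ : EuclideanSpace ℝ (Fin n) => (χ (l • ξ) - χ ((2 : ℝ) ^ (i + 1) • ξ)) *
      (Real.exp (-1 * ‖ξ‖ ^ (2 * α)) - 1)) = fun ξ => g (l • ξ) := by
    ext ξ
    simp only [hg]
    rw [phase_smul α hl0, one_smul, smul_smul (2 : ℝ), pow_succ, mul_comm (2 ^ i) (2 : ℝ), neg_mul s,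
      ← mul_assoc, hs, ← Real.rpow_add hl0, neg_add_cancel, Real.rpow_zero, neg_mul]
  rw [e, multiplierKernel_comp_smul g hl0, hg, abs_mul, abs_of_pos (by positivity : 0 < (l ^ n)⁻¹)]
  have h1 := H s hs0 hs1 (l⁻¹ • x)
  have hm0 : 0 < min α 1 := lt_min hα one_pos
  have h2 : (1 + ‖x‖) ^ ((n : ℝ) + min α 1) ≤
      l ^ ((n : ℝ) + min α 1) * (1 + ‖l⁻¹ • x‖) ^ (n + 1) := by
    have h3 : 1 + ‖x‖ ≤ l * (1 + ‖l⁻¹ • x‖) := by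
      rw [norm_smul, norm_inv, Real.norm_eq_abs, abs_of_pos hl0, mul_add,
        mul_inv_cancel_left₀ hl0.ne']
      linarith
    calc (1 + ‖x‖) ^ ((n : ℝ) + min α 1) ≤ (l * (1 + ‖l⁻¹ • x‖)) ^ ((n : ℝ) + min α 1) := by gcongr
      _ = l ^ ((n : ℝ) + min α 1) * (1 + ‖l⁻¹ • x‖) ^ ((n : ℝ) + min α 1) :=
        Real.mul_rpow hl0.le (by positivity)
      _ ≤ l ^ ((n : ℝ) + min α 1) * (1 + ‖l⁻¹ • x‖) ^ ((n + 1 : ℕ) : ℝ) := by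
        gcongr
        · linarith [norm_nonneg (l⁻¹ • x)]
        · push_cast
          gcongr
          exact min_le_right _ _
      _ = _ := by rw [Real.rpow_natCast]
  refine (mul_le_mul_of_nonneg_right h2 (by positivity)).trans ?_
  have h4 : l ^ ((n : ℝ) + min α 1) * (l ^ n)⁻¹ * s ≤ ((2 : ℝ) ^ (-α)) ^ i := by
    have e2 : ((2 : ℝ) ^ (-α)) ^ i = l ^ (-α) := by
      rw [hl, ← Real.rpow_natCast, ← Real.rpow_natCast, ← Real.rpow_mul (by norm_num),
        ← Real.rpow_mul (by norm_num), mul_comm]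
    rw [e2, hs, ← Real.rpow_natCast l n, ← Real.rpow_neg hl0.le, ← Real.rpow_add hl0,
      ← Real.rpow_add hl0]
    refine Real.rpow_le_rpow_of_exponent_le hl1 ?_
    linarith [min_le_left α 1]
  calc _ = (l ^ ((n : ℝ) + min α 1) * (l ^ n)⁻¹) * ((1 + ‖l⁻¹ • x‖) ^ (n + 1) *
        |multiplierKernel (fun ξ => (χ ((1 : ℝ) • ξ) - χ ((2 : ℝ) • ξ)) *
          (Real.exp (-s * ‖ξ‖ ^ (2 * α)) - 1)) (l⁻¹ • x)|) := by ring
    _ ≤ (l ^ ((n : ℝ) + min α 1) * (l ^ n)⁻¹) * (C * s) := by gcongr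
    _ = C * (l ^ ((n : ℝ) + min α 1) * (l ^ n)⁻¹ * s) := by ring
    _ ≤ _ := by gcongr

/-- After rescaling, the block evolves for the large time s = l^{2α}, and the rapid decay in s beats
the Jacobian l^n. -/
theorem exists_decay_high_frequency (hχ : IsLittlewoodPaleyBump χ) (hα : 0 < α) :
    ∃ C : ℝ, 0 ≤ C ∧ ∀ (i : ℕ) (x : EuclideanSpace ℝ (Fin n)),
      (1 + ‖x‖) ^ ((n : ℝ) + min α 1) * |multiplierKernel
        (fun ξ => (χ (((2 : ℝ) ^ (i + 1))⁻¹ • ξ) - χ (((2 : ℝ) ^ i)⁻¹ • ξ)) *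
          Real.exp (-1 * ‖ξ‖ ^ (2 * α))) x| ≤ C * (2⁻¹ : ℝ) ^ i := by
  -- M is such that s^M ≥ l^{n+1}: the power l^n compensates the Jacobian and one more factor l
  -- gives the ratio 1/2.
  obtain ⟨M, hM⟩ := exists_nat_ge ((n + 1) / (2 * α))
  rw [div_le_iff₀ (by positivity)] at hM
  obtain ⟨C, hC, H⟩ := hχ.exists_decay_annulus hα (r := 2⁻¹) (R := 1) (by norm_num)
    (by norm_num) (n + 1) M
  refine ⟨C, hC, fun i x => ?_⟩
  set l : ℝ := 2 ^ i with hl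
  have hl1 : 1 ≤ l := one_le_pow₀ one_le_two
  have hl0 : 0 < l := one_pos.trans_le hl1
  set s : ℝ := l ^ (2 * α) with hs
  have hs0 : 0 < s := Real.rpow_pos_of_pos hl0 _
  obtain ⟨g, hg⟩ : ∃ g : EuclideanSpace ℝ (Fin n) → ℝ, g = fun ξ =>
    (χ ((2⁻¹ : ℝ) • ξ) - χ ((1 : ℝ) • ξ)) * Real.exp (-s * ‖ξ‖ ^ (2 * α)) := ⟨_, rfl⟩
  have e : (fun ξ : EuclideanSpace ℝ (Fin n) => (χ (((2 : ℝ) ^ (i + 1))⁻¹ • ξ) - χ (l⁻¹ • ξ)) *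
      Real.exp (-1 * ‖ξ‖ ^ (2 * α))) = fun ξ => g (l⁻¹ • ξ) := by
    ext ξ
    simp only [hg]
    rw [phase_smul α (inv_pos.2 hl0), smul_smul, one_smul, pow_succ, mul_inv, neg_mul s,
      ← mul_assoc, hs, Real.inv_rpow hl0.le, mul_inv_cancel₀ hs0.ne',
      mul_comm (2 ^ i : ℝ)⁻¹, neg_mul]
  rw [e, multiplierKernel_comp_smul g (inv_pos.2 hl0), hg, abs_mul,
    abs_of_pos (by positivity : 0 < (l⁻¹ ^ n)⁻¹), inv_inv, inv_pow, inv_inv]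
  have h1 := H s hs0.le (l • x)
  have hm0 : 0 < min α 1 := lt_min hα one_pos
  have h2 : (1 + ‖x‖) ^ ((n : ℝ) + min α 1) ≤ (1 + ‖l • x‖) ^ (n + 1) := by
    have h3 : 1 + ‖x‖ ≤ 1 + ‖l • x‖ := by
      rw [norm_smul, Real.norm_eq_abs, abs_of_pos hl0]
      nlinarith [norm_nonneg x]
    calc (1 + ‖x‖) ^ ((n : ℝ) + min α 1) ≤ (1 + ‖l • x‖) ^ ((n : ℝ) + min α 1) := by gcongr
      _ ≤ (1 + ‖l • x‖) ^ ((n + 1 : ℕ) : ℝ) := by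
        gcongr
        · linarith [norm_nonneg (l • x)]
        · push_cast
          gcongr
          exact min_le_right _ _
      _ = _ := by rw [Real.rpow_natCast]
  refine (mul_le_mul_of_nonneg_right h2 (by positivity)).trans ?_
  have h4 : l ^ n * ((1 + s) ^ M)⁻¹ ≤ (2⁻¹ : ℝ) ^ i := by
    have h5 : l ^ (n + 1) ≤ (1 + s) ^ M := by
      calc l ^ (n + 1) = l ^ ((n : ℝ) + 1) := by
            rw [← Nat.cast_add_one, Real.rpow_natCast]
        _ ≤ l ^ ((M : ℝ) * (2 * α)) := Real.rpow_le_rpow_of_exponent_le hl1 hM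
        _ = s ^ M := by rw [hs, ← Real.rpow_natCast, ← Real.rpow_mul hl0.le, mul_comm]
        _ ≤ (1 + s) ^ M := by gcongr; linarith
    rw [inv_pow, ← hl, ← div_eq_mul_inv, div_le_iff₀ (by positivity), inv_mul_eq_div,
      le_div_iff₀ hl0, ← pow_succ]
    exact h5
  calc _ = l ^ n * ((1 + ‖l • x‖) ^ (n + 1) *
        |multiplierKernel (fun ξ => (χ ((2⁻¹ : ℝ) • ξ) - χ ((1 : ℝ) • ξ)) *
          Real.exp (-s * ‖ξ‖ ^ (2 * α))) (l • x)|) := by ring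
    _ ≤ l ^ n * (C * ((1 + s) ^ M)⁻¹) := by gcongr
    _ = C * (l ^ n * ((1 + s) ^ M)⁻¹) := by ring
    _ ≤ _ := by gcongr

theorem sum_low_frequency (χ : EuclideanSpace ℝ (Fin n) → ℝ) (I : ℕ)
    (ξ : EuclideanSpace ℝ (Fin n)) (r : ℝ) :
    ∑ i ∈ Finset.range I, (χ ((2 : ℝ) ^ i • ξ) - χ ((2 : ℝ) ^ (i + 1) • ξ)) * r =
      (χ ξ - χ ((2 : ℝ) ^ I • ξ)) * r := by
  rw [← Finset.sum_mul, Finset.sum_range_sub' (fun i => χ ((2 : ℝ) ^ i • ξ)), pow_zero, one_smul]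

theorem sum_high_frequency (χ : EuclideanSpace ℝ (Fin n) → ℝ) (I : ℕ)
    (ξ : EuclideanSpace ℝ (Fin n)) (r : ℝ) :
    ∑ i ∈ Finset.range I, (χ (((2 : ℝ) ^ (i + 1))⁻¹ • ξ) - χ (((2 : ℝ) ^ i)⁻¹ • ξ)) * r =
      (χ (((2 : ℝ) ^ I)⁻¹ • ξ) - χ ξ) * r := by
  rw [← Finset.sum_mul, Finset.sum_range_sub (fun i => χ (((2 : ℝ) ^ i)⁻¹ • ξ)), pow_zero,
    inv_one, one_smul]

theorem abs_le_one (hχ : IsLittlewoodPaleyBump χ) (ξ : EuclideanSpace ℝ (Fin n)) : |χ ξ| ≤ 1 := by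
  rw [abs_of_nonneg (hχ.nonneg ξ)]
  exact hχ.le_one ξ

theorem eventually_high_eq_one (hχ : IsLittlewoodPaleyBump χ) (ξ : EuclideanSpace ℝ (Fin n)) :
    ∀ᶠ I : ℕ in atTop, χ (((2 : ℝ) ^ I)⁻¹ • ξ) = 1 := by
  filter_upwards [(tendsto_pow_atTop_atTop_of_one_lt (one_lt_two (α := ℝ))).eventually_ge_atTop ‖ξ‖]
    with I hI
  refine hχ.eq_one _ ?_
  rw [norm_smul, norm_inv, norm_pow, Real.norm_ofNat, inv_mul_le_iff₀ (by positivity), mul_one]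
  exact hI

theorem eventually_low_eq_zero (hχ : IsLittlewoodPaleyBump χ) {ξ : EuclideanSpace ℝ (Fin n)}
    (hξ : ξ ≠ 0) : ∀ᶠ I : ℕ in atTop, χ ((2 : ℝ) ^ I • ξ) = 0 := by
  filter_upwards [(tendsto_pow_atTop_atTop_of_one_lt
    (one_lt_two (α := ℝ))).eventually_ge_atTop (2 / ‖ξ‖)] with I hI
  refine hχ.eq_zero _ ?_
  rw [norm_smul, norm_pow, Real.norm_ofNat]
  rwa [div_le_iff₀ (norm_pos_iff.2 hξ)] at hI

theorem integrable_annulus_mul (hχ : IsLittlewoodPaleyBump χ) {r R : ℝ} (hr : 0 < r) (hR : 0 < R)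
    {g : EuclideanSpace ℝ (Fin n) → ℝ} (hg : Continuous g) :
    Integrable fun ξ => (χ (r • ξ) - χ (R • ξ)) * g ξ :=
  ((hχ.integrable_comp_smul_mul hr hg).sub (hχ.integrable_comp_smul_mul hR hg)).congr
    (Eventually.of_forall fun _ => (sub_mul _ _ _).symm)

/-- Telescoping writes the symbol E as χ + Σ (low annuli)(E - 1) + Σ (high annuli) E. Subtracting 1
at low frequencies isolates the smooth piece χ and makes the singular remainder small on annuli near
the origin. The weighted kernels of the annuli form geometric series, and the partial sums converge
pointwise because their symbols converge dominatedly. -/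
theorem exists_decay_heatKernel_one (hχ : IsLittlewoodPaleyBump χ) (hn : 0 < n) (hα : 0 < α) :
    ∃ C : ℝ, 0 ≤ C ∧ ∀ x : EuclideanSpace ℝ (Fin n),
      |heatKernel α 1 x| ≤ C * (1 + ‖x‖) ^ (-((n : ℝ) + min α 1)) := by
  obtain ⟨C₀, h₀, H₀⟩ := hχ.exists_decay (n + 1)
  obtain ⟨C₁, h₁, H₁⟩ := hχ.exists_decay_low_frequency hα
  obtain ⟨C₂, h₂, H₂⟩ := hχ.exists_decay_high_frequency hα
  set q : ℝ := 2 ^ (-α)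
  have hq0 : 0 ≤ q := by positivity
  have hq1 : q < 1 := Real.rpow_lt_one_of_one_lt_of_neg one_lt_two (by linarith)
  refine ⟨C₀ + C₁ * (1 - q)⁻¹ + C₂ * (1 - 2⁻¹)⁻¹, ?_, fun x => ?_⟩
  · have : 0 < 1 - q := by linarith
    positivity
  rw [Real.rpow_neg (by positivity), ← div_eq_mul_inv, le_div_iff₀ (by positivity), mul_comm]
  set w : ℝ := (1 + ‖x‖) ^ ((n : ℝ) + min α 1)
  have hw : 0 ≤ w := by positivity
  set E : EuclideanSpace ℝ (Fin n) → ℝ := fun ξ => Real.exp (-1 * ‖ξ‖ ^ (2 * α))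
  have hE : Continuous E := continuous_heatSymbol hα 1
  have hEi : Integrable E := integrable_heatSymbol hn hα one_pos
  have hE0 : ∀ ξ, 0 < E ξ := fun ξ => Real.exp_pos _
  have hE1 : ∀ ξ, E ξ ≤ 1 := fun ξ => Real.exp_le_one_iff.2 (by
    have : 0 ≤ ‖ξ‖ ^ (2 * α) := by positivity
    linarith)
  set L : ℕ → EuclideanSpace ℝ (Fin n) → ℝ := fun i ξ =>
    (χ ((2 : ℝ) ^ i • ξ) - χ ((2 : ℝ) ^ (i + 1) • ξ)) * (E ξ - 1)
  set H : ℕ → EuclideanSpace ℝ (Fin n) → ℝ := fun i ξ =>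
    (χ (((2 : ℝ) ^ (i + 1))⁻¹ • ξ) - χ (((2 : ℝ) ^ i)⁻¹ • ξ)) * E ξ
  have hLi : ∀ i, Integrable (L i) := fun i =>
    hχ.integrable_annulus_mul (by positivity) (by positivity) (hE.sub continuous_const)
  have hHi : ∀ i, Integrable (H i) := fun i =>
    hχ.integrable_annulus_mul (by positivity) (by positivity) hE
  have hχi : Integrable χ := hχ.smooth.continuous.integrable_of_hasCompactSupport
    hχ.hasCompactSupport
  have hsum : ∀ I : ℕ, (fun ξ => (χ ξ + ∑ i ∈ Finset.range I, L i ξ) +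
      ∑ i ∈ Finset.range I, H i ξ) =
      fun ξ => χ (((2 : ℝ) ^ I)⁻¹ • ξ) * E ξ - χ ((2 : ℝ) ^ I • ξ) * (E ξ - 1) := by
    intro I
    ext ξ
    simp only [L, H]
    rw [sum_low_frequency, sum_high_frequency]
    ring
  have hlim : Tendsto (fun I => multiplierKernel (fun ξ => (χ ξ + ∑ i ∈ Finset.range I, L i ξ) +
      ∑ i ∈ Finset.range I, H i ξ) x) atTop (𝓝 (heatKernel α 1 x)) := by
    refine tendsto_multiplierKernel
      (g := fun ξ => E ξ + (Metric.closedBall 0 2).indicator (fun _ => (1 : ℝ)) ξ)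
      (hEi.add ((integrable_indicator_iff measurableSet_closedBall).2 ?_)) (fun I => ?_)
      (fun I ξ => ?_) (fun ξ => ?_) x
    · exact integrableOn_const (isCompact_closedBall _ _).measure_lt_top.ne
    · exact (hχi.add (integrable_finsetSum _ fun i _ => hLi i)).add
        (integrable_finsetSum _ fun i _ => hHi i)
    · rw [congrFun (hsum I) ξ]
      refine (abs_sub _ _).trans (add_le_add ?_ ?_)
      · rw [abs_mul, abs_of_pos (hE0 ξ)]
        exact mul_le_of_le_one_left (hE0 ξ).le (hχ.abs_le_one _)
      · by_cases hξ : ξ ∈ Metric.closedBall (0 : EuclideanSpace ℝ (Fin n)) 2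
        · rw [Set.indicator_of_mem hξ, abs_mul]
          refine mul_le_one₀ (hχ.abs_le_one _) (abs_nonneg _) ?_
          rw [abs_le]
          constructor <;> linarith [hE0 ξ, hE1 ξ]
        · rw [Set.indicator_of_notMem hξ, hχ.eq_zero]
          · simp
          · rw [norm_smul, norm_pow, Real.norm_ofNat]
            simp only [Metric.mem_closedBall, dist_zero_right, not_le] at hξ
            nlinarith [one_le_pow₀ (one_le_two (α := ℝ)) (n := I)]
    · rw [tendsto_congr fun I => congrFun (hsum I) ξ]
      refine tendsto_const_nhds.congr' ?_
      -- At the origin the cutoff χ(2^I ξ) stays equal to 1, but it is multiplied by E - 1, which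
      -- vanishes there.
      by_cases hξ : ξ = 0
      · refine Eventually.of_forall fun I => ?_
        simp [hξ, E, hχ.eq_one, Real.zero_rpow (by positivity : (2 * α) ≠ 0)]
      · filter_upwards [hχ.eventually_high_eq_one ξ, hχ.eventually_low_eq_zero hξ] with I h1 h2
        rw [h1, h2]
        simp [E]
  refine le_of_tendsto (hlim.abs.const_mul w) (Eventually.of_forall fun I => ?_)
  rw [multiplierKernel_add (m₁ := fun ξ => χ ξ + ∑ i ∈ Finset.range I, L i ξ)
      (hχi.add (integrable_finsetSum _ fun i _ => hLi i))
      (integrable_finsetSum _ fun i _ => hHi i),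
    multiplierKernel_add hχi (integrable_finsetSum _ fun i _ => hLi i),
    multiplierKernel_sum _ fun i _ => hLi i, multiplierKernel_sum _ fun i _ => hHi i]
  have hg : ∀ (a : ℝ), 0 ≤ a → a < 1 → ∑ i ∈ Finset.range I, a ^ i ≤ (1 - a)⁻¹ := fun a h0 h1 => by
    rw [← tsum_geometric_of_lt_one h0 h1]
    exact (summable_geometric_of_lt_one h0 h1).sum_le_tsum _ fun i _ => by positivity
  have b0 : w * |multiplierKernel χ x| ≤ C₀ := by
    refine le_trans ?_ (H₀ x)
    gcongr
    rw [← Real.rpow_natCast]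
    refine Real.rpow_le_rpow_of_exponent_le (by linarith [norm_nonneg x]) ?_
    push_cast
    linarith [min_le_right α 1]
  have b1 : w * |∑ i ∈ Finset.range I, multiplierKernel (L i) x| ≤ C₁ * (1 - q)⁻¹ := by
    calc _ ≤ w * ∑ i ∈ Finset.range I, |multiplierKernel (L i) x| := by
          gcongr; exact Finset.abs_sum_le_sum_abs _ _
      _ = ∑ i ∈ Finset.range I, w * |multiplierKernel (L i) x| := Finset.mul_sum _ _ _
      _ ≤ ∑ i ∈ Finset.range I, C₁ * q ^ i := Finset.sum_le_sum fun i _ => H₁ i x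
      _ = C₁ * ∑ i ∈ Finset.range I, q ^ i := (Finset.mul_sum _ _ _).symm
      _ ≤ _ := by gcongr; exact hg q hq0 hq1
  have b2 : w * |∑ i ∈ Finset.range I, multiplierKernel (H i) x| ≤ C₂ * (1 - 2⁻¹)⁻¹ := by
    calc _ ≤ w * ∑ i ∈ Finset.range I, |multiplierKernel (H i) x| := by
          gcongr; exact Finset.abs_sum_le_sum_abs _ _
      _ = ∑ i ∈ Finset.range I, w * |multiplierKernel (H i) x| := Finset.mul_sum _ _ _
      _ ≤ ∑ i ∈ Finset.range I, C₂ * 2⁻¹ ^ i := Finset.sum_le_sum fun i _ => H₂ i x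
      _ = C₂ * ∑ i ∈ Finset.range I, 2⁻¹ ^ i := (Finset.mul_sum _ _ _).symm
      _ ≤ _ := by gcongr; exact hg _ (by norm_num) (by norm_num)
  calc _ ≤ w * (|multiplierKernel χ x| + |∑ i ∈ Finset.range I, multiplierKernel (L i) x| +
        |∑ i ∈ Finset.range I, multiplierKernel (H i) x|) := by
        gcongr; exact abs_add_three _ _ _
    _ ≤ _ := by rw [mul_add, mul_add]; gcongr

end IsLittlewoodPaleyBump

end HeatKernelDecay

/-! ### Fourier inversion for kernels; mass, bounds and time continuity of the heat kernel. -/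

section HeatKernelProperties

variable {n : ℕ} {α : ℝ} {χ : EuclideanSpace ℝ (Fin n) → ℝ}

theorem continuous_heatKernel (hn : 0 < n) (hα : 0 < α) {t : ℝ} (ht : 0 < t) :
    Continuous (heatKernel α t : EuclideanSpace ℝ (Fin n) → ℝ) :=
  continuous_multiplierKernel (integrable_heatSymbol hn hα ht)

theorem fourier_coe_multiplierKernel {m : EuclideanSpace ℝ (Fin n) → ℝ} (hm : Continuous m)
    (hi : Integrable m) (he : ∀ ξ, m (-ξ) = m ξ) (hk : Integrable (multiplierKernel m)) :
    𝓕 (fun x => ((multiplierKernel m x : ℝ) : ℂ)) =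
      fun η : EuclideanSpace ℝ (Fin n) => ((m ((2 * Real.pi) • η) : ℝ) : ℂ) := by
  have h1 : (fun x => ((multiplierKernel m x : ℝ) : ℂ)) =
      𝓕⁻ (fun η : EuclideanSpace ℝ (Fin n) => ((m ((2 * Real.pi) • η) : ℝ) : ℂ)) :=
    funext fun x => coe_multiplierKernel m he x
  have h2 : Integrable (𝓕 (fun η : EuclideanSpace ℝ (Fin n) =>
      ((m ((2 * Real.pi) • η) : ℝ) : ℂ))) := by
    have h3 := hk.ofReal (𝕜 := ℂ)
    have h4 : Integrable (𝓕⁻ (fun η : EuclideanSpace ℝ (Fin n) =>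
      ((m ((2 * Real.pi) • η) : ℝ) : ℂ))) := h1 ▸ h3
    simpa [Real.fourierInv_eq_fourier_neg] using h4.comp_neg
  rw [h1]
  exact Continuous.fourier_fourierInv_eq
    (Complex.continuous_ofReal.comp (hm.comp (continuous_const_smul _)))
    (integrable_comp_two_pi_smul hi) h2

theorem integral_multiplierKernel {m : EuclideanSpace ℝ (Fin n) → ℝ} (hm : Continuous m)
    (hi : Integrable m) (he : ∀ ξ, m (-ξ) = m ξ) (hk : Integrable (multiplierKernel m)) :
    ∫ x, multiplierKernel m x = m 0 := by
  have h := congrFun (fourier_coe_multiplierKernel hm hi he hk) 0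
  simp only [Real.fourier_eq, smul_zero, inner_zero_right, neg_zero, AddChar.map_zero_eq_one,
    one_smul] at h
  rw [integral_complex_ofReal] at h
  exact_mod_cast h

/-- The convolution theorem identifies the Fourier transforms. The convolution is continuous, as one
factor is integrable and the other is bounded and continuous, so Fourier inversion gives equality at
every point. -/
theorem multiplierKernel_mul {m₁ m₂ : EuclideanSpace ℝ (Fin n) → ℝ}
    (hm₁ : Continuous m₁) (hi₁ : Integrable m₁) (he₁ : ∀ ξ, m₁ (-ξ) = m₁ ξ)
    (hk₁ : Integrable (multiplierKernel m₁))
    (hm₂ : Continuous m₂) (hi₂ : Integrable m₂) (he₂ : ∀ ξ, m₂ (-ξ) = m₂ ξ)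
    (hk₂ : Integrable (multiplierKernel m₂)) (hi : Integrable fun ξ => m₁ ξ * m₂ ξ) :
    multiplierKernel (fun ξ => m₁ ξ * m₂ ξ) =
      multiplierKernel m₁ ⋆[ContinuousLinearMap.lsmul ℝ ℝ, volume] multiplierKernel m₂ := by
  set k₁ : EuclideanSpace ℝ (Fin n) → ℂ := fun x => ((multiplierKernel m₁ x : ℝ) : ℂ)
  set k₂ : EuclideanSpace ℝ (Fin n) → ℂ := fun x => ((multiplierKernel m₂ x : ℝ) : ℂ) with hk₂d
  have hc₁ : Integrable k₁ := hk₁.ofReal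
  have hc₂ : Integrable k₂ := hk₂.ofReal
  have hc : 𝓕 (k₁ ⋆[ContinuousLinearMap.mul ℂ ℂ, volume] k₂) =
      fun η : EuclideanSpace ℝ (Fin n) =>
        (((fun ξ => m₁ ξ * m₂ ξ) ((2 * Real.pi) • η) : ℝ) : ℂ) := by
    ext η
    rw [Real.fourier_mul_convolution_eq hc₁ hc₂,
      fourier_coe_multiplierKernel hm₁ hi₁ he₁ hk₁, fourier_coe_multiplierKernel hm₂ hi₂ he₂ hk₂]
    push_cast
    rfl
  have hcont : Continuous (k₁ ⋆[ContinuousLinearMap.mul ℂ ℂ, volume] k₂) := by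
    refine BddAbove.continuous_convolution_right_of_integrable _ ⟨∫ ξ, |m₂ ξ|, ?_⟩ hc₁
      (Complex.continuous_ofReal.comp (continuous_multiplierKernel hi₂))
    rintro _ ⟨x, rfl⟩
    simpa [hk₂d] using abs_multiplierKernel_le_integral (m := m₂) x
  have hinv := hcont.fourierInv_fourier_eq
    (Integrable.integrable_convolution _ hc₁ hc₂)
    (by rw [hc]; exact integrable_comp_two_pi_smul hi)
  rw [hc] at hinv
  ext x
  have hx := congrFun hinv x
  rw [← coe_multiplierKernel (fun ξ => m₁ ξ * m₂ ξ) (fun ξ => by rw [he₁, he₂])] at hx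
  have h2 : (k₁ ⋆[ContinuousLinearMap.mul ℂ ℂ, volume] k₂) x =
      (((multiplierKernel m₁ ⋆[ContinuousLinearMap.lsmul ℝ ℝ, volume] multiplierKernel m₂) x : ℝ) :
        ℂ) := by
    simp only [convolution_def, ContinuousLinearMap.mul_apply', ContinuousLinearMap.lsmul_apply,
      smul_eq_mul, k₁, k₂]
    rw [← integral_complex_ofReal]
    simp
  rw [h2] at hx
  exact_mod_cast hx

theorem integrable_one_add_norm_smul_rpow (hα : 0 < α) {l : ℝ} (hl : 0 < l) :
    Integrable fun x : EuclideanSpace ℝ (Fin n) =>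
      (1 + ‖l • x‖) ^ (-((n : ℝ) + min α 1)) := by
  have h : Integrable fun x : EuclideanSpace ℝ (Fin n) =>
      (1 + ‖x‖) ^ (-((n : ℝ) + min α 1)) :=
    integrable_one_add_norm (by
      rw [finrank_euclideanSpace_fin]
      linarith [lt_min hα one_pos])
  exact h.comp_smul (R := l) hl.ne'

namespace IsLittlewoodPaleyBump

theorem exists_decay_heatKernel (hχ : IsLittlewoodPaleyBump χ) (hn : 0 < n) (hα : 0 < α) :
    ∃ C : ℝ, 0 ≤ C ∧ ∀ t : ℝ, 0 < t → ∀ x : EuclideanSpace ℝ (Fin n),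
      |heatKernel α t x| ≤ C * t ^ (-(n / (2 * α))) *
        (1 + ‖(t ^ (-(1 / (2 * α)))) • x‖) ^ (-((n : ℝ) + min α 1)) := by
  obtain ⟨C, hC, H⟩ := hχ.exists_decay_heatKernel_one hn hα
  refine ⟨C, hC, fun t ht x => ?_⟩
  rw [heatKernel_eq_smul hα ht, abs_mul, abs_of_pos (Real.rpow_pos_of_pos ht _), mul_comm C,
    mul_assoc]
  gcongr
  exact H _

theorem integrable_heatKernel (hχ : IsLittlewoodPaleyBump χ) (hn : 0 < n) (hα : 0 < α) {t : ℝ}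
    (ht : 0 < t) : Integrable (heatKernel α t : EuclideanSpace ℝ (Fin n) → ℝ) := by
  obtain ⟨C, hC, H⟩ := hχ.exists_decay_heatKernel hn hα
  refine Integrable.mono' ((integrable_one_add_norm_smul_rpow hα (l := t ^ (-(1 / (2 * α))))
    (Real.rpow_pos_of_pos ht _)).const_mul (C * t ^ (-(n / (2 * α)))))
    (continuous_heatKernel hn hα ht).aestronglyMeasurable (Eventually.of_forall fun x => H t ht x)

theorem exists_heatKernel_bound (hχ : IsLittlewoodPaleyBump χ) (hn : 0 < n) (hα : 0 < α) :
    ∃ A : ℝ, 0 < A ∧ ∀ t : ℝ, 0 < t →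
      ∫ x : EuclideanSpace ℝ (Fin n), |heatKernel α t x| ≤ A ∧
      ∀ x : EuclideanSpace ℝ (Fin n), |heatKernel α t x| ≤ A * t ^ (-(n / (2 * α))) := by
  obtain ⟨C, hC, H⟩ := hχ.exists_decay_heatKernel_one hn hα
  have hI : 0 ≤ ∫ x : EuclideanSpace ℝ (Fin n), |heatKernel α 1 x| :=
    integral_nonneg fun _ => abs_nonneg _
  refine ⟨C + (∫ x : EuclideanSpace ℝ (Fin n), |heatKernel α 1 x|) + 1, by positivity,
    fun t ht => ⟨?_, fun x => ?_⟩⟩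
  · have h := Measure.integral_comp_smul (volume : Measure (EuclideanSpace ℝ (Fin n)))
      (fun x => |heatKernel α 1 x|) (t ^ (-(1 / (2 * α))))
    have h2 : ∫ x : EuclideanSpace ℝ (Fin n), |heatKernel α t x| =
        ∫ x : EuclideanSpace ℝ (Fin n), |heatKernel α 1 x| := by
      simp_rw [heatKernel_eq_smul hα ht, abs_mul, abs_of_pos (Real.rpow_pos_of_pos ht _)]
      rw [integral_const_mul, h, finrank_euclideanSpace_fin, abs_of_pos (by positivity),
        smul_eq_mul, ← mul_assoc, ← Real.rpow_natCast, ← Real.rpow_mul ht.le,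
        ← Real.rpow_neg ht.le, ← Real.rpow_add ht]
      have : -((n : ℝ) / (2 * α)) + -(-(1 / (2 * α)) * n) = 0 := by ring
      rw [this, Real.rpow_zero, one_mul]
    rw [h2]
    linarith
  · rw [heatKernel_eq_smul hα ht, abs_mul, abs_of_pos (Real.rpow_pos_of_pos ht _), mul_comm]
    have h3 := H ((t ^ (-(1 / (2 * α)))) • x)
    have h4 : (1 + ‖(t ^ (-(1 / (2 * α)))) • x‖) ^ (-((n : ℝ) + min α 1)) ≤ 1 :=
      Real.rpow_le_one_of_one_le_of_nonpos (by linarith [norm_nonneg ((t ^ (-(1 / (2 * α)))) • x)])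
        (by linarith [lt_min hα one_pos, (Nat.cast_nonneg n : (0 : ℝ) ≤ n)])
    have h5 : |heatKernel α 1 ((t ^ (-(1 / (2 * α)))) • x)| ≤ C := h3.trans (by nlinarith)
    gcongr
    linarith

theorem tendsto_integral_heatKernel_sub (hχ : IsLittlewoodPaleyBump χ) (hn : 0 < n) (hα : 0 < α)
    {s : ℝ} (hs : 0 < s) :
    Tendsto (fun t => ∫ x : EuclideanSpace ℝ (Fin n), |heatKernel α t x - heatKernel α s x|)
      (𝓝 s) (𝓝 0) := by
  obtain ⟨C, hC, H⟩ := hχ.exists_decay_heatKernel hn hα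
  have hcont : ∀ x : EuclideanSpace ℝ (Fin n),
      ContinuousAt (fun t => heatKernel α t x) s := by
    intro x
    have h1 : ContinuousAt (fun t : ℝ => t ^ (-(n / (2 * α))) *
        heatKernel α 1 ((t ^ (-(1 / (2 * α)))) • x)) s :=
      (Real.continuousAt_rpow_const _ _ (Or.inl hs.ne')).mul
        ((continuous_heatKernel hn hα one_pos).continuousAt.comp
          ((Real.continuousAt_rpow_const _ _ (Or.inl hs.ne')).smul continuousAt_const))
    refine h1.congr ?_
    filter_upwards [lt_mem_nhds hs] with t ht
    exact (heatKernel_eq_smul hα ht x).symm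
  have h0 : (0 : ℝ) = ∫ x : EuclideanSpace ℝ (Fin n), (0 : ℝ) := by simp
  rw [h0]
  refine tendsto_integral_filter_of_dominated_convergence
    -- A majorant for all t in (s/2, 2s): the amplitude is largest at s/2 and the profile is widest
    -- at 2s.
    (fun x => C * (s / 2) ^ (-(n / (2 * α))) *
        (1 + ‖((2 * s) ^ (-(1 / (2 * α)))) • x‖) ^ (-((n : ℝ) + min α 1)) + |heatKernel α s x|)
    ?_ ?_ ?_ ?_
  · filter_upwards [lt_mem_nhds hs] with t ht
    exact ((continuous_heatKernel hn hα ht).sub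
      (continuous_heatKernel hn hα hs)).abs.aestronglyMeasurable
  · filter_upwards [Ioo_mem_nhds (by linarith : s / 2 < s) (by linarith : s < 2 * s)] with t ht
    have ht0 : 0 < t := by linarith [ht.1]
    refine Eventually.of_forall fun x => ?_
    rw [Real.norm_eq_abs, abs_abs]
    refine (abs_sub _ _).trans (add_le_add_left ((H t ht0 x).trans ?_) _)
    have e1 : t ^ (-((n : ℝ) / (2 * α))) ≤ (s / 2) ^ (-((n : ℝ) / (2 * α))) :=
      Real.rpow_le_rpow_of_nonpos (by positivity) ht.1.le (neg_nonpos.2 (by positivity))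
    have e2 : (1 + ‖(t ^ (-(1 / (2 * α)))) • x‖) ^ (-((n : ℝ) + min α 1)) ≤
        (1 + ‖((2 * s) ^ (-(1 / (2 * α)))) • x‖) ^ (-((n : ℝ) + min α 1)) := by
      refine Real.rpow_le_rpow_of_nonpos (by positivity) ?_
        (by linarith [lt_min hα one_pos, (Nat.cast_nonneg n : (0 : ℝ) ≤ n)])
      rw [norm_smul, norm_smul, Real.norm_eq_abs, Real.norm_eq_abs,
        abs_of_pos (Real.rpow_pos_of_pos ht0 _), abs_of_pos (by positivity)]
      gcongr 1 + ?_ * _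
      exact Real.rpow_le_rpow_of_nonpos ht0 ht.2.le (neg_nonpos.2 (by positivity))
    gcongr
  · exact ((integrable_one_add_norm_smul_rpow hα (by positivity)).const_mul _).add
      (hχ.integrable_heatKernel hn hα hs).abs
  · refine Eventually.of_forall fun x => ?_
    have := ((hcont x).sub (continuousAt_const (y := heatKernel α s x))).abs
    simpa [ContinuousAt] using this

theorem integral_heatKernel (hχ : IsLittlewoodPaleyBump χ) (hn : 0 < n) (hα : 0 < α) {t : ℝ}
    (ht : 0 < t) : ∫ x : EuclideanSpace ℝ (Fin n), heatKernel α t x = 1 := by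
  have h := integral_multiplierKernel (continuous_heatSymbol (n := n) hα t)
    (integrable_heatSymbol hn hα ht) (by simp) (hχ.integrable_heatKernel hn hα ht)
  unfold heatKernel
  rw [h]
  simp [Real.zero_rpow (by positivity : (2 * α) ≠ 0)]

end IsLittlewoodPaleyBump

end HeatKernelProperties

/-! ### Young's inequality for kernels with known integral and supremum bounds. -/

section YoungInequality

/-- Jensen's inequality for the weight w, obtained from Hölder by writing w = w^{1-1/m} w^{1/m}. It
underlies the convolution estimates, the approximate identity and Minkowski's integral inequality.
-/
theorem lintegral_mul_rpow_le {X : Type*} [MeasurableSpace X] {μ : Measure X} {w h : X → ℝ≥0∞}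
    (hw : AEMeasurable w μ) (hh : AEMeasurable h μ) (hw' : ∀ x, w x ≠ ∞) {m : ℝ} (hm : 1 ≤ m) :
    (∫⁻ x, w x * h x ∂μ) ^ m ≤ (∫⁻ x, w x ∂μ) ^ (m - 1) * ∫⁻ x, w x * h x ^ m ∂μ := by
  rcases hm.eq_or_lt with rfl | hm1
  · simp
  have hm0 : 0 < m := by linarith
  have hpq : (m / (m - 1)).HolderConjugate m := (Real.HolderConjugate.conjExponent hm1).symm
  have h1 := ENNReal.lintegral_mul_le_Lp_mul_Lq μ hpq
    (f := fun x => w x ^ (1 - 1 / m)) (g := fun x => w x ^ (1 / m) * h x)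
    (hw.pow_const _) ((hw.pow_const _).mul hh)
  have e1 : ∀ x, ((fun x => w x ^ (1 - 1 / m)) * fun x => w x ^ (1 / m) * h x) x = w x * h x := by
    intro x
    simp only [Pi.mul_apply]
    rw [← mul_assoc]
    rcases eq_or_ne (w x) 0 with h0 | h0
    · have : 0 < 1 - 1 / m := by
        rw [sub_pos, div_lt_one hm0]; exact hm1
      rw [h0, ENNReal.zero_rpow_of_pos this, zero_mul, zero_mul]
    · rw [← ENNReal.rpow_add _ _ h0 (hw' x), sub_add_cancel, ENNReal.rpow_one]
  have e2 : ∀ x, (w x ^ (1 - 1 / m)) ^ (m / (m - 1)) = w x := by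
    intro x
    have : (1 - 1 / m) * (m / (m - 1)) = 1 := by
      have : m - 1 ≠ 0 := by linarith
      field_simp
    rw [← ENNReal.rpow_mul, this, ENNReal.rpow_one]
  have e3 : ∀ x, (w x ^ (1 / m) * h x) ^ m = w x * h x ^ m := by
    intro x
    rw [ENNReal.mul_rpow_of_nonneg _ _ hm0.le, ← ENNReal.rpow_mul, one_div,
      inv_mul_cancel₀ hm0.ne', ENNReal.rpow_one]
  simp only [e1, e2, e3] at h1
  calc _ ≤ ((∫⁻ x, w x ∂μ) ^ (1 / (m / (m - 1))) * (∫⁻ x, w x * h x ^ m ∂μ) ^ (1 / m)) ^ m :=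
        ENNReal.rpow_le_rpow h1 hm0.le
    _ = _ := by
        rw [ENNReal.mul_rpow_of_nonneg _ _ hm0.le, ← ENNReal.rpow_mul, ← ENNReal.rpow_mul, one_div,
          one_div, inv_mul_cancel₀ hm0.ne', ENNReal.rpow_one, inv_div, div_mul_cancel₀ _ hm0.ne']

variable {n : ℕ}

/-- Continuous convolution kernels with integral at most `A` and supremum at most `B`. -/
structure IsBoundedKernel (k : EuclideanSpace ℝ (Fin n) → ℝ) (A B : ℝ) : Prop where
  continuous : Continuous k
  integrable : Integrable k
  integral_le : ∫ x, |k x| ≤ A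
  abs_le : ∀ x, |k x| ≤ B

variable {k : EuclideanSpace ℝ (Fin n) → ℝ} {A B : ℝ}

namespace IsBoundedKernel

theorem left_nonneg (hk : IsBoundedKernel k A B) : 0 ≤ A :=
  (integral_nonneg fun _ => abs_nonneg _).trans hk.integral_le

theorem right_nonneg (hk : IsBoundedKernel k A B) : 0 ≤ B := (abs_nonneg _).trans (hk.abs_le 0)

theorem mono (hk : IsBoundedKernel k A B) {A' B' : ℝ} (hA : A ≤ A') (hB : B ≤ B') :
    IsBoundedKernel k A' B' :=
  ⟨hk.continuous, hk.integrable, hk.integral_le.trans hA, fun x => (hk.abs_le x).trans hB⟩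

theorem lintegral_enorm_le (hk : IsBoundedKernel k A B) : ∫⁻ x, ‖k x‖ₑ ≤ ENNReal.ofReal A := by
  rw [← ofReal_integral_norm_eq_lintegral_enorm hk.integrable]
  exact ENNReal.ofReal_le_ofReal hk.integral_le

theorem enorm_le (hk : IsBoundedKernel k A B) (x : EuclideanSpace ℝ (Fin n)) :
    ‖k x‖ₑ ≤ ENNReal.ofReal B := by
  rw [Real.enorm_eq_ofReal_abs]
  exact ENNReal.ofReal_le_ofReal (hk.abs_le x)

theorem lconv_rpow_le (hk : IsBoundedKernel k A B) {h : EuclideanSpace ℝ (Fin n) → ℝ≥0∞}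
    (hh : AEMeasurable h) {m : ℝ} (hm : 1 ≤ m) (x : EuclideanSpace ℝ (Fin n)) :
    (∫⁻ y, ‖k y‖ₑ * h (x - y)) ^ m ≤
      ENNReal.ofReal A ^ (m - 1) * ∫⁻ y, ‖k y‖ₑ * h (x - y) ^ m := by
  refine (lintegral_mul_rpow_le hk.continuous.enorm.aemeasurable
    (hh.comp_quasiMeasurePreserving (quasiMeasurePreserving_sub_left_of_right_invariant _ x))
    (fun _ => enorm_ne_top) hm).trans ?_
  exact mul_le_mul_left (ENNReal.rpow_le_rpow hk.lintegral_enorm_le (by linarith)) _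

theorem lconv_rpow_le_sup (hk : IsBoundedKernel k A B) {h : EuclideanSpace ℝ (Fin n) → ℝ≥0∞}
    (hh : AEMeasurable h) {m : ℝ} (hm : 1 ≤ m) (x : EuclideanSpace ℝ (Fin n)) :
    (∫⁻ y, ‖k y‖ₑ * h (x - y)) ^ m ≤
      ENNReal.ofReal A ^ (m - 1) * ENNReal.ofReal B * ∫⁻ y, h y ^ m := by
  refine (hk.lconv_rpow_le hh hm x).trans ?_
  rw [mul_assoc]
  gcongr
  calc ∫⁻ y, ‖k y‖ₑ * h (x - y) ^ m ≤ ∫⁻ y, ENNReal.ofReal B * h (x - y) ^ m := by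
        gcongr with y; exact hk.enorm_le y
    _ = ENNReal.ofReal B * ∫⁻ y, h (x - y) ^ m := lintegral_const_mul' _ _ ENNReal.ofReal_ne_top
    _ = _ := by rw [lintegral_sub_left_eq_self (fun y => h y ^ m) x]

theorem aemeasurable_lconv_integrand (hk : IsBoundedKernel k A B)
    {h : EuclideanSpace ℝ (Fin n) → ℝ≥0∞} (hh : AEMeasurable h) :
    AEMeasurable (fun z : EuclideanSpace ℝ (Fin n) × EuclideanSpace ℝ (Fin n) =>
      ‖k z.2‖ₑ * h (z.1 - z.2)) (volume.prod volume) :=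
  ((hk.continuous.comp continuous_snd).enorm.aemeasurable).mul
    (hh.comp_quasiMeasurePreserving (quasiMeasurePreserving_sub_of_right_invariant _ _))

theorem lintegral_lconv_le (hk : IsBoundedKernel k A B) {h : EuclideanSpace ℝ (Fin n) → ℝ≥0∞}
    (hh : AEMeasurable h) :
    ∫⁻ x, ∫⁻ y, ‖k y‖ₑ * h (x - y) ≤ ENNReal.ofReal A * ∫⁻ y, h y := by
  rw [lintegral_lintegral_swap (hk.aemeasurable_lconv_integrand hh)]
  calc ∫⁻ y, ∫⁻ x, ‖k y‖ₑ * h (x - y) = ∫⁻ y, ‖k y‖ₑ * ∫⁻ x, h x := by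
        refine lintegral_congr fun y => ?_
        rw [lintegral_const_mul' _ _ enorm_ne_top, lintegral_sub_right_eq_self h y]
    _ = (∫⁻ y, ‖k y‖ₑ) * ∫⁻ x, h x := lintegral_mul_const _ hk.continuous.enorm.measurable
    _ ≤ _ := by gcongr; exact hk.lintegral_enorm_le

theorem lintegral_lconv_rpow_le (hk : IsBoundedKernel k A B)
    {h : EuclideanSpace ℝ (Fin n) → ℝ≥0∞} (hh : AEMeasurable h) {m : ℝ} (hm : 1 ≤ m) :
    ∫⁻ x, (∫⁻ y, ‖k y‖ₑ * h (x - y)) ^ m ≤ ENNReal.ofReal A ^ m * ∫⁻ y, h y ^ m := by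
  calc _ ≤ ∫⁻ x, ENNReal.ofReal A ^ (m - 1) * ∫⁻ y, ‖k y‖ₑ * h (x - y) ^ m :=
        lintegral_mono fun x => hk.lconv_rpow_le hh hm x
    _ = ENNReal.ofReal A ^ (m - 1) * ∫⁻ x, ∫⁻ y, ‖k y‖ₑ * h (x - y) ^ m :=
        lintegral_const_mul' _ _ (ENNReal.rpow_ne_top_of_nonneg (by linarith) ENNReal.ofReal_ne_top)
    _ ≤ ENNReal.ofReal A ^ (m - 1) * (ENNReal.ofReal A * ∫⁻ y, h y ^ m) := by
        gcongr
        exact hk.lintegral_lconv_le (hh.pow_const m)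
    _ = _ := by
        rw [← mul_assoc]
        congr 1
        conv_lhs => rw [← ENNReal.rpow_one (ENNReal.ofReal A), ← ENNReal.rpow_mul, one_mul]
        rw [← ENNReal.rpow_add_of_nonneg _ _ (by linarith) zero_le_one, sub_add_cancel]

/-- Write c^r = c^m c^{r-m} for the convolution c; the second factor is bounded by the supremum
estimate and the first is integrated by the L^m estimate. The constant A^{1-ω} B^ω, with ω = 1/m -
1/r, replaces the Lebesgue norm of the kernel in Young's inequality. -/
theorem lintegral_lconv_rpow_le_of_le (hk : IsBoundedKernel k A B)
    {h : EuclideanSpace ℝ (Fin n) → ℝ≥0∞} (hh : AEMeasurable h) {m r : ℝ} (hm : 1 ≤ m)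
    (hr : m ≤ r) :
    (∫⁻ x, (∫⁻ y, ‖k y‖ₑ * h (x - y)) ^ r) ^ (1 / r) ≤
      ENNReal.ofReal (A ^ (1 - (1 / m - 1 / r)) * B ^ (1 / m - 1 / r)) *
        (∫⁻ y, h y ^ m) ^ (1 / m) := by
  have hm0 : 0 < m := by linarith
  have hr0 : 0 < r := by linarith
  have hA := hk.left_nonneg
  have hB := hk.right_nonneg
  have hω : 0 ≤ 1 / m - 1 / r := sub_nonneg.2 (one_div_le_one_div_of_le hm0 hr)
  have hω1 : 1 / m - 1 / r < 1 := by
    have : 1 / m ≤ 1 := by rw [div_le_one hm0]; exact hm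
    have : 0 < 1 / r := by positivity
    linarith
  set a := ENNReal.ofReal A
  set β := ENNReal.ofReal B
  set I := ∫⁻ y, h y ^ m
  set c : EuclideanSpace ℝ (Fin n) → ℝ≥0∞ := fun x => ∫⁻ y, ‖k y‖ₑ * h (x - y)
  have hsup : ∀ x, c x ≤ (a ^ (m - 1) * β * I) ^ (1 / m) := fun x => by
    rw [one_div, ENNReal.le_rpow_inv_iff hm0]
    exact hk.lconv_rpow_le_sup hh hm x
  have hstep : ∫⁻ x, c x ^ r ≤ (a ^ m * I) * (a ^ (m - 1) * β * I) ^ ((r - m) / m) := by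
    calc ∫⁻ x, c x ^ r = ∫⁻ x, c x ^ m * c x ^ (r - m) := by
          refine lintegral_congr fun x => ?_
          rw [← ENNReal.rpow_add_of_nonneg _ _ hm0.le (by linarith)]
          congr 1
          ring
      _ ≤ ∫⁻ x, c x ^ m * (a ^ (m - 1) * β * I) ^ ((r - m) / m) := by
          gcongr with x
          refine (ENNReal.rpow_le_rpow (hsup x) (by linarith)).trans (le_of_eq ?_)
          rw [← ENNReal.rpow_mul]
          congr 1
          ring
      _ = (∫⁻ x, c x ^ m) * (a ^ (m - 1) * β * I) ^ ((r - m) / m) := by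
          refine lintegral_mul_const'' _ (AEMeasurable.pow_const ?_ _)
          exact (hk.aemeasurable_lconv_integrand hh).lintegral_prod_right'
      _ ≤ _ := by
          gcongr
          exact hk.lintegral_lconv_rpow_le hh hm
  have hrm : 0 ≤ (r - m) / m := div_nonneg (by linarith) hm0.le
  refine (ENNReal.rpow_le_rpow hstep (by positivity)).trans (le_of_eq ?_)
  rw [ENNReal.mul_rpow_of_nonneg _ _ (by positivity : 0 ≤ 1 / r),
    ENNReal.mul_rpow_of_nonneg _ _ (by positivity : 0 ≤ 1 / r), ← ENNReal.rpow_mul,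
    ← ENNReal.rpow_mul, ENNReal.mul_rpow_of_nonneg _ _ (by positivity : 0 ≤ (r - m) / m * (1 / r)),
    ENNReal.mul_rpow_of_nonneg _ _ (by positivity : 0 ≤ (r - m) / m * (1 / r)), ← ENNReal.rpow_mul,
    ENNReal.ofReal_mul (by positivity), ← ENNReal.ofReal_rpow_of_nonneg hA (by linarith),
    ← ENNReal.ofReal_rpow_of_nonneg hB hω]
  have e1 : (r - m) / m * (1 / r) = 1 / m - 1 / r := by field_simp
  rw [e1]
  have e2 : 1 - (1 / m - 1 / r) = m * (1 / r) + (m - 1) * (1 / m - 1 / r) := by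
    field_simp
    ring
  have e3 : 1 / m = 1 / r + (1 / m - 1 / r) := by ring
  rw [e2, ENNReal.rpow_add_of_nonneg (x := a) _ _ (by positivity) (mul_nonneg (by linarith) hω)]
  conv_rhs => rw [e3, ENNReal.rpow_add_of_nonneg (x := I) _ _ (by positivity) hω, ← e3]
  ring

variable {𝕜 : Type*} [RCLike 𝕜] {g : EuclideanSpace ℝ (Fin n) → 𝕜} {m r : ℝ}

theorem lintegral_rpow_eq {g : EuclideanSpace ℝ (Fin n) → 𝕜} (hm : 0 < m) :
    (∫⁻ y, ‖g y‖ₑ ^ m) ^ (1 / m) = eLpNorm g (ENNReal.ofReal m) volume := by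
  rw [eLpNorm_eq_lintegral_rpow_enorm_toReal (by simpa using hm) ENNReal.ofReal_ne_top,
    ENNReal.toReal_ofReal hm.le]

theorem enorm_convolution_le (k : EuclideanSpace ℝ (Fin n) → ℝ)
    (g : EuclideanSpace ℝ (Fin n) → 𝕜) (x : EuclideanSpace ℝ (Fin n)) :
    ‖(k ⋆[ContinuousLinearMap.lsmul ℝ ℝ, volume] g) x‖ₑ ≤ ∫⁻ y, ‖k y‖ₑ * ‖g (x - y)‖ₑ := by
  rw [convolution_def]
  refine (enorm_integral_le_lintegral_enorm _).trans (le_of_eq (lintegral_congr fun y => ?_))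
  rw [ContinuousLinearMap.lsmul_apply, enorm_smul]

theorem lconv_le_sup (hk : IsBoundedKernel k A B) (hm : 1 ≤ m)
    (hg : AEStronglyMeasurable g volume) (x : EuclideanSpace ℝ (Fin n)) :
    ∫⁻ y, ‖k y‖ₑ * ‖g (x - y)‖ₑ ≤
      ENNReal.ofReal (A ^ (1 - 1 / m) * B ^ (1 / m)) * eLpNorm g (ENNReal.ofReal m) volume := by
  have hm0 : 0 < m := by linarith
  have h1m : 1 / m ≤ 1 := by rw [div_le_one hm0]; exact hm
  have hA := hk.left_nonneg
  have hB := hk.right_nonneg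
  have h := ENNReal.rpow_le_rpow (hk.lconv_rpow_le_sup hg.enorm hm x)
    (by positivity : 0 ≤ 1 / m)
  rw [← ENNReal.rpow_mul, mul_one_div_cancel hm0.ne', ENNReal.rpow_one] at h
  refine h.trans (le_of_eq ?_)
  rw [← lintegral_rpow_eq hm0, ENNReal.mul_rpow_of_nonneg _ _ (by positivity : 0 ≤ 1 / m),
    ENNReal.mul_rpow_of_nonneg _ _ (by positivity : 0 ≤ 1 / m), ← ENNReal.rpow_mul,
    ENNReal.ofReal_mul (by positivity), ENNReal.ofReal_rpow_of_nonneg hB (by positivity),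
    ← ENNReal.ofReal_rpow_of_nonneg hA (by linarith)]
  congr 3
  field_simp

theorem convolutionExistsAt (hk : IsBoundedKernel k A B) (hm : 1 ≤ m)
    (hg : MemLp g (ENNReal.ofReal m) volume) (x : EuclideanSpace ℝ (Fin n)) :
    ConvolutionExistsAt k g x (ContinuousLinearMap.lsmul ℝ ℝ) volume := by
  refine ⟨?_, ?_⟩
  · exact hk.continuous.aestronglyMeasurable.smul (hg.1.comp_quasiMeasurePreserving
      (quasiMeasurePreserving_sub_left_of_right_invariant _ x))
  · refine lt_of_le_of_lt ?_ (lt_of_le_of_lt (hk.lconv_le_sup hm hg.1 x)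
      (ENNReal.mul_lt_top ENNReal.ofReal_lt_top hg.2))
    refine lintegral_mono fun y => ?_
    simp only [ContinuousLinearMap.lsmul_apply, enorm_smul, le_refl]

theorem enorm_convolution_le_sup (hk : IsBoundedKernel k A B) (hm : 1 ≤ m)
    (hg : AEStronglyMeasurable g volume) (x : EuclideanSpace ℝ (Fin n)) :
    ‖(k ⋆[ContinuousLinearMap.lsmul ℝ ℝ, volume] g) x‖ₑ ≤
      ENNReal.ofReal (A ^ (1 - 1 / m) * B ^ (1 / m)) * eLpNorm g (ENNReal.ofReal m) volume :=
  (enorm_convolution_le k g x).trans (hk.lconv_le_sup hm hg x)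

/-- Young's convolution inequality, with the kernel norm replaced by interpolation. -/
theorem eLpNorm_convolution_le (hk : IsBoundedKernel k A B) (hm : 1 ≤ m) (hr : m ≤ r)
    (hg : AEStronglyMeasurable g volume) :
    eLpNorm (k ⋆[ContinuousLinearMap.lsmul ℝ ℝ, volume] g) (ENNReal.ofReal r) volume ≤
      ENNReal.ofReal (A ^ (1 - (1 / m - 1 / r)) * B ^ (1 / m - 1 / r)) *
        eLpNorm g (ENNReal.ofReal m) volume := by
  rw [← lintegral_rpow_eq (by linarith), ← lintegral_rpow_eq (by linarith)]
  refine le_trans ?_ (hk.lintegral_lconv_rpow_le_of_le hg.enorm hm hr)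
  have : 0 ≤ 1 / r := by
    have : 0 < r := by linarith
    positivity
  gcongr with x
  · linarith
  · exact enorm_convolution_le k g x

theorem convolution_sub_right (hk : IsBoundedKernel k A B) (hm : 1 ≤ m)
    {g₁ g₂ : EuclideanSpace ℝ (Fin n) → 𝕜}
    (h₁ : MemLp g₁ (ENNReal.ofReal m) volume) (h₂ : MemLp g₂ (ENNReal.ofReal m) volume) :
    k ⋆[ContinuousLinearMap.lsmul ℝ ℝ, volume] (g₁ - g₂) =
      k ⋆[ContinuousLinearMap.lsmul ℝ ℝ, volume] g₁ -
        k ⋆[ContinuousLinearMap.lsmul ℝ ℝ, volume] g₂ := by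
  ext x
  simp only [convolution_def, Pi.sub_apply, map_sub]
  exact integral_sub (hk.convolutionExistsAt hm h₁ x) (hk.convolutionExistsAt hm h₂ x)

theorem convolution_sub_left {k₁ k₂ : EuclideanSpace ℝ (Fin n) → ℝ} {A₁ B₁ A₂ B₂ : ℝ}
    (hk₁ : IsBoundedKernel k₁ A₁ B₁) (hk₂ : IsBoundedKernel k₂ A₂ B₂) (hm : 1 ≤ m)
    (hg : MemLp g (ENNReal.ofReal m) volume) :
    (k₁ - k₂) ⋆[ContinuousLinearMap.lsmul ℝ ℝ, volume] g =
      k₁ ⋆[ContinuousLinearMap.lsmul ℝ ℝ, volume] g -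
        k₂ ⋆[ContinuousLinearMap.lsmul ℝ ℝ, volume] g := by
  ext x
  simp only [convolution_def, Pi.sub_apply, map_sub, sub_apply]
  exact integral_sub (hk₁.convolutionExistsAt hm hg x) (hk₂.convolutionExistsAt hm hg x)

theorem sub {k₁ k₂ : EuclideanSpace ℝ (Fin n) → ℝ} {A₁ B₁ A₂ B₂ : ℝ}
    (hk₁ : IsBoundedKernel k₁ A₁ B₁) (hk₂ : IsBoundedKernel k₂ A₂ B₂) :
    IsBoundedKernel (k₁ - k₂) (∫ x, |k₁ x - k₂ x|) (B₁ + B₂) :=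
  ⟨hk₁.continuous.sub hk₂.continuous, hk₁.integrable.sub hk₂.integrable, le_rfl,
    fun x => (abs_sub _ _).trans (add_le_add (hk₁.abs_le x) (hk₂.abs_le x))⟩

theorem tendsto_eLpNorm_translate {p : ℝ≥0∞} (hp1 : 1 ≤ p) (hp : p ≠ ∞) (hg : MemLp g p volume) :
    Tendsto (fun z : EuclideanSpace ℝ (Fin n) => eLpNorm (fun x => g (x + z) - g x) p volume)
      (𝓝 0) (𝓝 0) := by
  have : Fact (1 ≤ p) := ⟨hp1⟩
  set τ : EuclideanSpace ℝ (Fin n) → C(EuclideanSpace ℝ (Fin n), EuclideanSpace ℝ (Fin n)) :=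
    fun z => ⟨fun x => x + z, by fun_prop⟩
  have hτ : Continuous τ := ContinuousMap.continuous_of_continuous_uncurry _ (by
    simp only [τ]
    exact continuous_snd.add continuous_fst)
  have hmp : ∀ z, MeasurePreserving (τ z) (volume : Measure (EuclideanSpace ℝ (Fin n))) volume :=
    fun z => measurePreserving_add_right volume z
  have h := Filter.Tendsto.compMeasurePreservingLp (tendsto_const_nhds (x := hg.toLp g))
    (hτ.tendsto 0) hmp (hmp 0) hp
  rw [tendsto_iff_edist_tendsto_0] at h
  refine h.congr fun z => ?_
  rw [Lp.toLp_compMeasurePreserving hg, Lp.toLp_compMeasurePreserving hg, Lp.edist_toLp_toLp]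
  refine eLpNorm_congr_ae (Eventually.of_forall fun x => ?_)
  simp [τ]

/-- Moving the point x amounts to translating g, and translations are continuous in L^m for finite
m; the supremum bound then applies to the difference of g and its translate. -/
theorem continuous_convolution (hk : IsBoundedKernel k A B) (hm : 1 ≤ m)
    (hg : MemLp g (ENNReal.ofReal m) volume) :
    Continuous (k ⋆[ContinuousLinearMap.lsmul ℝ ℝ, volume] g) := by
  rw [continuous_iff_continuousAt]
  intro x
  rw [ContinuousAt, tendsto_iff_edist_tendsto_0]
  have h1 := tendsto_eLpNorm_translate (by simpa using ENNReal.ofReal_le_ofReal hm)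
    ENNReal.ofReal_ne_top hg
  have h2 : Tendsto (fun x' => x' - x) (𝓝 x) (𝓝 0) := by
    have : Continuous fun x' : EuclideanSpace ℝ (Fin n) => x' - x := by fun_prop
    simpa using this.tendsto x
  have h3 := ENNReal.Tendsto.const_mul (a := ENNReal.ofReal (A ^ (1 - 1 / m) * B ^ (1 / m)))
    (h1.comp h2) (Or.inr ENNReal.ofReal_ne_top)
  rw [mul_zero] at h3
  refine tendsto_of_tendsto_of_tendsto_of_le_of_le tendsto_const_nhds h3 (fun _ => zero_le)
    fun x' => ?_
  have hmp : MeasurePreserving (fun y => y + (x' - x))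
    (volume : Measure (EuclideanSpace ℝ (Fin n))) volume := measurePreserving_add_right volume _
  have hg' : MemLp (fun y => g (y + (x' - x))) (ENNReal.ofReal m) volume :=
    hg.comp_measurePreserving hmp
  have e : (k ⋆[ContinuousLinearMap.lsmul ℝ ℝ, volume] g) x' =
      (k ⋆[ContinuousLinearMap.lsmul ℝ ℝ, volume] (fun y => g (y + (x' - x)))) x := by
    simp only [convolution_def]
    congr 1
    ext y
    congr 2
    abel
  simp only [Function.comp_def]
  rw [edist_eq_enorm_sub, e, ← Pi.sub_apply, ← hk.convolution_sub_right hm hg' hg]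
  exact hk.enorm_convolution_le_sup hm (hg'.1.sub hg.1) x

theorem memLp_convolution (hk : IsBoundedKernel k A B) (hm : 1 ≤ m) (hr : m ≤ r)
    (hg : MemLp g (ENNReal.ofReal m) volume) :
    MemLp (k ⋆[ContinuousLinearMap.lsmul ℝ ℝ, volume] g) (ENNReal.ofReal r) volume :=
  ⟨(hk.continuous_convolution hm hg).aestronglyMeasurable,
    (hk.eLpNorm_convolution_le hm hr hg.1).trans_lt (ENNReal.mul_lt_top ENNReal.ofReal_lt_top hg.2)⟩

end IsBoundedKernel

end YoungInequality

/-! ### L^p theory of the semigroup. -/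

section HeatSemigroup

variable {n : ℕ} {α A : ℝ} {𝕜 : Type*} [RCLike 𝕜]

/-- The bounds on the heat kernels on which the `L^p` theory of the semigroup rests. -/
structure HeatBounds (n : ℕ) (α A : ℝ) : Prop where
  pos : 0 < A
  kernel : ∀ t : ℝ, 0 < t → IsBoundedKernel (heatKernel α t : EuclideanSpace ℝ (Fin n) → ℝ)
    A (A * t ^ (-(n / (2 * α))))
  tendsto : ∀ s : ℝ, 0 < s → Tendsto
    (fun t => ∫ x : EuclideanSpace ℝ (Fin n), |heatKernel α t x - heatKernel α s x|) (𝓝 s) (𝓝 0)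

theorem IsLittlewoodPaleyBump.exists_heatBounds {χ : EuclideanSpace ℝ (Fin n) → ℝ}
    (hχ : IsLittlewoodPaleyBump χ) (hn : 0 < n) (hα : 0 < α) : ∃ A, HeatBounds n α A := by
  obtain ⟨A, hA, H⟩ := hχ.exists_heatKernel_bound hn hα
  exact ⟨A, hA, fun t ht => ⟨continuous_heatKernel hn hα ht, hχ.integrable_heatKernel hn hα ht,
    (H t ht).1, (H t ht).2⟩, fun s hs => hχ.tendsto_integral_heatKernel_sub hn hα hs⟩

theorem fracSemigroup_eq (α t : ℝ) (f : EuclideanSpace ℝ (Fin n) → 𝕜) :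
    fracSemigroup α t f = heatKernel α t ⋆[ContinuousLinearMap.lsmul ℝ ℝ, volume] f := rfl

theorem fracSemigroup_congr {f g : EuclideanSpace ℝ (Fin n) → 𝕜} (h : f =ᵐ[volume] g) (α t : ℝ) :
    fracSemigroup α t f = fracSemigroup α t g := by
  rw [fracSemigroup_eq, fracSemigroup_eq]
  exact convolution_congr _ (ae_eq_refl _) h

namespace HeatBounds

variable (hK : HeatBounds n α A) {m r : ℝ} {g : EuclideanSpace ℝ (Fin n) → 𝕜}

include hK

theorem eLpNorm_fracSemigroup_le {t : ℝ} (ht : 0 < t) (hm : 1 ≤ m) (hr : m ≤ r)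
    (hg : AEStronglyMeasurable g volume) :
    eLpNorm (fracSemigroup α t g) (ENNReal.ofReal r) volume ≤
      ENNReal.ofReal (A * t ^ (-(n / (2 * α) * (1 / m - 1 / r)))) *
        eLpNorm g (ENNReal.ofReal m) volume := by
  refine ((hK.kernel t ht).eLpNorm_convolution_le hm hr hg).trans (le_of_eq ?_)
  congr 2
  rw [Real.mul_rpow hK.pos.le (by positivity), ← mul_assoc, ← Real.rpow_add hK.pos, sub_add_cancel,
    Real.rpow_one, ← Real.rpow_mul ht.le, neg_mul]

theorem enorm_fracSemigroup_le {t : ℝ} (ht : 0 < t) (hm : 1 ≤ m)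
    (hg : AEStronglyMeasurable g volume) (x : EuclideanSpace ℝ (Fin n)) :
    ‖fracSemigroup α t g x‖ₑ ≤
      ENNReal.ofReal (A * t ^ (-(n / (2 * α) * (1 / m)))) *
        eLpNorm g (ENNReal.ofReal m) volume := by
  refine ((hK.kernel t ht).enorm_convolution_le_sup hm hg x).trans (le_of_eq ?_)
  congr 2
  rw [Real.mul_rpow hK.pos.le (by positivity), ← mul_assoc, ← Real.rpow_add hK.pos, sub_add_cancel,
    Real.rpow_one, ← Real.rpow_mul ht.le, neg_mul]

theorem memLp_fracSemigroup {t : ℝ} (ht : 0 < t) (hm : 1 ≤ m) (hr : m ≤ r)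
    (hg : MemLp g (ENNReal.ofReal m) volume) :
    MemLp (fracSemigroup α t g) (ENNReal.ofReal r) volume :=
  (hK.kernel t ht).memLp_convolution hm hr hg

theorem continuous_fracSemigroup {t : ℝ} (ht : 0 < t) (hm : 1 ≤ m)
    (hg : MemLp g (ENNReal.ofReal m) volume) : Continuous (fracSemigroup α t g) :=
  (hK.kernel t ht).continuous_convolution hm hg

theorem fracSemigroup_sub {t : ℝ} (ht : 0 < t) (hm : 1 ≤ m)
    {g₁ g₂ : EuclideanSpace ℝ (Fin n) → 𝕜}
    (h₁ : MemLp g₁ (ENNReal.ofReal m) volume) (h₂ : MemLp g₂ (ENNReal.ofReal m) volume) :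
    fracSemigroup α t (g₁ - g₂) = fracSemigroup α t g₁ - fracSemigroup α t g₂ :=
  (hK.kernel t ht).convolution_sub_right hm h₁ h₂

/-- Modulus of continuity in time of the semigroup, uniformly on `L^m`-bounded sets. -/
theorem exists_modulus {s : ℝ} (hs : 0 < s) {ω : ℝ} (h0 : 0 ≤ ω) (h1 : ω < 1) :
    ∃ δ : ℝ → ℝ, Tendsto δ (𝓝 s) (𝓝 0) ∧ ∀ᶠ t in 𝓝 s, 0 < t ∧ ∃ D B : ℝ,
      IsBoundedKernel (heatKernel α t - heatKernel α s : EuclideanSpace ℝ (Fin n) → ℝ) D B ∧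
      D ^ (1 - ω) * B ^ ω = δ t := by
  -- Only the L¹ distance of the kernels is known to tend to 0, while their suprema are merely
  -- bounded near s. The interpolated constant still tends to 0 because 1 - ω > 0.
  refine ⟨fun t => (∫ x : EuclideanSpace ℝ (Fin n), |heatKernel α t x - heatKernel α s x|) ^ (1 - ω)
    * (A * t ^ (-(n / (2 * α))) + A * s ^ (-(n / (2 * α)))) ^ ω, ?_, ?_⟩
  · have e1 : Tendsto (fun t => (∫ x : EuclideanSpace ℝ (Fin n),
        |heatKernel α t x - heatKernel α s x|) ^ (1 - ω)) (𝓝 s) (𝓝 0) := by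
      have := (hK.tendsto s hs).rpow_const (p := 1 - ω) (Or.inr (by linarith))
      rwa [Real.zero_rpow (by linarith)] at this
    have e2 : Tendsto (fun t : ℝ => (A * t ^ (-(n / (2 * α))) + A * s ^ (-(n / (2 * α)))) ^ ω)
        (𝓝 s) (𝓝 ((A * s ^ (-(n / (2 * α))) + A * s ^ (-(n / (2 * α)))) ^ ω)) :=
      (((Real.continuousAt_rpow_const s _ (Or.inl hs.ne')).tendsto.const_mul A).add_const
        _).rpow_const (Or.inr h0)
    simpa using e1.mul e2
  · filter_upwards [lt_mem_nhds hs] with t ht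
    exact ⟨ht, _, _, (hK.kernel t ht).sub (hK.kernel s hs), rfl⟩

theorem tendsto_fracSemigroup_modulus {s : ℝ} (hs : 0 < s) (hm : 1 ≤ m) (hr : m ≤ r) :
    ∃ δ : ℝ → ℝ, Tendsto δ (𝓝 s) (𝓝 0) ∧ ∀ᶠ t in 𝓝 s, 0 < t ∧
      ∀ g : EuclideanSpace ℝ (Fin n) → 𝕜, MemLp g (ENNReal.ofReal m) volume →
      eLpNorm (fracSemigroup α t g - fracSemigroup α s g) (ENNReal.ofReal r) volume ≤
        ENNReal.ofReal (δ t) * eLpNorm g (ENNReal.ofReal m) volume := by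
  have hm0 : 0 < m := by linarith
  have hr0 : 0 < r := by linarith
  have hω1 : 1 / m - 1 / r < 1 := by
    have : 1 / m ≤ 1 := by rw [div_le_one hm0]; exact hm
    have : 0 < 1 / r := by positivity
    linarith
  obtain ⟨δ, hδ, h⟩ := hK.exists_modulus hs
    (sub_nonneg.2 (one_div_le_one_div_of_le hm0 hr)) hω1
  refine ⟨δ, hδ, h.mono fun t ⟨ht, D, B, hk, hD⟩ => ⟨ht, fun g hg => ?_⟩⟩
  rw [fracSemigroup_eq, fracSemigroup_eq,
    ← IsBoundedKernel.convolution_sub_left (hK.kernel t ht) (hK.kernel s hs) hm hg, ← hD]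
  exact hk.eLpNorm_convolution_le hm hr hg.1

theorem tendsto_fracSemigroup_modulus_sup {s : ℝ} (hs : 0 < s) (hm : 1 < m) :
    ∃ δ : ℝ → ℝ, Tendsto δ (𝓝 s) (𝓝 0) ∧ ∀ᶠ t in 𝓝 s, 0 < t ∧
      ∀ g : EuclideanSpace ℝ (Fin n) → 𝕜, MemLp g (ENNReal.ofReal m) volume → ∀ x,
      ‖fracSemigroup α t g x - fracSemigroup α s g x‖ₑ ≤
        ENNReal.ofReal (δ t) * eLpNorm g (ENNReal.ofReal m) volume := by
  have hm0 : 0 < m := by linarith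
  have hω1 : 1 / m < 1 := by rw [div_lt_one hm0]; exact hm
  obtain ⟨δ, hδ, h⟩ := hK.exists_modulus hs (by positivity) hω1
  refine ⟨δ, hδ, h.mono fun t ⟨ht, D, B, hk, hD⟩ => ⟨ht, fun g hg x => ?_⟩⟩
  rw [fracSemigroup_eq, fracSemigroup_eq, ← Pi.sub_apply,
    ← IsBoundedKernel.convolution_sub_left (hK.kernel t ht) (hK.kernel s hs) hm.le hg, ← hD]
  exact hk.enorm_convolution_le_sup hm.le hg.1 x

/-- Density: the evolution of a compactly supported continuous function is bounded in L^r, so the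
weight sends it to 0, while the smoothing estimate bounds the weighted norm of the remainder by A
times its L^m norm, uniformly in t. -/
theorem tendsto_weighted_fracSemigroup (hn : 0 < n) (hα : 0 < α) (hm : 1 ≤ m) (hr : m < r)
    (hg : MemLp g (ENNReal.ofReal m) volume) :
    Tendsto (fun t : ℝ => ENNReal.ofReal (t ^ (n / (2 * α) * (1 / m - 1 / r))) *
      eLpNorm (fracSemigroup α t g) (ENNReal.ofReal r) volume) (𝓝[>] 0) (𝓝 0) := by
  have hm0 : 0 < m := by linarith
  have hn' : (0 : ℝ) < n := by exact_mod_cast hn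
  set θ : ℝ := n / (2 * α) * (1 / m - 1 / r) with hθ
  have hθ0 : 0 < θ := mul_pos (by positivity) (sub_pos.2 (one_div_lt_one_div_of_lt hm0 hr))
  rw [ENNReal.tendsto_nhds_zero]
  intro ε hε
  obtain ⟨η, hη0, hη⟩ : ∃ η : ℝ≥0∞, 0 < η ∧ ENNReal.ofReal A * η ≤ ε / 2 := by
    rcases eq_or_ne ε ⊤ with rfl | hε'
    · exact ⟨1, one_pos, by rw [ENNReal.top_div_of_ne_top (by simp)]; exact le_top⟩
    · refine ⟨ε / 2 / ENNReal.ofReal A, ENNReal.div_pos (ENNReal.half_pos hε.ne').ne'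
        ENNReal.ofReal_ne_top, ?_⟩
      exact ENNReal.mul_div_le
  obtain ⟨φ, hφc, hφd, hφ, hφm⟩ := hg.exists_hasCompactSupport_eLpNorm_sub_le
    ENNReal.ofReal_ne_top hη0.ne'
  have hφr : MemLp φ (ENNReal.ofReal r) volume := hφ.memLp_of_hasCompactSupport hφc
  have h1 : Tendsto (fun t : ℝ => ENNReal.ofReal (t ^ θ) *
      (ENNReal.ofReal A * eLpNorm φ (ENNReal.ofReal r) volume)) (𝓝[>] 0) (𝓝 0) := by
    have h2 : Tendsto (fun t : ℝ => t ^ θ) (𝓝[>] 0) (𝓝 0) := by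
      have := (Real.continuousAt_rpow_const 0 θ (Or.inr hθ0.le)).tendsto
      rw [Real.zero_rpow hθ0.ne'] at this
      exact this.mono_left nhdsWithin_le_nhds
    have h3 := ENNReal.Tendsto.mul_const (ENNReal.tendsto_ofReal h2)
      (b := ENNReal.ofReal A * eLpNorm φ (ENNReal.ofReal r) volume)
      (Or.inr (ENNReal.mul_ne_top ENNReal.ofReal_ne_top hφr.2.ne))
    simpa using h3
  filter_upwards [(ENNReal.tendsto_nhds_zero.1 h1) (ε / 2) (ENNReal.half_pos hε.ne'),
    self_mem_nhdsWithin] with t ht1 ht0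
  have ht0 : 0 < t := ht0
  have hsplit : fracSemigroup α t g = fracSemigroup α t φ + fracSemigroup α t (g - φ) := by
    rw [hK.fracSemigroup_sub ht0 hm hg hφm]
    abel
  have hb1 : eLpNorm (fracSemigroup α t φ) (ENNReal.ofReal r) volume ≤
      ENNReal.ofReal A * eLpNorm φ (ENNReal.ofReal r) volume := by
    have := hK.eLpNorm_fracSemigroup_le ht0 (hm.trans hr.le) le_rfl hφr.1
    simpa using this
  have hb2 : ENNReal.ofReal (t ^ θ) * eLpNorm (fracSemigroup α t (g - φ)) (ENNReal.ofReal r) volume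
      ≤ ENNReal.ofReal A * η := by
    refine (mul_le_mul_right (hK.eLpNorm_fracSemigroup_le ht0 hm hr.le (hg.sub hφm).1) _).trans ?_
    rw [← mul_assoc, ← ENNReal.ofReal_mul (by positivity), mul_left_comm, ← Real.rpow_add ht0,
      ← hθ, add_neg_cancel, Real.rpow_zero, mul_one]
    gcongr
  calc _ ≤ ENNReal.ofReal (t ^ θ) * (eLpNorm (fracSemigroup α t φ) (ENNReal.ofReal r) volume +
        eLpNorm (fracSemigroup α t (g - φ)) (ENNReal.ofReal r) volume) := by
        gcongr
        rw [hsplit]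
        refine eLpNorm_add_le (hK.memLp_fracSemigroup ht0 hm hr.le hφm).1
          (hK.memLp_fracSemigroup ht0 hm hr.le (hg.sub hφm)).1 ?_
        simpa using ENNReal.ofReal_le_ofReal (hm.trans hr.le)
    _ ≤ ε / 2 + ε / 2 := by
        rw [mul_add]
        refine add_le_add ((mul_le_mul_right hb1 _).trans ht1) (hb2.trans hη)
    _ = ε := ENNReal.add_halves ε

end HeatBounds

theorem fracSemigroup_eq_integral_smul (hα : 0 < α) {t : ℝ} (ht : 0 < t)
    (g : EuclideanSpace ℝ (Fin n) → 𝕜) (x : EuclideanSpace ℝ (Fin n)) :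
    fracSemigroup α t g x =
      ∫ y, heatKernel α 1 y • g (x - (t ^ (1 / (2 * α))) • y) := by
  have hl : 0 < t ^ (1 / (2 * α)) := Real.rpow_pos_of_pos ht _
  have h := Measure.integral_comp_smul (volume : Measure (EuclideanSpace ℝ (Fin n)))
    (fun y => heatKernel α t y • g (x - y)) (t ^ (1 / (2 * α)))
  rw [finrank_euclideanSpace_fin, abs_of_pos (by positivity),
    eq_inv_smul_iff₀ (by positivity), ← integral_smul] at h
  rw [fracSemigroup_eq, convolution_def]
  refine Eq.trans h.symm (integral_congr_ae (Eventually.of_forall fun y => ?_))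
  simp only
  rw [heatKernel_eq_smul hα ht, smul_smul, smul_smul (t ^ (-(1 / (2 * α)))), ← Real.rpow_add ht,
    neg_add_cancel, Real.rpow_zero, one_smul, ← mul_assoc, ← Real.rpow_natCast,
    ← Real.rpow_mul ht.le, ← Real.rpow_add ht]
  have : 1 / (2 * α) * n + -(n / (2 * α)) = 0 := by ring
  rw [this, Real.rpow_zero, one_mul]

/-- Approximate identity: the kernel has integral 1, so S(t)φ - φ averages φ(x - t^{1/(2α)} y) -
φ(x) against the fixed kernel at time 1, which may change sign. Jensen and Tonelli reduce the claim
to continuity of translations in L^r and dominated convergence in y. -/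
theorem IsLittlewoodPaleyBump.tendsto_fracSemigroup {χ : EuclideanSpace ℝ (Fin n) → ℝ}
    (hχ : IsLittlewoodPaleyBump χ) (hn : 0 < n) (hα : 0 < α) {r : ℝ} (hr : 1 ≤ r)
    {φ : EuclideanSpace ℝ (Fin n) → 𝕜} (hφ : MemLp φ (ENNReal.ofReal r) volume) :
    Tendsto (fun t => eLpNorm (fracSemigroup α t φ - φ) (ENNReal.ofReal r) volume)
      (𝓝[>] 0) (𝓝 0) := by
  have hr0 : 0 < r := by linarith
  obtain ⟨A, hK⟩ := hχ.exists_heatBounds hn hα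
  wlog hmeas : StronglyMeasurable φ generalizing φ
  · have h := this (hφ.ae_eq hφ.1.ae_eq_mk) hφ.1.stronglyMeasurable_mk
    refine h.congr fun t => ?_
    rw [← fracSemigroup_congr hφ.1.ae_eq_mk]
    refine eLpNorm_congr_ae ?_
    filter_upwards [hφ.1.ae_eq_mk] with x hx
    simp [hx]
  set w : EuclideanSpace ℝ (Fin n) → ℝ≥0∞ := fun y => ‖heatKernel α 1 y‖ₑ
  have hwm : Measurable w := (continuous_heatKernel hn hα one_pos).enorm.measurable
  set Ω : ℝ → EuclideanSpace ℝ (Fin n) → ℝ≥0∞ := fun l y =>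
    ∫⁻ x, ‖φ (x - l • y) - φ x‖ₑ ^ r with hΩ
  have hmeas2 : ∀ l : ℝ, Measurable (fun z : EuclideanSpace ℝ (Fin n) × EuclideanSpace ℝ (Fin n) =>
      ‖φ (z.2 - l • z.1) - φ z.2‖ₑ ^ r) := fun l => by
    have h1 := hmeas.measurable
    fun_prop
  have hΩm : ∀ l, Measurable (Ω l) := fun l => (hmeas2 l).lintegral_prod_right'
  have hΩe : ∀ l y, Ω l y =
      eLpNorm (fun x => φ (x + (-(l • y))) - φ x) (ENNReal.ofReal r) volume ^ r := by
    intro l y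
    rw [← IsBoundedKernel.lintegral_rpow_eq hr0, ← ENNReal.rpow_mul, one_div,
      inv_mul_cancel₀ hr0.ne', ENNReal.rpow_one]
    simp only [hΩ, sub_eq_add_neg]
  have hp1 : (1 : ℝ≥0∞) ≤ ENNReal.ofReal r := by simpa using ENNReal.ofReal_le_ofReal hr
  have hΩb : ∀ l y, Ω l y ≤ (2 * eLpNorm φ (ENNReal.ofReal r) volume) ^ r := by
    intro l y
    rw [hΩe]
    gcongr
    have hmp : MeasurePreserving (fun x => x + (-(l • y)))
      (volume : Measure (EuclideanSpace ℝ (Fin n))) volume := measurePreserving_add_right volume _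
    refine (eLpNorm_sub_le (hφ.comp_measurePreserving hmp).1 hφ.1 hp1).trans (le_of_eq ?_)
    rw [two_mul]
    congr 1
    exact eLpNorm_comp_measurePreserving hφ.1 hmp
  have key : ∀ t, 0 < t → eLpNorm (fracSemigroup α t φ - φ) (ENNReal.ofReal r) volume ≤
      (ENNReal.ofReal A ^ (r - 1) * ∫⁻ y, w y * Ω (t ^ (1 / (2 * α))) y) ^ (1 / r) := by
    intro t ht
    set l := t ^ (1 / (2 * α))
    have hl : 0 < l := Real.rpow_pos_of_pos ht _
    rw [← IsBoundedKernel.lintegral_rpow_eq hr0]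
    gcongr
    have hpt : ∀ x, ‖(fracSemigroup α t φ - φ) x‖ₑ ^ r ≤ ENNReal.ofReal A ^ (r - 1) *
        ∫⁻ y, w y * ‖φ (x - l • y) - φ x‖ₑ ^ r := by
      intro x
      have e1 : (fracSemigroup α t φ - φ) x =
          ∫ y, heatKernel α 1 y • (φ (x - l • y) - φ x) := by
        simp only [smul_sub]
        rw [integral_sub, integral_smul_const, hχ.integral_heatKernel hn hα one_pos, one_smul,
          Pi.sub_apply, fracSemigroup_eq_integral_smul hα ht]
        · have h1 := (hK.kernel t ht).convolutionExistsAt hr hφ x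
          have h2 := (h1.comp_smul (R := l) hl.ne').smul ((t ^ ((n : ℝ) / (2 * α)) : ℝ))
          refine h2.congr (Eventually.of_forall fun y => ?_)
          simp only [Pi.smul_apply, ContinuousLinearMap.lsmul_apply]
          rw [heatKernel_eq_smul hα ht, smul_smul, ← mul_assoc, ← Real.rpow_add ht,
            add_neg_cancel, Real.rpow_zero, one_mul, smul_smul (t ^ (-(1 / (2 * α)))),
            ← Real.rpow_add ht, neg_add_cancel, Real.rpow_zero, one_smul]
        · exact (hK.kernel 1 one_pos).integrable.smul_const _
      rw [e1]
      have e2 : ‖∫ y, heatKernel α 1 y • (φ (x - l • y) - φ x)‖ₑ ≤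
          ∫⁻ y, w y * ‖φ (x - l • y) - φ x‖ₑ :=
        (enorm_integral_le_lintegral_enorm _).trans
          (le_of_eq (lintegral_congr fun y => enorm_smul _ _))
      refine (ENNReal.rpow_le_rpow e2 hr0.le).trans ?_
      refine (lintegral_mul_rpow_le hwm.aemeasurable ?_ (fun _ => enorm_ne_top) hr).trans ?_
      · have h1 := hmeas.measurable
        exact Measurable.aemeasurable (by fun_prop)
      · exact mul_le_mul_left (ENNReal.rpow_le_rpow (hK.kernel 1 one_pos).lintegral_enorm_le
          (by linarith)) _
    calc _ ≤ ∫⁻ x, ENNReal.ofReal A ^ (r - 1) * ∫⁻ y, w y * ‖φ (x - l • y) - φ x‖ₑ ^ r :=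
          lintegral_mono hpt
      _ = ENNReal.ofReal A ^ (r - 1) * ∫⁻ x, ∫⁻ y, w y * ‖φ (x - l • y) - φ x‖ₑ ^ r :=
          lintegral_const_mul' _ _ (ENNReal.rpow_ne_top_of_nonneg (by linarith)
            ENNReal.ofReal_ne_top)
      _ = ENNReal.ofReal A ^ (r - 1) * ∫⁻ y, w y * Ω l y := by
          congr 1
          rw [lintegral_lintegral_swap]
          · refine lintegral_congr fun y => ?_
            rw [lintegral_const_mul' _ _ enorm_ne_top]
          · have h1 := hmeas.measurable
            exact Measurable.aemeasurable (by fun_prop)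
  have hlim : Tendsto (fun t : ℝ => ∫⁻ y, w y * Ω (t ^ (1 / (2 * α))) y) (𝓝[>] 0) (𝓝 0) := by
    have h0 : (0 : ℝ≥0∞) = ∫⁻ y : EuclideanSpace ℝ (Fin n), (0 : ℝ≥0∞) := by simp
    rw [h0]
    refine tendsto_lintegral_filter_of_dominated_convergence
      (fun y => w y * (2 * eLpNorm φ (ENNReal.ofReal r) volume) ^ r)
      (Eventually.of_forall fun t => hwm.mul (hΩm _))
      (Eventually.of_forall fun t => Eventually.of_forall fun y => by gcongr; exact hΩb _ _)
      ?_ (Eventually.of_forall fun y => ?_)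
    · rw [lintegral_mul_const _ hwm]
      refine ENNReal.mul_ne_top ?_ (ENNReal.rpow_ne_top_of_nonneg hr0.le
        (ENNReal.mul_ne_top (by simp) hφ.2.ne))
      exact (hK.kernel 1 one_pos).integrable.2.ne
    · have h1 : Tendsto (fun t : ℝ => -((t ^ (1 / (2 * α))) • y)) (𝓝[>] 0) (𝓝 0) := by
        have h2 := (Real.continuousAt_rpow_const 0 (1 / (2 * α)) (Or.inr (by positivity))).tendsto
        rw [Real.zero_rpow (by positivity)] at h2
        simpa using ((h2.mono_left nhdsWithin_le_nhds).smul_const y).neg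
      have h3 := (IsBoundedKernel.tendsto_eLpNorm_translate hp1 ENNReal.ofReal_ne_top hφ).comp h1
      have h4 : Tendsto (fun t : ℝ => Ω (t ^ (1 / (2 * α))) y) (𝓝[>] 0) (𝓝 0) := by
        have h5 := h3.ennrpow_const r
        rw [ENNReal.zero_rpow_of_pos hr0] at h5
        exact h5.congr fun t => (hΩe _ _).symm
      have h6 := ENNReal.Tendsto.const_mul (a := w y) h4 (Or.inr enorm_ne_top)
      rwa [mul_zero] at h6
  have hlim2 : Tendsto (fun t : ℝ => (ENNReal.ofReal A ^ (r - 1) *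
      ∫⁻ y, w y * Ω (t ^ (1 / (2 * α))) y) ^ (1 / r)) (𝓝[>] 0) (𝓝 0) := by
    have h1 := ENNReal.Tendsto.const_mul (a := ENNReal.ofReal A ^ (r - 1)) hlim
      (Or.inr (ENNReal.rpow_ne_top_of_nonneg (by linarith) ENNReal.ofReal_ne_top))
    have h2 := h1.ennrpow_const (1 / r)
    rwa [mul_zero, ENNReal.zero_rpow_of_pos (by positivity)] at h2
  refine tendsto_of_tendsto_of_tendsto_of_le_of_le' tendsto_const_nhds hlim2
    (Eventually.of_forall fun _ => zero_le) ?_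
  filter_upwards [self_mem_nhdsWithin] with t ht
  exact key t ht

end HeatSemigroup

/-! ### Rescaling, convolving and summing bounded kernels. -/

section KernelOperations

variable {n : ℕ} {k k₁ k₂ : EuclideanSpace ℝ (Fin n) → ℝ} {A B A₁ B₁ A₂ B₂ : ℝ}
  {𝕜 : Type*} [RCLike 𝕜] {m r : ℝ} {g : EuclideanSpace ℝ (Fin n) → 𝕜}

namespace IsBoundedKernel

theorem abs (hk : IsBoundedKernel k A B) : IsBoundedKernel (fun x => |k x|) A B :=
  ⟨hk.continuous.abs, hk.integrable.abs, by simpa using hk.integral_le,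
    fun x => by simpa using hk.abs_le x⟩

theorem comp_smul (hk : IsBoundedKernel k A B) {l : ℝ} (hl : 0 < l) :
    IsBoundedKernel (fun x => (l ^ n)⁻¹ * k (l⁻¹ • x)) A ((l ^ n)⁻¹ * B) := by
  refine ⟨continuous_const.mul (hk.continuous.comp (continuous_const_smul _)),
    (hk.integrable.comp_smul (R := l⁻¹) (by positivity)).const_mul _, ?_, fun x => ?_⟩
  · have h := Measure.integral_comp_smul (volume : Measure (EuclideanSpace ℝ (Fin n)))
      (fun x => |k x|) l⁻¹
    simp_rw [abs_mul]
    rw [integral_const_mul, h, finrank_euclideanSpace_fin, abs_of_pos (by positivity),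
      abs_of_pos (by positivity), smul_eq_mul, ← mul_assoc, inv_pow, inv_inv,
      inv_mul_cancel₀ (by positivity), one_mul]
    exact hk.integral_le
  · rw [abs_mul, abs_of_pos (by positivity : 0 < (l ^ n)⁻¹)]
    gcongr
    exact hk.abs_le _

theorem of_decay (hc : Continuous k) (hd : ∀ x, (1 + ‖x‖) ^ (n + 1) * |k x| ≤ B) :
    IsBoundedKernel k (B * ∫ x : EuclideanSpace ℝ (Fin n), ((1 + ‖x‖) ^ (n + 1))⁻¹) B := by
  have hI : Integrable fun x : EuclideanSpace ℝ (Fin n) => ((1 + ‖x‖) ^ (n + 1))⁻¹ := by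
    have h : Integrable fun x : EuclideanSpace ℝ (Fin n) => (1 + ‖x‖) ^ (-((n : ℝ) + 1)) :=
      integrable_one_add_norm (by
        rw [finrank_euclideanSpace_fin]
        linarith)
    refine h.congr (Eventually.of_forall fun x => ?_)
    simp only
    rw [Real.rpow_neg (by positivity)]
    congr 1
    exact_mod_cast Real.rpow_natCast (1 + ‖x‖) (n + 1)
  have hb : ∀ x, |k x| ≤ B * ((1 + ‖x‖) ^ (n + 1))⁻¹ := fun x => by
    rw [← div_eq_mul_inv, le_div_iff₀ (by positivity), mul_comm]
    exact hd x
  have hB : 0 ≤ B := le_trans (by positivity) (hd 0)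
  have hi : Integrable k := Integrable.mono' (hI.const_mul B) hc.aestronglyMeasurable
    (Eventually.of_forall hb)
  refine ⟨hc, hi, ?_, fun x => (hb x).trans (mul_le_of_le_one_right hB (inv_le_one_of_one_le₀
    (one_le_pow₀ (by linarith [norm_nonneg x]))))⟩
  rw [← integral_const_mul]
  exact integral_mono hi.abs (hI.const_mul B) hb

theorem convolution (hk₁ : IsBoundedKernel k₁ A₁ B₁) (hk₂ : IsBoundedKernel k₂ A₂ B₂) :
    IsBoundedKernel (k₁ ⋆[ContinuousLinearMap.lsmul ℝ ℝ, volume] k₂) (A₁ * A₂) (A₁ * B₂) := by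
  have hm : MemLp k₂ (ENNReal.ofReal 1) volume := by
    simpa using memLp_one_iff_integrable.2 hk₂.integrable
  have hl : ∫⁻ x, ‖(k₁ ⋆[ContinuousLinearMap.lsmul ℝ ℝ, volume] k₂) x‖ₑ ≤
      ENNReal.ofReal (A₁ * A₂) := by
    refine (lintegral_mono fun x => enorm_convolution_le k₁ k₂ x).trans
      ((hk₁.lintegral_lconv_le hk₂.continuous.enorm.aemeasurable).trans ?_)
    rw [ENNReal.ofReal_mul hk₁.left_nonneg]
    gcongr
    exact hk₂.lintegral_enorm_le
  have hc := hk₁.continuous_convolution le_rfl hm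
  have hi : Integrable (k₁ ⋆[ContinuousLinearMap.lsmul ℝ ℝ, volume] k₂) :=
    ⟨hc.aestronglyMeasurable, hl.trans_lt ENNReal.ofReal_lt_top⟩
  refine ⟨hc, hi, ?_, fun x => ?_⟩
  · have := ofReal_integral_norm_eq_lintegral_enorm hi
    rw [← ENNReal.ofReal_le_ofReal_iff (mul_nonneg hk₁.left_nonneg hk₂.left_nonneg)]
    exact this.le.trans hl
  · rw [← ENNReal.ofReal_le_ofReal_iff (mul_nonneg hk₁.left_nonneg hk₂.right_nonneg),
      ← Real.enorm_eq_ofReal_abs, ENNReal.ofReal_mul hk₁.left_nonneg]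
    refine (enorm_convolution_le k₁ k₂ x).trans ?_
    calc ∫⁻ y, ‖k₁ y‖ₑ * ‖k₂ (x - y)‖ₑ ≤ ∫⁻ y, ‖k₁ y‖ₑ * ENNReal.ofReal B₂ := by
          gcongr with y
          exact hk₂.enorm_le _
      _ = (∫⁻ y, ‖k₁ y‖ₑ) * ENNReal.ofReal B₂ :=
          lintegral_mul_const _ hk₁.continuous.enorm.measurable
      _ ≤ _ := by
          gcongr
          exact hk₁.lintegral_enorm_le

theorem convolution_assoc (hk₁ : IsBoundedKernel k₁ A₁ B₁) (hk₂ : IsBoundedKernel k₂ A₂ B₂)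
    (hm : 1 ≤ m) (hg : MemLp g (ENNReal.ofReal m) volume) :
    (k₁ ⋆[ContinuousLinearMap.lsmul ℝ ℝ, volume] k₂)
      ⋆[ContinuousLinearMap.lsmul ℝ ℝ, volume] g =
    k₁ ⋆[ContinuousLinearMap.lsmul ℝ ℝ, volume]
      (k₂ ⋆[ContinuousLinearMap.lsmul ℝ ℝ, volume] g) := by
  ext x
  have hm₂ : MemLp k₂ (ENNReal.ofReal 1) volume := by
    simpa using memLp_one_iff_integrable.2 hk₂.integrable
  have e : ContinuousLinearMap.mul ℝ ℝ = ContinuousLinearMap.lsmul ℝ ℝ := by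
    ext; simp
  refine MeasureTheory.convolution_assoc _ _ _ _ (fun a b z => by
      simp only [ContinuousLinearMap.lsmul_apply, smul_eq_mul, mul_smul])
    hk₁.continuous.aestronglyMeasurable hk₂.continuous.aestronglyMeasurable hg.1
    (Eventually.of_forall fun y => hk₁.convolutionExistsAt le_rfl hm₂ y)
    (Eventually.of_forall fun y => ?_) ?_
  · rw [e]
    exact hk₂.abs.convolutionExistsAt hm hg.norm y
  · rw [e]
    exact hk₁.abs.convolutionExistsAt hm (hk₂.abs.memLp_convolution hm le_rfl hg.norm) x

theorem convolution_sum_left {ι : Type*} (s : Finset ι) {k : ι → EuclideanSpace ℝ (Fin n) → ℝ}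
    {A B : ι → ℝ} (hk : ∀ i, IsBoundedKernel (k i) (A i) (B i)) (hm : 1 ≤ m)
    (hg : MemLp g (ENNReal.ofReal m) volume) :
    (fun x => ∑ i ∈ s, k i x) ⋆[ContinuousLinearMap.lsmul ℝ ℝ, volume] g =
      ∑ i ∈ s, k i ⋆[ContinuousLinearMap.lsmul ℝ ℝ, volume] g := by
  ext x
  rw [Finset.sum_apply]
  simp only [convolution_def, ContinuousLinearMap.lsmul_apply, Finset.sum_smul]
  exact integral_finsetSum _ fun i _ => (hk i).convolutionExistsAt hm hg x

end IsBoundedKernel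

end KernelOperations

/-! ### Bernstein-type estimates for dyadic blocks of the semigroup. -/

section BesovEstimate

variable {n : ℕ} {α : ℝ} {χ : EuclideanSpace ℝ (Fin n) → ℝ}

namespace IsLittlewoodPaleyBump

theorem exists_isBoundedKernel_comp_smul (hχ : IsLittlewoodPaleyBump χ) :
    ∃ C : ℝ, ∀ l : ℝ, 0 < l →
      IsBoundedKernel (multiplierKernel fun ξ => χ (l • ξ)) C ((l ^ n)⁻¹ * C) := by
  obtain ⟨C, hC, H⟩ := hχ.exists_decay (n + 1)
  have h1 := IsBoundedKernel.of_decay (continuous_multiplierKernel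
    (by simpa using hχ.integrable_comp_smul_mul one_pos continuous_const (g := fun _ => 1))) H
  have h2 := h1.mono (le_max_left _ C) (le_max_right (C * ∫ x : EuclideanSpace ℝ (Fin n),
    ((1 + ‖x‖) ^ (n + 1))⁻¹) C)
  refine ⟨max (C * ∫ x : EuclideanSpace ℝ (Fin n), ((1 + ‖x‖) ^ (n + 1))⁻¹) C, fun l hl => ?_⟩
  have h3 := h2.comp_smul hl
  rwa [← funext (multiplierKernel_comp_smul χ hl)] at h3

/-- By scaling, the annulus at frequency 1/l sees the time t l^{-2α}. Only the first power of the
available decay in this time is kept; this suffices for the dyadic sums since θ < 1. -/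
theorem exists_isBoundedKernel_annulus (hχ : IsLittlewoodPaleyBump χ) (hα : 0 < α) {r R : ℝ}
    (hr : 0 < r) (hR : r ≤ R) :
    ∃ C : ℝ, 0 ≤ C ∧ ∀ l : ℝ, 0 < l → ∀ t : ℝ, 0 ≤ t → IsBoundedKernel (multiplierKernel fun ξ =>
        (χ ((r * l) • ξ) - χ ((R * l) • ξ)) * Real.exp (-t * ‖ξ‖ ^ (2 * α)))
      (C * (1 + t * l ^ (-(2 * α)))⁻¹) ((l ^ n)⁻¹ * (C * (1 + t * l ^ (-(2 * α)))⁻¹)) := by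
  obtain ⟨C, hC, H⟩ := hχ.exists_decay_annulus hα hr hR (n + 1) 1
  set I := ∫ x : EuclideanSpace ℝ (Fin n), ((1 + ‖x‖) ^ (n + 1))⁻¹
  have hI : 0 ≤ I := integral_nonneg fun x => by positivity
  refine ⟨C * I + C, by positivity, fun l hl t ht => ?_⟩
  set s := t * l ^ (-(2 * α)) with hs
  have hs0 : 0 ≤ s := by positivity
  obtain ⟨g, hg⟩ : ∃ g : EuclideanSpace ℝ (Fin n) → ℝ, g = fun ξ =>
      (χ (r • ξ) - χ (R • ξ)) * Real.exp (-s * ‖ξ‖ ^ (2 * α)) := ⟨_, rfl⟩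
  have h1 := H s hs0
  rw [← hg, pow_one] at h1
  have hgi : Integrable g := by
    rw [hg]
    exact hχ.integrable_annulus_mul hr (hr.trans_le hR) (continuous_heatSymbol hα s)
  have h2 := ((IsBoundedKernel.of_decay (continuous_multiplierKernel hgi) h1).mono
    (A' := (C * I + C) * (1 + s)⁻¹) (B' := (C * I + C) * (1 + s)⁻¹)
    (by have : 0 ≤ C * (1 + s)⁻¹ := by positivity
        linarith)
    (by have : 0 ≤ C * I * (1 + s)⁻¹ := by positivity
        linarith)).comp_smul hl
  rw [← funext (multiplierKernel_comp_smul g hl)] at h2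
  convert h2 using 3 with ξ
  rw [hg]
  simp only [smul_smul]
  rw [phase_smul α hl, hs]
  congr 2
  rw [← mul_assoc, neg_mul, neg_mul, mul_assoc t, ← Real.rpow_add hl, neg_add_cancel,
    Real.rpow_zero, mul_one, neg_mul]

/-- The wider annulus equals 1 on the support of the narrower one. This allows a dyadic block to be
reproduced by one more convolution. -/
theorem annulus_mul_annulus (hχ : IsLittlewoodPaleyBump χ) (l : ℝ)
    (ξ : EuclideanSpace ℝ (Fin n)) :
    (χ ((1 / 2 * l) • ξ) - χ ((4 * l) • ξ)) * (χ (l • ξ) - χ ((2 * l) • ξ)) =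
      χ (l • ξ) - χ ((2 * l) • ξ) := by
  have hn : ∀ c : ℝ, 0 ≤ c → ‖(c * l) • ξ‖ = c * ‖l • ξ‖ := fun c hc => by
    rw [mul_smul, norm_smul, Real.norm_of_nonneg hc]
  rcases le_or_gt ‖l • ξ‖ (1 / 2) with h | h
  · rw [hχ.eq_one (l • ξ) (by linarith),
      hχ.eq_one ((2 * l) • ξ) (by rw [hn _ (by norm_num)]; linarith)]
    ring
  rcases le_or_gt 2 ‖l • ξ‖ with h2 | h2
  · rw [hχ.eq_zero (l • ξ) (by linarith),
      hχ.eq_zero ((2 * l) • ξ) (by rw [hn _ (by norm_num)]; linarith)]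
    ring
  · rw [hχ.eq_one ((1 / 2 * l) • ξ) (by rw [hn _ (by norm_num)]; linarith),
      hχ.eq_zero ((4 * l) • ξ) (by rw [hn _ (by norm_num)]; linarith)]
    ring

theorem even (hχ : IsLittlewoodPaleyBump χ) (l : ℝ) (ξ : EuclideanSpace ℝ (Fin n)) :
    χ (l • -ξ) = χ (l • ξ) := hχ.radial _ _ (by rw [smul_neg, norm_neg])

variable {𝕜 : Type*} [RCLike 𝕜] {φ : EuclideanSpace ℝ (Fin n) → 𝕜} {p P r : ℝ}

/-- The heat factor is attached to the wider annulus, and this kernel acts on the already localized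
Δ_j φ. Young's inequality from L^p to L^P gives the Bernstein factor l^{-n(1/p-1/P)}. The hypothesis
on φ in L^r serves to make the convolutions exist and associate; its norm does not enter. -/
theorem exists_block_bound (hχ : IsLittlewoodPaleyBump χ) (hα : 0 < α) :
    ∃ C : ℝ, 0 ≤ C ∧ ∀ l : ℝ, 0 < l → ∀ t : ℝ, 0 ≤ t → ∀ p P r : ℝ, 1 ≤ p → p ≤ P → 1 ≤ r →
      ∀ φ : EuclideanSpace ℝ (Fin n) → 𝕜, MemLp φ (ENNReal.ofReal r) volume →
      eLpNorm (multiplierConv (fun ξ => (χ (l • ξ) - χ ((2 * l) • ξ)) *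
        Real.exp (-t * ‖ξ‖ ^ (2 * α))) φ) (ENNReal.ofReal P) volume ≤
      ENNReal.ofReal (C * (1 + t * l ^ (-(2 * α)))⁻¹ * l ^ (-(n * (1 / p - 1 / P)))) *
        eLpNorm (multiplierConv (fun ξ => χ (l • ξ) - χ ((2 * l) • ξ)) φ)
          (ENNReal.ofReal p) volume := by
  obtain ⟨C, hC, H⟩ := hχ.exists_isBoundedKernel_annulus hα (r := 1 / 2) (R := 4)
    (by norm_num) (by norm_num)
  obtain ⟨C', hC', H'⟩ := hχ.exists_isBoundedKernel_annulus hα (r := 1) (R := 2)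
    (by norm_num) (by norm_num)
  refine ⟨C, hC, fun l hl t ht p P r hp hP hr φ hφ => ?_⟩
  have h1 := H l hl t ht
  have h2 := H' l hl 0 le_rfl
  simp only [one_mul, neg_zero, zero_mul, Real.exp_zero, mul_one, add_zero, inv_one] at h2
  have hi2 : Integrable fun ξ => χ (l • ξ) - χ ((2 * l) • ξ) := by
    simpa using hχ.integrable_annulus_mul hl (by positivity : 0 < 2 * l)
      (continuous_const : Continuous fun _ : EuclideanSpace ℝ (Fin n) => (1 : ℝ))
  have hchi : ∀ c : ℝ, Continuous fun ξ : EuclideanSpace ℝ (Fin n) => χ (c • ξ) := fun c =>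
    hχ.smooth.continuous.comp (continuous_const_smul c)
  have hprod : (fun ξ : EuclideanSpace ℝ (Fin n) => (χ ((1 / 2 * l) • ξ) - χ ((4 * l) • ξ)) *
      Real.exp (-t * ‖ξ‖ ^ (2 * α)) * (χ (l • ξ) - χ ((2 * l) • ξ))) =
      fun ξ => (χ (l • ξ) - χ ((2 * l) • ξ)) * Real.exp (-t * ‖ξ‖ ^ (2 * α)) := by
    ext ξ
    rw [mul_right_comm, hχ.annulus_mul_annulus]
  have hi1 : Integrable fun ξ => (χ ((1 / 2 * l) • ξ) - χ ((4 * l) • ξ)) *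
      Real.exp (-t * ‖ξ‖ ^ (2 * α)) :=
    hχ.integrable_annulus_mul (by positivity) (by positivity) (continuous_heatSymbol hα t)
  have hm := multiplierKernel_mul
    (m₁ := fun ξ => (χ ((1 / 2 * l) • ξ) - χ ((4 * l) • ξ)) * Real.exp (-t * ‖ξ‖ ^ (2 * α)))
    (m₂ := fun ξ => χ (l • ξ) - χ ((2 * l) • ξ))
    (((hchi (1 / 2 * l)).sub (hchi (4 * l))).mul (continuous_heatSymbol hα t)) hi1
    (fun ξ => by simp only [hχ.even, norm_neg]) h1.integrable
    ((hchi l).sub (hchi (2 * l))) hi2 (fun ξ => by simp only [hχ.even]) h2.integrable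
    (by rw [hprod]
        exact hχ.integrable_annulus_mul hl (by positivity) (continuous_heatSymbol hα t))
  rw [hprod] at hm
  unfold multiplierConv
  rw [hm, h1.convolution_assoc h2 hr hφ]
  refine (h1.eLpNorm_convolution_le hp hP
    (h2.memLp_convolution hr le_rfl hφ).1).trans (le_of_eq ?_)
  congr 2
  set ω := 1 / p - 1 / P with hω
  have hD : 0 ≤ C * (1 + t * l ^ (-(2 * α)))⁻¹ := by positivity
  -- Recombining D^{1-ω} D^ω = D uses a positive base; the degenerate case D = 0 is settled by 1 - ω
  -- ≠ 0.
  rcases hD.eq_or_lt with h0 | h0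
  · have hω1 : 1 - ω ≠ 0 := by
      have : 1 / p ≤ 1 := by rw [div_le_one (by linarith)]; exact hp
      have : 0 < 1 / P := by
        have : 0 < P := by linarith
        positivity
      intro h
      linarith
    rw [← h0, Real.zero_rpow hω1, zero_mul, zero_mul]
  rw [Real.mul_rpow (by positivity) h0.le, mul_left_comm, ← Real.rpow_add h0, sub_add_cancel,
    Real.rpow_one, mul_comm, ← Real.rpow_natCast, ← Real.rpow_neg hl.le, ← Real.rpow_mul hl.le,
    neg_mul]

end IsLittlewoodPaleyBump

end BesovEstimate

/-! ### Dyadic sums that reproduce a power of t. -/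

section DyadicSums

theorem summable_rpow_mul_inv {q θ : ℝ} (hq : 1 < q) (hθ : 0 < θ) (hθ' : θ < 1) :
    Summable fun j : ℤ => q ^ ((j : ℝ) * θ) * (1 + q ^ (j : ℝ))⁻¹ := by
  have hq0 : 0 < q := by linarith
  refine Summable.of_nat_of_neg ?_ ?_
  · refine Summable.of_nonneg_of_le (fun j => by positivity) (fun j => ?_)
      (summable_geometric_of_lt_one (r := q ^ (-(1 - θ))) (by positivity)
        (Real.rpow_lt_one_of_one_lt_of_neg hq (by linarith)))
    rw [← Real.rpow_natCast, ← Real.rpow_mul hq0.le, Int.cast_natCast]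
    have h1 : (1 + q ^ (j : ℝ))⁻¹ ≤ q ^ (-(j : ℝ)) := by
      rw [Real.rpow_neg hq0.le]
      gcongr
      linarith
    refine (mul_le_mul_of_nonneg_left h1 (by positivity)).trans (le_of_eq ?_)
    rw [← Real.rpow_add hq0]
    congr 1
    ring
  · refine Summable.of_nonneg_of_le (fun j => by positivity) (fun j => ?_)
      (summable_geometric_of_lt_one (r := q ^ (-θ)) (by positivity)
        (Real.rpow_lt_one_of_one_lt_of_neg hq (by linarith)))
    rw [← Real.rpow_natCast, ← Real.rpow_mul hq0.le]
    push_cast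
    have h1 : (1 + q ^ (-(j : ℝ)))⁻¹ ≤ 1 :=
      inv_le_one_of_one_le₀ (by linarith [Real.rpow_pos_of_pos hq0 (-(j : ℝ))])
    refine (mul_le_of_le_one_right (by positivity) h1).trans (le_of_eq ?_)
    congr 1
    ring

/-- Choose j₀ with q^{j₀} ≤ t < q^{j₀+1} and shift the index by j₀: the sum becomes t^{-θ} times the
sum at t = 1, up to the rounding factor q^θ. That sum converges at -∞ because θ > 0 and at +∞
because θ < 1. -/
theorem exists_tsum_rpow_mul_inv_le {q θ : ℝ} (hq : 1 < q) (hθ : 0 < θ) (hθ' : θ < 1) :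
    ∃ C : ℝ, 0 ≤ C ∧ ∀ t : ℝ, 0 < t →
      ∑' j : ℤ, ENNReal.ofReal (q ^ ((j : ℝ) * θ) * (1 + t * q ^ (j : ℝ))⁻¹) ≤
        ENNReal.ofReal (C * t ^ (-θ)) := by
  have hq0 : 0 < q := by linarith
  set S : ℝ := ∑' j : ℤ, q ^ ((j : ℝ) * θ) * (1 + q ^ (j : ℝ))⁻¹
  have hS : 0 ≤ S := tsum_nonneg fun j => by positivity
  refine ⟨q ^ θ * S, by positivity, fun t ht => ?_⟩
  obtain ⟨j₀, hj1, hj2⟩ := exists_mem_Ico_zpow ht hq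
  rw [← Real.rpow_intCast] at hj1 hj2
  rw [← (Equiv.subRight j₀).tsum_eq]
  have hterm : ∀ i : ℤ, q ^ ((((Equiv.subRight j₀) i : ℤ) : ℝ) * θ) *
      (1 + t * q ^ (((Equiv.subRight j₀) i : ℤ) : ℝ))⁻¹ ≤
      q ^ θ * t ^ (-θ) * (q ^ ((i : ℝ) * θ) * (1 + q ^ (i : ℝ))⁻¹) := by
    intro i
    simp only [Equiv.subRight_apply, Int.cast_sub]
    have h1 : q ^ (((i : ℝ) - j₀) * θ) = q ^ (-(j₀ : ℝ) * θ) * q ^ ((i : ℝ) * θ) := by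
      rw [← Real.rpow_add hq0]; congr 1; ring
    have h2 : q ^ (-(j₀ : ℝ) * θ) ≤ q ^ θ * t ^ (-θ) := by
      have h3 : t ^ θ ≤ (q ^ (((j₀ + 1 : ℤ)) : ℝ)) ^ θ :=
        Real.rpow_le_rpow ht.le hj2.le hθ.le
      rw [← Real.rpow_mul hq0.le] at h3
      rw [Real.rpow_neg ht.le, ← div_eq_mul_inv, le_div_iff₀ (by positivity)]
      refine (mul_le_mul_of_nonneg_left h3 (by positivity)).trans (le_of_eq ?_)
      rw [← Real.rpow_add hq0]
      congr 1
      push_cast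
      ring
    have h4 : q ^ (i : ℝ) ≤ t * q ^ ((i : ℝ) - j₀) := by
      refine le_trans (le_of_eq ?_) (mul_le_mul_of_nonneg_right hj1 (by positivity))
      rw [← Real.rpow_add hq0]
      congr 1
      ring
    rw [h1, mul_assoc]
    gcongr
  calc _ ≤ ∑' i : ℤ, ENNReal.ofReal (q ^ θ * t ^ (-θ) *
        (q ^ ((i : ℝ) * θ) * (1 + q ^ (i : ℝ))⁻¹)) :=
        ENNReal.tsum_le_tsum fun i => ENNReal.ofReal_le_ofReal (hterm i)
    _ = ENNReal.ofReal (∑' i : ℤ, q ^ θ * t ^ (-θ) *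
        (q ^ ((i : ℝ) * θ) * (1 + q ^ (i : ℝ))⁻¹)) :=
        (ENNReal.ofReal_tsum_of_nonneg (fun i => by positivity)
          ((summable_rpow_mul_inv hq hθ hθ').mul_left _)).symm
    _ ≤ _ := by
        rw [tsum_mul_left]
        refine ENNReal.ofReal_le_ofReal (le_of_eq ?_)
        ring

end DyadicSums

/-! ### The heat flow in L^P, bounded by the Besov norm of the data. -/

section BesovHeat

variable {n : ℕ} {α : ℝ} {χ : EuclideanSpace ℝ (Fin n) → ℝ} {𝕜 : Type*} [RCLike 𝕜]

namespace IsLittlewoodPaleyBump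

/-- The index i - N runs over |j| ≤ N, and the sum telescopes because 2 · 2^{-j} = 2^{-(j-1)}. -/
theorem sum_dyadic (χ : EuclideanSpace ℝ (Fin n) → ℝ) (N : ℕ) (ξ : EuclideanSpace ℝ (Fin n))
    (e : ℝ) :
    ∑ i ∈ Finset.range (2 * N + 1), (χ ((2 : ℝ) ^ (-((i : ℤ) - N)) • ξ) -
      χ ((2 * (2 : ℝ) ^ (-((i : ℤ) - N))) • ξ)) * e =
      (χ (((2 : ℝ) ^ N)⁻¹ • ξ) - χ ((2 : ℝ) ^ (N + 1) • ξ)) * e := by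
  have h : ∀ i : ℕ, 2 * (2 : ℝ) ^ (-((i : ℤ) - N)) = (2 : ℝ) ^ (-((i : ℤ) - N - 1)) := fun i => by
    rw [← zpow_one_add₀ two_ne_zero]
    congr 1
    ring
  rw [← Finset.sum_mul]
  congr 1
  have h2 := Finset.sum_range_sub (fun i : ℕ => χ ((2 : ℝ) ^ (-((i : ℤ) - N - 1)) • ξ)) (2 * N + 1)
  have e1 : (-(((2 * N + 1 : ℕ) : ℤ) - N - 1)) = -(N : ℤ) := by push_cast; ring
  have e2 : (-(((0 : ℕ) : ℤ) - N - 1)) = ((N + 1 : ℕ) : ℤ) := by push_cast; ring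
  rw [e1, e2, zpow_neg, zpow_natCast, zpow_natCast] at h2
  rw [← h2]
  refine Finset.sum_congr rfl fun i _ => ?_
  rw [h]
  congr 4
  push_cast
  ring

/-- Control of the tails of the Littlewood-Paley decomposition. The truncated symbols vanish at the
origin, so the remainder kernel has integral 1 for every N and cannot tend to 0 in L¹. Its supremum
does tend to 0, being at most the integral of the remaining symbol; together with a uniform L¹ bound
this is enough for data in L^r with r finite. -/
theorem exists_isBoundedKernel_remainder (hχ : IsLittlewoodPaleyBump χ) (hn : 0 < n) (hα : 0 < α) :
    ∃ A : ℝ, ∀ t : ℝ, 0 < t → ∃ B : ℕ → ℝ, Tendsto B atTop (𝓝 0) ∧ ∀ N,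
      IsBoundedKernel (heatKernel α t - multiplierKernel fun ξ =>
        (χ (((2 : ℝ) ^ N)⁻¹ • ξ) - χ ((2 : ℝ) ^ (N + 1) • ξ)) * Real.exp (-t * ‖ξ‖ ^ (2 * α)))
        A (B N) := by
  obtain ⟨A, hK⟩ := hχ.exists_heatBounds hn hα
  obtain ⟨C, hC⟩ := hχ.exists_isBoundedKernel_comp_smul
  refine ⟨A + (C * A + C * A), fun t ht => ?_⟩
  set e : EuclideanSpace ℝ (Fin n) → ℝ := fun ξ => Real.exp (-t * ‖ξ‖ ^ (2 * α)) with he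
  have hec : Continuous e := continuous_heatSymbol hα t
  have hei : Integrable e := integrable_heatSymbol hn hα ht
  have hchi : ∀ c : ℝ, Continuous fun ξ : EuclideanSpace ℝ (Fin n) => χ (c • ξ) := fun c =>
    hχ.smooth.continuous.comp (continuous_const_smul c)
  have hci : ∀ l : ℝ, 0 < l → Integrable fun ξ => χ (l • ξ) * e ξ := fun l hl =>
    hχ.integrable_comp_smul_mul hl hec
  have hpk : ∀ l : ℝ, 0 < l → ∃ B, IsBoundedKernel (multiplierKernel fun ξ => χ (l • ξ) * e ξ)
      (C * A) B := by
    intro l hl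
    have h1 := hC l hl
    have h2 := hK.kernel t ht
    have hm := multiplierKernel_mul (m₁ := fun ξ => χ (l • ξ)) (m₂ := e) (hchi l)
      (by simpa using hχ.integrable_comp_smul_mul hl continuous_const (g := fun _ => 1))
      (fun ξ => hχ.even l ξ) h1.integrable hec hei (by simp [he]) h2.integrable (hci l hl)
    rw [hm]
    exact ⟨_, h1.convolution h2⟩
  set m : ℕ → EuclideanSpace ℝ (Fin n) → ℝ := fun N ξ =>
    (χ (((2 : ℝ) ^ N)⁻¹ • ξ) - χ ((2 : ℝ) ^ (N + 1) • ξ)) * e ξ with hm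
  have hmc : ∀ N, Continuous (m N) := fun N => ((hchi _).sub (hchi _)).mul hec
  have hmi : ∀ N, Integrable (m N) := fun N =>
    hχ.integrable_annulus_mul (by positivity) (by positivity) hec
  have hab : ∀ N ξ, |e ξ - m N ξ| ≤ 2 * e ξ := by
    intro N ξ
    have h0 : 0 < e ξ := Real.exp_pos _
    have e1 : e ξ - m N ξ =
        (1 - χ (((2 : ℝ) ^ N)⁻¹ • ξ) + χ ((2 : ℝ) ^ (N + 1) • ξ)) * e ξ := by
      simp only [hm]; ring
    rw [e1, abs_mul, abs_of_pos h0]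
    refine mul_le_mul_of_nonneg_right ?_ h0.le
    rw [abs_le]
    constructor <;> linarith [hχ.nonneg (((2 : ℝ) ^ N)⁻¹ • ξ), hχ.le_one (((2 : ℝ) ^ N)⁻¹ • ξ),
      hχ.nonneg ((2 : ℝ) ^ (N + 1) • ξ), hχ.le_one ((2 : ℝ) ^ (N + 1) • ξ)]
  refine ⟨fun N => ∫ ξ, |e ξ - m N ξ|, ?_, fun N => ?_⟩
  · have h0 : (0 : ℝ) = ∫ ξ : EuclideanSpace ℝ (Fin n), (0 : ℝ) := by simp
    rw [h0]
    have : Nontrivial (EuclideanSpace ℝ (Fin n)) := by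
      have : NeZero n := ⟨hn.ne'⟩
      infer_instance
    refine tendsto_integral_of_dominated_convergence (fun ξ => 2 * e ξ)
      (fun N => (hec.sub (hmc N)).abs.aestronglyMeasurable) (hei.const_mul 2)
      (fun N => Eventually.of_forall fun ξ => by simpa using hab N ξ) ?_
    have hne : ∀ᵐ ξ : EuclideanSpace ℝ (Fin n), ξ ≠ 0 := by
      rw [ae_iff]
      simp
    filter_upwards [hne] with ξ hξ
    refine tendsto_const_nhds.congr' ?_
    filter_upwards [hχ.eventually_high_eq_one ξ,
      (tendsto_add_atTop_nat 1).eventually (hχ.eventually_low_eq_zero hξ)] with N h1 h2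
    simp only [hm]
    rw [h1, h2]
    simp
  · have hsub : Integrable fun ξ => e ξ - m N ξ := hei.sub (hmi N)
    have hker : heatKernel α t - multiplierKernel (m N) =
        multiplierKernel fun ξ => e ξ - m N ξ := by
      ext x
      have := multiplierKernel_add (hmi N) hsub x
      simp only [add_sub_cancel] at this
      rw [Pi.sub_apply, sub_eq_iff_eq_add']
      exact this
    obtain ⟨B₁, h1⟩ := hpk (((2 : ℝ) ^ N)⁻¹) (by positivity)
    obtain ⟨B₂, h2⟩ := hpk ((2 : ℝ) ^ (N + 1)) (by positivity)
    have h3 := hK.kernel t ht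
    have hmk : ∀ x, multiplierKernel (m N) x =
        multiplierKernel (fun ξ => χ (((2 : ℝ) ^ N)⁻¹ • ξ) * e ξ) x -
          multiplierKernel (fun ξ => χ ((2 : ℝ) ^ (N + 1) • ξ) * e ξ) x := by
      intro x
      have := multiplierKernel_add (hmi N) (hci ((2 : ℝ) ^ (N + 1)) (by positivity)) x
      rw [eq_sub_iff_add_eq, ← this]
      congr 1
      ext ξ
      simp only [hm]
      ring
    have hint := h3.integrable.sub (h1.integrable.sub h2.integrable)
    have heq : heatKernel α t - multiplierKernel (m N) =
        heatKernel α t - (multiplierKernel (fun ξ => χ (((2 : ℝ) ^ N)⁻¹ • ξ) * e ξ) -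
          multiplierKernel (fun ξ => χ ((2 : ℝ) ^ (N + 1) • ξ) * e ξ)) := by
      ext x
      simp [hmk]
    refine ⟨h3.continuous.sub (continuous_multiplierKernel (hmi N)), heq ▸ hint, ?_, fun x => ?_⟩
    · change ∫ x, |(heatKernel α t - multiplierKernel (m N) : EuclideanSpace ℝ (Fin n) → ℝ) x| ≤ _
      rw [heq]
      calc _ ≤ ∫ x, (|heatKernel α t x| + (|multiplierKernel
              (fun ξ => χ (((2 : ℝ) ^ N)⁻¹ • ξ) * e ξ) x| +
            |multiplierKernel (fun ξ => χ ((2 : ℝ) ^ (N + 1) • ξ) * e ξ) x|)) := by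
            refine integral_mono hint.abs
              (h3.integrable.abs.add (h1.integrable.abs.add h2.integrable.abs)) fun x => ?_
            exact (abs_sub _ _).trans (by
              gcongr
              exact abs_sub _ _)
        _ ≤ _ := by
            have e1 := integral_add h3.integrable.abs (h1.integrable.abs.add h2.integrable.abs)
            have e2 := integral_add h1.integrable.abs h2.integrable.abs
            simp only [Pi.add_apply] at e1
            rw [e1, e2]
            linarith [h3.integral_le, h1.integral_le, h2.integral_le]
    · change |(heatKernel α t - multiplierKernel (m N) : EuclideanSpace ℝ (Fin n) → ℝ) x| ≤ _
      rw [hker]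
      exact abs_multiplierKernel_le_integral x

/-- The heat extension of a distribution of negative Besov regularity. -/
theorem exists_eLpNorm_fracSemigroup_le_besovNorm (hχ : IsLittlewoodPaleyBump χ) (hn : 0 < n)
    (hα : 0 < α) {p P r σ θ : ℝ} (hp : 1 ≤ p) (hP : p ≤ P) (hr : 1 ≤ r) (hθ : 0 < θ) (hθ' : θ < 1)
    (hσ : 2 * α * θ = σ + n * (1 / p - 1 / P)) :
    ∃ C : ℝ, 0 ≤ C ∧ ∀ t : ℝ, 0 < t → ∀ φ : EuclideanSpace ℝ (Fin n) → 𝕜,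
      MemLp φ (ENNReal.ofReal r) volume →
      eLpNorm (fracSemigroup α t φ) (ENNReal.ofReal P) volume ≤
        ENNReal.ofReal (C * t ^ (-θ)) * besovNorm χ (-σ) p φ := by
  obtain ⟨C₁, hC₁, H₁⟩ := hχ.exists_block_bound (𝕜 := 𝕜) hα
  obtain ⟨C₂, hC₂, H₂⟩ := exists_tsum_rpow_mul_inv_le (q := (2 : ℝ) ^ (2 * α)) (θ := θ)
    (Real.one_lt_rpow one_lt_two (by positivity)) hθ hθ'
  obtain ⟨A, hA⟩ := hχ.exists_isBoundedKernel_remainder hn hα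
  obtain ⟨A₀, hK⟩ := hχ.exists_heatBounds hn hα
  refine ⟨C₁ * C₂, by positivity, fun t ht φ hφ => ?_⟩
  obtain ⟨B, hB, hR⟩ := hA t ht
  set b := besovNorm χ (-σ) p φ
  set ψ : ℤ → EuclideanSpace ℝ (Fin n) → ℝ := fun j ξ => (χ ((2 : ℝ) ^ (-j) • ξ) -
    χ ((2 * (2 : ℝ) ^ (-j)) • ξ)) * Real.exp (-t * ‖ξ‖ ^ (2 * α)) with hψ
  obtain ⟨C₃, hC₃, H₃⟩ := hχ.exists_isBoundedKernel_annulus hα (r := 1) (R := 2)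
    (by norm_num) (by norm_num)
  have hψb : ∀ j, ∃ A B, IsBoundedKernel (multiplierKernel (ψ j)) A B := fun j => by
    have := H₃ ((2 : ℝ) ^ (-j)) (by positivity) t ht.le
    simp only [one_mul] at this
    exact ⟨_, _, this⟩
  choose A' B' hψb using hψb
  have hblock : ∀ j, eLpNorm (multiplierConv (ψ j) φ) (ENNReal.ofReal P) volume ≤
      ENNReal.ofReal (C₁ * (((2 : ℝ) ^ (2 * α)) ^ ((j : ℝ) * θ) *
        (1 + t * ((2 : ℝ) ^ (2 * α)) ^ (j : ℝ))⁻¹)) * b := by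
    intro j
    have hl : 0 < (2 : ℝ) ^ (-j) := by positivity
    refine (H₁ _ hl t ht.le p P r hp hP hr φ hφ).trans ?_
    have hb : eLpNorm (dyadicBlock χ j φ) (ENNReal.ofReal p) volume ≤
        ENNReal.ofReal ((2 : ℝ) ^ ((j : ℝ) * σ)) * b := by
      have h1 : ENNReal.ofReal ((2 : ℝ) ^ ((j : ℝ) * -σ)) *
          eLpNorm (dyadicBlock χ j φ) (ENNReal.ofReal p) volume ≤ b :=
        le_iSup (fun j : ℤ => ENNReal.ofReal ((2 : ℝ) ^ ((j : ℝ) * -σ)) *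
          eLpNorm (dyadicBlock χ j φ) (ENNReal.ofReal p) volume) j
      refine le_trans (le_of_eq ?_) (mul_le_mul_right h1 _)
      rw [← mul_assoc, ← ENNReal.ofReal_mul (by positivity), ← Real.rpow_add two_pos]
      simp
    refine (mul_le_mul_right hb _).trans (le_of_eq ?_)
    rw [← mul_assoc, ← ENNReal.ofReal_mul (by positivity)]
    congr 2
    rw [← Real.rpow_intCast, ← Real.rpow_mul two_pos.le, ← Real.rpow_mul two_pos.le,
      ← Real.rpow_mul two_pos.le, ← Real.rpow_mul two_pos.le, mul_assoc, mul_assoc,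
      ← Real.rpow_add two_pos, mul_comm (_)⁻¹]
    -- The relation `hσ` enters here: the Bernstein power and the Besov weight combine to 2^{2αθj},
    -- the power in the dyadic sum.
    have e1 : ((-j : ℤ) : ℝ) * -(n * (1 / p - 1 / P)) + j * σ = 2 * α * (j * θ) := by
      push_cast
      linear_combination -(j : ℝ) * hσ
    have e2 : ((-j : ℤ) : ℝ) * -(2 * α) = 2 * α * j := by push_cast; ring
    rw [e1, e2]
  have hlim : ∀ x, Tendsto (fun N : ℕ => (∑ i ∈ Finset.range (2 * N + 1),
      multiplierConv (ψ ((i : ℤ) - N)) φ) x) atTop (𝓝 (fracSemigroup α t φ x)) := by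
    intro x
    have hr0 : 0 < r := by linarith
    rw [tendsto_iff_edist_tendsto_0]
    have h1 : Tendsto (fun N => ENNReal.ofReal (A ^ (1 - 1 / r) * B N ^ (1 / r)) *
        eLpNorm φ (ENNReal.ofReal r) volume) atTop (𝓝 0) := by
      have h2 := hB.rpow_const (p := 1 / r) (Or.inr (by positivity))
      rw [Real.zero_rpow (by positivity)] at h2
      have h3 := ENNReal.Tendsto.mul_const (ENNReal.tendsto_ofReal (h2.const_mul (A ^ (1 - 1 / r))))
        (b := eLpNorm φ (ENNReal.ofReal r) volume) (Or.inr hφ.2.ne)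
      simpa using h3
    refine tendsto_of_tendsto_of_tendsto_of_le_of_le tendsto_const_nhds h1 (fun _ => zero_le)
      fun N => ?_
    have hsum : (∑ i ∈ Finset.range (2 * N + 1), multiplierConv (ψ ((i : ℤ) - N)) φ) =
        (multiplierKernel fun ξ => (χ (((2 : ℝ) ^ N)⁻¹ • ξ) - χ ((2 : ℝ) ^ (N + 1) • ξ)) *
          Real.exp (-t * ‖ξ‖ ^ (2 * α))) ⋆[ContinuousLinearMap.lsmul ℝ ℝ, volume] φ := by
      have h1 := IsBoundedKernel.convolution_sum_left (Finset.range (2 * N + 1))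
        (k := fun i : ℕ => multiplierKernel (ψ ((i : ℤ) - N))) (fun i => hψb _) hr hφ
      unfold multiplierConv
      rw [← h1]
      congr 1
      ext y
      rw [← multiplierKernel_sum]
      · congr 1
        ext ξ
        exact sum_dyadic χ N ξ _
      · intro i _
        exact hχ.integrable_annulus_mul (by positivity) (by positivity) (continuous_heatSymbol hα t)
    have hS := (hK.kernel t ht).sub (hR N)
    rw [sub_sub_cancel] at hS
    rw [hsum, edist_comm, edist_eq_enorm_sub, fracSemigroup_eq, ← Pi.sub_apply,
      ← IsBoundedKernel.convolution_sub_left (hK.kernel t ht) hS hr hφ]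
    exact (hR N).enorm_convolution_le_sup hr hφ.1 x
  have hmeas : ∀ j, AEStronglyMeasurable (multiplierConv (ψ j) φ) volume := fun j =>
    ((hψb j).continuous_convolution hr hφ).aestronglyMeasurable
  -- Fatou's lemma: pointwise convergence of the partial sums suffices, and convergence in L^P is
  -- not needed.
  refine (Lp.eLpNorm_lim_le_liminf_eLpNorm (fun N => Finset.aestronglyMeasurable_sum _
    fun i _ => hmeas _) _ (Eventually.of_forall hlim)).trans ?_
  have hP1 : (1 : ℝ≥0∞) ≤ ENNReal.ofReal P := by
    simpa using ENNReal.ofReal_le_ofReal (hp.trans hP)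
  have hbound : ∀ N : ℕ, eLpNorm (∑ i ∈ Finset.range (2 * N + 1),
      multiplierConv (ψ ((i : ℤ) - N)) φ) (ENNReal.ofReal P) volume ≤
      ENNReal.ofReal (C₁ * C₂ * t ^ (-θ)) * b := by
    intro N
    refine (eLpNorm_sum_le (fun i _ => hmeas _) hP1).trans ?_
    set a : ℤ → ℝ≥0∞ := fun j => ENNReal.ofReal (((2 : ℝ) ^ (2 * α)) ^ ((j : ℝ) * θ) *
        (1 + t * ((2 : ℝ) ^ (2 * α)) ^ (j : ℝ))⁻¹)
    calc _ ≤ ∑ i ∈ Finset.range (2 * N + 1), ENNReal.ofReal C₁ * a ((i : ℤ) - N) * b := by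
          refine Finset.sum_le_sum fun i _ => (hblock _).trans (le_of_eq ?_)
          rw [ENNReal.ofReal_mul hC₁]
      _ = ENNReal.ofReal C₁ * (∑ i ∈ Finset.range (2 * N + 1), a ((i : ℤ) - N)) * b := by
          rw [Finset.mul_sum, Finset.sum_mul]
      _ ≤ ENNReal.ofReal C₁ * (∑' j, a j) * b := by
          gcongr
          have hinj : Function.Injective fun i : ℕ => (i : ℤ) - N := fun i j h => by
            simpa using h
          rw [← Finset.sum_image (f := a) (g := fun i : ℕ => (i : ℤ) - N) (fun i _ j _ h => hinj h)]
          exact ENNReal.sum_le_tsum _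
      _ ≤ ENNReal.ofReal C₁ * ENNReal.ofReal (C₂ * t ^ (-θ)) * b := by
          gcongr
          exact H₂ t ht
      _ = _ := by rw [← ENNReal.ofReal_mul hC₁, mul_assoc]
  exact liminf_le_of_le (by isBoundedDefault) fun c hc => by
    obtain ⟨N, hN⟩ := hc.exists
    exact hN.trans (hbound N)

end IsLittlewoodPaleyBump

end BesovHeat

/-! ### Lipschitz estimates for the power nonlinearity and interpolation of Lebesgue norms. -/

section Nonlinearity

/-- Bernoulli's inequality with exponent b + 1, applied to c/a. Multiplying by the smaller number c
compensates the lack of Lipschitz continuity of x^b at 0 when b < 1, so all b > 0 are covered. -/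
theorem rpow_sub_rpow_mul_le {a c b : ℝ} (hc : 0 ≤ c) (hca : c ≤ a) (hb : 0 < b) :
    (a ^ b - c ^ b) * c ≤ b * a ^ b * (a - c) := by
  rcases hca.eq_or_lt with rfl | hlt
  · simp
  have ha : 0 < a := hc.trans_lt hlt
  have h := one_add_mul_self_le_rpow_one_add (s := c / a - 1)
    (by have : 0 ≤ c / a := by positivity
        linarith) (p := b + 1) (by linarith)
  rw [add_sub_cancel, Real.div_rpow hc ha.le, le_div_iff₀ (by positivity),
    Real.rpow_add_one ha.ne', Real.rpow_add_one' hc (by linarith)] at h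
  have e : (1 + (b + 1) * (c / a - 1)) * (a ^ b * a) = a ^ b * (a + (b + 1) * (c - a)) := by
    field_simp
  rw [e] at h
  linarith

variable {𝕜 : Type*} [RCLike 𝕜] {κ b : ℝ}

/-- For ‖w‖ ≤ ‖z‖ write |z|^b z - |w|^b w = |z|^b (z - w) + (|z|^b - |w|^b) w; the difference of
powers multiplies the smaller number, as the preceding inequality requires. -/
theorem norm_powerNonlinearity_sub_le (hκ : κ = 1 ∨ κ = -1) (hb : 0 < b) (z w : 𝕜) :
    ‖powerNonlinearity κ b z - powerNonlinearity κ b w‖ ≤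
      (b + 1) * (‖z‖ + ‖w‖) ^ b * ‖z - w‖ := by
  have hκ1 : |κ| = 1 := by rcases hκ with rfl | rfl <;> simp
  wlog hzw : ‖w‖ ≤ ‖z‖ generalizing z w
  · have := this w z (le_of_not_ge hzw)
    rwa [norm_sub_rev, add_comm ‖w‖, norm_sub_rev w] at this
  have e : powerNonlinearity κ b z - powerNonlinearity κ b w =
      κ • (‖z‖ ^ b • (z - w) + (‖z‖ ^ b - ‖w‖ ^ b) • w) := by
    simp only [powerNonlinearity, mul_smul]
    rw [← smul_sub]
    congr 1
    rw [smul_sub, sub_smul]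
    abel
  have h0 : 0 ≤ ‖z‖ ^ b - ‖w‖ ^ b :=
    sub_nonneg.2 (Real.rpow_le_rpow (norm_nonneg _) hzw hb.le)
  have h1 := rpow_sub_rpow_mul_le (norm_nonneg w) hzw hb
  have h2 : ‖z‖ - ‖w‖ ≤ ‖z - w‖ := norm_sub_norm_le z w
  have h3 : ‖z‖ ^ b ≤ (‖z‖ + ‖w‖) ^ b :=
    Real.rpow_le_rpow (norm_nonneg _) (by linarith [norm_nonneg w]) hb.le
  rw [e, norm_smul, Real.norm_eq_abs, hκ1, one_mul]
  calc _ ≤ ‖z‖ ^ b * ‖z - w‖ + (‖z‖ ^ b - ‖w‖ ^ b) * ‖w‖ := by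
        refine (norm_add_le _ _).trans (le_of_eq ?_)
        rw [norm_smul, norm_smul, Real.norm_of_nonneg h0, Real.norm_of_nonneg (by positivity)]
    _ ≤ ‖z‖ ^ b * ‖z - w‖ + b * ‖z‖ ^ b * ‖z - w‖ := by
        exact add_le_add_right (h1.trans (by gcongr)) _
    _ = (b + 1) * ‖z‖ ^ b * ‖z - w‖ := by ring
    _ ≤ _ := by gcongr

theorem continuous_powerNonlinearity (κ : ℝ) (hb : 0 < b) :
    Continuous (powerNonlinearity κ b : 𝕜 → 𝕜) :=
  (continuous_const.mul (continuous_norm.rpow_const fun _ => Or.inr hb.le)).smul continuous_id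

variable {X : Type*} [MeasurableSpace X] {μ : Measure X} {u v : X → 𝕜}

theorem holderTriple_div {p b : ℝ} (hp : 0 < p) (hb : 0 < b) :
    ENNReal.HolderTriple (ENNReal.ofReal (p / b)) (ENNReal.ofReal p)
      (ENNReal.ofReal (p / (b + 1))) :=
  Real.HolderTriple.ennrealOfReal ⟨by field_simp, by positivity, hp⟩

theorem eLpNorm_powerNonlinearity_sub_le (hκ : κ = 1 ∨ κ = -1) (hb : 0 < b) {p : ℝ} (hp : 1 ≤ p)
    (hu : AEStronglyMeasurable u μ) (hv : AEStronglyMeasurable v μ) :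
    eLpNorm (fun x => powerNonlinearity κ b (u x) - powerNonlinearity κ b (v x))
      (ENNReal.ofReal (p / (b + 1))) μ ≤
    ENNReal.ofReal (b + 1) * (eLpNorm u (ENNReal.ofReal p) μ + eLpNorm v (ENNReal.ofReal p) μ) ^ b *
      eLpNorm (fun x => u x - v x) (ENNReal.ofReal p) μ := by
  have hp0 : 0 < p := by linarith
  have := holderTriple_div hp0 hb
  have hs : AEStronglyMeasurable (fun x => ‖u x‖ + ‖v x‖) μ := hu.norm.add hv.norm
  have h := eLpNorm_le_eLpNorm_mul_eLpNorm_of_nnnorm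
    (p := ENNReal.ofReal (p / b)) (q := ENNReal.ofReal p) (r := ENNReal.ofReal (p / (b + 1)))
    (f := fun x => ‖‖u x‖ + ‖v x‖‖ ^ b) (g := fun x => ‖u x - v x‖) (μ := μ)
    (hs.norm.aemeasurable.pow_const b).aestronglyMeasurable (hu.sub hv).norm
    (fun a c => a * c) 1 (Eventually.of_forall fun x => by simp)
  rw [eLpNorm_norm_rpow _ hb, ← ENNReal.ofReal_mul (by positivity), div_mul_cancel₀ _ hb.ne',
    eLpNorm_norm, ENNReal.coe_one, one_mul] at h
  have hs2 : eLpNorm (fun x => ‖u x‖ + ‖v x‖) (ENNReal.ofReal p) μ ≤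
      eLpNorm u (ENNReal.ofReal p) μ + eLpNorm v (ENNReal.ofReal p) μ := by
    refine (eLpNorm_add_le hu.norm hv.norm (by simpa using ENNReal.ofReal_le_ofReal hp)).trans
      (le_of_eq ?_)
    rw [eLpNorm_norm, eLpNorm_norm]
  calc _ ≤ ENNReal.ofReal (b + 1) * eLpNorm (fun x => ‖‖u x‖ + ‖v x‖‖ ^ b * ‖u x - v x‖)
        (ENNReal.ofReal (p / (b + 1))) μ := by
        refine (eLpNorm_le_mul_eLpNorm_of_ae_le_mul (c := b + 1)
          (Eventually.of_forall fun x => ?_) _)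
        rw [Real.norm_of_nonneg (by positivity : 0 ≤ ‖u x‖ + ‖v x‖),
          Real.norm_of_nonneg (by positivity), ← mul_assoc]
        exact norm_powerNonlinearity_sub_le hκ hb _ _
    _ ≤ _ := by
        rw [mul_assoc]
        gcongr
        exact h.trans (by gcongr)

theorem eLpNorm_powerNonlinearity_le (hκ : κ = 1 ∨ κ = -1) (hb : 0 < b) {p : ℝ} (hp : 1 ≤ p)
    (hu : AEStronglyMeasurable u μ) :
    eLpNorm (fun x => powerNonlinearity κ b (u x)) (ENNReal.ofReal (p / (b + 1))) μ ≤
      ENNReal.ofReal (b + 1) * eLpNorm u (ENNReal.ofReal p) μ ^ (b + 1) := by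
  have h := eLpNorm_powerNonlinearity_sub_le hκ hb hp hu (v := fun _ => (0 : 𝕜))
    aestronglyMeasurable_const
  have e : powerNonlinearity κ b (0 : 𝕜) = 0 := by simp [powerNonlinearity]
  simp only [e, sub_zero] at h
  rw [eLpNorm_zero', add_zero, mul_assoc] at h
  refine h.trans (le_of_eq ?_)
  congr 1
  rw [ENNReal.rpow_add_of_nonneg _ _ hb.le zero_le_one, ENNReal.rpow_one]

theorem memLp_powerNonlinearity (hκ : κ = 1 ∨ κ = -1) (hb : 0 < b) {p : ℝ} (hp : 1 ≤ p)
    (hu : MemLp u (ENNReal.ofReal p) μ) :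
    MemLp (fun x => powerNonlinearity κ b (u x)) (ENNReal.ofReal (p / (b + 1))) μ :=
  ⟨(continuous_powerNonlinearity κ hb).comp_aestronglyMeasurable hu.1,
    (eLpNorm_powerNonlinearity_le hκ hb hp hu.1).trans_lt (ENNReal.mul_lt_top ENNReal.ofReal_lt_top
      (ENNReal.rpow_lt_top_of_nonneg (by linarith) hu.2.ne))⟩

theorem tendsto_eLpNorm_powerNonlinearity_sub (hκ : κ = 1 ∨ κ = -1) (hb : 0 < b) {p : ℝ}
    (hp : 1 ≤ p) {ι : Type*} {l : Filter ι} {u : ι → X → 𝕜} {v : X → 𝕜}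
    (hu : ∀ᶠ i in l, AEStronglyMeasurable (u i) μ) (hv : MemLp v (ENNReal.ofReal p) μ)
    (h : Tendsto (fun i => eLpNorm (fun x => u i x - v x) (ENNReal.ofReal p) μ) l (𝓝 0)) :
    Tendsto (fun i => eLpNorm (fun x => powerNonlinearity κ b (u i x) - powerNonlinearity κ b (v x))
      (ENNReal.ofReal (p / (b + 1))) μ) l (𝓝 0) := by
  set V := eLpNorm v (ENNReal.ofReal p) μ
  have hV : V ≠ ∞ := hv.2.ne
  have h1 : Tendsto (fun i => ENNReal.ofReal (b + 1) * (2 * V + 1) ^ b *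
      eLpNorm (fun x => u i x - v x) (ENNReal.ofReal p) μ) l (𝓝 0) := by
    have := ENNReal.Tendsto.const_mul (a := ENNReal.ofReal (b + 1) * (2 * V + 1) ^ b) h
      (Or.inr (ENNReal.mul_ne_top ENNReal.ofReal_ne_top
        (ENNReal.rpow_ne_top_of_nonneg hb.le (by finiteness))))
    rwa [mul_zero] at this
  refine tendsto_of_tendsto_of_tendsto_of_le_of_le' tendsto_const_nhds h1
    (Eventually.of_forall fun _ => zero_le) ?_
  filter_upwards [hu, (ENNReal.tendsto_nhds_zero.1 h) 1 one_pos] with i hi h2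
  refine (eLpNorm_powerNonlinearity_sub_le hκ hb hp hi hv.1).trans
    (mul_le_mul_left (mul_le_mul_right (ENNReal.rpow_le_rpow ?_ hb.le) _) _)
  have h3 : eLpNorm (u i) (ENNReal.ofReal p) μ ≤ 1 + V := by
    have e : u i = (fun x => u i x - v x) + v := by ext x; simp
    calc _ = eLpNorm ((fun x => u i x - v x) + v) (ENNReal.ofReal p) μ := by rw [← e]
      _ ≤ _ := (eLpNorm_add_le (hi.sub hv.1) hv.1
        (by simpa using ENNReal.ofReal_le_ofReal hp)).trans (add_le_add_left h2 _)
  calc _ ≤ 1 + V + V := add_le_add_left h3 _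
    _ = _ := by ring

/-- Interpolation between Lebesgue norms. -/
theorem eLpNorm_le_rpow_mul_rpow {r p s l : ℝ} (hr : 0 < r) (hp : 0 < p) (hl : 0 < l) (hl' : l < 1)
    (hs : 1 / s = (1 - l) / r + l / p) (hu : AEStronglyMeasurable u μ) :
    eLpNorm u (ENNReal.ofReal s) μ ≤
      eLpNorm u (ENNReal.ofReal r) μ ^ (1 - l) * eLpNorm u (ENNReal.ofReal p) μ ^ l := by
  have h1l : 0 < 1 - l := by linarith
  have : ENNReal.HolderTriple (ENNReal.ofReal (r / (1 - l))) (ENNReal.ofReal (p / l))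
      (ENNReal.ofReal s) :=
    Real.HolderTriple.ennrealOfReal ⟨by rw [inv_div, inv_div, ← hs, one_div], by positivity,
      by positivity⟩
  have h := eLpNorm_le_eLpNorm_mul_eLpNorm_of_nnnorm
    (p := ENNReal.ofReal (r / (1 - l))) (q := ENNReal.ofReal (p / l)) (r := ENNReal.ofReal s)
    (f := fun x => ‖u x‖ ^ (1 - l)) (g := fun x => ‖u x‖ ^ l) (μ := μ)
    (hu.norm.aemeasurable.pow_const _).aestronglyMeasurable
    (hu.norm.aemeasurable.pow_const _).aestronglyMeasurable
    (fun a c => a * c) 1 (Eventually.of_forall fun x => by simp)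
  rw [eLpNorm_norm_rpow _ h1l, eLpNorm_norm_rpow _ hl, ← ENNReal.ofReal_mul (by positivity),
    ← ENNReal.ofReal_mul (by positivity), div_mul_cancel₀ _ hl.ne', div_mul_cancel₀ _ h1l.ne',
    ENNReal.coe_one, one_mul] at h
  refine le_trans (le_of_eq ?_) h
  rw [← eLpNorm_norm]
  congr 1
  ext x
  rw [← Real.rpow_add_of_nonneg (norm_nonneg _) h1l.le hl.le, sub_add_cancel, Real.rpow_one]

end Nonlinearity

/-! ### Minkowski's integral inequality. -/

section Minkowski

variable {T X : Type*} [MeasurableSpace T] [MeasurableSpace X] {μ : Measure T} {ν : Measure X}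
  [IsFiniteMeasure μ] [SFinite ν] {r : ℝ}

/-- Minkowski's integral inequality, with a majorant of the inner norms. -/
theorem lintegral_lintegral_rpow_le {F : X → T → ℝ≥0∞}
    (hF : AEMeasurable (Function.uncurry F) (ν.prod μ)) {a : T → ℝ≥0∞} (ha : AEMeasurable a μ)
    (hr : 1 ≤ r) (h : ∀ᵐ τ ∂μ, ∫⁻ x, F x τ ^ r ∂ν ≤ a τ ^ r) :
    ∫⁻ x, (∫⁻ τ, F x τ ∂μ) ^ r ∂ν ≤ (∫⁻ τ, a τ ∂μ) ^ r := by
  have hr0 : 0 < r := by linarith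
  rcases eq_or_ne (∫⁻ τ, a τ ∂μ) ∞ with htop | htop
  · rw [htop, ENNReal.top_rpow_of_pos hr0]
    exact le_top
  have key : ∀ ε : ℝ≥0∞, ε ≠ 0 → ε ≠ ∞ → ∫⁻ x, (∫⁻ τ, F x τ ∂μ) ^ r ∂ν ≤
      (∫⁻ τ, a τ ∂μ + ε * μ Set.univ) ^ r := by
    intro ε hε hε'
    -- Jensen with the weight a would give the claim directly. Passing through real values makes w
    -- finite everywhere, at the cost of a null set, and adding ε makes it nonzero; the extra mass ε
    -- μ(T) disappears as ε → 0 because μ is finite.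
    set w : T → ℝ≥0∞ := fun τ => ENNReal.ofReal (a τ).toReal + ε with hw
    have hwm : AEMeasurable w μ := ha.ennreal_toReal.ennreal_ofReal.add_const _
    have hw0 : ∀ τ, w τ ≠ 0 := fun τ => by simp [hw, hε]
    have hwt : ∀ τ, w τ ≠ ∞ := fun τ => by simp [hw, hε']
    have hwa : ∀ᵐ τ ∂μ, w τ = a τ + ε := by
      filter_upwards [ae_lt_top' ha htop] with τ hτ
      simp only [hw]
      rw [ENNReal.ofReal_toReal hτ.ne]
    have hwint : ∫⁻ τ, w τ ∂μ = ∫⁻ τ, a τ ∂μ + ε * μ Set.univ := by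
      rw [lintegral_congr_ae hwa, lintegral_add_right _ measurable_const, lintegral_const]
    have hwsnd : AEMeasurable (fun z : X × T => w z.2) (ν.prod μ) :=
      hwm.comp_quasiMeasurePreserving Measure.quasiMeasurePreserving_snd
    have hG : AEMeasurable (Function.uncurry fun x τ => w τ * (F x τ / w τ) ^ r) (ν.prod μ) :=
      hwsnd.mul ((hF.div hwsnd).pow_const r)
    have hsec : ∀ᵐ x ∂ν, AEMeasurable (F x) μ := by
      filter_upwards [hF.aestronglyMeasurable.prodMk_left] with x hx
      exact hx.aemeasurable
    rw [← hwint]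
    calc ∫⁻ x, (∫⁻ τ, F x τ ∂μ) ^ r ∂ν
        ≤ ∫⁻ x, (∫⁻ τ, w τ ∂μ) ^ (r - 1) * ∫⁻ τ, w τ * (F x τ / w τ) ^ r ∂μ ∂ν := by
          refine lintegral_mono_ae ?_
          filter_upwards [hsec] with x hx
          have := lintegral_mul_rpow_le hwm (hx.div hwm) hwt hr
          simpa only [ENNReal.mul_div_cancel (hw0 _) (hwt _), Pi.div_apply] using this
      _ = (∫⁻ τ, w τ ∂μ) ^ (r - 1) * ∫⁻ x, ∫⁻ τ, w τ * (F x τ / w τ) ^ r ∂μ ∂ν := by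
          refine lintegral_const_mul' _ _ (ENNReal.rpow_ne_top_of_nonneg (by linarith) ?_)
          rw [hwint]
          finiteness
      _ = (∫⁻ τ, w τ ∂μ) ^ (r - 1) * ∫⁻ τ, ∫⁻ x, w τ * (F x τ / w τ) ^ r ∂ν ∂μ := by
          rw [lintegral_lintegral_swap hG]
      _ ≤ (∫⁻ τ, w τ ∂μ) ^ (r - 1) * ∫⁻ τ, w τ ∂μ := by
          refine mul_le_mul_right (lintegral_mono_ae ?_) _
          filter_upwards [h, hwa] with τ hτ hτ2
          have e : ∀ x, w τ * (F x τ / w τ) ^ r = w τ * (w τ ^ r)⁻¹ * F x τ ^ r := fun x => by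
            rw [ENNReal.div_rpow_of_nonneg _ _ hr0.le, div_eq_mul_inv]
            ring
          have hwr0 : w τ ^ r ≠ 0 := by simp [ENNReal.rpow_eq_zero_iff, hw0, hwt]
          have hwrt : w τ ^ r ≠ ∞ := ENNReal.rpow_ne_top_of_nonneg hr0.le (hwt τ)
          simp only [e]
          rw [lintegral_const_mul' _ _ (ENNReal.mul_ne_top (hwt τ) (ENNReal.inv_ne_top.2 hwr0))]
          calc _ ≤ w τ * (w τ ^ r)⁻¹ * w τ ^ r := by
                refine mul_le_mul_right (hτ.trans (ENNReal.rpow_le_rpow ?_ hr0.le)) _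
                rw [hτ2]
                exact le_self_add
            _ = w τ := by rw [mul_assoc, ENNReal.inv_mul_cancel hwr0 hwrt, mul_one]
      _ = (∫⁻ τ, w τ ∂μ) ^ r := by
          conv_rhs => rw [show r = (r - 1) + 1 by ring,
            ENNReal.rpow_add_of_nonneg _ _ (by linarith) zero_le_one, ENNReal.rpow_one]
  have hlim : Tendsto (fun k : ℕ => (∫⁻ τ, a τ ∂μ + ((k : ℝ≥0∞) + 1)⁻¹ * μ Set.univ) ^ r) atTop
      (𝓝 ((∫⁻ τ, a τ ∂μ) ^ r)) := by
    have h1 : Tendsto (fun k : ℕ => ((k : ℝ≥0∞) + 1)⁻¹) atTop (𝓝 0) := by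
      have := (tendsto_add_atTop_iff_nat 1).2 ENNReal.tendsto_inv_nat_nhds_zero
      simpa using this
    have h2 := (tendsto_const_nhds (x := ∫⁻ τ, a τ ∂μ)).add
      (ENNReal.Tendsto.mul_const h1 (b := μ Set.univ) (Or.inr (measure_ne_top _ _)))
    rw [zero_mul, add_zero] at h2
    exact h2.ennrpow_const r
  refine ge_of_tendsto' hlim fun k => key _ (by simp) (by simp)

variable {𝕜 : Type*} [RCLike 𝕜] {F : T → X → 𝕜}

theorem eLpNorm_lintegral_le (hF : AEStronglyMeasurable (fun z : X × T => F z.2 z.1) (ν.prod μ))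
    {a : T → ℝ≥0∞} (ha : AEMeasurable a μ) (hr : 1 ≤ r)
    (h : ∀ᵐ τ ∂μ, eLpNorm (F τ) (ENNReal.ofReal r) ν ≤ a τ) :
    (∫⁻ x, (∫⁻ τ, ‖F τ x‖ₑ ∂μ) ^ r ∂ν) ^ (1 / r) ≤ ∫⁻ τ, a τ ∂μ := by
  have hr0 : 0 < r := by linarith
  have hm := lintegral_lintegral_rpow_le (F := fun x τ => ‖F τ x‖ₑ) hF.enorm ha hr (by
    filter_upwards [h] with τ hτ
    rw [eLpNorm_eq_lintegral_rpow_enorm_toReal (by simpa using hr0) ENNReal.ofReal_ne_top,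
      ENNReal.toReal_ofReal hr0.le, one_div, ENNReal.rpow_inv_le_iff hr0] at hτ
    exact hτ)
  rw [one_div, ENNReal.rpow_inv_le_iff hr0]
  exact hm

theorem ae_integrable_of_eLpNorm_le
    (hF : AEStronglyMeasurable (fun z : X × T => F z.2 z.1) (ν.prod μ))
    {a : T → ℝ≥0∞} (ha : AEMeasurable a μ) (hr : 1 ≤ r)
    (h : ∀ᵐ τ ∂μ, eLpNorm (F τ) (ENNReal.ofReal r) ν ≤ a τ) (hfin : ∫⁻ τ, a τ ∂μ ≠ ∞) :
    ∀ᵐ x ∂ν, Integrable (fun τ => F τ x) μ := by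
  have hr0 : 0 < r := by linarith
  have h1 := eLpNorm_lintegral_le hF ha hr h
  have h2 : ∫⁻ x, (∫⁻ τ, ‖F τ x‖ₑ ∂μ) ^ r ∂ν ≠ ∞ := by
    intro h3
    rw [h3, ENNReal.top_rpow_of_pos (by positivity), top_le_iff] at h1
    exact hfin h1
  have hmeas : AEMeasurable (fun x => (∫⁻ τ, ‖F τ x‖ₑ ∂μ) ^ r) ν :=
    hF.enorm.lintegral_prod_right'.pow_const r
  filter_upwards [ae_lt_top' hmeas h2, hF.prodMk_left] with x hx hx2
  refine ⟨hx2, ?_⟩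
  by_contra h4
  rw [hasFiniteIntegral_iff_enorm, not_lt, top_le_iff] at h4
  rw [h4, ENNReal.top_rpow_of_pos hr0] at hx
  exact lt_irrefl _ hx

theorem eLpNorm_integral_le (hF : AEStronglyMeasurable (fun z : X × T => F z.2 z.1) (ν.prod μ))
    {a : T → ℝ≥0∞} (ha : AEMeasurable a μ) (hr : 1 ≤ r)
    (h : ∀ᵐ τ ∂μ, eLpNorm (F τ) (ENNReal.ofReal r) ν ≤ a τ) :
    eLpNorm (fun x => ∫ τ, F τ x ∂μ) (ENNReal.ofReal r) ν ≤ ∫⁻ τ, a τ ∂μ := by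
  have hr0 : 0 < r := by linarith
  rw [eLpNorm_eq_lintegral_rpow_enorm_toReal (by simpa using hr0) ENNReal.ofReal_ne_top,
    ENNReal.toReal_ofReal hr0.le]
  refine le_trans ?_ (eLpNorm_lintegral_le hF ha hr h)
  gcongr with x
  exact enorm_integral_le_lintegral_enorm _

end Minkowski

/-! ### Continuous L^m-valued paths and the semigroup along them. -/

section Paths

variable {n : ℕ} {α A : ℝ} {𝕜 : Type*} [RCLike 𝕜] {m r : ℝ}

/-- Continuous functions of positive time with values in `L^m`. -/
structure IsLpPath (m : ℝ) (g : ℝ → EuclideanSpace ℝ (Fin n) → 𝕜) : Prop where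
  memLp : ∀ t, 0 < t → MemLp (g t) (ENNReal.ofReal m) volume
  tendsto : ∀ s, 0 < s → Tendsto (fun t => eLpNorm (g t - g s) (ENNReal.ofReal m) volume)
    (𝓝 s) (𝓝 0)

theorem eventually_eLpNorm_le_add_one {X ι : Type*} [MeasurableSpace X] {μ : Measure X}
    (hm : 1 ≤ m) {l : Filter ι} {g : ι → X → 𝕜} {g₀ : X → 𝕜}
    (hg : ∀ᶠ i in l, MemLp (g i) (ENNReal.ofReal m) μ) (hg₀ : MemLp g₀ (ENNReal.ofReal m) μ)
    (h : Tendsto (fun i => eLpNorm (g i - g₀) (ENNReal.ofReal m) μ) l (𝓝 0)) :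
    ∀ᶠ i in l, eLpNorm (g i) (ENNReal.ofReal m) μ ≤ eLpNorm g₀ (ENNReal.ofReal m) μ + 1 := by
  filter_upwards [hg, (ENNReal.tendsto_nhds_zero.1 h) 1 one_pos] with i hi h1
  calc eLpNorm (g i) (ENNReal.ofReal m) μ = eLpNorm (g₀ + (g i - g₀)) (ENNReal.ofReal m) μ := by
        rw [add_sub_cancel]
    _ ≤ _ := (eLpNorm_add_le hg₀.1 (hi.sub hg₀).1
        (by simpa using ENNReal.ofReal_le_ofReal hm)).trans (add_le_add_right h1 _)

namespace HeatBounds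

variable (hK : HeatBounds n α A)

include hK

theorem tendsto_eLpNorm_fracSemigroup_sub (hm : 1 ≤ m) (hr : m ≤ r) {ι : Type*} {l : Filter ι}
    {a : ι → ℝ} {a₀ : ℝ} (ha₀ : 0 < a₀) (ha : Tendsto a l (𝓝 a₀))
    {g : ι → EuclideanSpace ℝ (Fin n) → 𝕜} {g₀ : EuclideanSpace ℝ (Fin n) → 𝕜}
    (hg : ∀ᶠ i in l, MemLp (g i) (ENNReal.ofReal m) volume)
    (hg₀ : MemLp g₀ (ENNReal.ofReal m) volume)
    (h : Tendsto (fun i => eLpNorm (g i - g₀) (ENNReal.ofReal m) volume) l (𝓝 0)) :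
    Tendsto (fun i => eLpNorm (fracSemigroup α (a i) (g i) - fracSemigroup α a₀ g₀)
      (ENNReal.ofReal r) volume) l (𝓝 0) := by
  obtain ⟨δ, hδ, H⟩ := hK.tendsto_fracSemigroup_modulus (𝕜 := 𝕜) ha₀ hm hr
  set c := ENNReal.ofReal (A * a₀ ^ (-(n / (2 * α) * (1 / m - 1 / r))))
  have h1 : Tendsto (fun i => ENNReal.ofReal (δ (a i)) *
      (eLpNorm g₀ (ENNReal.ofReal m) volume + 1) +
      c * eLpNorm (g i - g₀) (ENNReal.ofReal m) volume) l (𝓝 0) := by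
    have e1 := ENNReal.Tendsto.mul_const (ENNReal.tendsto_ofReal (hδ.comp ha))
      (b := eLpNorm g₀ (ENNReal.ofReal m) volume + 1) (Or.inr (by
        have := hg₀.2.ne
        finiteness))
    have e2 := ENNReal.Tendsto.const_mul (a := c) h (Or.inr ENNReal.ofReal_ne_top)
    simpa using e1.add e2
  refine tendsto_of_tendsto_of_tendsto_of_le_of_le' tendsto_const_nhds h1
    (Eventually.of_forall fun _ => zero_le) ?_
  filter_upwards [hg, ha.eventually H, eventually_eLpNorm_le_add_one hm hg hg₀ h]
    with i hi ⟨hai, H2⟩ hb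
  have e : fracSemigroup α (a i) (g i) - fracSemigroup α a₀ g₀ =
      (fracSemigroup α (a i) (g i) - fracSemigroup α a₀ (g i)) +
        fracSemigroup α a₀ (g i - g₀) := by
    rw [hK.fracSemigroup_sub ha₀ hm hi hg₀]
    abel
  rw [e]
  refine (eLpNorm_add_le ((hK.memLp_fracSemigroup hai hm hr hi).sub
    (hK.memLp_fracSemigroup ha₀ hm hr hi)).1
    (hK.memLp_fracSemigroup ha₀ hm hr (hi.sub hg₀)).1
    (by simpa using ENNReal.ofReal_le_ofReal (hm.trans hr))).trans ?_
  exact add_le_add ((H2 _ hi).trans (mul_le_mul_right hb _))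
    (hK.eLpNorm_fracSemigroup_le ha₀ hm hr (hi.sub hg₀).1)

/-- Joint continuity in (x, τ) supplies the measurability used for Tonelli and Minkowski. The
condition m > 1 is needed for the modulus of continuity in supremum norm, whose L¹ factor has
exponent 1 - 1/m. -/
theorem continuousOn_fracSemigroup_path (hm : 1 < m) {g : ℝ → EuclideanSpace ℝ (Fin n) → 𝕜}
    (hg : IsLpPath m g) (t : ℝ) :
    ContinuousOn (fun z : EuclideanSpace ℝ (Fin n) × ℝ => fracSemigroup α (t - z.2) (g z.2) z.1)
      (Set.univ ×ˢ Set.Ioo 0 t) := by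
  rintro ⟨x₀, s⟩ ⟨-, hs0, hst⟩
  refine ContinuousAt.continuousWithinAt ?_
  have hts : 0 < t - s := by simpa using hst
  have hs0 : 0 < s := hs0
  obtain ⟨δ, hδ, H⟩ := hK.tendsto_fracSemigroup_modulus_sup (𝕜 := 𝕜) hts hm
  have hsnd : Tendsto (fun z : EuclideanSpace ℝ (Fin n) × ℝ => z.2) (𝓝 (x₀, s)) (𝓝 s) :=
    continuous_snd.tendsto _
  have hfst : Tendsto (fun z : EuclideanSpace ℝ (Fin n) × ℝ => z.1) (𝓝 (x₀, s)) (𝓝 x₀) :=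
    continuous_fst.tendsto _
  have ha : Tendsto (fun z : EuclideanSpace ℝ (Fin n) × ℝ => t - z.2) (𝓝 (x₀, s)) (𝓝 (t - s)) :=
    hsnd.const_sub t
  have hgs := (hg.tendsto s hs0).comp hsnd
  have hmem : ∀ᶠ z : EuclideanSpace ℝ (Fin n) × ℝ in 𝓝 (x₀, s),
      MemLp (g z.2) (ENNReal.ofReal m) volume :=
    (hsnd.eventually (lt_mem_nhds hs0)).mono fun z hz => hg.memLp _ hz
  set c := ENNReal.ofReal (A * (t - s) ^ (-(n / (2 * α) * (1 / m))))
  rw [ContinuousAt, tendsto_iff_edist_tendsto_0]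
  have hcont := (hK.continuous_fracSemigroup hts hm.le (hg.memLp s hs0)).tendsto x₀
  rw [tendsto_iff_edist_tendsto_0] at hcont
  have h1 : Tendsto (fun z : EuclideanSpace ℝ (Fin n) × ℝ => ENNReal.ofReal (δ (t - z.2)) *
      (eLpNorm (g s) (ENNReal.ofReal m) volume + 1) +
      c * eLpNorm (g z.2 - g s) (ENNReal.ofReal m) volume +
      edist (fracSemigroup α (t - s) (g s) z.1) (fracSemigroup α (t - s) (g s) x₀))
      (𝓝 (x₀, s)) (𝓝 0) := by
    have e1 := ENNReal.Tendsto.mul_const (ENNReal.tendsto_ofReal (hδ.comp ha))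
      (b := eLpNorm (g s) (ENNReal.ofReal m) volume + 1) (Or.inr (by
        have := (hg.memLp s hs0).2.ne
        finiteness))
    have e2 := ENNReal.Tendsto.const_mul (a := c) hgs (Or.inr ENNReal.ofReal_ne_top)
    simpa using (e1.add e2).add (hcont.comp hfst)
  refine tendsto_of_tendsto_of_tendsto_of_le_of_le' tendsto_const_nhds h1
    (Eventually.of_forall fun _ => zero_le) ?_
  filter_upwards [hmem, ha.eventually H,
    eventually_eLpNorm_le_add_one hm.le hmem (hg.memLp s hs0) hgs] with z hi ⟨hai, H2⟩ hb
  refine (edist_triangle _ (fracSemigroup α (t - s) (g z.2) z.1) _).trans ?_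
  rw [add_assoc]
  refine add_le_add ?_ ((edist_triangle _ (fracSemigroup α (t - s) (g s) z.1) _).trans
    (add_le_add ?_ le_rfl))
  · rw [edist_eq_enorm_sub]
    exact (H2 _ hi _).trans (mul_le_mul_right hb _)
  · rw [edist_eq_enorm_sub, ← Pi.sub_apply, ← hK.fracSemigroup_sub hts hm.le hi (hg.memLp s hs0)]
    exact hK.enorm_fracSemigroup_le hts hm.le (hi.sub (hg.memLp s hs0)).1 _

theorem aestronglyMeasurable_fracSemigroup_path (hm : 1 < m)
    {g : ℝ → EuclideanSpace ℝ (Fin n) → 𝕜} (hg : IsLpPath m g) (t : ℝ) :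
    AEStronglyMeasurable
      (fun z : EuclideanSpace ℝ (Fin n) × ℝ => fracSemigroup α (t - z.2) (g z.2) z.1)
      (volume.prod (volume.restrict (Set.Ioo 0 t))) := by
  have h := (hK.continuousOn_fracSemigroup_path hm hg t).aestronglyMeasurable
    (μ := volume.prod volume) (MeasurableSet.univ.prod measurableSet_Ioo)
  rwa [← Measure.prod_restrict, Measure.restrict_univ] at h

end HeatBounds

end Paths

/-! ### Bounds for Beta integrals. -/

section TimeIntegrals

variable {β γ t : ℝ}

theorem lintegral_rpow_neg_le (hβ : β < 1) (ht : 0 < t) :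
    ∫⁻ τ in Set.Ioo 0 t, ENNReal.ofReal (τ ^ (-β)) = ENNReal.ofReal (t ^ (1 - β) / (1 - β)) := by
  have hi : IntervalIntegrable (fun τ : ℝ => τ ^ (-β)) volume 0 t :=
    intervalIntegral.intervalIntegrable_rpow' (by linarith)
  have hi2 : Integrable (fun τ : ℝ => τ ^ (-β)) (volume.restrict (Set.Ioo 0 t)) :=
    (intervalIntegrable_iff_integrableOn_Ioo_of_le ht.le).1 hi
  rw [← ofReal_integral_eq_lintegral_ofReal hi2
    ((ae_restrict_mem measurableSet_Ioo).mono fun τ hτ => Real.rpow_nonneg hτ.1.le _),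
    ← integral_Ioc_eq_integral_Ioo, ← intervalIntegral.integral_of_le ht.le,
    integral_rpow (Or.inl (by linarith)), Real.zero_rpow (by linarith), sub_zero,
    neg_add_eq_sub]

theorem lintegral_sub_rpow_neg_le (hγ : γ < 1) {a : ℝ} (ht : a < t) :
    ∫⁻ τ in Set.Ioo a t, ENNReal.ofReal ((t - τ) ^ (-γ)) =
      ENNReal.ofReal ((t - a) ^ (1 - γ) / (1 - γ)) := by
  have hi : IntervalIntegrable (fun τ : ℝ => τ ^ (-γ)) volume (t - a) (t - t) :=
    intervalIntegral.intervalIntegrable_rpow' (by linarith)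
  have hi1 : IntervalIntegrable (fun τ : ℝ => (t - τ) ^ (-γ)) volume a t := by
    simpa using hi.comp_sub_left t
  have hi2 : Integrable (fun τ : ℝ => (t - τ) ^ (-γ)) (volume.restrict (Set.Ioo a t)) :=
    (intervalIntegrable_iff_integrableOn_Ioo_of_le ht.le).1 hi1
  rw [← ofReal_integral_eq_lintegral_ofReal hi2
    ((ae_restrict_mem measurableSet_Ioo).mono fun τ hτ =>
      Real.rpow_nonneg (sub_nonneg.2 hτ.2.le) _),
    ← integral_Ioc_eq_integral_Ioo, ← intervalIntegral.integral_of_le ht.le,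
    intervalIntegral.integral_comp_sub_left (fun τ => τ ^ (-γ)), sub_self,
    integral_rpow (Or.inl (by linarith)), Real.zero_rpow (by linarith), sub_zero,
    neg_add_eq_sub]

/-- On each half of (0, t) one of the two factors is comparable to a power of t and the other is
integrable. -/
theorem exists_lintegral_beta_le (hβ : 0 ≤ β) (hβ' : β < 1) (hγ : 0 ≤ γ) (hγ' : γ < 1) :
    ∃ K : ℝ, 0 ≤ K ∧ ∀ t : ℝ, 0 < t →
      ∫⁻ τ in Set.Ioo 0 t, ENNReal.ofReal ((t - τ) ^ (-γ) * τ ^ (-β)) ≤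
        ENNReal.ofReal (K * t ^ (1 - γ - β)) := by
  have h1β : 0 < 1 - β := by linarith
  have h1γ : 0 < 1 - γ := by linarith
  refine ⟨(1 / 2) ^ (-γ) / (1 - β) + (1 / 2) ^ (-β) / (1 - γ), by positivity, fun t ht => ?_⟩
  have hp : ∀ τ ∈ Set.Ioo 0 t, ENNReal.ofReal ((t - τ) ^ (-γ) * τ ^ (-β)) ≤
      ENNReal.ofReal ((t / 2) ^ (-γ)) * ENNReal.ofReal (τ ^ (-β)) +
        ENNReal.ofReal ((t / 2) ^ (-β)) * ENNReal.ofReal ((t - τ) ^ (-γ)) := by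
    rintro τ ⟨h0, h1⟩
    have htτ : 0 < t - τ := by linarith
    rw [← ENNReal.ofReal_mul (by positivity), ← ENNReal.ofReal_mul (by positivity),
      ← ENNReal.ofReal_add (by positivity) (by positivity)]
    refine ENNReal.ofReal_le_ofReal ?_
    rcases le_total τ (t / 2) with h | h
    · have : (t - τ) ^ (-γ) ≤ (t / 2) ^ (-γ) :=
        Real.rpow_le_rpow_of_nonpos (by positivity) (by linarith) (by linarith)
      have h2 : (t - τ) ^ (-γ) * τ ^ (-β) ≤ (t / 2) ^ (-γ) * τ ^ (-β) := by gcongr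
      have : 0 ≤ (t / 2) ^ (-β) * (t - τ) ^ (-γ) := by positivity
      linarith
    · have : τ ^ (-β) ≤ (t / 2) ^ (-β) :=
        Real.rpow_le_rpow_of_nonpos (by positivity) h (by linarith)
      have h2 : (t - τ) ^ (-γ) * τ ^ (-β) ≤ (t - τ) ^ (-γ) * (t / 2) ^ (-β) := by gcongr
      have : 0 ≤ (t / 2) ^ (-γ) * τ ^ (-β) := by positivity
      linarith
  refine (setLIntegral_mono' measurableSet_Ioo hp).trans ?_
  rw [lintegral_add_left' (by fun_prop), lintegral_const_mul' _ _ ENNReal.ofReal_ne_top,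
    lintegral_const_mul' _ _ ENNReal.ofReal_ne_top, lintegral_rpow_neg_le hβ' ht,
    lintegral_sub_rpow_neg_le hγ' ht, sub_zero, ← ENNReal.ofReal_mul (by positivity),
    ← ENNReal.ofReal_mul (by positivity), ← ENNReal.ofReal_add (by positivity) (by positivity)]
  refine ENNReal.ofReal_le_ofReal (le_of_eq ?_)
  rw [div_eq_mul_one_div t 2, Real.mul_rpow ht.le (by norm_num),
    Real.mul_rpow ht.le (by norm_num), add_mul]
  have e1 : t ^ (-γ) * t ^ (1 - β) = t ^ (1 - γ - β) := by
    rw [← Real.rpow_add ht]; congr 1; ring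
  have e2 : t ^ (-β) * t ^ (1 - γ) = t ^ (1 - γ - β) := by
    rw [← Real.rpow_add ht]; congr 1; ring
  rw [← e1]
  nth_rw 2 [e1]
  rw [← e2]
  ring

end TimeIntegrals

/-! ### Existence, size and time continuity of the Duhamel integral. -/

section Duhamel

variable {n : ℕ} {α A : ℝ} {𝕜 : Type*} [RCLike 𝕜] {m r β : ℝ}

/-- The Duhamel integral `∫_0^t S(t-τ) g(τ) dτ`. -/
noncomputable def duhamel (α : ℝ) (g : ℝ → EuclideanSpace ℝ (Fin n) → 𝕜) (t : ℝ)
    (x : EuclideanSpace ℝ (Fin n)) : 𝕜 :=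
  ∫ τ in (0 : ℝ)..t, fracSemigroup α (t - τ) (g τ) x

namespace HeatBounds

variable (hK : HeatBounds n α A) {g : ℝ → EuclideanSpace ℝ (Fin n) → 𝕜}

include hK

theorem ae_eLpNorm_fracSemigroup_path_le (hm : 1 < m) (hr : m ≤ r) (hg : IsLpPath m g) {t : ℝ}
    {N : ℝ → ℝ≥0∞} (hb : ∀ τ ∈ Set.Ioo 0 t, eLpNorm (g τ) (ENNReal.ofReal m) volume ≤ N τ) :
    ∀ᵐ τ ∂(volume.restrict (Set.Ioo 0 t)),
      eLpNorm (fracSemigroup α (t - τ) (g τ)) (ENNReal.ofReal r) volume ≤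
        ENNReal.ofReal (A * (t - τ) ^ (-(n / (2 * α) * (1 / m - 1 / r)))) * N τ := by
  filter_upwards [ae_restrict_mem measurableSet_Ioo] with τ hτ
  exact (hK.eLpNorm_fracSemigroup_le (sub_pos.2 hτ.2) hm.le hr (hg.memLp τ hτ.1).1).trans
    (mul_le_mul_right (hb τ hτ) _)

theorem aestronglyMeasurable_duhamel (hm : 1 < m) (hg : IsLpPath m g) {t : ℝ} (ht : 0 < t) :
    AEStronglyMeasurable (duhamel α g t) volume := by
  have h := (hK.aestronglyMeasurable_fracSemigroup_path hm hg t).integral_prod_right'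
  refine h.congr (Eventually.of_forall fun x => ?_)
  simp only [duhamel]
  rw [intervalIntegral.integral_of_le ht.le, integral_Ioc_eq_integral_Ioo]

theorem eLpNorm_duhamel_le (hm : 1 < m) (hr : m ≤ r) (hg : IsLpPath m g) {t : ℝ} (ht : 0 < t)
    {N : ℝ → ℝ≥0∞} (hN : AEMeasurable N (volume.restrict (Set.Ioo 0 t)))
    (hb : ∀ τ ∈ Set.Ioo 0 t, eLpNorm (g τ) (ENNReal.ofReal m) volume ≤ N τ) :
    eLpNorm (duhamel α g t) (ENNReal.ofReal r) volume ≤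
      ∫⁻ τ in Set.Ioo 0 t,
        ENNReal.ofReal (A * (t - τ) ^ (-(n / (2 * α) * (1 / m - 1 / r)))) * N τ := by
  have h := eLpNorm_integral_le (F := fun τ => fracSemigroup α (t - τ) (g τ)) (r := r)
    (hK.aestronglyMeasurable_fracSemigroup_path hm hg t)
    (a := fun τ => ENNReal.ofReal (A * (t - τ) ^ (-(n / (2 * α) * (1 / m - 1 / r)))) * N τ)
    (AEMeasurable.mul (by fun_prop) hN) (hm.le.trans hr)
    (hK.ae_eLpNorm_fracSemigroup_path_le hm hr hg hb)
  refine le_trans (le_of_eq ?_) h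
  congr 1
  ext x
  simp only [duhamel]
  rw [intervalIntegral.integral_of_le ht.le, integral_Ioc_eq_integral_Ioo]

theorem ae_intervalIntegrable_path (hm : 1 < m) (hr : m ≤ r) (hg : IsLpPath m g) {t : ℝ}
    (ht : 0 < t) {N : ℝ → ℝ≥0∞} (hN : AEMeasurable N (volume.restrict (Set.Ioo 0 t)))
    (hb : ∀ τ ∈ Set.Ioo 0 t, eLpNorm (g τ) (ENNReal.ofReal m) volume ≤ N τ)
    (hfin : ∫⁻ τ in Set.Ioo 0 t,
        ENNReal.ofReal (A * (t - τ) ^ (-(n / (2 * α) * (1 / m - 1 / r)))) * N τ ≠ ∞) :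
    ∀ᵐ x, IntervalIntegrable (fun τ => fracSemigroup α (t - τ) (g τ) x) volume 0 t := by
  have h := ae_integrable_of_eLpNorm_le (F := fun τ => fracSemigroup α (t - τ) (g τ)) (r := r)
    (hK.aestronglyMeasurable_fracSemigroup_path hm hg t)
    (AEMeasurable.mul (by fun_prop) hN) (hm.le.trans hr)
    (hK.ae_eLpNorm_fracSemigroup_path_le hm hr hg hb) hfin
  filter_upwards [h] with x hx
  exact (intervalIntegrable_iff_integrableOn_Ioo_of_le ht.le).2 hx

/-- The kernel exponent `n/(2α) (1/m - 1/r)` is written `γ`. -/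
theorem exists_duhamel_bound (hβ : 0 ≤ β) (hβ' : β < 1) (hm : 1 < m) (hr : m ≤ r) {γ : ℝ}
    (hγ : n / (2 * α) * (1 / m - 1 / r) = γ) (hγ0 : 0 ≤ γ) (hγ1 : γ < 1) :
    ∃ K : ℝ, 0 ≤ K ∧ ∀ g : ℝ → EuclideanSpace ℝ (Fin n) → 𝕜, IsLpPath m g → ∀ t : ℝ, 0 < t →
      ∀ M : ℝ, 0 ≤ M → (∀ τ ∈ Set.Ioo 0 t, eLpNorm (g τ) (ENNReal.ofReal m) volume ≤
        ENNReal.ofReal (M * τ ^ (-β))) →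
      (∀ᵐ x, IntervalIntegrable (fun τ => fracSemigroup α (t - τ) (g τ) x) volume 0 t) ∧
      eLpNorm (duhamel α g t) (ENNReal.ofReal r) volume ≤
        ENNReal.ofReal (K * M * t ^ (1 - γ - β)) := by
  obtain ⟨K, hK0, H⟩ := exists_lintegral_beta_le hβ hβ' hγ0 hγ1
  have hA := hK.pos
  refine ⟨A * K, by positivity, fun g hg t ht M hM hb => ?_⟩
  have hN : AEMeasurable (fun τ : ℝ => ENNReal.ofReal (M * τ ^ (-β)))
      (volume.restrict (Set.Ioo 0 t)) := by fun_prop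
  have hle : ∫⁻ τ in Set.Ioo 0 t,
      ENNReal.ofReal (A * (t - τ) ^ (-(n / (2 * α) * (1 / m - 1 / r)))) *
        ENNReal.ofReal (M * τ ^ (-β)) ≤ ENNReal.ofReal (A * K * M * t ^ (1 - γ - β)) := by
    rw [hγ]
    calc _ = ∫⁻ τ in Set.Ioo 0 t, ENNReal.ofReal (A * M) *
          ENNReal.ofReal ((t - τ) ^ (-γ) * τ ^ (-β)) := by
          refine setLIntegral_congr_fun measurableSet_Ioo fun τ hτ => ?_
          have : 0 < t - τ := sub_pos.2 hτ.2
          rw [← ENNReal.ofReal_mul (by positivity), ← ENNReal.ofReal_mul (by positivity)]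
          congr 1
          ring
      _ = ENNReal.ofReal (A * M) *
          ∫⁻ τ in Set.Ioo 0 t, ENNReal.ofReal ((t - τ) ^ (-γ) * τ ^ (-β)) :=
          lintegral_const_mul' _ _ ENNReal.ofReal_ne_top
      _ ≤ ENNReal.ofReal (A * M) * ENNReal.ofReal (K * t ^ (1 - γ - β)) :=
          mul_le_mul_right (H t ht) _
      _ = _ := by
          rw [← ENNReal.ofReal_mul (by positivity)]
          congr 1
          ring
  exact ⟨hK.ae_intervalIntegrable_path hm hr hg ht hN hb (hle.trans_lt ENNReal.ofReal_lt_top).ne,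
    (hK.eLpNorm_duhamel_le hm hr hg ht hN hb).trans hle⟩

/-- The substitution τ = ts moves all the integrals to the fixed interval (0, 1), where the
integrands have a common majorant, a multiple of (1 - s)^{-γ} s^{-β}, and depend continuously on t
in L^r for each s. Dominated convergence and Minkowski then give the claim. -/
theorem tendsto_eLpNorm_duhamel_sub (hβ : 0 ≤ β) (hβ' : β < 1) (hm : 1 < m) (hr : m ≤ r) {γ : ℝ}
    (hγ : n / (2 * α) * (1 / m - 1 / r) = γ) (hγ0 : 0 ≤ γ) (hγ1 : γ < 1) (hg : IsLpPath m g)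
    {M : ℝ} (hM : 0 ≤ M)
    (hb : ∀ τ, 0 < τ → eLpNorm (g τ) (ENNReal.ofReal m) volume ≤ ENNReal.ofReal (M * τ ^ (-β)))
    {t₀ : ℝ} (ht₀ : 0 < t₀) :
    Tendsto (fun t => eLpNorm (duhamel α g t - duhamel α g t₀) (ENNReal.ofReal r) volume)
      (𝓝 t₀) (𝓝 0) := by
  have hA := hK.pos
  have hr1 : 1 ≤ r := hm.le.trans hr
  set μ : Measure ℝ := volume.restrict (Set.Ioo 0 1) with hμ
  set F : ℝ → ℝ → EuclideanSpace ℝ (Fin n) → 𝕜 := fun t s x =>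
    t • fracSemigroup α (t - t * s) (g (t * s)) x with hF
  have hD : ∀ t, duhamel α g t = fun x => ∫ s, F t s x ∂μ := by
    intro t
    ext x
    simp only [duhamel, hF]
    rw [integral_smul, hμ, ← integral_Ioc_eq_integral_Ioo,
      ← intervalIntegral.integral_of_le zero_le_one,
      intervalIntegral.smul_integral_comp_mul_left
        (fun τ => fracSemigroup α (t - τ) (g τ) x) t, mul_zero, mul_one]
  have hFm : ∀ t, 0 < t → AEStronglyMeasurable
      (fun z : EuclideanSpace ℝ (Fin n) × ℝ => F t z.2 z.1) (volume.prod μ) := by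
    intro t ht
    have hc : ContinuousOn (fun z : EuclideanSpace ℝ (Fin n) × ℝ => F t z.2 z.1)
        (Set.univ ×ˢ Set.Ioo 0 1) := by
      refine ContinuousOn.const_smul ?_ t
      exact (hK.continuousOn_fracSemigroup_path hm hg t).comp
        (f := fun z : EuclideanSpace ℝ (Fin n) × ℝ => (z.1, t * z.2)) (by fun_prop)
        fun z hz => ⟨trivial, mul_pos ht hz.2.1, by
          have := mul_lt_mul_of_pos_left hz.2.2 ht
          rwa [mul_one] at this⟩
    have h := hc.aestronglyMeasurable (μ := volume.prod volume)
      (MeasurableSet.univ.prod measurableSet_Ioo)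
    rwa [← Measure.prod_restrict, Measure.restrict_univ] at h
  have hFb : ∀ t, 0 < t → ∀ s ∈ Set.Ioo (0 : ℝ) 1,
      MemLp (F t s) (ENNReal.ofReal r) volume ∧
      eLpNorm (F t s) (ENNReal.ofReal r) volume ≤
        ENNReal.ofReal (A * M * t ^ (1 - γ - β)) *
          ENNReal.ofReal ((1 - s) ^ (-γ) * s ^ (-β)) := by
    intro t ht s hs
    have hs1 : 0 < 1 - s := sub_pos.2 hs.2
    have hs0 : 0 < s := hs.1
    have hts : t - t * s = t * (1 - s) := by ring
    have hpos : 0 < t - t * s := by rw [hts]; positivity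
    refine ⟨(hK.memLp_fracSemigroup hpos hm.le hr (hg.memLp _ (by positivity))).const_smul t, ?_⟩
    have h1 := (hK.eLpNorm_fracSemigroup_le hpos hm.le hr (hg.memLp (t * s) (by positivity)).1).trans
      (mul_le_mul_right (hb (t * s) (by positivity)) _)
    have h2 := eLpNorm_const_smul t (fracSemigroup α (t - t * s) (g (t * s)))
      (ENNReal.ofReal r) volume
    refine h2.le.trans ((mul_le_mul_right h1 _).trans (le_of_eq ?_))
    rw [hγ, Real.enorm_eq_ofReal ht.le, ← ENNReal.ofReal_mul (by positivity),
      ← ENNReal.ofReal_mul (by positivity), ← ENNReal.ofReal_mul (by positivity)]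
    congr 1
    rw [hts, Real.mul_rpow ht.le hs1.le, Real.mul_rpow ht.le hs0.le]
    have : t ^ (1 - γ - β) = t * t ^ (-γ) * t ^ (-β) := by
      conv_rhs => rw [← Real.rpow_one t, ← Real.rpow_mul ht.le, ← Real.rpow_mul ht.le, one_mul,
        one_mul, ← Real.rpow_add ht, ← Real.rpow_add ht]
      congr 1
    rw [this]
    ring
  obtain ⟨K, hK0, hKb⟩ := exists_lintegral_beta_le hβ hβ' hγ0 hγ1
  have hK1 := hKb 1 one_pos
  have hbeta : ∫⁻ s, ENNReal.ofReal ((1 - s) ^ (-γ) * s ^ (-β)) ∂μ ≠ ∞ :=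
    (hK1.trans_lt ENNReal.ofReal_lt_top).ne
  have hbm : AEMeasurable (fun s : ℝ => ENNReal.ofReal ((1 - s) ^ (-γ) * s ^ (-β))) μ := by fun_prop
  have hFi : ∀ t, 0 < t → ∀ᵐ x, Integrable (fun s => F t s x) μ := by
    intro t ht
    refine ae_integrable_of_eLpNorm_le (hFm t ht) (hbm.const_mul _) hr1
      ((ae_restrict_mem measurableSet_Ioo).mono fun s hs => (hFb t ht s hs).2) ?_
    rw [lintegral_const_mul' _ _ ENNReal.ofReal_ne_top]
    exact ENNReal.mul_ne_top ENNReal.ofReal_ne_top hbeta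
  set h : ℝ → ℝ → ℝ≥0∞ := fun t s => eLpNorm (F t s - F t₀ s) (ENNReal.ofReal r) volume
  have hdm : ∀ t, 0 < t → AEStronglyMeasurable
      (fun z : EuclideanSpace ℝ (Fin n) × ℝ => (F t z.2 - F t₀ z.2) z.1) (volume.prod μ) :=
    fun t ht => (hFm t ht).sub (hFm t₀ ht₀)
  have hhm : ∀ t, 0 < t → AEMeasurable (h t) μ := by
    intro t ht
    have h1 := ((hdm t ht).enorm.pow_const r).lintegral_prod_left'.pow_const (1 / r)
    refine h1.congr (Eventually.of_forall fun s => ?_)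
    exact IsBoundedKernel.lintegral_rpow_eq (by linarith)
  have hle : ∀ t, 0 < t →
      eLpNorm (duhamel α g t - duhamel α g t₀) (ENNReal.ofReal r) volume ≤ ∫⁻ s, h t s ∂μ := by
    intro t ht
    have h1 := eLpNorm_integral_le (F := fun s => F t s - F t₀ s) (hdm t ht) (hhm t ht) hr1
      (Eventually.of_forall fun s => le_rfl)
    refine le_trans (le_of_eq (eLpNorm_congr_ae ?_)) h1
    filter_upwards [hFi t ht, hFi t₀ ht₀] with x h2 h3
    rw [Pi.sub_apply, hD, hD]
    exact (integral_sub h2 h3).symm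
  have hlim : Tendsto (fun t => ∫⁻ s, h t s ∂μ) (𝓝 t₀) (𝓝 0) := by
    have h0 : (0 : ℝ≥0∞) = ∫⁻ s, (0 : ℝ≥0∞) ∂μ := by simp
    rw [h0]
    set c : ℝ → ℝ := fun t => A * M * t ^ (1 - γ - β) with hc
    have hcc : ∀ᶠ t in 𝓝 t₀, c t ≤ c t₀ + 1 := by
      have : Tendsto c (𝓝 t₀) (𝓝 (c t₀)) :=
        (Real.continuousAt_rpow_const _ _ (Or.inl ht₀.ne')).tendsto.const_mul _
      exact (this.eventually (gt_mem_nhds (by linarith : c t₀ < c t₀ + 1))).mono fun _ h => h.le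
    refine tendsto_lintegral_filter_of_dominated_convergence'
      (fun s => (ENNReal.ofReal (c t₀ + 1) + ENNReal.ofReal (c t₀)) *
        ENNReal.ofReal ((1 - s) ^ (-γ) * s ^ (-β))) ?_ ?_ ?_ ?_
    · filter_upwards [lt_mem_nhds ht₀] with t ht
      exact hhm t ht
    · filter_upwards [lt_mem_nhds ht₀, hcc] with t ht hct
      refine (ae_restrict_mem measurableSet_Ioo).mono fun s hs => ?_
      have h1 := hFb t ht s hs
      have h2 := hFb t₀ ht₀ s hs
      refine (eLpNorm_sub_le h1.1.1 h2.1.1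
        (by simpa using ENNReal.ofReal_le_ofReal hr1)).trans ?_
      rw [add_mul]
      refine add_le_add (h1.2.trans ?_) h2.2
      exact mul_le_mul_left (ENNReal.ofReal_le_ofReal hct) _
    · rw [lintegral_const_mul' _ _ (by finiteness)]
      exact ENNReal.mul_ne_top (by finiteness) hbeta
    · refine (ae_restrict_mem measurableSet_Ioo).mono fun s hs => ?_
      have hs0 : 0 < s := hs.1
      have hs1 : 0 < 1 - s := sub_pos.2 hs.2
      have ha₀ : 0 < t₀ - t₀ * s := by
        have : t₀ - t₀ * s = t₀ * (1 - s) := by ring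
        rw [this]; positivity
      have hts : Tendsto (fun t : ℝ => t * s) (𝓝 t₀) (𝓝 (t₀ * s)) :=
        tendsto_id.mul_const s
      have ha : Tendsto (fun t : ℝ => t - t * s) (𝓝 t₀) (𝓝 (t₀ - t₀ * s)) := tendsto_id.sub hts
      have hts0 : 0 < t₀ * s := by positivity
      set G : ℝ → EuclideanSpace ℝ (Fin n) → 𝕜 := fun t => fracSemigroup α (t - t * s) (g (t * s))
      have h1 : Tendsto (fun t => eLpNorm (G t - G t₀) (ENNReal.ofReal r) volume) (𝓝 t₀) (𝓝 0) :=
        hK.tendsto_eLpNorm_fracSemigroup_sub hm.le hr ha₀ ha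
          (g := fun t => g (t * s)) (g₀ := g (t₀ * s))
          ((hts.eventually (lt_mem_nhds hts0)).mono fun t ht => hg.memLp _ ht)
          (hg.memLp _ hts0) ((hg.tendsto _ hts0).comp hts)
      have hG : ∀ t, 0 < t → MemLp (G t) (ENNReal.ofReal r) volume := fun t ht =>
        hK.memLp_fracSemigroup (by
          have : t - t * s = t * (1 - s) := by ring
          rw [this]; positivity) hm.le hr (hg.memLp _ (by positivity))
      have h2 : Tendsto (fun t : ℝ => ‖t‖ₑ * eLpNorm (G t - G t₀) (ENNReal.ofReal r) volume +
          ‖t - t₀‖ₑ * eLpNorm (G t₀) (ENNReal.ofReal r) volume) (𝓝 t₀) (𝓝 0) := by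
        have e1 : Tendsto (fun t : ℝ => ‖t‖ₑ) (𝓝 t₀) (𝓝 ‖t₀‖ₑ) := continuous_enorm.tendsto _
        have e2 : Tendsto (fun t : ℝ => ‖t - t₀‖ₑ) (𝓝 t₀) (𝓝 0) := by
          have : Continuous fun t : ℝ => ‖t - t₀‖ₑ := by fun_prop
          simpa using this.tendsto t₀
        have e3 := ENNReal.Tendsto.mul e1 (Or.inr ENNReal.zero_ne_top) h1 (Or.inr enorm_ne_top)
        have e4 := ENNReal.Tendsto.mul_const e2 (b := eLpNorm (G t₀) (ENNReal.ofReal r) volume)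
          (Or.inr (hG t₀ ht₀).2.ne)
        simpa using e3.add e4
      refine tendsto_of_tendsto_of_tendsto_of_le_of_le' tendsto_const_nhds h2
        (Eventually.of_forall fun _ => zero_le) ?_
      filter_upwards [lt_mem_nhds ht₀] with t ht
      have e : F t s - F t₀ s = t • (G t - G t₀) + (t - t₀) • G t₀ := by
        change t • G t - t₀ • G t₀ = _
        rw [smul_sub, sub_smul]
        abel
      simp only [h]
      rw [e, ← eLpNorm_const_smul, ← eLpNorm_const_smul]
      exact eLpNorm_add_le (((hG t ht).sub (hG t₀ ht₀)).1.const_smul t) ((hG t₀ ht₀).1.const_smul _)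
        (by simpa using ENNReal.ofReal_le_ofReal hr1)
  refine tendsto_of_tendsto_of_tendsto_of_le_of_le' tendsto_const_nhds hlim
    (Eventually.of_forall fun _ => zero_le) ?_
  filter_upwards [lt_mem_nhds ht₀] with t ht
  exact hle t ht

end HeatBounds

end Duhamel

/-! ### The contraction principle in time-weighted spaces. -/

section FixedPoint

variable {n : ℕ} {𝕜 : Type*} [RCLike 𝕜] {P θ R : ℝ}

theorem IsLpPath.of_ae {u v : ℝ → EuclideanSpace ℝ (Fin n) → 𝕜} (hu : IsLpPath P u)
    (h : ∀ t, 0 < t → u t =ᵐ[volume] v t) : IsLpPath P v := by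
  refine ⟨fun t ht => (hu.memLp t ht).ae_eq (h t ht), fun s hs => ?_⟩
  refine (hu.tendsto s hs).congr' ?_
  filter_upwards [lt_mem_nhds hs] with t ht
  exact eLpNorm_congr_ae ((h t ht).sub (h s hs))

/-- The ball of radius `R` in the space of weighted continuous `L^P` valued functions. -/
structure InWeightedBall (P θ R : ℝ) (u : ℝ → EuclideanSpace ℝ (Fin n) → 𝕜) : Prop where
  path : IsLpPath P u
  bound : ∀ t, 0 < t → eLpNorm (u t) (ENNReal.ofReal P) volume ≤ ENNReal.ofReal (R * t ^ (-θ))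

/-- The weighted path attached to a bounded continuous function on `(0, ∞)`. -/
noncomputable def weightedPath (θ : ℝ) {p : ℝ≥0∞} [Fact (1 ≤ p)]
    (U : BoundedContinuousFunction (Set.Ioi (0 : ℝ))
      (Lp 𝕜 p (volume : Measure (EuclideanSpace ℝ (Fin n))))) (t : ℝ) :
    EuclideanSpace ℝ (Fin n) → 𝕜 :=
  if h : 0 < t then ⇑((t ^ (-θ) : ℝ) • U ⟨t, h⟩) else 0

theorem inWeightedBall_weightedPath [Fact (1 ≤ ENNReal.ofReal P)]
    {U : BoundedContinuousFunction (Set.Ioi (0 : ℝ))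
      (Lp 𝕜 (ENNReal.ofReal P) (volume : Measure (EuclideanSpace ℝ (Fin n))))} (hU : ‖U‖ ≤ R) :
    InWeightedBall P θ R (weightedPath θ U) := by
  have hval : ∀ t (ht : 0 < t), weightedPath θ U t = ⇑((t ^ (-θ) : ℝ) • U ⟨t, ht⟩) := fun t ht => by
    simp only [weightedPath, ht, dif_pos]
  refine ⟨⟨fun t ht => ?_, fun s hs => ?_⟩, fun t ht => ?_⟩
  · rw [hval t ht]
    exact Lp.memLp _
  · have hc : Continuous fun t : Set.Ioi (0 : ℝ) => ((t : ℝ) ^ (-θ) : ℝ) • U t := by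
      have hc1 : Continuous fun t : Set.Ioi (0 : ℝ) => ((t : ℝ) ^ (-θ) : ℝ) :=
        continuous_subtype_val.rpow_const fun t => Or.inl (ne_of_gt t.2)
      exact hc1.smul U.continuous
    have h1 := hc.tendsto ⟨s, hs⟩
    rw [tendsto_iff_edist_tendsto_0] at h1
    have h2 : map (fun t : Set.Ioi (0 : ℝ) => (t : ℝ)) (𝓝 ⟨s, hs⟩) = 𝓝 s :=
      map_nhds_subtype_coe_eq_nhds hs (Ioi_mem_nhds hs)
    rw [← h2, tendsto_map'_iff]
    refine h1.congr fun t => ?_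
    rw [Lp.edist_def]
    simp only [Function.comp]
    rw [hval _ t.2, hval s hs]
  · rw [hval t ht]
    have h1 : ‖(t ^ (-θ) : ℝ) • U ⟨t, ht⟩‖ ≤ R * t ^ (-θ) := by
      rw [norm_smul, Real.norm_of_nonneg (by positivity), mul_comm]
      gcongr
      exact (U.norm_coe_le_norm _).trans hU
    rw [← Lp.enorm_def, ← ofReal_norm]
    exact ENNReal.ofReal_le_ofReal h1

theorem exists_weightedPath_ae_eq [Fact (1 ≤ ENNReal.ofReal P)] (hR : 0 ≤ R)
    {u : ℝ → EuclideanSpace ℝ (Fin n) → 𝕜} (hu : InWeightedBall P θ R u) :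
    ∃ U : BoundedContinuousFunction (Set.Ioi (0 : ℝ))
      (Lp 𝕜 (ENNReal.ofReal P) (volume : Measure (EuclideanSpace ℝ (Fin n)))),
      ‖U‖ ≤ R ∧ ∀ t, 0 < t → weightedPath θ U t =ᵐ[volume] u t := by
  set f : Set.Ioi (0 : ℝ) → Lp 𝕜 (ENNReal.ofReal P)
    (volume : Measure (EuclideanSpace ℝ (Fin n))) := fun t =>
      ((t : ℝ) ^ θ : ℝ) • (hu.path.memLp t t.2).toLp (u t)
  have hfc : Continuous f := by
    have hc1 : Continuous fun t : Set.Ioi (0 : ℝ) => ((t : ℝ) ^ θ : ℝ) :=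
      continuous_subtype_val.rpow_const fun t => Or.inl (ne_of_gt t.2)
    refine hc1.smul (continuous_iff_continuousAt.2 fun s => ?_)
    rw [ContinuousAt, tendsto_iff_edist_tendsto_0]
    have h1 := (hu.path.tendsto s s.2).comp (continuous_subtype_val.tendsto s)
    refine h1.congr fun t => ?_
    rw [Lp.edist_toLp_toLp]
    rfl
  have hfb : ∀ t, ‖f t‖ ≤ R := by
    intro t
    have ht : 0 < (t : ℝ) := t.2
    simp only [f]
    rw [norm_smul, Real.norm_of_nonneg (by positivity), Lp.norm_toLp]
    have h1 := ENNReal.toReal_mono ENNReal.ofReal_ne_top (hu.bound t ht)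
    rw [ENNReal.toReal_ofReal (by positivity)] at h1
    refine (mul_le_mul_of_nonneg_left h1 (by positivity)).trans (le_of_eq ?_)
    rw [mul_left_comm, ← Real.rpow_add ht, add_neg_cancel, Real.rpow_zero, mul_one]
  refine ⟨BoundedContinuousFunction.ofNormedAddCommGroup f hfc R hfb,
    BoundedContinuousFunction.norm_ofNormedAddCommGroup_le hfc hR hfb, fun t ht => ?_⟩
  simp only [weightedPath, ht, dif_pos]
  have e : (t ^ (-θ) : ℝ) • (BoundedContinuousFunction.ofNormedAddCommGroup f hfc R hfb) ⟨t, ht⟩ =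
      (hu.path.memLp t ht).toLp (u t) := by
    change (t ^ (-θ) : ℝ) • ((t ^ θ : ℝ) • (hu.path.memLp t ht).toLp (u t)) = _
    rw [smul_smul, ← Real.rpow_add ht, neg_add_cancel, Real.rpow_zero, one_smul]
  rw [e]
  exact MemLp.coeFn_toLp _

theorem dist_le_of_weightedPath [Fact (1 ≤ ENNReal.ofReal P)] {d : ℝ} (hd : 0 ≤ d)
    {U V : BoundedContinuousFunction (Set.Ioi (0 : ℝ))
      (Lp 𝕜 (ENNReal.ofReal P) (volume : Measure (EuclideanSpace ℝ (Fin n))))}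
    (h : ∀ t, 0 < t → eLpNorm (weightedPath θ U t - weightedPath θ V t) (ENNReal.ofReal P) volume ≤
      ENNReal.ofReal (d * t ^ (-θ))) : dist U V ≤ d := by
  rw [BoundedContinuousFunction.dist_le hd]
  rintro ⟨t, ht⟩
  have ht : 0 < t := ht
  have h1 := h t ht
  simp only [weightedPath, ht, dif_pos] at h1
  rw [← Lp.edist_def, edist_dist, ENNReal.ofReal_le_ofReal_iff (by positivity), dist_smul₀,
    Real.norm_of_nonneg (by positivity), mul_comm] at h1
  exact le_of_mul_le_mul_right h1 (by positivity)

theorem eLpNorm_weightedPath_sub_le [Fact (1 ≤ ENNReal.ofReal P)]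
    (U V : BoundedContinuousFunction (Set.Ioi (0 : ℝ))
      (Lp 𝕜 (ENNReal.ofReal P) (volume : Measure (EuclideanSpace ℝ (Fin n))))) {t : ℝ}
    (ht : 0 < t) :
    eLpNorm (weightedPath θ U t - weightedPath θ V t) (ENNReal.ofReal P) volume ≤
      ENNReal.ofReal (dist U V * t ^ (-θ)) := by
  simp only [weightedPath, ht, dif_pos]
  rw [← Lp.edist_def, edist_dist, dist_smul₀, Real.norm_of_nonneg (by positivity), mul_comm]
  gcongr
  exact BoundedContinuousFunction.dist_coe_le_dist _

/-- The contraction principle in the weighted space. -/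
theorem exists_fixedPoint_weighted (hP : 1 ≤ P) (hR : 0 ≤ R)
    (Ψ : (ℝ → EuclideanSpace ℝ (Fin n) → 𝕜) → ℝ → EuclideanSpace ℝ (Fin n) → 𝕜)
    (hmap : ∀ u, InWeightedBall P θ R u → InWeightedBall P θ R (Ψ u))
    (hcontr : ∀ u v, InWeightedBall P θ R u → InWeightedBall P θ R v → ∀ d : ℝ, 0 ≤ d →
      (∀ t, 0 < t → eLpNorm (u t - v t) (ENNReal.ofReal P) volume ≤
        ENNReal.ofReal (d * t ^ (-θ))) →
      ∀ t, 0 < t → eLpNorm (Ψ u t - Ψ v t) (ENNReal.ofReal P) volume ≤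
        ENNReal.ofReal (d / 2 * t ^ (-θ))) :
    ∃ u, InWeightedBall P θ R u ∧ ∀ t, 0 < t → Ψ u t =ᵐ[volume] u t := by
  have : Fact (1 ≤ ENNReal.ofReal P) := ⟨by simpa using ENNReal.ofReal_le_ofReal hP⟩
  -- For t^θ u(t) the weighted norm is the supremum norm, so the Banach principle applies on a
  -- closed ball of bounded continuous functions with values in L^P.
  set Y := BoundedContinuousFunction (Set.Ioi (0 : ℝ))
      (Lp 𝕜 (ENNReal.ofReal P) (volume : Measure (EuclideanSpace ℝ (Fin n))))
  have hball : ∀ U : {U : Y // U ∈ Metric.closedBall (0 : Y) R},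
      InWeightedBall P θ R (weightedPath θ U.1) := fun U =>
    inWeightedBall_weightedPath (mem_closedBall_zero_iff.1 U.2)
  choose f hfR hf using fun U : {U : Y // U ∈ Metric.closedBall (0 : Y) R} =>
    exists_weightedPath_ae_eq hR (hmap _ (hball U))
  have hcs : CompleteSpace {U : Y // U ∈ Metric.closedBall (0 : Y) R} :=
    Metric.isClosed_closedBall.completeSpace_coe
  have hne : Nonempty {U : Y // U ∈ Metric.closedBall (0 : Y) R} :=
    ⟨⟨0, Metric.mem_closedBall_self hR⟩⟩
  set F : {U : Y // U ∈ Metric.closedBall (0 : Y) R} → {U : Y // U ∈ Metric.closedBall (0 : Y) R} :=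
    fun U => ⟨f U, mem_closedBall_zero_iff.2 (hfR U)⟩ with hF
  have hlip : ContractingWith (1 / 2) F := by
    refine ⟨by rw [← NNReal.coe_lt_coe]; norm_num, LipschitzWith.of_dist_le_mul fun U V => ?_⟩
    change dist (f U) (f V) ≤ _
    refine dist_le_of_weightedPath (θ := θ) (by positivity) fun t ht => ?_
    have h1 := hcontr _ _ (hball U) (hball V) (dist U V) dist_nonneg
      (fun t ht => eLpNorm_weightedPath_sub_le U.1 V.1 ht) t ht
    rw [eLpNorm_congr_ae ((hf U t ht).sub (hf V t ht))]
    refine h1.trans (le_of_eq ?_)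
    congr 2
    simp
    ring
  set U := ContractingWith.fixedPoint F hlip
  have hU : F U = U := hlip.fixedPoint_isFixedPt
  refine ⟨weightedPath θ U.1, hball U, fun t ht => ?_⟩
  have h1 := hf U t ht
  have h2 : f U = U.1 := congrArg Subtype.val hU
  rw [h2] at h1
  exact h1.symm

end FixedPoint

/-! ### Arithmetic of the exponents. -/

section Exponents

/-- Exponents `P` with `max r₀ (b + 1) < P < r₀ (b + 1)`, where `r₀` is the critical exponent, and
the weight `θ = n/(2α) (1/r₀ - 1/P)`. -/
structure SubcriticalExponent (n : ℕ) (α b P θ : ℝ) : Prop where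
  n_pos : 0 < n
  α_pos : 0 < α
  b_pos : 0 < b
  one_lt_crit : 1 < critExponent n α b
  add_one_lt : b + 1 < P
  crit_lt : critExponent n α b < P
  lt_crit_mul : P < critExponent n α b * (b + 1)
  θ_eq : θ = n / (2 * α) * (1 / critExponent n α b - 1 / P)

namespace SubcriticalExponent

variable {n : ℕ} {α b P θ : ℝ} (h : SubcriticalExponent n α b P θ)

include h

theorem crit_pos : 0 < critExponent n α b := by linarith [h.one_lt_crit]

theorem P_pos : 0 < P := by linarith [h.crit_pos, h.crit_lt]

theorem one_lt_P : 1 < P := h.one_lt_crit.trans h.crit_lt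

theorem one_lt_source : 1 < P / (b + 1) := by
  rw [one_lt_div (by linarith [h.b_pos])]
  exact h.add_one_lt

theorem source_le : P / (b + 1) ≤ P :=
  div_le_self h.P_pos.le (by linarith [h.b_pos])

theorem source_le_crit : P / (b + 1) ≤ critExponent n α b := by
  rw [div_le_iff₀ (by linarith [h.b_pos])]
  exact h.lt_crit_mul.le

theorem div_crit : n / (2 * α) * (1 / critExponent n α b) = 1 / b := by
  have hn : (0 : ℝ) < n := by exact_mod_cast h.n_pos
  have h1 := h.α_pos
  have h2 := h.b_pos
  rw [critExponent]
  field_simp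

theorem θ_eq' : θ = 1 / b - n / (2 * α) / P := by
  rw [h.θ_eq, mul_sub, h.div_crit, mul_one_div]

theorem θ_pos : 0 < θ := by
  have hn : (0 : ℝ) < n := by exact_mod_cast h.n_pos
  have h1 := h.α_pos
  rw [h.θ_eq]
  exact mul_pos (by positivity) (sub_pos.2 (one_div_lt_one_div_of_lt h.crit_pos h.crit_lt))

/-- Integrability of the source at τ = 0; it amounts to P < r₀(b + 1). -/
theorem weight_lt_one : θ * (b + 1) < 1 := by
  have hP := h.P_pos
  have hb := h.b_pos
  have h3 := h.lt_crit_mul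
  have e : critExponent n α b = n / (2 * α) * b := by rw [critExponent]; ring
  rw [h.θ_eq']
  rw [e] at h3
  have : 1 < n / (2 * α) / P * b * (b + 1) := by
    rw [div_mul_eq_mul_div, div_mul_eq_mul_div, lt_div_iff₀ hP, one_mul]
    exact h3
  have h4 : (1 / b - n / (2 * α) / P) * (b + 1) =
      1 + (1 - n / (2 * α) / P * b * (b + 1)) / b := by
    field_simp
    ring
  rw [h4]
  have : (1 - n / (2 * α) / P * b * (b + 1)) / b < 0 := div_neg_of_neg_of_pos (by linarith) hb
  linarith

theorem weight_nonneg : 0 ≤ θ * (b + 1) := mul_nonneg h.θ_pos.le (by linarith [h.b_pos])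

theorem smoothing_eq : n / (2 * α) * (1 / (P / (b + 1)) - 1 / P) = n / (2 * α) / P * b := by
  have hP := h.P_pos
  have hb : 0 < b + 1 := by linarith [h.b_pos]
  rw [one_div_div]
  field_simp
  ring

theorem smoothing_nonneg : 0 ≤ n / (2 * α) / P * b := by
  have := h.P_pos
  have := h.b_pos
  have := h.α_pos
  positivity

/-- Integrability of the smoothing factor at τ = t; it amounts to P > r₀. -/
theorem smoothing_lt_one : n / (2 * α) / P * b < 1 := by
  have hP := h.P_pos
  have h3 := h.crit_lt
  have e : critExponent n α b = n / (2 * α) * b := by rw [critExponent]; ring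
  rw [div_mul_eq_mul_div, div_lt_one hP, ← e]
  exact h3

/-- Criticality: the Duhamel term reproduces the weight t^{-θ} with no spare power of t. -/
theorem smoothing_balance : 1 - n / (2 * α) / P * b - θ * (b + 1) = -θ := by
  have hb := h.b_pos
  rw [h.θ_eq']
  field_simp
  ring

theorem smoothing_crit_nonneg :
    0 ≤ n / (2 * α) * (1 / (P / (b + 1)) - 1 / critExponent n α b) := by
  have := h.α_pos
  have := h.b_pos
  have := h.P_pos
  exact mul_nonneg (by positivity)
    (sub_nonneg.2 (one_div_le_one_div_of_le (by positivity) h.source_le_crit))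

/-- With target L^{r₀} the two time singularities add up to exactly 1, so the Duhamel term is
bounded there uniformly in time. -/
theorem smoothing_crit_eq :
    n / (2 * α) * (1 / (P / (b + 1)) - 1 / critExponent n α b) = 1 - θ * (b + 1) := by
  have hb := h.b_pos
  have hP := h.P_pos
  rw [mul_sub, h.div_crit, h.θ_eq', one_div_div]
  field_simp
  ring

theorem smoothing_crit_lt_one :
    n / (2 * α) * (1 / (P / (b + 1)) - 1 / critExponent n α b) < 1 := by
  rw [h.smoothing_crit_eq]
  have := mul_pos h.θ_pos (by linarith [h.b_pos] : 0 < b + 1)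
  linarith

end SubcriticalExponent

end Exponents

/-! ### The nonlinearity along paths with a weighted bound. -/

section Sources

variable {n : ℕ} {α b P θ κ R : ℝ} {𝕜 : Type*} [RCLike 𝕜]
  {u v : ℝ → EuclideanSpace ℝ (Fin n) → 𝕜}

theorem isLpPath_powerNonlinearity (hκ : κ = 1 ∨ κ = -1) (hb : 0 < b) (hP : 1 ≤ P)
    (hu : IsLpPath P u) :
    IsLpPath (P / (b + 1)) fun t y => powerNonlinearity κ b (u t y) := by
  refine ⟨fun t ht => memLp_powerNonlinearity hκ hb hP (hu.memLp t ht), fun s hs => ?_⟩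
  exact tendsto_eLpNorm_powerNonlinearity_sub hκ hb hP
    ((lt_mem_nhds hs).mono fun t ht => (hu.memLp t ht).1) (hu.memLp s hs) (hu.tendsto s hs)

theorem IsLpPath.sub {m : ℝ} (hm : 1 ≤ m) (hu : IsLpPath m u) (hv : IsLpPath m v) :
    IsLpPath m fun t y => u t y - v t y := by
  refine ⟨fun t ht => (hu.memLp t ht).sub (hv.memLp t ht), fun s hs => ?_⟩
  have h1 := (hu.tendsto s hs).add (hv.tendsto s hs)
  rw [add_zero] at h1
  refine tendsto_of_tendsto_of_tendsto_of_le_of_le' tendsto_const_nhds h1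
    (Eventually.of_forall fun _ => zero_le) ?_
  filter_upwards [lt_mem_nhds hs] with t ht
  have e : (fun y => u t y - v t y) - (fun y => u s y - v s y) = (u t - u s) - (v t - v s) := by
    ext y
    simp only [Pi.sub_apply]
    abel
  rw [e]
  exact eLpNorm_sub_le ((hu.memLp t ht).sub (hu.memLp s hs)).1
    ((hv.memLp t ht).sub (hv.memLp s hs)).1 (by simpa using ENNReal.ofReal_le_ofReal hm)

theorem eLpNorm_powerNonlinearity_le_of_weight (hκ : κ = 1 ∨ κ = -1) (hb : 0 < b) (hP : 1 ≤ P)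
    {M t : ℝ} (hM : 0 ≤ M) (ht : 0 < t) (hu : AEStronglyMeasurable (u t) volume)
    (hb' : eLpNorm (u t) (ENNReal.ofReal P) volume ≤ ENNReal.ofReal (M * t ^ (-θ))) :
    eLpNorm (fun y => powerNonlinearity κ b (u t y)) (ENNReal.ofReal (P / (b + 1))) volume ≤
      ENNReal.ofReal ((b + 1) * M ^ (b + 1) * t ^ (-(θ * (b + 1)))) := by
  refine (eLpNorm_powerNonlinearity_le hκ hb hP hu).trans ?_
  calc _ ≤ ENNReal.ofReal (b + 1) * ENNReal.ofReal (M * t ^ (-θ)) ^ (b + 1) := by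
        gcongr
    _ = _ := by
        rw [ENNReal.ofReal_rpow_of_nonneg (by positivity) (by positivity),
          ← ENNReal.ofReal_mul (by positivity), Real.mul_rpow hM (by positivity),
          ← Real.rpow_mul ht.le, neg_mul, mul_assoc]

theorem eLpNorm_powerNonlinearity_sub_le_of_weight (hκ : κ = 1 ∨ κ = -1) (hb : 0 < b) (hP : 1 ≤ P)
    {M d t : ℝ} (hM : 0 ≤ M) (ht : 0 < t)
    (hu : AEStronglyMeasurable (u t) volume) (hv : AEStronglyMeasurable (v t) volume)
    (hub : eLpNorm (u t) (ENNReal.ofReal P) volume ≤ ENNReal.ofReal (M * t ^ (-θ)))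
    (hvb : eLpNorm (v t) (ENNReal.ofReal P) volume ≤ ENNReal.ofReal (M * t ^ (-θ)))
    (hdb : eLpNorm (u t - v t) (ENNReal.ofReal P) volume ≤ ENNReal.ofReal (d * t ^ (-θ))) :
    eLpNorm (fun y => powerNonlinearity κ b (u t y) - powerNonlinearity κ b (v t y))
      (ENNReal.ofReal (P / (b + 1))) volume ≤
      ENNReal.ofReal ((b + 1) * (2 * M) ^ b * d * t ^ (-(θ * (b + 1)))) := by
  refine (eLpNorm_powerNonlinearity_sub_le hκ hb hP hu hv).trans ?_
  calc _ ≤ ENNReal.ofReal (b + 1) * (ENNReal.ofReal (M * t ^ (-θ)) +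
          ENNReal.ofReal (M * t ^ (-θ))) ^ b * ENNReal.ofReal (d * t ^ (-θ)) :=
        mul_le_mul' (mul_le_mul_right (ENNReal.rpow_le_rpow (add_le_add hub hvb) hb.le) _) hdb
    _ = _ := by
        rw [← ENNReal.ofReal_add (by positivity) (by positivity),
          ENNReal.ofReal_rpow_of_nonneg (by positivity) hb.le,
          ← ENNReal.ofReal_mul (by positivity), ← ENNReal.ofReal_mul (by positivity)]
        congr 1
        have e1 : M * t ^ (-θ) + M * t ^ (-θ) = 2 * M * t ^ (-θ) := by ring
        have e2 : t ^ (-(θ * (b + 1))) = t ^ (-θ * b) * t ^ (-θ) := by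
          rw [← Real.rpow_add ht]; congr 1; ring
        rw [e1, Real.mul_rpow (by positivity) (by positivity), ← Real.rpow_mul ht.le, e2]
        ring

theorem duhamel_congr {g g' : ℝ → EuclideanSpace ℝ (Fin n) → 𝕜} {t : ℝ}
    (h : ∀ τ, 0 < τ → g τ =ᵐ[volume] g' τ) (ht : 0 < t) : duhamel α g t = duhamel α g' t := by
  ext x
  simp only [duhamel]
  rw [intervalIntegral.integral_of_le ht.le, intervalIntegral.integral_of_le ht.le]
  refine setIntegral_congr_fun measurableSet_Ioc fun τ hτ => ?_
  rw [fracSemigroup_congr (h τ hτ.1)]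

theorem intervalIntegrable_path_congr {g g' : ℝ → EuclideanSpace ℝ (Fin n) → 𝕜} {t : ℝ}
    (h : ∀ τ, 0 < τ → g τ =ᵐ[volume] g' τ) (ht : 0 < t) {x : EuclideanSpace ℝ (Fin n)}
    (hi : IntervalIntegrable (fun τ => fracSemigroup α (t - τ) (g τ) x) volume 0 t) :
    IntervalIntegrable (fun τ => fracSemigroup α (t - τ) (g' τ) x) volume 0 t := by
  refine hi.congr ?_
  rw [Set.uIoc_of_le ht.le]
  intro τ hτ
  simp only
  rw [fracSemigroup_congr (h τ hτ.1)]

/-- If both integrands are integrable, Duhamel integrals may be subtracted. -/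
theorem HeatBounds.duhamel_sub {A m t : ℝ} (hK : HeatBounds n α A) (hm : 1 ≤ m)
    {g g' : ℝ → EuclideanSpace ℝ (Fin n) → 𝕜} (hg : IsLpPath m g) (hg' : IsLpPath m g')
    (ht : 0 < t) {x : EuclideanSpace ℝ (Fin n)}
    (hi : IntervalIntegrable (fun τ => fracSemigroup α (t - τ) (g τ) x) volume 0 t)
    (hi' : IntervalIntegrable (fun τ => fracSemigroup α (t - τ) (g' τ) x) volume 0 t) :
    duhamel α g t x - duhamel α g' t x = duhamel α (fun τ y => g τ y - g' τ y) t x := by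
  simp only [duhamel]
  rw [← intervalIntegral.integral_sub hi hi', intervalIntegral.integral_of_le ht.le,
    intervalIntegral.integral_of_le ht.le, integral_Ioc_eq_integral_Ioo,
    integral_Ioc_eq_integral_Ioo]
  refine setIntegral_congr_fun measurableSet_Ioo fun τ hτ => ?_
  have h := hK.fracSemigroup_sub (sub_pos.2 hτ.2) hm (hg.memLp τ hτ.1) (hg'.memLp τ hτ.1)
  rw [← Pi.sub_apply, ← h]
  rfl

end Sources

/-! ### The fixed point of the mild formulation and its size near time zero. -/

section NonlinearDuhamel

variable {n : ℕ} {α b P θ κ R A : ℝ} {𝕜 : Type*} [RCLike 𝕜]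

/-- The bounds of the nonlinear Duhamel term by the weighted norms on `(0, t)`. -/
structure DuhamelBounds (𝕜 : Type*) [RCLike 𝕜] (n : ℕ) (α b P θ K : ℝ) : Prop where
  nonneg : 0 ≤ K
  bound : ∀ κ : ℝ, κ = 1 ∨ κ = -1 → ∀ u : ℝ → EuclideanSpace ℝ (Fin n) → 𝕜, IsLpPath P u →
    ∀ t : ℝ, 0 < t → ∀ M : ℝ, 0 ≤ M → (∀ τ ∈ Set.Ioo 0 t,
      eLpNorm (u τ) (ENNReal.ofReal P) volume ≤ ENNReal.ofReal (M * τ ^ (-θ))) →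
    (∀ᵐ x, IntervalIntegrable
      (fun τ => fracSemigroup α (t - τ) (fun y => powerNonlinearity κ b (u τ y)) x) volume 0 t) ∧
    eLpNorm (duhamel α (fun τ y => powerNonlinearity κ b (u τ y)) t) (ENNReal.ofReal P) volume ≤
      ENNReal.ofReal (K * M ^ b * M * t ^ (-θ)) ∧
    eLpNorm (duhamel α (fun τ y => powerNonlinearity κ b (u τ y)) t)
      (ENNReal.ofReal (critExponent n α b)) volume ≤ ENNReal.ofReal (K * M ^ b * M)
  diff : ∀ κ : ℝ, κ = 1 ∨ κ = -1 → ∀ u v : ℝ → EuclideanSpace ℝ (Fin n) → 𝕜, IsLpPath P u →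
    IsLpPath P v → ∀ t : ℝ, 0 < t → ∀ M d : ℝ, 0 ≤ M → 0 ≤ d → (∀ τ ∈ Set.Ioo 0 t,
      eLpNorm (u τ) (ENNReal.ofReal P) volume ≤ ENNReal.ofReal (M * τ ^ (-θ)) ∧
      eLpNorm (v τ) (ENNReal.ofReal P) volume ≤ ENNReal.ofReal (M * τ ^ (-θ)) ∧
      eLpNorm (u τ - v τ) (ENNReal.ofReal P) volume ≤ ENNReal.ofReal (d * τ ^ (-θ))) →
    eLpNorm (duhamel α (fun τ y => powerNonlinearity κ b (u τ y)) t -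
      duhamel α (fun τ y => powerNonlinearity κ b (v τ y)) t) (ENNReal.ofReal P) volume ≤
      ENNReal.ofReal (K * (2 * M) ^ b * d * t ^ (-θ))

/-- The same source in L^{P/(b+1)} is sent once to L^P and once to L^{r₀}. Integrability of the two
separate integrands makes it legitimate to write the difference as the Duhamel term of the
difference of sources. -/
theorem SubcriticalExponent.exists_duhamelBounds (h : SubcriticalExponent n α b P θ)
    (hK : HeatBounds n α A) : ∃ K, DuhamelBounds 𝕜 n α b P θ K := by
  have hb := h.b_pos
  have hP1 := h.one_lt_P.le
  obtain ⟨K₁, hK₁, H₁⟩ := hK.exists_duhamel_bound (𝕜 := 𝕜) h.weight_nonneg h.weight_lt_one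
    h.one_lt_source h.source_le h.smoothing_eq h.smoothing_nonneg h.smoothing_lt_one
  obtain ⟨K₂, hK₂, H₂⟩ := hK.exists_duhamel_bound (𝕜 := 𝕜) h.weight_nonneg h.weight_lt_one
    h.one_lt_source h.source_le_crit rfl h.smoothing_crit_nonneg h.smoothing_crit_lt_one
  rw [h.smoothing_balance] at H₁
  have hbal : 1 - n / (2 * α) * (1 / (P / (b + 1)) - 1 / critExponent n α b) - θ * (b + 1) = 0 := by
    rw [h.smoothing_crit_eq]; ring
  rw [hbal] at H₂
  have hle₁ : K₁ * (b + 1) ≤ (K₁ + K₂) * (b + 1) := by nlinarith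
  have hle₂ : K₂ * (b + 1) ≤ (K₁ + K₂) * (b + 1) := by nlinarith
  refine ⟨(K₁ + K₂) * (b + 1), by positivity, fun κ hκ u hu t ht M hM hub => ?_,
    fun κ hκ u v hu hv t ht M d hM hd hb' => ?_⟩
  · have hpow : M ^ (b + 1) = M ^ b * M := Real.rpow_add_one' hM (by positivity)
    have hsrc := isLpPath_powerNonlinearity hκ hb hP1 hu
    have hsb : ∀ τ ∈ Set.Ioo 0 t, eLpNorm (fun y => powerNonlinearity κ b (u τ y))
        (ENNReal.ofReal (P / (b + 1))) volume ≤
        ENNReal.ofReal ((b + 1) * M ^ (b + 1) * τ ^ (-(θ * (b + 1)))) := fun τ hτ =>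
      eLpNorm_powerNonlinearity_le_of_weight hκ hb hP1 hM hτ.1 (hu.memLp τ hτ.1).1 (hub τ hτ)
    obtain ⟨hi, h1⟩ := H₁ _ hsrc t ht _ (by positivity) hsb
    obtain ⟨-, h2⟩ := H₂ _ hsrc t ht _ (by positivity) hsb
    rw [Real.rpow_zero, mul_one] at h2
    refine ⟨hi, h1.trans (ENNReal.ofReal_le_ofReal ?_), h2.trans (ENNReal.ofReal_le_ofReal ?_)⟩
    · rw [hpow]
      calc _ = K₁ * (b + 1) * (M ^ b * M * t ^ (-θ)) := by ring
        _ ≤ (K₁ + K₂) * (b + 1) * (M ^ b * M * t ^ (-θ)) := by gcongr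
        _ = _ := by ring
    · rw [hpow]
      calc _ = K₂ * (b + 1) * (M ^ b * M) := by ring
        _ ≤ (K₁ + K₂) * (b + 1) * (M ^ b * M) := by gcongr
        _ = _ := by ring
  · have hsu := isLpPath_powerNonlinearity hκ hb hP1 hu
    have hsv := isLpPath_powerNonlinearity hκ hb hP1 hv
    obtain ⟨hiu, -⟩ := H₁ _ hsu t ht ((b + 1) * M ^ (b + 1)) (by positivity) fun τ hτ =>
      eLpNorm_powerNonlinearity_le_of_weight hκ hb hP1 hM hτ.1 (hu.memLp τ hτ.1).1 (hb' τ hτ).1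
    obtain ⟨hiv, -⟩ := H₁ _ hsv t ht ((b + 1) * M ^ (b + 1)) (by positivity) fun τ hτ =>
      eLpNorm_powerNonlinearity_le_of_weight hκ hb hP1 hM hτ.1 (hv.memLp τ hτ.1).1 (hb' τ hτ).2.1
    obtain ⟨-, h1⟩ := H₁ _ (hsu.sub h.one_lt_source.le hsv) t ht ((b + 1) * (2 * M) ^ b * d)
      (by positivity) fun τ hτ =>
      eLpNorm_powerNonlinearity_sub_le_of_weight hκ hb hP1 hM hτ.1 (hu.memLp τ hτ.1).1
        (hv.memLp τ hτ.1).1 (hb' τ hτ).1 (hb' τ hτ).2.1 (hb' τ hτ).2.2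
    refine le_trans (le_of_eq (eLpNorm_congr_ae ?_)) (h1.trans (ENNReal.ofReal_le_ofReal ?_))
    · filter_upwards [hiu, hiv] with x hx hx'
      rw [Pi.sub_apply]
      exact hK.duhamel_sub h.one_lt_source.le hsu hsv ht hx hx'
    · calc _ = K₁ * (b + 1) * ((2 * M) ^ b * d * t ^ (-θ)) := by ring
        _ ≤ (K₁ + K₂) * (b + 1) * ((2 * M) ^ b * d * t ^ (-θ)) := by gcongr
        _ = _ := by ring

/-- The fixed point map of the mild formulation. -/
noncomputable def mildMap (α b κ : ℝ) (φ : EuclideanSpace ℝ (Fin n) → 𝕜)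
    (u : ℝ → EuclideanSpace ℝ (Fin n) → 𝕜) (t : ℝ) : EuclideanSpace ℝ (Fin n) → 𝕜 :=
  fracSemigroup α t φ + duhamel α (fun τ y => powerNonlinearity κ b (u τ y)) t

variable {r : ℝ} {φ : EuclideanSpace ℝ (Fin n) → 𝕜} {u : ℝ → EuclideanSpace ℝ (Fin n) → 𝕜}

theorem HeatBounds.isLpPath_fracSemigroup (hK : HeatBounds n α A) (hr : 1 ≤ r) (hrP : r ≤ P)
    (hφ : MemLp φ (ENNReal.ofReal r) volume) : IsLpPath P fun t => fracSemigroup α t φ :=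
  ⟨fun t ht => hK.memLp_fracSemigroup ht hr hrP hφ, fun s hs =>
    hK.tendsto_eLpNorm_fracSemigroup_sub hr hrP hs tendsto_id (g := fun _ => φ)
      (Eventually.of_forall fun _ => hφ) hφ (by simp)⟩

theorem IsLpPath.add {m : ℝ} (hm : 1 ≤ m) {v : ℝ → EuclideanSpace ℝ (Fin n) → 𝕜}
    (hu : IsLpPath m u) (hv : IsLpPath m v) : IsLpPath m fun t => u t + v t := by
  refine ⟨fun t ht => (hu.memLp t ht).add (hv.memLp t ht), fun s hs => ?_⟩
  have h1 := (hu.tendsto s hs).add (hv.tendsto s hs)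
  rw [add_zero] at h1
  refine tendsto_of_tendsto_of_tendsto_of_le_of_le' tendsto_const_nhds h1
    (Eventually.of_forall fun _ => zero_le) ?_
  filter_upwards [lt_mem_nhds hs] with t ht
  rw [add_sub_add_comm]
  exact eLpNorm_add_le ((hu.memLp t ht).sub (hu.memLp s hs)).1
    ((hv.memLp t ht).sub (hv.memLp s hs)).1 (by simpa using ENNReal.ofReal_le_ofReal hm)

theorem SubcriticalExponent.isLpPath_duhamel (h : SubcriticalExponent n α b P θ)
    (hK : HeatBounds n α A) (hκ : κ = 1 ∨ κ = -1) (hR : 0 ≤ R) (hu : InWeightedBall P θ R u) :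
    IsLpPath P (duhamel α fun τ y => powerNonlinearity κ b (u τ y)) ∧
    IsLpPath (critExponent n α b) (duhamel α fun τ y => powerNonlinearity κ b (u τ y)) := by
  obtain ⟨K, hKb⟩ := h.exists_duhamelBounds (𝕜 := 𝕜) hK
  have hb := h.b_pos
  have hP1 := h.one_lt_P.le
  have hsrc := isLpPath_powerNonlinearity hκ hb hP1 hu.path
  have hsb : ∀ τ, 0 < τ → eLpNorm (fun y => powerNonlinearity κ b (u τ y))
      (ENNReal.ofReal (P / (b + 1))) volume ≤
      ENNReal.ofReal ((b + 1) * R ^ (b + 1) * τ ^ (-(θ * (b + 1)))) := fun τ hτ =>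
    eLpNorm_powerNonlinearity_le_of_weight hκ hb hP1 hR hτ (hu.path.memLp τ hτ).1 (hu.bound τ hτ)
  have hbd := fun t (ht : 0 < t) => hKb.bound κ hκ u hu.path t ht R hR fun τ hτ =>
    hu.bound τ hτ.1
  have hmeas := fun t (ht : 0 < t) => hK.aestronglyMeasurable_duhamel h.one_lt_source hsrc ht
  exact ⟨⟨fun t ht => ⟨hmeas t ht, (hbd t ht).2.1.trans_lt ENNReal.ofReal_lt_top⟩, fun s hs =>
      hK.tendsto_eLpNorm_duhamel_sub h.weight_nonneg h.weight_lt_one h.one_lt_source h.source_le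
        h.smoothing_eq h.smoothing_nonneg h.smoothing_lt_one hsrc (by positivity) hsb hs⟩,
    ⟨fun t ht => ⟨hmeas t ht, (hbd t ht).2.2.trans_lt ENNReal.ofReal_lt_top⟩, fun s hs =>
      hK.tendsto_eLpNorm_duhamel_sub h.weight_nonneg h.weight_lt_one h.one_lt_source
        h.source_le_crit rfl h.smoothing_crit_nonneg h.smoothing_crit_lt_one hsrc (by positivity)
        hsb hs⟩⟩

/-- Half of the radius R is left for the free evolution and half for the Duhamel term. The condition
on K(2R)^b gives both invariance of the ball and the contraction factor 1/2. -/
theorem SubcriticalExponent.exists_fixedPoint (h : SubcriticalExponent n α b P θ)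
    (hK : HeatBounds n α A) {K : ℝ} (hKb : DuhamelBounds 𝕜 n α b P θ K) (hR : 0 ≤ R)
    (hR' : K * (2 * R) ^ b ≤ 1 / 2) (hκ : κ = 1 ∨ κ = -1)
    (hφ : MemLp φ (ENNReal.ofReal (critExponent n α b)) volume)
    (hsmall : ∀ t, 0 < t → eLpNorm (fracSemigroup α t φ) (ENNReal.ofReal P) volume ≤
      ENNReal.ofReal (R / 2 * t ^ (-θ))) :
    ∃ u, InWeightedBall P θ R u ∧ ∀ t, 0 < t → mildMap α b κ φ u t =ᵐ[volume] u t := by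
  have hP1 := h.one_lt_P.le
  have hb := h.b_pos
  have hP1' : (1 : ℝ≥0∞) ≤ ENNReal.ofReal P := by simpa using ENNReal.ofReal_le_ofReal hP1
  have hS := hK.isLpPath_fracSemigroup h.one_lt_crit.le h.crit_lt.le hφ
  have hKR : K * R ^ b ≤ 1 / 2 := by
    refine le_trans (mul_le_mul_of_nonneg_left ?_ hKb.nonneg) hR'
    exact Real.rpow_le_rpow hR (by linarith) hb.le
  refine exists_fixedPoint_weighted hP1 hR _ (fun u hu => ?_) (fun u v hu hv d hd hdb t ht => ?_)
  · have hD := (h.isLpPath_duhamel hK hκ hR hu).1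
    refine ⟨hS.add hP1 hD, fun t ht => ?_⟩
    have h1 := (hKb.bound κ hκ u hu.path t ht R hR fun τ hτ => hu.bound τ hτ.1).2.1
    refine (eLpNorm_add_le (hS.memLp t ht).1 (hD.memLp t ht).1 hP1').trans
      ((add_le_add (hsmall t ht) h1).trans ?_)
    have hKb0 := hKb.nonneg
    rw [← ENNReal.ofReal_add (by positivity) (by positivity)]
    refine ENNReal.ofReal_le_ofReal ?_
    rw [← add_mul]
    gcongr
    have : K * R ^ b * R ≤ 1 / 2 * R := by gcongr
    linarith
  · have h1 := hKb.diff κ hκ u v hu.path hv.path t ht R d hR hd fun τ hτ =>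
      ⟨hu.bound τ hτ.1, hv.bound τ hτ.1, hdb τ hτ.1⟩
    simp only [mildMap]
    rw [add_sub_add_left_eq_sub]
    refine h1.trans (ENNReal.ofReal_le_ofReal ?_)
    gcongr
    have : K * (2 * R) ^ b * d ≤ 1 / 2 * d := by gcongr
    linarith

/-- Smallness of the free evolution on `(0, T)` gives smallness of the solution there. -/
theorem SubcriticalExponent.weight_le_of_free_le (h : SubcriticalExponent n α b P θ)
    (hK : HeatBounds n α A) {K : ℝ} (hKb : DuhamelBounds 𝕜 n α b P θ K) (hR : 0 ≤ R)
    (hR' : K * (2 * R) ^ b ≤ 1 / 2) (hκ : κ = 1 ∨ κ = -1)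
    (hφ : MemLp φ (ENNReal.ofReal (critExponent n α b)) volume) (hu : InWeightedBall P θ R u)
    (hfix : ∀ t, 0 < t → mildMap α b κ φ u t =ᵐ[volume] u t) {ε T : ℝ} (hε : 0 < ε)
    (hεR : ε ≤ R / 2)
    (hsmall : ∀ t ∈ Set.Ioo 0 T, eLpNorm (fracSemigroup α t φ) (ENNReal.ofReal P) volume ≤
      ENNReal.ofReal (ε * t ^ (-θ))) :
    ∀ t ∈ Set.Ioo 0 T, eLpNorm (u t) (ENNReal.ofReal P) volume ≤
      ENNReal.ofReal (3 * ε * t ^ (-θ)) := by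
  have hP1 := h.one_lt_P.le
  have hb := h.b_pos
  have hP1' : (1 : ℝ≥0∞) ≤ ENNReal.ofReal P := by simpa using ENNReal.ofReal_le_ofReal hP1
  have hS := hK.isLpPath_fracSemigroup h.one_lt_crit.le h.crit_lt.le hφ
  have hD := (h.isLpPath_duhamel hK hκ hR hu).1
  -- The equation turns a bound M on (0, T) into ε + M/2. Iterated from R, these bounds decrease
  -- towards 2ε, and 3ε is reached after finitely many steps.
  have key : ∀ k : ℕ, ∀ t ∈ Set.Ioo 0 T, eLpNorm (u t) (ENNReal.ofReal P) volume ≤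
      ENNReal.ofReal ((2 * ε + R / 2 ^ k) * t ^ (-θ)) := by
    intro k
    induction k with
    | zero =>
      intro t ht
      have ht0 := ht.1
      refine (hu.bound t ht.1).trans (ENNReal.ofReal_le_ofReal ?_)
      gcongr
      simp only [pow_zero, div_one]
      linarith
    | succ k ih =>
      intro t ht
      have ht0 := ht.1
      set M := 2 * ε + R / 2 ^ k with hM
      have hM0 : 0 ≤ M := by positivity
      -- Since 2ε ≤ R, every iterate stays below 2R, so K M^b ≤ 1/2 holds at each step.
      have hM2 : M ≤ 2 * R := by
        have : R / 2 ^ k ≤ R := div_le_self hR (one_le_pow₀ (by norm_num))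
        linarith
      have h1 := (hKb.bound κ hκ u hu.path t ht.1 M hM0 fun τ hτ =>
        ih τ ⟨hτ.1, hτ.2.trans ht.2⟩).2.1
      rw [← eLpNorm_congr_ae (hfix t ht.1)]
      refine (eLpNorm_add_le (hS.memLp t ht.1).1 (hD.memLp t ht.1).1 hP1').trans
        ((add_le_add (hsmall t ht) h1).trans ?_)
      have hKb0 := hKb.nonneg
      rw [← ENNReal.ofReal_add (by positivity) (by positivity)]
      refine ENNReal.ofReal_le_ofReal ?_
      rw [← add_mul]
      refine mul_le_mul_of_nonneg_right ?_ (by positivity)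
      have h2 : K * M ^ b ≤ 1 / 2 := by
        refine le_trans (mul_le_mul_of_nonneg_left ?_ hKb.nonneg) hR'
        exact Real.rpow_le_rpow hM0 hM2 hb.le
      have h3 : K * M ^ b * M ≤ 1 / 2 * M := by gcongr
      have h4 : R / 2 ^ (k + 1) = R / 2 ^ k / 2 := by rw [pow_succ]; field_simp
      rw [h4]
      linarith
  intro t ht
  have ht0 := ht.1
  obtain ⟨k, hk⟩ : ∃ k : ℕ, R / 2 ^ k ≤ ε := by
    obtain ⟨k, hk⟩ := pow_unbounded_of_one_lt (R / ε) (one_lt_two (α := ℝ))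
    refine ⟨k, ?_⟩
    rw [div_lt_iff₀ hε] at hk
    rw [div_le_iff₀ (by positivity)]
    linarith
  refine (key k t ht).trans (ENNReal.ofReal_le_ofReal ?_)
  gcongr
  linarith

end NonlinearDuhamel

/-! ### Small solutions: continuity at time zero and the smallness condition on the data. -/

section Existence

variable {n : ℕ} {α b P θ κ R A : ℝ} {𝕜 : Type*} [RCLike 𝕜]
  {φ : EuclideanSpace ℝ (Fin n) → 𝕜} {χ : EuclideanSpace ℝ (Fin n) → ℝ}

theorem ofReal_rpow_mul_le_iff {t c : ℝ} (ht : 0 < t) {x : ℝ≥0∞} :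
    ENNReal.ofReal (t ^ θ) * x ≤ ENNReal.ofReal c ↔ x ≤ ENNReal.ofReal (c * t ^ (-θ)) := by
  have h0 : ENNReal.ofReal (t ^ θ) ≠ 0 := by
    simpa using Real.rpow_pos_of_pos ht θ
  rw [mul_comm, mul_comm c, ← ENNReal.le_div_iff_mul_le (Or.inl h0) (Or.inl ENNReal.ofReal_ne_top),
    Real.rpow_neg ht.le, ENNReal.ofReal_mul (by positivity),
    ENNReal.ofReal_inv_of_pos (by positivity), mul_comm, div_eq_mul_inv]

theorem eLpNorm_coe_sub {X : Type*} [MeasurableSpace X] {μ : Measure X} {p : ℝ≥0∞}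
    (u v : X →ₘ[μ] 𝕜) : eLpNorm (⇑(u - v)) p μ = eLpNorm (⇑u - ⇑v) p μ :=
  eLpNorm_congr_ae (AEEqFun.coeFn_sub u v)

/-- The solutions provided by the contraction principle. -/
structure IsSmallSolution (α b P θ R κ : ℝ) (φ : EuclideanSpace ℝ (Fin n) → 𝕜)
    (U : ℝ → (EuclideanSpace ℝ (Fin n) →ₘ[volume] 𝕜)) : Prop where
  mild : IsMildSolution α b κ φ U
  continuousInLp : ContinuousInLp (Set.Ici 0) (critExponent n α b) U
  ball : InWeightedBall P θ R fun t => ⇑(U t)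
  bounded : ∃ B : ℝ≥0∞, B ≠ ∞ ∧ ∀ t, 0 < t →
    eLpNorm (U t) (ENNReal.ofReal (critExponent n α b)) volume ≤ B
  tendsto : Tendsto (fun t => ENNReal.ofReal (t ^ θ) * eLpNorm (U t) (ENNReal.ofReal P) volume)
    (𝓝[>] 0) (𝓝 0)

/-- Continuity in L^{r₀} at t = 0 is the delicate point: membership in the ball only bounds the
Duhamel term there. It tends to 0 because the weighted L^P norm of the solution does, which in turn
follows from the same property of the free evolution of an L^{r₀} function. -/
theorem SubcriticalExponent.exists_isSmallSolution (h : SubcriticalExponent n α b P θ)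
    (hχ : IsLittlewoodPaleyBump χ)
    (hK : HeatBounds n α A) {K : ℝ} (hKb : DuhamelBounds 𝕜 n α b P θ K) (hR : 0 < R)
    (hR' : K * (2 * R) ^ b ≤ 1 / 2) (hκ : κ = 1 ∨ κ = -1)
    (hφ : MemLp φ (ENNReal.ofReal (critExponent n α b)) volume)
    (hsmall : ∀ t, 0 < t → eLpNorm (fracSemigroup α t φ) (ENNReal.ofReal P) volume ≤
      ENNReal.ofReal (R / 2 * t ^ (-θ))) :
    ∃ U : ℝ → (EuclideanSpace ℝ (Fin n) →ₘ[volume] 𝕜), IsSmallSolution α b P θ R κ φ U := by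
  obtain ⟨u, hu, hfix⟩ := h.exists_fixedPoint hK hKb hR.le hR' hκ hφ hsmall
  have hr1 := h.one_lt_crit.le
  have hr1' : (1 : ℝ≥0∞) ≤ ENNReal.ofReal (critExponent n α b) := by
    simpa using ENNReal.ofReal_le_ofReal hr1
  set r₀ := critExponent n α b with hr₀
  set g : ℝ → EuclideanSpace ℝ (Fin n) → 𝕜 := fun τ y => powerNonlinearity κ b (u τ y) with hg
  -- The fixed point is determined only for t > 0; the value at t = 0 is set to φ.
  set U : ℝ → (EuclideanSpace ℝ (Fin n) →ₘ[volume] 𝕜) := fun t =>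
    if ht : 0 < t then AEEqFun.mk (u t) (hu.path.memLp t ht).1 else AEEqFun.mk φ hφ.1 with hUdef
  have hU : ∀ t, 0 < t → ⇑(U t) =ᵐ[volume] u t := fun t ht => by
    simp only [hUdef, ht, dif_pos]
    exact AEEqFun.coeFn_mk _ _
  have hU0 : ⇑(U 0) =ᵐ[volume] φ := by
    simp only [hUdef, lt_irrefl, dif_neg, not_false_iff]
    exact AEEqFun.coeFn_mk _ _
  have hball : InWeightedBall P θ R fun t => ⇑(U t) :=
    ⟨hu.path.of_ae fun t ht => (hU t ht).symm, fun t ht => by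
      rw [eLpNorm_congr_ae (hU t ht)]
      exact hu.bound t ht⟩
  obtain ⟨hDP, hDr⟩ := h.isLpPath_duhamel hK hκ hR.le hu
  have hSr := hK.isLpPath_fracSemigroup hr1 le_rfl hφ
  have hsum : IsLpPath r₀ fun t => ⇑(U t) := by
    refine (hSr.add hr1 hDr).of_ae fun t ht => ?_
    exact (hfix t ht).trans (hU t ht).symm
  have hdot : ∀ ε : ℝ, 0 < ε → ε ≤ R / 2 → ∃ T, 0 < T ∧ ∀ t ∈ Set.Ioo 0 T,
      eLpNorm (u t) (ENNReal.ofReal P) volume ≤ ENNReal.ofReal (3 * ε * t ^ (-θ)) := by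
    intro ε hε hεR
    have h1 := hK.tendsto_weighted_fracSemigroup h.n_pos h.α_pos hr1 h.crit_lt hφ
    rw [← h.θ_eq] at h1
    have h2 := (ENNReal.tendsto_nhds_zero.1 h1) (ENNReal.ofReal ε) (by simpa using hε)
    obtain ⟨T, hT, h3⟩ := mem_nhdsGT_iff_exists_Ioo_subset.1 h2
    refine ⟨T, hT, h.weight_le_of_free_le hK hKb hR.le hR' hκ hφ hu hfix hε hεR fun t ht => ?_⟩
    exact (ofReal_rpow_mul_le_iff ht.1).1 (h3 ht)
  have hD0 : Tendsto (fun t => eLpNorm (duhamel α g t) (ENNReal.ofReal r₀) volume)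
      (𝓝[>] 0) (𝓝 0) := by
    have hc : Tendsto (fun ε : ℝ => ENNReal.ofReal (K * (3 * ε) ^ b * (3 * ε))) (𝓝[>] 0) (𝓝 0) := by
      have hcont : Continuous fun ε : ℝ => ENNReal.ofReal (K * (3 * ε) ^ b * (3 * ε)) := by
        have : Continuous fun ε : ℝ => (3 * ε) ^ b :=
          (continuous_const.mul continuous_id).rpow_const fun _ => Or.inr h.b_pos.le
        exact ENNReal.continuous_ofReal.comp
          ((continuous_const.mul this).mul (continuous_const.mul continuous_id))
      have := (hcont.tendsto 0).mono_left (nhdsWithin_le_nhds (s := Set.Ioi 0))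
      simpa using this
    rw [ENNReal.tendsto_nhds_zero]
    intro η hη
    have h1 := (ENNReal.tendsto_nhds_zero.1 hc) η hη
    have h2 : ∀ᶠ ε : ℝ in 𝓝[>] 0, ε ≤ R / 2 :=
      nhdsWithin_le_nhds ((gt_mem_nhds (half_pos hR)).mono fun _ h => h.le)
    obtain ⟨ε, ⟨hε1, hε2⟩, hε⟩ := ((h1.and h2).and self_mem_nhdsWithin).exists
    have hε : 0 < ε := hε
    obtain ⟨T, hT, h3⟩ := hdot ε hε hε2
    filter_upwards [Ioo_mem_nhdsGT hT] with t ht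
    refine le_trans ?_ hε1
    exact (hKb.bound κ hκ u hu.path t ht.1 (3 * ε) (by positivity) fun τ hτ =>
      h3 τ ⟨hτ.1, hτ.2.trans ht.2⟩).2.2
  refine ⟨U, ⟨hU0, fun t ht => ?_⟩, ⟨fun t ht => ?_, fun t₀ ht₀ => ?_⟩, hball, ?_, ?_⟩
  · have hf : ∀ τ, 0 < τ → g τ =ᵐ[volume] fun y => powerNonlinearity κ b (U τ y) := fun τ hτ => by
      filter_upwards [hU τ hτ] with y hy
      simp only [hg, hy]
    have hi := (hKb.bound κ hκ u hu.path t ht R hR.le fun τ hτ => hu.bound τ hτ.1).1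
    filter_upwards [hi, hU t ht, hfix t ht] with x h1 h2 h3
    refine ⟨intervalIntegrable_path_congr hf ht h1, ?_⟩
    rw [h2, ← h3]
    have := congrFun (duhamel_congr (α := α) hf ht) x
    simp only [mildMap, Pi.add_apply]
    rw [this]
    rfl
  · rcases (Set.mem_Ici.1 ht).eq_or_lt with rfl | ht
    · exact hφ.ae_eq hU0.symm
    · exact hsum.memLp t ht
  · simp only [eLpNorm_coe_sub]
    rcases (Set.mem_Ici.1 ht₀).eq_or_lt with rfl | ht₀
    · rw [← Set.Ioi_insert, nhdsWithin_insert, tendsto_sup]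
      refine ⟨by rw [tendsto_pure_left]; intro s hs; simpa using mem_of_mem_nhds hs, ?_⟩
      have h1 := (hχ.tendsto_fracSemigroup h.n_pos h.α_pos hr1 hφ).add hD0
      rw [add_zero] at h1
      refine tendsto_of_tendsto_of_tendsto_of_le_of_le' tendsto_const_nhds h1
        (Eventually.of_forall fun _ => zero_le) ?_
      filter_upwards [self_mem_nhdsWithin] with t ht
      have ht : 0 < t := ht
      have e : ⇑(U t) - ⇑(U 0) =ᵐ[volume] (fracSemigroup α t φ - φ) + duhamel α g t := by
        filter_upwards [hU t ht, hfix t ht, hU0] with x h2 h3 h4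
        simp only [Pi.sub_apply, Pi.add_apply]
        rw [h2, ← h3, h4]
        simp only [mildMap, Pi.add_apply]
        exact add_sub_right_comm _ _ _
      rw [eLpNorm_congr_ae e]
      exact eLpNorm_add_le ((hSr.memLp t ht).sub hφ).1 (hDr.memLp t ht).1 hr1'
    · exact (hsum.tendsto t₀ ht₀).mono_left nhdsWithin_le_nhds
  · refine ⟨ENNReal.ofReal A * eLpNorm φ (ENNReal.ofReal r₀) volume +
      ENNReal.ofReal (K * R ^ b * R), ?_, fun t ht => ?_⟩
    · have := hφ.2.ne
      finiteness
    · rw [← eLpNorm_congr_ae ((hfix t ht).trans (hU t ht).symm)]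
      refine (eLpNorm_add_le (hSr.memLp t ht).1 (hDr.memLp t ht).1 hr1').trans (add_le_add ?_ ?_)
      · have := hK.eLpNorm_fracSemigroup_le ht hr1 le_rfl hφ.1
        simpa using this
      · exact (hKb.bound κ hκ u hu.path t ht R hR.le fun τ hτ => hu.bound τ hτ.1).2.2
  · rw [ENNReal.tendsto_nhds_zero]
    intro η hη
    obtain ⟨ε, hε, hε1, hε2⟩ : ∃ ε : ℝ, 0 < ε ∧ ε ≤ R / 2 ∧ ENNReal.ofReal (3 * ε) ≤ η := by
      rcases eq_or_ne η ∞ with rfl | hη'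
      · exact ⟨R / 2, half_pos hR, le_rfl, le_top⟩
      · have hηr : 0 < η.toReal := ENNReal.toReal_pos hη.ne' hη'
        refine ⟨min (R / 2) (η.toReal / 3), lt_min (half_pos hR) (by positivity), min_le_left _ _, ?_⟩
        rw [ENNReal.ofReal_le_iff_le_toReal hη']
        have := min_le_right (R / 2) (η.toReal / 3)
        linarith
    obtain ⟨T, hT, h3⟩ := hdot ε hε hε1
    filter_upwards [Ioo_mem_nhdsGT hT] with t ht
    refine le_trans ?_ hε2
    rw [ofReal_rpow_mul_le_iff ht.1, eLpNorm_congr_ae (hU t ht.1)]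
    exact h3 t ht

/-- Global existence for data which are small in the Besov norm. -/
theorem SubcriticalExponent.exists_isSmallSolution_of_besovNorm (𝕜 : Type*) [RCLike 𝕜]
    (h : SubcriticalExponent n α b P θ)
    (hχ : IsLittlewoodPaleyBump χ) {p σ : ℝ} (hp : 1 ≤ p) (hpP : p ≤ P)
    (hσ : σ = 2 * α / b - n / p) :
    ∃ ε R : ℝ, 0 < ε ∧ 0 < R ∧ ∀ κ : ℝ, (κ = 1 ∨ κ = -1) →
      ∀ φ : EuclideanSpace ℝ (Fin n) → 𝕜,
      MemLp φ (ENNReal.ofReal (critExponent n α b)) volume →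
      besovNorm χ (-σ) p φ ≤ ENNReal.ofReal ε →
      ∃ U : ℝ → (EuclideanSpace ℝ (Fin n) →ₘ[volume] 𝕜), IsSmallSolution α b P θ R κ φ U := by
  have hb := h.b_pos
  have hα := h.α_pos
  have hP := h.P_pos
  obtain ⟨A, hK⟩ := hχ.exists_heatBounds h.n_pos hα
  obtain ⟨K, hKb⟩ := h.exists_duhamelBounds (𝕜 := 𝕜) hK
  have hθ1 : θ < 1 := by
    have h1 := h.weight_lt_one
    have h2 := mul_pos h.θ_pos hb
    linarith
  obtain ⟨C, hC, HC⟩ := hχ.exists_eLpNorm_fracSemigroup_le_besovNorm (𝕜 := 𝕜) h.n_pos hα hp hpP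
    h.one_lt_crit.le h.θ_pos hθ1 (σ := σ) (by
      rw [h.θ_eq', hσ]
      field_simp
      ring)
  obtain ⟨R, hR, hR'⟩ : ∃ R : ℝ, 0 < R ∧ K * (2 * R) ^ b ≤ 1 / 2 := by
    have hc : Continuous fun R : ℝ => K * (2 * R) ^ b :=
      continuous_const.mul ((continuous_const.mul continuous_id).rpow_const fun _ => Or.inr hb.le)
    have h1 := (hc.tendsto 0).mono_left (nhdsWithin_le_nhds (s := Set.Ioi 0))
    simp only [mul_zero, Real.zero_rpow hb.ne'] at h1
    have h2 := h1.eventually (gt_mem_nhds (by norm_num : (0 : ℝ) < 1 / 2))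
    obtain ⟨R, hR1, hR2⟩ := (h2.and self_mem_nhdsWithin).exists
    exact ⟨R, hR2, hR1.le⟩
  -- This makes C ε ≤ R/2, the share of the ball left to the free evolution; C + 1 guards against C
  -- = 0.
  refine ⟨R / (2 * (C + 1)), R, by positivity, hR, fun κ hκ φ hφ hbes => ?_⟩
  refine h.exists_isSmallSolution hχ hK hKb hR hR' hκ hφ fun t ht => ?_
  refine (HC t ht φ hφ).trans ((mul_le_mul_right hbes _).trans ?_)
  rw [← ENNReal.ofReal_mul (by positivity)]
  refine ENNReal.ofReal_le_ofReal ?_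
  have h1 : C * (R / (2 * (C + 1))) ≤ R / 2 := by
    rw [mul_div_assoc', div_le_div_iff₀ (by positivity) two_pos]
    nlinarith
  calc _ = C * (R / (2 * (C + 1))) * t ^ (-θ) := by ring
    _ ≤ _ := by gcongr

end Existence

/-! ### Continuation of local uniqueness in time. -/

section UniquenessFramework

variable {n : ℕ} {α b r m κ A : ℝ} {𝕜 : Type*} [RCLike 𝕜]
  {φ : EuclideanSpace ℝ (Fin n) → 𝕜}
  {U V : ℝ → (EuclideanSpace ℝ (Fin n) →ₘ[volume] 𝕜)}

theorem ContinuousInLp.mono {I J : Set ℝ} (h : ContinuousInLp I r U) (hJ : J ⊆ I) :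
    ContinuousInLp J r U :=
  ⟨fun t ht => h.1 t (hJ ht), fun t ht => (h.2 t (hJ ht)).mono_left (nhdsWithin_mono t hJ)⟩

theorem ContinuousInLp.isLpPath_shift (h : ContinuousInLp (Set.Ioi 0) r U) {T : ℝ} (hT : 0 ≤ T) :
    IsLpPath r fun t => ⇑(U (T + t)) := by
  refine ⟨fun t ht => h.1 _ (by simp only [Set.mem_Ioi]; linarith), fun s hs => ?_⟩
  have h0 : T + s ∈ Set.Ioi (0 : ℝ) := by simp only [Set.mem_Ioi]; linarith
  have h1 := h.2 (T + s) h0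
  rw [isOpen_Ioi.nhdsWithin_eq h0] at h1
  simp only [eLpNorm_coe_sub] at h1
  exact h1.comp ((continuous_const.add continuous_id).tendsto s)

theorem ContinuousInLp.eq_of_eq_Ico (hU : ContinuousInLp (Set.Ici 0) r U)
    (hV : ContinuousInLp (Set.Ici 0) r V) (hr : 1 ≤ r) {t : ℝ} (ht : 0 < t)
    (h : ∀ τ ∈ Set.Ico 0 t, U τ = V τ) : U t = V t := by
  have hr1 : (1 : ℝ≥0∞) ≤ ENNReal.ofReal r := by simpa using ENNReal.ofReal_le_ofReal hr
  have hne : (𝓝[Set.Ico 0 t] t).NeBot := by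
    rw [← mem_closure_iff_nhdsWithin_neBot, closure_Ico ht.ne]
    exact ⟨ht.le, le_rfl⟩
  have hle : 𝓝[Set.Ico 0 t] t ≤ 𝓝[Set.Ici 0] t := nhdsWithin_mono t Set.Ico_subset_Ici_self
  have h1 := ((hU.2 t ht.le).mono_left hle).add ((hV.2 t ht.le).mono_left hle)
  rw [add_zero] at h1
  have h2 : eLpNorm (⇑(U t) - ⇑(V t)) (ENNReal.ofReal r) volume ≤ 0 := by
    refine ge_of_tendsto h1 ?_
    filter_upwards [self_mem_nhdsWithin] with τ hτ
    rw [h τ hτ, eLpNorm_coe_sub, eLpNorm_coe_sub, eLpNorm_sub_comm (V τ)]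
    have hVτ := hV.1 τ hτ.1
    have e : ⇑(U t) - ⇑(V t) = (⇑(U t) - ⇑(V τ)) + (⇑(V τ) - ⇑(V t)) := by abel
    rw [e]
    exact eLpNorm_add_le ((hU.1 t ht.le).sub hVτ).1 (hVτ.sub (hV.1 t ht.le)).1 hr1
  have h3 := (eLpNorm_eq_zero_iff ((hU.1 t ht.le).sub (hV.1 t ht.le)).1
    (one_pos.trans_le hr1).ne').1 (le_antisymm h2 zero_le)
  refine AEEqFun.ext ?_
  filter_upwards [h3] with x hx
  exact sub_eq_zero.1 hx

/-- Two continuous paths which start together and cannot separate are equal. -/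
theorem ContinuousInLp.eq_of_local (hU : ContinuousInLp (Set.Ici 0) r U)
    (hV : ContinuousInLp (Set.Ici 0) r V) (hr : 1 ≤ r) (h0 : U 0 = V 0)
    (hloc : ∀ T, 0 ≤ T → (∀ t ∈ Set.Icc 0 T, U t = V t) →
      ∃ δ > 0, ∀ t ∈ Set.Ioo 0 δ, U (T + t) = V (T + t)) {t : ℝ} (ht : 0 ≤ t) : U t = V t := by
  -- Agreement on the half-open interval [0, x) makes this set closed without any continuity;
  -- continuity in L^r is used only to add the endpoint x. Continuous induction on [0, t] then
  -- concludes.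
  set s : Set ℝ := {x | ∀ τ ∈ Set.Ico 0 x, U τ = V τ} with hs
  have hcl : IsClosed s := by
    refine isClosed_of_closure_subset fun x hx τ hτ => ?_
    obtain ⟨y, hy, hy'⟩ := mem_closure_iff.1 hx (Set.Ioi τ) isOpen_Ioi hτ.2
    exact hy' τ ⟨hτ.1, hy⟩
  have hIcc : ∀ x, 0 ≤ x → x ∈ s → ∀ τ ∈ Set.Icc 0 x, U τ = V τ := by
    intro x hx hxs τ hτ
    rcases hτ.2.eq_or_lt with rfl | h
    · rcases hx.eq_or_lt with rfl | hx
      · exact h0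
      · exact hU.eq_of_eq_Ico hV hr hx hxs
    · exact hxs τ ⟨hτ.1, h⟩
  have hsub : Set.Icc 0 t ⊆ s := by
    refine IsClosed.Icc_subset_of_forall_exists_gt (hcl.inter isClosed_Icc) ?_ ?_
    · intro τ hτ
      exact absurd hτ.2 (not_lt.2 hτ.1)
    · rintro x ⟨hxs, hx0, -⟩ y hy
      have hx := hIcc x hx0 hxs
      obtain ⟨δ, hδ, H⟩ := hloc x hx0 hx
      have hy : x < y := hy
      refine ⟨min y (x + δ), fun τ hτ => ?_, lt_min hy (by linarith), min_le_left _ _⟩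
      rcases le_or_gt τ x with h | h
      · exact hx τ ⟨hτ.1, h⟩
      · have h2 := hτ.2.trans_le (min_le_right _ _)
        have := H (τ - x) ⟨by linarith, by linarith⟩
        simpa using this
  exact hIcc t ht (hsub ⟨ht, le_rfl⟩) t ⟨ht, le_rfl⟩

/-- The difference of two mild solutions which agree on `[0, T]`. -/
theorem IsMildSolution.sub_eq_duhamel (hK : HeatBounds n α A) (hm : 1 ≤ m)
    (hU : IsMildSolution α b κ φ U) (hV : IsMildSolution α b κ φ V)
    (hf : IsLpPath m fun t y => powerNonlinearity κ b (U t y))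
    (hg : IsLpPath m fun t y => powerNonlinearity κ b (V t y)) {T : ℝ} (hT : 0 ≤ T)
    (heq : ∀ τ ∈ Set.Icc 0 T, U τ = V τ) {s : ℝ} (hs : 0 < s) :
    ⇑(U (T + s)) - ⇑(V (T + s)) =ᵐ[volume] duhamel α (fun τ y =>
      powerNonlinearity κ b (U (T + τ) y) - powerNonlinearity κ b (V (T + τ) y)) s := by
  have ht : 0 < T + s := by linarith
  filter_upwards [hU.2 _ ht, hV.2 _ ht] with x h1 h2
  set h : ℝ → EuclideanSpace ℝ (Fin n) → 𝕜 := fun τ y =>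
    powerNonlinearity κ b (U τ y) - powerNonlinearity κ b (V τ y) with hh
  have hd := hK.duhamel_sub hm hf hg ht h1.1 h2.1
  have h3 : (⇑(U (T + s)) - ⇑(V (T + s))) x = duhamel α h (T + s) x := by
    rw [Pi.sub_apply, h1.2, h2.2, add_sub_add_left_eq_sub]
    exact hd
  rw [h3]
  simp only [duhamel]
  have hi : IntervalIntegrable (fun τ => fracSemigroup α (T + s - τ) (h τ) x) volume 0 (T + s) := by
    have h4 := h1.1.sub h2.1
    rw [intervalIntegrable_iff_integrableOn_Ioo_of_le ht.le] at h4 ⊢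
    refine h4.congr_fun (fun τ hτ => ?_) measurableSet_Ioo
    have := hK.fracSemigroup_sub (sub_pos.2 hτ.2) hm (hf.memLp τ hτ.1) (hg.memLp τ hτ.1)
    exact (congrFun this x).symm
  have hzero : ∀ τ ∈ Set.Icc 0 T, fracSemigroup α (T + s - τ) (h τ) x = 0 := by
    intro τ hτ
    have : h τ = 0 := by
      ext y
      simp [hh, heq τ hτ]
    rw [this, fracSemigroup_eq, convolution_zero]
    rfl
  have hmem : T ∈ Set.uIcc 0 (T + s) := by
    rw [Set.uIcc_of_le ht.le]
    exact ⟨hT, by linarith⟩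
  -- The sources agree on [0, T], so that part of the integral vanishes, and translating the rest by
  -- T gives a Duhamel integral started at zero.
  rw [← intervalIntegral.integral_add_adjacent_intervals
    (hi.mono_set (Set.uIcc_subset_uIcc_left hmem)) (hi.mono_set (Set.uIcc_subset_uIcc_right hmem)),
    intervalIntegral.integral_zero_ae (Eventually.of_forall fun τ hτ => ?_), zero_add]
  · have e := intervalIntegral.integral_comp_add_left
      (fun τ => fracSemigroup α (T + s - τ) (h τ) x) T (a := 0) (b := s)
    rw [add_zero] at e
    rw [← e]
    simp only [add_sub_add_left_eq_sub, hh]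
  · rw [Set.uIoc_of_le hT] at hτ
    exact hzero τ ⟨hτ.1.le, hτ.2⟩

end UniquenessFramework

/-! ### Local uniqueness under smallness of the weighted norm. -/

section SubcriticalUniqueness

variable {n : ℕ} {α b P θ κ A K : ℝ} {𝕜 : Type*} [RCLike 𝕜]

/-- Two paths with small weighted norms whose difference is the difference of the Duhamel terms
are equal. -/
theorem DuhamelBounds.sub_ae_eq_zero (hKb : DuhamelBounds 𝕜 n α b P θ K) (hκ : κ = 1 ∨ κ = -1)
    (hP : 1 ≤ P) {u v : ℝ → EuclideanSpace ℝ (Fin n) → 𝕜} (hu : IsLpPath P u) (hv : IsLpPath P v)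
    {M δ : ℝ} (hM : 0 ≤ M) (hM' : K * (2 * M) ^ b ≤ 1 / 2)
    (hub : ∀ t ∈ Set.Ioo 0 δ, eLpNorm (u t) (ENNReal.ofReal P) volume ≤
      ENNReal.ofReal (M * t ^ (-θ)))
    (hvb : ∀ t ∈ Set.Ioo 0 δ, eLpNorm (v t) (ENNReal.ofReal P) volume ≤
      ENNReal.ofReal (M * t ^ (-θ)))
    (hsub : ∀ t ∈ Set.Ioo 0 δ, u t - v t =ᵐ[volume]
      duhamel α (fun τ y => powerNonlinearity κ b (u τ y)) t -
        duhamel α (fun τ y => powerNonlinearity κ b (v τ y)) t) :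
    ∀ t ∈ Set.Ioo 0 δ, u t - v t =ᵐ[volume] 0 := by
  have hP1 : (1 : ℝ≥0∞) ≤ ENNReal.ofReal P := by simpa using ENNReal.ofReal_le_ofReal hP
  -- Starting from the trivial bound 2M for the weighted difference, each use of the Duhamel
  -- difference estimate halves it.
  have key : ∀ k : ℕ, ∀ t ∈ Set.Ioo 0 δ, eLpNorm (u t - v t) (ENNReal.ofReal P) volume ≤
      ENNReal.ofReal (2 * M * (1 / 2) ^ k * t ^ (-θ)) := by
    intro k
    induction k with
    | zero =>
      intro t ht
      have ht0 := ht.1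
      refine (eLpNorm_sub_le (hu.memLp t ht0).1 (hv.memLp t ht0).1 hP1).trans
        ((add_le_add (hub t ht) (hvb t ht)).trans (le_of_eq ?_))
      rw [← ENNReal.ofReal_add (by positivity) (by positivity)]
      congr 1
      ring
    | succ k ih =>
      intro t ht
      have ht0 := ht.1
      rw [eLpNorm_congr_ae (hsub t ht)]
      refine (hKb.diff κ hκ u v hu hv t ht0 M (2 * M * (1 / 2) ^ k) hM (by positivity)
        fun τ hτ => ?_).trans (ENNReal.ofReal_le_ofReal ?_)
      · have hτ' : τ ∈ Set.Ioo 0 δ := ⟨hτ.1, hτ.2.trans ht.2⟩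
        exact ⟨hub τ hτ', hvb τ hτ', ih τ hτ'⟩
      · refine mul_le_mul_of_nonneg_right ?_ (by positivity)
        calc _ ≤ 1 / 2 * (2 * M * (1 / 2) ^ k) := by gcongr
          _ = _ := by rw [pow_succ]; ring
  intro t ht
  have hlim : Tendsto (fun k : ℕ => ENNReal.ofReal (2 * M * (1 / 2) ^ k * t ^ (-θ)))
      atTop (𝓝 0) := by
    have h1 : Tendsto (fun k : ℕ => (1 / 2 : ℝ) ^ k) atTop (𝓝 0) :=
      tendsto_pow_atTop_nhds_zero_of_lt_one (by norm_num) (by norm_num)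
    have h2 := ENNReal.tendsto_ofReal ((h1.const_mul (2 * M)).mul_const (t ^ (-θ)))
    simpa using h2
  have h0 := ge_of_tendsto' hlim fun k => key k t ht
  exact (eLpNorm_eq_zero_iff ((hu.memLp t ht.1).sub (hv.memLp t ht.1)).1
    (one_pos.trans_le hP1).ne').1 (le_antisymm h0 zero_le)

end SubcriticalUniqueness

/-! ### Uniqueness in the weighted class for p > r₀. -/

section SubcriticalClass

variable {n : ℕ} {α b r p s l P θ κ A M : ℝ} {𝕜 : Type*} [RCLike 𝕜]
  {φ : EuclideanSpace ℝ (Fin n) → 𝕜}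
  {U V : ℝ → (EuclideanSpace ℝ (Fin n) →ₘ[volume] 𝕜)}

theorem memLp_of_interpolation {X : Type*} [MeasurableSpace X] {μ : Measure X} (hr : 0 < r)
    (hp : 0 < p) (hl : 0 < l) (hl' : l < 1) (hs : 1 / s = (1 - l) / r + l / p) {u : X → 𝕜}
    (hur : MemLp u (ENNReal.ofReal r) μ) (hup : MemLp u (ENNReal.ofReal p) μ) :
    MemLp u (ENNReal.ofReal s) μ :=
  ⟨hur.1, (eLpNorm_le_rpow_mul_rpow hr hp hl hl' hs hur.1).trans_lt (ENNReal.mul_lt_top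
    (ENNReal.rpow_lt_top_of_nonneg (by linarith) hur.2.ne)
    (ENNReal.rpow_lt_top_of_nonneg hl.le hup.2.ne))⟩

theorem ContinuousInLp.interpolation {I : Set ℝ} (hr : 0 < r) (hp : 0 < p) (hl : 0 < l)
    (hl' : l < 1) (hs : 1 / s = (1 - l) / r + l / p) (h : ContinuousInLp I r U)
    (h' : ContinuousInLp I p U) : ContinuousInLp I s U := by
  refine ⟨fun t ht => memLp_of_interpolation hr hp hl hl' hs (h.1 t ht) (h'.1 t ht),
    fun t₀ ht₀ => ?_⟩
  have h1 := (h.2 t₀ ht₀).ennrpow_const (1 - l)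
  have h2 := (h'.2 t₀ ht₀).ennrpow_const l
  rw [ENNReal.zero_rpow_of_pos (by linarith)] at h1
  rw [ENNReal.zero_rpow_of_pos hl] at h2
  have h3 := ENNReal.Tendsto.mul h1 (Or.inr ENNReal.zero_ne_top) h2 (Or.inr ENNReal.zero_ne_top)
  rw [zero_mul] at h3
  exact tendsto_of_tendsto_of_tendsto_of_le_of_le tendsto_const_nhds h3 (fun _ => zero_le)
    fun t => eLpNorm_le_rpow_mul_rpow hr hp hl hl' hs (U t - U t₀).aestronglyMeasurable

/-- Away from the initial time, the weight makes the norms small. -/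
theorem ContinuousInLp.tendsto_weighted_shift (h : ContinuousInLp (Set.Ioi 0) r U) (hr : 1 ≤ r)
    (hθ : 0 < θ) {T : ℝ} (hT : 0 < T) :
    Tendsto (fun t => ENNReal.ofReal (t ^ θ) * eLpNorm (U (T + t)) (ENNReal.ofReal r) volume)
      (𝓝[>] 0) (𝓝 0) := by
  have ha : Tendsto (fun t : ℝ => T + t) (𝓝[>] 0) (𝓝[Set.Ioi 0] T) := by
    rw [isOpen_Ioi.nhdsWithin_eq (Set.mem_Ioi.2 hT)]
    have : Tendsto (fun t : ℝ => T + t) (𝓝 0) (𝓝 T) := by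
      simpa using (tendsto_const_nhds (x := T)).add (tendsto_id (α := ℝ) (x := 𝓝 0))
    exact this.mono_left nhdsWithin_le_nhds
  have h1 := (h.2 T hT).comp ha
  simp only [eLpNorm_coe_sub] at h1
  have h2 := eventually_eLpNorm_le_add_one hr
    (by filter_upwards [self_mem_nhdsWithin] with t ht
        exact h.1 (T + t) (add_pos hT ht)) (h.1 T hT) h1
  have h3 : Tendsto (fun t : ℝ => ENNReal.ofReal (t ^ θ)) (𝓝[>] 0) (𝓝 0) := by
    have hc : Continuous fun t : ℝ => ENNReal.ofReal (t ^ θ) :=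
      ENNReal.continuous_ofReal.comp (continuous_id.rpow_const fun _ => Or.inr hθ.le)
    have := (hc.tendsto 0).mono_left (nhdsWithin_le_nhds (s := Set.Ioi 0))
    simpa [Real.zero_rpow hθ.ne'] using this
  have hfin : eLpNorm (U T) (ENNReal.ofReal r) volume + 1 ≠ ∞ := by
    have := (h.1 T hT).2.ne
    finiteness
  have h4 := ENNReal.Tendsto.mul_const (b := eLpNorm (U T) (ENNReal.ofReal r) volume + 1) h3
    (Or.inr hfin)
  rw [zero_mul] at h4
  refine tendsto_of_tendsto_of_tendsto_of_le_of_le' tendsto_const_nhds h4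
    (Eventually.of_forall fun _ => zero_le) ?_
  filter_upwards [h2] with t ht
  exact mul_le_mul_right ht _

/-- Continuity in the critical space and boundedness of a weighted norm make the weighted norms of
intermediate exponents small at the initial time. -/
theorem tendsto_weighted_of_interpolation {χ : EuclideanSpace ℝ (Fin n) → ℝ}
    (hχ : IsLittlewoodPaleyBump χ) (hn : 0 < n) (hα : 0 < α) (hr : 1 ≤ r) (hrs : r < s)
    (hrp : r < p) (hl : 0 < l) (hl' : l < 1) (hs : 1 / s = (1 - l) / r + l / p)
    (hφ : MemLp φ (ENNReal.ofReal r) volume) (hU : ContinuousInLp (Set.Ici 0) r U)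
    (hU0 : U 0 =ᵐ[volume] φ)
    (hb : ∀ t, 0 < t → eLpNorm (U t) (ENNReal.ofReal p) volume ≤
      ENNReal.ofReal (M * t ^ (-(n / (2 * α) * (1 / r - 1 / p))))) :
    Tendsto (fun t => ENNReal.ofReal (t ^ (n / (2 * α) * (1 / r - 1 / s))) *
      eLpNorm (U t) (ENNReal.ofReal s) volume) (𝓝[>] 0) (𝓝 0) := by
  obtain ⟨A, hK⟩ := hχ.exists_heatBounds hn hα
  have hr0 : 0 < r := by linarith
  have hp0 : 0 < p := by linarith
  have hr1 : (1 : ℝ≥0∞) ≤ ENNReal.ofReal r := by simpa using ENNReal.ofReal_le_ofReal hr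
  have hp1 : (1 : ℝ≥0∞) ≤ ENNReal.ofReal p := by
    simpa using ENNReal.ofReal_le_ofReal (hr.trans hrp.le)
  have hs1 : (1 : ℝ≥0∞) ≤ ENNReal.ofReal s := by
    simpa using ENNReal.ofReal_le_ofReal (hr.trans hrs.le)
  have hA := hK.pos
  set θ := n / (2 * α) * (1 / r - 1 / p) with hθ
  -- The weight exponent is affine in 1/s and vanishes at s = r, so interpolation multiplies it by
  -- l.
  have hθs : n / (2 * α) * (1 / r - 1 / s) = θ * l := by
    rw [hs, hθ]
    field_simp
    ring
  have h1 := hK.tendsto_weighted_fracSemigroup hn hα hr hrs hφ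
  rw [hθs] at h1 ⊢
  have hS := hχ.tendsto_fracSemigroup hn hα hr hφ
  have hU1 := (hU.2 0 Set.self_mem_Ici).mono_left (nhdsWithin_mono 0 Set.Ioi_subset_Ici_self)
  -- U(t) and S(t)φ both tend to φ in L^r, so their difference is o(1) in L^r while it is O(t^{-θ})
  -- in L^p; interpolating, it is o(t^{-θl}) in L^s. The free part is treated by density.
  have hd := hU1.add hS
  rw [add_zero] at hd
  have hd1 := hd.ennrpow_const (1 - l)
  rw [ENNReal.zero_rpow_of_pos (by linarith)] at hd1
  set B : ℝ≥0∞ := ENNReal.ofReal M + ENNReal.ofReal A * eLpNorm φ (ENNReal.ofReal r) volume with hB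
  have hBt : B ^ l ≠ ∞ := by
    have := hφ.2.ne
    exact ENNReal.rpow_ne_top_of_nonneg hl.le (by finiteness)
  have h2 := h1.add (ENNReal.Tendsto.mul_const hd1 (Or.inr hBt))
  rw [zero_mul, add_zero] at h2
  refine tendsto_of_tendsto_of_tendsto_of_le_of_le' tendsto_const_nhds h2
    (Eventually.of_forall fun _ => zero_le) ?_
  filter_upwards [self_mem_nhdsWithin] with t ht
  have ht : 0 < t := ht
  have hSr := hK.memLp_fracSemigroup ht hr le_rfl hφ
  have hSs := hK.memLp_fracSemigroup ht hr hrs.le hφ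
  have hSp := hK.memLp_fracSemigroup ht hr hrp.le hφ
  have hUm := (U t).aestronglyMeasurable
  have e : ⇑(U t) = fracSemigroup α t φ + (⇑(U t) - fracSemigroup α t φ) := by abel
  have hdr : eLpNorm (⇑(U t) - fracSemigroup α t φ) (ENNReal.ofReal r) volume ≤
      eLpNorm (⇑(U t - U 0)) (ENNReal.ofReal r) volume +
        eLpNorm (fracSemigroup α t φ - φ) (ENNReal.ofReal r) volume := by
    rw [eLpNorm_coe_sub, eLpNorm_sub_comm (fracSemigroup α t φ)]
    have e2 : ⇑(U t) - fracSemigroup α t φ =ᵐ[volume]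
        (⇑(U t) - ⇑(U 0)) + (φ - fracSemigroup α t φ) := by
      filter_upwards [hU0] with x hx
      simp only [Pi.sub_apply, Pi.add_apply, hx]
      abel
    rw [eLpNorm_congr_ae e2]
    exact eLpNorm_add_le (hUm.sub (U 0).aestronglyMeasurable) (hφ.sub hSr).1 hr1
  have hdp : eLpNorm (⇑(U t) - fracSemigroup α t φ) (ENNReal.ofReal p) volume ≤
      ENNReal.ofReal (t ^ (-θ)) * B := by
    refine (eLpNorm_sub_le hUm hSp.1 hp1).trans ((add_le_add (hb t ht)
      (hK.eLpNorm_fracSemigroup_le ht hr hrp.le hφ.1)).trans (le_of_eq ?_))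
    rw [hB, mul_add, ← ENNReal.ofReal_mul (by positivity), mul_comm M, ← mul_assoc,
      ← ENNReal.ofReal_mul (by positivity), mul_comm A]
  calc ENNReal.ofReal (t ^ (θ * l)) * eLpNorm (U t) (ENNReal.ofReal s) volume
      ≤ ENNReal.ofReal (t ^ (θ * l)) * (eLpNorm (fracSemigroup α t φ) (ENNReal.ofReal s) volume +
        eLpNorm (⇑(U t) - fracSemigroup α t φ) (ENNReal.ofReal s) volume) := by
        refine mul_le_mul_right ?_ _
        conv_lhs => rw [e]
        exact eLpNorm_add_le hSs.1 (hUm.sub hSs.1) hs1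
    _ ≤ ENNReal.ofReal (t ^ (θ * l)) * eLpNorm (fracSemigroup α t φ) (ENNReal.ofReal s) volume +
        ENNReal.ofReal (t ^ (θ * l)) * ((eLpNorm (⇑(U t - U 0)) (ENNReal.ofReal r) volume +
        eLpNorm (fracSemigroup α t φ - φ) (ENNReal.ofReal r) volume) ^ (1 - l) *
          (ENNReal.ofReal (t ^ (-θ)) * B) ^ l) := by
        rw [mul_add]
        refine add_le_add le_rfl (mul_le_mul_right ?_ _)
        exact (eLpNorm_le_rpow_mul_rpow hr0 hp0 hl hl' hs (hUm.sub hSs.1)).trans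
          (mul_le_mul' (ENNReal.rpow_le_rpow hdr (by linarith)) (ENNReal.rpow_le_rpow hdp hl.le))
    _ = _ := by
        rw [ENNReal.mul_rpow_of_nonneg _ _ hl.le, ENNReal.ofReal_rpow_of_nonneg (by positivity) hl.le,
          ← Real.rpow_mul ht.le]
        have e3 : ENNReal.ofReal (t ^ (θ * l)) * ENNReal.ofReal (t ^ (-θ * l)) = 1 := by
          rw [← ENNReal.ofReal_mul (by positivity), ← Real.rpow_add ht]
          simp
        congr 1
        calc _ = (ENNReal.ofReal (t ^ (θ * l)) * ENNReal.ofReal (t ^ (-θ * l))) *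
            ((eLpNorm (⇑(U t - U 0)) (ENNReal.ofReal r) volume +
              eLpNorm (fracSemigroup α t φ - φ) (ENNReal.ofReal r) volume) ^ (1 - l) * B ^ l) := by
              ring
          _ = _ := by rw [e3, one_mul]

/-- Uniqueness in the weighted class. -/
theorem SubcriticalExponent.eq_of_isMildSolution (h : SubcriticalExponent n α b P θ)
    {χ : EuclideanSpace ℝ (Fin n) → ℝ} (hχ : IsLittlewoodPaleyBump χ) (hκ : κ = 1 ∨ κ = -1)
    (hφ : MemLp φ (ENNReal.ofReal (critExponent n α b)) volume)
    (hU : IsMildSolution α b κ φ U) (hV : IsMildSolution α b κ φ V)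
    (hUc : ContinuousInLp (Set.Ici 0) (critExponent n α b) U)
    (hVc : ContinuousInLp (Set.Ici 0) (critExponent n α b) V)
    (hUp : ContinuousInLp (Set.Ioi 0) P U) (hVp : ContinuousInLp (Set.Ioi 0) P V)
    (hUb : ∀ t, 0 < t → eLpNorm (U t) (ENNReal.ofReal P) volume ≤ ENNReal.ofReal (M * t ^ (-θ)))
    (hVb : ∀ t, 0 < t → eLpNorm (V t) (ENNReal.ofReal P) volume ≤ ENNReal.ofReal (M * t ^ (-θ)))
    {t : ℝ} (ht : 0 ≤ t) : U t = V t := by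
  have hr1 := h.one_lt_crit.le
  have hr0 := h.crit_pos
  have hP0 := h.P_pos
  have hb := h.b_pos
  set r := critExponent n α b with hr
  -- Strict inequality s < P leaves a positive power of the L^{r₀} norm in the interpolation. That
  -- power supplies the smallness missing from the boundedness assumption in L^P, while s still
  -- obeys the Duhamel estimates.
  obtain ⟨s, hs1, hs2⟩ := exists_between (max_lt h.crit_lt h.add_one_lt)
  have hrs : r < s := (le_max_left _ _).trans_lt hs1
  have hbs : b + 1 < s := (le_max_right _ _).trans_lt hs1
  have hs0 : 0 < s := by linarith
  have h' : SubcriticalExponent n α b s (n / (2 * α) * (1 / r - 1 / s)) :=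
    ⟨h.n_pos, h.α_pos, hb, h.one_lt_crit, hbs, hrs, hs2.trans h.lt_crit_mul, rfl⟩
  obtain ⟨l, hl, hl', hsl⟩ : ∃ l : ℝ, 0 < l ∧ l < 1 ∧ 1 / s = (1 - l) / r + l / P := by
    have h1 : 1 / P < 1 / s := one_div_lt_one_div_of_lt hs0 hs2
    have h2 : 1 / s < 1 / r := one_div_lt_one_div_of_lt hr0 hrs
    have h3 : 0 < 1 / r - 1 / P := by linarith
    refine ⟨(1 / r - 1 / s) / (1 / r - 1 / P), div_pos (by linarith) h3,
      (div_lt_one h3).2 (by linarith), ?_⟩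
    have h4 : (1 / r - 1 / s) / (1 / r - 1 / P) * (1 / r - 1 / P) = 1 / r - 1 / s :=
      div_mul_cancel₀ _ h3.ne'
    generalize (1 / r - 1 / s) / (1 / r - 1 / P) = c at h4
    rw [div_eq_mul_one_div (1 - c) r, div_eq_mul_one_div c P]
    linarith
  obtain ⟨A, hK⟩ := hχ.exists_heatBounds h.n_pos h.α_pos
  obtain ⟨K, hKb⟩ := h'.exists_duhamelBounds (𝕜 := 𝕜) hK
  obtain ⟨R, hR, hR'⟩ : ∃ R : ℝ, 0 < R ∧ K * (2 * R) ^ b ≤ 1 / 2 := by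
    have hc : Continuous fun R : ℝ => K * (2 * R) ^ b :=
      continuous_const.mul ((continuous_const.mul continuous_id).rpow_const fun _ => Or.inr hb.le)
    have h1 := (hc.tendsto 0).mono_left (nhdsWithin_le_nhds (s := Set.Ioi 0))
    simp only [mul_zero, Real.zero_rpow hb.ne'] at h1
    have h2 := h1.eventually (gt_mem_nhds (by norm_num : (0 : ℝ) < 1 / 2))
    obtain ⟨R, hR1, hR2⟩ := (h2.and self_mem_nhdsWithin).exists
    exact ⟨R, hR2, hR1.le⟩
  have hUs := (hUc.mono Set.Ioi_subset_Ici_self).interpolation hr0 hP0 hl hl' hsl hUp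
  have hVs := (hVc.mono Set.Ioi_subset_Ici_self).interpolation hr0 hP0 hl hl' hsl hVp
  have hsmall : ∀ W : ℝ → (EuclideanSpace ℝ (Fin n) →ₘ[volume] 𝕜), W 0 =ᵐ[volume] φ →
      ContinuousInLp (Set.Ici 0) r W → ContinuousInLp (Set.Ioi 0) s W →
      (∀ t, 0 < t → eLpNorm (W t) (ENNReal.ofReal P) volume ≤ ENNReal.ofReal (M * t ^ (-θ))) →
      ∀ T, 0 ≤ T → ∃ δ > 0, ∀ t ∈ Set.Ioo 0 δ, eLpNorm (W (T + t)) (ENNReal.ofReal s) volume ≤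
        ENNReal.ofReal (R * t ^ (-(n / (2 * α) * (1 / r - 1 / s)))) := by
    intro W hW0 hWc hWs hWb T hT
    have hlim : Tendsto (fun t => ENNReal.ofReal (t ^ (n / (2 * α) * (1 / r - 1 / s))) *
        eLpNorm (W (T + t)) (ENNReal.ofReal s) volume) (𝓝[>] 0) (𝓝 0) := by
      rcases hT.eq_or_lt with rfl | hT
      · simp only [zero_add]
        rw [h.θ_eq] at hWb
        exact tendsto_weighted_of_interpolation hχ h.n_pos h.α_pos hr1 hrs h.crit_lt hl hl' hsl hφ
          hWc hW0 hWb
      · exact hWs.tendsto_weighted_shift h'.one_lt_P.le h'.θ_pos hT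
    have h2 := (ENNReal.tendsto_nhds_zero.1 hlim) (ENNReal.ofReal R) (by simpa using hR)
    obtain ⟨δ, hδ, h3⟩ := mem_nhdsGT_iff_exists_Ioo_subset.1 h2
    exact ⟨δ, hδ, fun t ht => (ofReal_rpow_mul_le_iff ht.1).1 (h3 ht)⟩
  have h00 : U 0 = V 0 := AEEqFun.ext (hU.1.trans hV.1.symm)
  refine hUc.eq_of_local hVc hr1 h00 (fun T hT heq => ?_) ht
  obtain ⟨δ₁, hδ₁, H₁⟩ := hsmall U hU.1 hUc hUs hUb T hT
  obtain ⟨δ₂, hδ₂, H₂⟩ := hsmall V hV.1 hVc hVs hVb T hT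
  have hUT := hUs.isLpPath_shift hT
  have hVT := hVs.isLpPath_shift hT
  have hU0 := hUs.isLpPath_shift le_rfl
  have hV0 := hVs.isLpPath_shift le_rfl
  simp only [zero_add] at hU0 hV0
  have hs1' := h'.one_lt_P.le
  have hsrc := fun {w : ℝ → EuclideanSpace ℝ (Fin n) → 𝕜} (hw : IsLpPath s w) =>
    isLpPath_powerNonlinearity hκ hb hs1' hw
  refine ⟨min δ₁ δ₂, lt_min hδ₁ hδ₂, fun t ht => ?_⟩
  have hlt : ∀ τ ∈ Set.Ioo 0 (min δ₁ δ₂), τ ∈ Set.Ioo 0 δ₁ ∧ τ ∈ Set.Ioo 0 δ₂ := fun τ hτ =>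
    ⟨⟨hτ.1, hτ.2.trans_le (min_le_left _ _)⟩, ⟨hτ.1, hτ.2.trans_le (min_le_right _ _)⟩⟩
  have hz := hKb.sub_ae_eq_zero hκ hs1' hUT hVT hR.le hR' (fun τ hτ => H₁ τ (hlt τ hτ).1)
    (fun τ hτ => H₂ τ (hlt τ hτ).2) (fun τ hτ => ?_) t ht
  · refine AEEqFun.ext ?_
    filter_upwards [hz] with x hx
    exact sub_eq_zero.1 hx
  · have hi₁ := (hKb.bound κ hκ _ hUT τ hτ.1 R hR.le fun τ' hτ' =>
      H₁ τ' (hlt τ' ⟨hτ'.1, hτ'.2.trans hτ.2⟩).1).1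
    have hi₂ := (hKb.bound κ hκ _ hVT τ hτ.1 R hR.le fun τ' hτ' =>
      H₂ τ' (hlt τ' ⟨hτ'.1, hτ'.2.trans hτ.2⟩).2).1
    have h1 := hU.sub_eq_duhamel hK h'.one_lt_source.le hV (hsrc hU0) (hsrc hV0) hT heq hτ.1
    filter_upwards [h1, hi₁, hi₂] with x hx hx₁ hx₂
    rw [hx, Pi.sub_apply]
    exact (hK.duhamel_sub h'.one_lt_source.le (hsrc hUT) (hsrc hVT) hτ.1 hx₁ hx₂).symm

end SubcriticalClass

/-! ### Weak Lebesgue spaces described by integrals over sets of given measure. -/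

section WeakBounds

/-- The bound a is used up to l and the decay bound beyond. Having two competing bounds is what lets
the endpoint integrals converge, in levels and in time alike. -/
theorem lintegral_Ioi_le_of_le_of_le {F : ℝ → ℝ≥0∞} {a c κ l : ℝ} (hκ : 1 < κ) (hl : 0 < l)
    (ha : 0 ≤ a) (hc : 0 ≤ c) (h1 : ∀ s, 0 < s → F s ≤ ENNReal.ofReal a)
    (h2 : ∀ s, 0 < s → F s ≤ ENNReal.ofReal (c * s ^ (-κ))) :
    ∫⁻ s in Set.Ioi 0, F s ≤ ENNReal.ofReal (a * l + c * (l ^ (1 - κ) / (κ - 1))) := by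
  have hκ' : 0 < κ - 1 := by linarith
  have hi : IntegrableOn (fun s : ℝ => s ^ (-κ)) (Set.Ioi l) :=
    integrableOn_Ioi_rpow_of_lt (by linarith) hl
  rw [← Set.Ioc_union_Ioi_eq_Ioi hl.le, ENNReal.ofReal_add (by positivity) (by positivity)]
  refine (lintegral_union_le _ _ _).trans (add_le_add ?_ ?_)
  · calc _ ≤ ∫⁻ _ in Set.Ioc 0 l, ENNReal.ofReal a :=
          setLIntegral_mono measurable_const fun s hs => h1 s hs.1
      _ = _ := by
          rw [setLIntegral_const, Real.volume_Ioc, sub_zero, ENNReal.ofReal_mul ha]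
  · calc _ ≤ ∫⁻ s in Set.Ioi l, ENNReal.ofReal c * ENNReal.ofReal (s ^ (-κ)) := by
          refine setLIntegral_mono (by fun_prop) fun s hs => (h2 s (hl.trans hs)).trans ?_
          rw [ENNReal.ofReal_mul hc]
      _ = _ := by
          rw [lintegral_const_mul _ (by fun_prop), ← ofReal_integral_eq_lintegral_ofReal hi
            ((ae_restrict_mem measurableSet_Ioi).mono fun s hs =>
              Real.rpow_nonneg (hl.trans hs).le _),
            integral_Ioi_rpow_of_lt (by linarith) hl, ENNReal.ofReal_mul hc]
          congr 2
          rw [neg_add_eq_sub, neg_div, ← div_neg, neg_sub]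

variable {X : Type*} [MeasurableSpace X] {μ : Measure X}

/-- The functions with integral at most `N V ^ η` over sets of measure at most `V`; for `η < 1` they
form a weak Lebesgue space. -/
def HasWeakBound (μ : Measure X) (N η : ℝ) (h : X → ℝ≥0∞) : Prop :=
  ∀ F, MeasurableSet F → ∀ V : ℝ, 0 < V → μ F ≤ ENNReal.ofReal V →
    ∫⁻ x in F, h x ∂μ ≤ ENNReal.ofReal (N * V ^ η)

variable {N η : ℝ} {h : X → ℝ≥0∞}

theorem HasWeakBound.mono (hh : HasWeakBound μ N η h) {N' : ℝ} (hN : N ≤ N') :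
    HasWeakBound μ N' η h := fun F hF V hV hFV =>
  (hh F hF V hV hFV).trans (ENNReal.ofReal_le_ofReal
    (mul_le_mul_of_nonneg_right hN (by positivity)))

theorem HasWeakBound.congr_ae (hh : HasWeakBound μ N η h) {h' : X → ℝ≥0∞} (e : h =ᵐ[μ] h') :
    HasWeakBound μ N η h' := fun F hF V hV hFV => by
  rw [← lintegral_congr_ae (ae_restrict_of_ae e)]
  exact hh F hF V hV hFV

theorem HasWeakBound.const_mul (hh : HasWeakBound μ N η h) {C : ℝ} (hC : 0 ≤ C) :
    HasWeakBound μ (C * N) η fun x => ENNReal.ofReal C * h x := by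
  intro F hF V hV hFV
  rw [lintegral_const_mul' _ _ ENNReal.ofReal_ne_top, mul_assoc, ENNReal.ofReal_mul hC]
  exact mul_le_mul_right (hh F hF V hV hFV) _

/-- Multiplication with a function in a weak Lebesgue space. -/
theorem HasWeakBound.mul (hh : HasWeakBound μ N η h) (hhm : Measurable h) (hN : 0 ≤ N) {c : X → ℝ}
    (hc : Measurable c) (hc0 : ∀ x, 0 ≤ c x) {ε q : ℝ} (hε : 0 < ε) (hq : 0 < q)
    (hqη : 1 < q * η)
    (hlev : ∀ l, 0 < l → μ {x | l < c x} ≤ ENNReal.ofReal ((ε / l) ^ q)) :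
    HasWeakBound μ (N * (1 + 1 / (q * η - 1)) * ε) (η - 1 / q)
      fun x => h x * ENNReal.ofReal (c x) := by
  intro F hF V hV hFV
  set m := (μ.withDensity h).restrict F with hm
  have hmap : ∀ l, m {x | l < c x} = ∫⁻ x in {x | l < c x} ∩ F, h x ∂μ := fun l => by
    have hs : MeasurableSet {x | l < c x} := measurableSet_lt measurable_const hc
    rw [hm, Measure.restrict_apply hs, withDensity_apply _ (hs.inter hF)]
  have e : ∫⁻ x in F, h x * ENNReal.ofReal (c x) ∂μ = ∫⁻ x, ENNReal.ofReal (c x) ∂m := by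
    rw [hm, restrict_withDensity hF, lintegral_withDensity_eq_lintegral_mul _ hhm
      hc.ennreal_ofReal]
    rfl
  rw [e, lintegral_eq_lintegral_meas_lt _ (Eventually.of_forall hc0) hc.aemeasurable]
  -- Layer cake over the levels of c: below the cut only the measure V of F is used, above it the
  -- measure (ε/s)^q of the level set. The cut ε V^{-1/q} is where the two measures agree.
  refine (lintegral_Ioi_le_of_le_of_le (a := N * V ^ η) (c := N * ε ^ (q * η)) (κ := q * η)
    (l := ε * V ^ (-(1 / q))) hqη (by positivity) (by positivity) (by positivity)
    (fun s hs => ?_) fun s hs => ?_).trans (le_of_eq ?_)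
  · rw [hmap]
    exact hh _ ((measurableSet_lt measurable_const hc).inter hF) V hV
      ((measure_mono Set.inter_subset_right).trans hFV)
  · rw [hmap]
    refine (hh _ ((measurableSet_lt measurable_const hc).inter hF) ((ε / s) ^ q) (by positivity)
      ((measure_mono Set.inter_subset_left).trans (hlev s hs))).trans (le_of_eq ?_)
    rw [← Real.rpow_mul (by positivity), Real.div_rpow hε.le hs.le, Real.rpow_neg hs.le]
    congr 1
    ring
  · congr 1
    have h1 : ε ^ (q * η) * (ε * V ^ (-(1 / q))) ^ (1 - q * η) = ε * V ^ (η - 1 / q) := by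
      rw [Real.mul_rpow hε.le (by positivity), ← Real.rpow_mul hV.le, ← mul_assoc,
        ← Real.rpow_add hε, add_sub_cancel, Real.rpow_one]
      congr 2
      field_simp
      ring
    have h2 : V ^ η * (ε * V ^ (-(1 / q))) = ε * V ^ (η - 1 / q) := by
      rw [mul_left_comm, ← Real.rpow_add hV, sub_eq_add_neg]
    calc _ = N * (V ^ η * (ε * V ^ (-(1 / q)))) + N * (ε ^ (q * η) *
          (ε * V ^ (-(1 / q))) ^ (1 - q * η)) / (q * η - 1) := by ring
      _ = _ := by rw [h1, h2]; ring

/-- Integration of a bounded function of weak type `1`. -/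
theorem HasWeakBound.lintegral_mul_le (hh : HasWeakBound μ N η h) (hhm : Measurable h) (hN : 0 ≤ N)
    (hη1 : η < 1) {H : X → ℝ≥0∞} (hH : Measurable H) {L D : ℝ} (hL : 0 < L)
    (hD : 0 < D) (hHL : ∀ x, H x ≤ ENNReal.ofReal L) (hHD : ∫⁻ x, H x ∂μ ≤ ENNReal.ofReal D) :
    ∫⁻ x, h x * H x ∂μ ≤ ENNReal.ofReal (N * (D ^ η * (L ^ (1 - η) / (1 - η)))) := by
  set c : X → ℝ := fun x => (H x).toReal with hc
  have hfin : ∀ x, H x ≠ ∞ := fun x => ne_top_of_le_ne_top ENNReal.ofReal_ne_top (hHL x)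
  have hcH : ∀ x, ENNReal.ofReal (c x) = H x := fun x => ENNReal.ofReal_toReal (hfin x)
  have hcm : Measurable c := hH.ennreal_toReal
  have hs : ∀ l, MeasurableSet {x | l < c x} := fun l => measurableSet_lt measurable_const hcm
  have hcL : ∀ x, c x ≤ L := fun x => ENNReal.toReal_le_of_le_ofReal hL.le (hHL x)
  have e : ∫⁻ x, h x * H x ∂μ = ∫⁻ x, ENNReal.ofReal (c x) ∂(μ.withDensity h) := by
    rw [lintegral_withDensity_eq_lintegral_mul _ hhm hcm.ennreal_ofReal]
    simp only [Pi.mul_apply, hcH]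
  rw [e, lintegral_eq_lintegral_meas_lt _ (Eventually.of_forall fun x => ENNReal.toReal_nonneg)
    hcm.aemeasurable, ← lintegral_indicator measurableSet_Ioi]
  -- Layer cake for H: a level set at height l has measure at most D/l and is empty for l ≥ L, so
  -- the bound is a multiple of l^{-η} on (0, L), integrable since η < 1.
  calc _ ≤ ∫⁻ l, (Set.Ioo 0 L).indicator
        (fun l => ENNReal.ofReal (N * D ^ η) * ENNReal.ofReal (l ^ (-η))) l := by
        refine lintegral_mono fun l => ?_
        by_cases hl : l ∈ Set.Ioi (0 : ℝ)
        · have hl0 : 0 < l := hl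
          rw [Set.indicator_of_mem hl]
          rcases le_or_gt L l with hlL | hlL
          · have : {x | l < c x} = ∅ := by
              ext x
              simp only [Set.mem_ofPred_eq, Set.mem_empty_iff_false, iff_false, not_lt]
              exact (hcL x).trans hlL
            rw [this, measure_empty]
            exact zero_le
          · rw [Set.indicator_of_mem (Set.mem_Ioo.2 ⟨hl0, hlL⟩),
              ← ENNReal.ofReal_mul (by positivity), withDensity_apply _ (hs l)]
            refine (hh _ (hs l) (D / l) (by positivity) ?_).trans (le_of_eq ?_)
            · have h1 := mul_meas_ge_le_lintegral hH (μ := μ) (ENNReal.ofReal l)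
              rw [ENNReal.ofReal_div_of_pos hl0, ENNReal.le_div_iff_mul_le
                (Or.inl (by simpa using hl0)) (Or.inl ENNReal.ofReal_ne_top), mul_comm]
              refine le_trans (mul_le_mul_right (measure_mono fun x hx => ?_) _) (h1.trans hHD)
              have hx : l < c x := hx
              rw [Set.mem_ofPred_eq, ← hcH]
              exact ENNReal.ofReal_le_ofReal hx.le
            · rw [Real.div_rpow hD.le hl0.le, Real.rpow_neg hl0.le]
              congr 1
              ring
        · rw [Set.indicator_of_notMem hl]
          exact zero_le
    _ = _ := by
        rw [lintegral_indicator measurableSet_Ioo, lintegral_const_mul _ (by fun_prop),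
          lintegral_rpow_neg_le hη1 hL, ← ENNReal.ofReal_mul (by positivity), mul_assoc]

theorem HasWeakBound.ae_eq_zero [SigmaFinite μ]
    (hh : ∀ k : ℕ, HasWeakBound μ (N * (1 / 2) ^ k) η h) (hhm : Measurable h) : h =ᵐ[μ] 0 := by
  refine ae_of_forall_measure_lt_top_ae_restrict _ fun F hF hFt => ?_
  have hV : μ F ≤ ENNReal.ofReal ((μ F).toReal + 1) := by
    rw [ENNReal.le_ofReal_iff_toReal_le hFt.ne (by positivity)]
    linarith
  have h1 : Tendsto (fun k : ℕ => ENNReal.ofReal (N * (1 / 2) ^ k * ((μ F).toReal + 1) ^ η))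
      atTop (𝓝 0) := by
    have h1 : Tendsto (fun k : ℕ => (1 / 2 : ℝ) ^ k) atTop (𝓝 0) :=
      tendsto_pow_atTop_nhds_zero_of_lt_one (by norm_num) (by norm_num)
    have h2 := ENNReal.tendsto_ofReal ((h1.const_mul N).mul_const (((μ F).toReal + 1) ^ η))
    simpa using h2
  have h2 := ge_of_tendsto' h1 fun k => hh k F hF _ (by positivity) hV
  exact (lintegral_eq_zero_iff hhm).1 (le_antisymm h2 zero_le)

theorem hasWeakBound_of_eLpNorm_le {E : Type*} [NormedAddCommGroup E] {f : X → E} {r : ℝ}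
    (hr : 1 < r) (hf : AEStronglyMeasurable f μ) (hN : 0 ≤ N)
    (hle : eLpNorm f (ENNReal.ofReal r) μ ≤ ENNReal.ofReal N) :
    HasWeakBound μ N (1 - 1 / r) fun x => ‖f x‖ₑ := by
  intro F hF V hV hFV
  have hr0 : 0 < r := by linarith
  have h1 := eLpNorm_le_eLpNorm_mul_rpow_measure_univ (p := 1) (q := ENNReal.ofReal r)
    (μ := μ.restrict F) (by simpa using ENNReal.ofReal_le_ofReal hr.le) hf.restrict
  rw [eLpNorm_one_eq_lintegral_enorm, ENNReal.toReal_ofReal hr0.le, Measure.restrict_apply_univ,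
    ENNReal.toReal_one, div_one] at h1
  have hη : 0 ≤ 1 - 1 / r := by
    rw [sub_nonneg, div_le_one hr0]
    exact hr.le
  refine h1.trans ?_
  rw [ENNReal.ofReal_mul hN, ← ENNReal.ofReal_rpow_of_nonneg hV.le hη]
  exact mul_le_mul' ((eLpNorm_restrict_le _ _ _ _).trans hle) (ENNReal.rpow_le_rpow hFV hη)

end WeakBounds

/-! ### The Duhamel integral in weak Lebesgue spaces. -/

section WeakSmoothing

variable {n : ℕ} {α A B : ℝ} {k : EuclideanSpace ℝ (Fin n) → ℝ}
  {h : EuclideanSpace ℝ (Fin n) → ℝ≥0∞} {N η : ℝ}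

/-- Duality: the kernel is moved onto the indicator of F, giving a function H with integral at most
AV and supremum at most both A and BV. Either bound on the supremum may be used, and the two choices
yield the bounds for short and long times. -/
theorem IsBoundedKernel.setLIntegral_lconv_le (hk : IsBoundedKernel k A B) (hA : 0 < A)
    (hh : HasWeakBound volume N η h) (hhm : Measurable h) (hN : 0 ≤ N) (hη1 : η < 1)
    {F : Set (EuclideanSpace ℝ (Fin n))} {V : ℝ} (hV : 0 < V)
    (hFV : volume F ≤ ENNReal.ofReal V) {L : ℝ} (hL : 0 < L) (hL' : A ≤ L ∨ B * V ≤ L) :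
    ∫⁻ x in F, ∫⁻ y, ‖k y‖ₑ * h (x - y) ≤
      ENNReal.ofReal (N * ((A * V) ^ η * (L ^ (1 - η) / (1 - η)))) := by
  have hB := hk.right_nonneg
  have hkm : Measurable fun z : EuclideanSpace ℝ (Fin n) × EuclideanSpace ℝ (Fin n) =>
      ‖k (z.1 - z.2)‖ₑ := (hk.continuous.comp (by fun_prop)).enorm.measurable
  set H : EuclideanSpace ℝ (Fin n) → ℝ≥0∞ := fun y => ∫⁻ x in F, ‖k (x - y)‖ₑ with hH
  have hHm : Measurable H := by
    have : Measurable fun z : EuclideanSpace ℝ (Fin n) × EuclideanSpace ℝ (Fin n) =>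
      ‖k (z.2 - z.1)‖ₑ := (hk.continuous.comp (by fun_prop)).enorm.measurable
    exact this.lintegral_prod_right'
  have hHL : ∀ y, H y ≤ ENNReal.ofReal L := by
    intro y
    rcases hL' with h1 | h1
    · refine le_trans ?_ (ENNReal.ofReal_le_ofReal h1)
      refine (setLIntegral_le_lintegral _ _).trans ?_
      rw [lintegral_sub_right_eq_self (fun x => ‖k x‖ₑ) y]
      exact hk.lintegral_enorm_le
    · refine le_trans ?_ (ENNReal.ofReal_le_ofReal h1)
      calc H y ≤ ∫⁻ _ in F, ENNReal.ofReal B := lintegral_mono fun x => hk.enorm_le _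
        _ ≤ _ := by
            rw [setLIntegral_const, ENNReal.ofReal_mul hB]
            exact mul_le_mul_right hFV _
  have hHD : ∫⁻ y, H y ≤ ENNReal.ofReal (A * V) := by
    simp only [hH]
    rw [lintegral_lintegral_swap (by
      exact ((hk.continuous.comp (by fun_prop :
        Continuous fun z : EuclideanSpace ℝ (Fin n) × EuclideanSpace ℝ (Fin n) =>
          z.2 - z.1)).enorm.measurable).aemeasurable)]
    calc _ ≤ ∫⁻ _ in F, ENNReal.ofReal A := by
          refine lintegral_mono fun x => ?_
          rw [lintegral_sub_left_eq_self (fun y => ‖k y‖ₑ) x]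
          exact hk.lintegral_enorm_le
      _ ≤ _ := by
          rw [setLIntegral_const, ENNReal.ofReal_mul hA.le]
          exact mul_le_mul_right hFV _
  refine le_trans (le_of_eq ?_)
    (hh.lintegral_mul_le hhm hN hη1 hHm hL (by positivity) hHL hHD)
  calc ∫⁻ x in F, ∫⁻ y, ‖k y‖ₑ * h (x - y) = ∫⁻ x in F, ∫⁻ y, ‖k (x - y)‖ₑ * h y := by
        refine lintegral_congr fun x => ?_
        rw [← lintegral_sub_left_eq_self (fun y => ‖k y‖ₑ * h (x - y)) x]
        simp only [sub_sub_cancel]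
    _ = ∫⁻ y, ∫⁻ x in F, ‖k (x - y)‖ₑ * h y :=
        lintegral_lintegral_swap (hkm.mul (hhm.comp measurable_snd)).aemeasurable
    _ = _ := by
        refine lintegral_congr fun y => ?_
        have hy : Measurable fun x => ‖k (x - y)‖ₑ :=
          (hk.continuous.comp (continuous_id.sub continuous_const)).enorm.measurable
        rw [lintegral_mul_const _ hy, mul_comm]

variable {𝕜 : Type*} [RCLike 𝕜]

/-- The Duhamel term of a source of weak type: the exponent `ρ` of the first part is critical. -/
theorem HeatBounds.hasWeakBound_duhamel (hK : HeatBounds n α A) {m : ℝ} (hm : 1 < m)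
    {G : ℝ → EuclideanSpace ℝ (Fin n) → 𝕜} (hG : IsLpPath m G) {ρ N₁ N₂ s : ℝ} (hs : 0 < s)
    (hN₁ : 0 ≤ N₁) (hN₂ : 0 ≤ N₂) (hρ1 : ρ < 1) (hη1 : η < 1)
    (hν : 0 < n / (2 * α)) (hcrit : ρ + 1 / (n / (2 * α)) = η)
    (hsrc : ∀ τ ∈ Set.Ioo 0 s, ∃ h₁ h₂ : EuclideanSpace ℝ (Fin n) → ℝ≥0∞, Measurable h₁ ∧
      Measurable h₂ ∧ (∀ x, ‖G τ x‖ₑ ≤ h₁ x + h₂ x) ∧ HasWeakBound volume N₁ ρ h₁ ∧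
        HasWeakBound volume N₂ η h₂) :
    HasWeakBound volume (A / (1 - ρ) * (1 + 1 / (n / (2 * α) * (1 - ρ) - 1)) * N₁ +
      A / (1 - η) * s * N₂) η fun x => ‖duhamel α G s x‖ₑ := by
  intro F hF V hV hFV
  have hA := hK.pos
  set ν := n / (2 * α) with hνdef
  have h1ρ : 0 < 1 - ρ := by linarith
  have h1η : 0 < 1 - η := by linarith
  -- The scaling relation ρ + 1/ν = η gives ν(1 - ρ) = 1 + ν(1 - η), which exceeds 1 exactly because
  -- η < 1.
  have hκ : 1 < ν * (1 - ρ) := by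
    have : ν * (1 - ρ) = ν * (1 - η) + 1 := by
      rw [← hcrit]
      field_simp
      ring
    nlinarith [mul_pos hν h1η]
  set a := N₁ * (A * V ^ ρ / (1 - ρ)) with ha
  set c := N₁ * (A * V / (1 - ρ)) with hc
  set d := N₂ * (A * V ^ η / (1 - η)) with hd
  -- The integral over a fixed set F is bounded near σ = 0 and decays faster than 1/σ at infinity,
  -- the two bounds crossing at σ = V^{1/ν}. A strong norm would give the non-integrable 1/σ
  -- instead.
  set Φ : ℝ → ℝ≥0∞ := fun σ => min (ENNReal.ofReal a) (ENNReal.ofReal (c * σ ^ (-(ν * (1 - ρ)))))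
    with hΦ
  have hAA : ∀ θ : ℝ, A ^ θ * A ^ (1 - θ) = A := fun θ => by
    rw [← Real.rpow_add hA, add_sub_cancel, Real.rpow_one]
  have hstep : ∀ τ ∈ Set.Ioo 0 s, ∫⁻ x in F, ‖fracSemigroup α (s - τ) (G τ) x‖ₑ ≤
      Φ (s - τ) + ENNReal.ofReal d := by
    intro τ hτ
    have hσ : 0 < s - τ := sub_pos.2 hτ.2
    obtain ⟨h₁, h₂, hm₁, hm₂, hle, hw₁, hw₂⟩ := hsrc τ hτ
    have hk := hK.kernel (s - τ) hσ
    have hsplit : ∀ x, ‖fracSemigroup α (s - τ) (G τ) x‖ₑ ≤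
        (∫⁻ y, ‖heatKernel α (s - τ) y‖ₑ * h₁ (x - y)) +
          ∫⁻ y, ‖heatKernel α (s - τ) y‖ₑ * h₂ (x - y) := by
      intro x
      have hmk : Measurable fun y : EuclideanSpace ℝ (Fin n) => ‖heatKernel α (s - τ) y‖ₑ :=
        hk.continuous.enorm.measurable
      have hmx : Measurable fun y => ‖heatKernel α (s - τ) y‖ₑ * h₁ (x - y) :=
        hmk.mul (hm₁.comp (measurable_const.sub measurable_id))
      rw [← lintegral_add_left hmx]
      refine (IsBoundedKernel.enorm_convolution_le _ _ x).trans (lintegral_mono fun y => ?_)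
      rw [← mul_add]
      exact mul_le_mul_right (hle _) _
    have hmeas : Measurable fun x => ∫⁻ y, ‖heatKernel α (s - τ) y‖ₑ * h₁ (x - y) := by
      have : Measurable fun z : EuclideanSpace ℝ (Fin n) × EuclideanSpace ℝ (Fin n) =>
          ‖heatKernel α (s - τ) z.2‖ₑ * h₁ (z.1 - z.2) :=
        ((hk.continuous.comp continuous_snd).enorm.measurable).mul (hm₁.comp (by fun_prop))
      exact this.lintegral_prod_right'
    refine (lintegral_mono hsplit).trans ?_
    rw [lintegral_add_left hmeas]
    refine add_le_add (le_min ?_ ?_) ?_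
    · refine (hk.setLIntegral_lconv_le hA hw₁ hm₁ hN₁ hρ1 hV hFV hA (Or.inl le_rfl)).trans
        (le_of_eq ?_)
      rw [ha, Real.mul_rpow hA.le hV.le]
      congr 1
      calc _ = N₁ * ((A ^ ρ * A ^ (1 - ρ)) * V ^ ρ / (1 - ρ)) := by ring
        _ = _ := by rw [hAA]
    · refine (hk.setLIntegral_lconv_le hA hw₁ hm₁ hN₁ hρ1 hV hFV
        (L := A * (s - τ) ^ (-ν) * V) (by positivity) (Or.inr le_rfl)).trans (le_of_eq ?_)
      rw [hc, Real.mul_rpow hA.le hV.le, Real.mul_rpow (by positivity) hV.le,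
        Real.mul_rpow hA.le (by positivity), ← Real.rpow_mul hσ.le]
      have hVV : V ^ ρ * V ^ (1 - ρ) = V := by
        rw [← Real.rpow_add hV, add_sub_cancel, Real.rpow_one]
      congr 1
      calc _ = N₁ * ((A ^ ρ * A ^ (1 - ρ)) * (V ^ ρ * V ^ (1 - ρ)) / (1 - ρ)) *
            (s - τ) ^ (-ν * (1 - ρ)) := by ring
        _ = _ := by rw [hAA, hVV, neg_mul]
    · refine (hk.setLIntegral_lconv_le hA hw₂ hm₂ hN₂ hη1 hV hFV hA (Or.inl le_rfl)).trans
        (le_of_eq ?_)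
      rw [hd, Real.mul_rpow hA.le hV.le]
      congr 1
      calc _ = N₂ * ((A ^ η * A ^ (1 - η)) * V ^ η / (1 - η)) := by ring
        _ = _ := by rw [hAA]
  have hjoint := (hK.aestronglyMeasurable_fracSemigroup_path hm hG s).enorm
  have hjoint' : AEMeasurable (Function.uncurry fun (x : EuclideanSpace ℝ (Fin n)) (τ : ℝ) =>
      ‖fracSemigroup α (s - τ) (G τ) x‖ₑ)
      ((volume.restrict F).prod (volume.restrict (Set.Ioo 0 s))) := by
    refine hjoint.mono_measure ?_
    exact Measure.prod_mono Measure.restrict_le_self le_rfl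
  calc ∫⁻ x in F, ‖duhamel α G s x‖ₑ
      ≤ ∫⁻ x in F, ∫⁻ τ in Set.Ioo 0 s, ‖fracSemigroup α (s - τ) (G τ) x‖ₑ := by
        refine lintegral_mono fun x => ?_
        simp only [duhamel]
        rw [intervalIntegral.integral_of_le hs.le, integral_Ioc_eq_integral_Ioo]
        exact enorm_integral_le_lintegral_enorm _
    _ = ∫⁻ τ in Set.Ioo 0 s, ∫⁻ x in F, ‖fracSemigroup α (s - τ) (G τ) x‖ₑ :=
        lintegral_lintegral_swap hjoint'
    _ ≤ ∫⁻ τ in Set.Ioo 0 s, (Φ (s - τ) + ENNReal.ofReal d) :=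
        setLIntegral_mono (by fun_prop) hstep
    _ = (∫⁻ τ in Set.Ioo 0 s, Φ (s - τ)) + ENNReal.ofReal d * ENNReal.ofReal s := by
        rw [lintegral_add_right _ measurable_const, setLIntegral_const, Real.volume_Ioo, sub_zero]
    -- The critical part is integrated over all positive times, so its constant does not depend on
    -- s; only the other part keeps the factor s.
    _ ≤ (∫⁻ σ in Set.Ioi 0, Φ σ) + ENNReal.ofReal d * ENNReal.ofReal s := by
        refine add_le_add ?_ le_rfl
        rw [← lintegral_indicator measurableSet_Ioi, ← lintegral_indicator measurableSet_Ioo,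
          ← lintegral_sub_left_eq_self ((Set.Ioi 0).indicator Φ) s]
        refine lintegral_mono fun τ => ?_
        by_cases hτ : τ ∈ Set.Ioo 0 s
        · rw [Set.indicator_of_mem hτ, Set.indicator_of_mem (Set.mem_Ioi.2 (sub_pos.2 hτ.2))]
        · rw [Set.indicator_of_notMem hτ]
          exact zero_le
    _ ≤ ENNReal.ofReal (a * V ^ (1 / ν) +
          c * ((V ^ (1 / ν)) ^ (1 - ν * (1 - ρ)) / (ν * (1 - ρ) - 1))) +
        ENNReal.ofReal (d * s) := by
        rw [ENNReal.ofReal_mul (by positivity : 0 ≤ d)]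
        refine add_le_add (lintegral_Ioi_le_of_le_of_le hκ (by positivity) (by positivity)
          (by positivity) (fun σ _ => min_le_left _ _) fun σ _ => min_le_right _ _) le_rfl
    _ = _ := by
        have hκ0 : 0 < ν * (1 - ρ) - 1 := by linarith
        rw [← ENNReal.ofReal_add (by positivity) (by positivity)]
        congr 1
        have e1 : V ^ ρ * V ^ (1 / ν) = V ^ η := by rw [← Real.rpow_add hV, hcrit]
        have e2 : V * (V ^ (1 / ν)) ^ (1 - ν * (1 - ρ)) = V ^ η := by
          rw [← Real.rpow_mul hV.le]
          nth_rewrite 1 [← Real.rpow_one V]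
          rw [← Real.rpow_add hV, ← hcrit]
          congr 1
          field_simp
          ring
        calc _ = N₁ * (A * (V ^ ρ * V ^ (1 / ν)) / (1 - ρ)) +
              N₁ * (A * (V * (V ^ (1 / ν)) ^ (1 - ν * (1 - ρ))) / (1 - ρ)) / (ν * (1 - ρ) - 1) +
              N₂ * (A * V ^ η / (1 - η)) * s := by rw [ha, hc, hd]; ring
          _ = _ := by rw [e1, e2]; ring

end WeakSmoothing

/-! ### Uniqueness among continuous L^{r₀}-valued paths when r₀ > b + 1. -/

section CriticalUniqueness

variable {n : ℕ} {α b κ A : ℝ} {𝕜 : Type*} [RCLike 𝕜]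
  {φ : EuclideanSpace ℝ (Fin n) → 𝕜}
  {U V : ℝ → (EuclideanSpace ℝ (Fin n) →ₘ[volume] 𝕜)}

/-- Comparison with a bounded g, where c = ‖z - g‖ + ‖w - g‖: one of c and 2M dominates the other.
The first resulting coefficient is small in a critical norm when z and w are close to g; the second
is bounded and hence subcritical. -/
theorem norm_powerNonlinearity_sub_le_of_norm_le (hκ : κ = 1 ∨ κ = -1) (hb : 0 < b) {z w g : 𝕜}
    {M : ℝ} (hg : ‖g‖ ≤ M) :
    ‖powerNonlinearity κ b z - powerNonlinearity κ b w‖ ≤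
      (b + 1) * 2 ^ b * ((‖z - g‖ + ‖w - g‖) ^ b * ‖z - w‖) + (b + 1) * (4 * M) ^ b * ‖z - w‖ := by
  have hM : 0 ≤ M := (norm_nonneg _).trans hg
  set c := ‖z - g‖ + ‖w - g‖ with hc
  have hc0 : 0 ≤ c := by positivity
  have h1 : ‖z‖ + ‖w‖ ≤ c + 2 * M := by
    have hz := norm_le_norm_add_norm_sub' z g
    have hw := norm_le_norm_add_norm_sub' w g
    linarith
  have h2 : (‖z‖ + ‖w‖) ^ b ≤ 2 ^ b * c ^ b + (4 * M) ^ b := by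
    rcases le_total (2 * M) c with h | h
    · calc (‖z‖ + ‖w‖) ^ b ≤ (2 * c) ^ b :=
            Real.rpow_le_rpow (by positivity) (by linarith) hb.le
        _ = 2 ^ b * c ^ b := Real.mul_rpow two_pos.le hc0
        _ ≤ _ := le_add_of_nonneg_right (by positivity)
    · calc (‖z‖ + ‖w‖) ^ b ≤ (4 * M) ^ b :=
            Real.rpow_le_rpow (by positivity) (by linarith) hb.le
        _ ≤ _ := le_add_of_nonneg_left (by positivity)
  calc _ ≤ (b + 1) * (‖z‖ + ‖w‖) ^ b * ‖z - w‖ := norm_powerNonlinearity_sub_le hκ hb z w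
    _ ≤ (b + 1) * (2 ^ b * c ^ b + (4 * M) ^ b) * ‖z - w‖ := by gcongr
    _ = _ := by ring

/-- Chebyshev's inequality, in the form needed to place c^b in weak L^{r/b}. -/
theorem measure_lt_rpow_le {X : Type*} [MeasurableSpace X] {μ : Measure X} {c : X → ℝ}
    (hc : AEStronglyMeasurable c μ) (hc0 : ∀ x, 0 ≤ c x) {r ε : ℝ} (hr : 0 < r) (hb : 0 < b)
    (hε : 0 ≤ ε)
    (hle : eLpNorm c (ENNReal.ofReal r) μ ≤ ENNReal.ofReal ε) {l : ℝ} (hl : 0 < l) :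
    μ {x | l < c x ^ b} ≤ ENNReal.ofReal ((ε ^ b / l) ^ (r / b)) := by
  have hl' : 0 < l ^ (1 / b) := by positivity
  have h1 := meas_ge_le_mul_pow_eLpNorm_enorm μ (p := ENNReal.ofReal r) (by simpa using hr)
    ENNReal.ofReal_ne_top hc (ε := ENNReal.ofReal (l ^ (1 / b))) (by simpa using hl')
    (fun h => absurd h ENNReal.ofReal_ne_top)
  rw [ENNReal.toReal_ofReal hr.le] at h1
  refine (measure_mono fun x hx => ?_).trans (h1.trans ((mul_le_mul_right
    (ENNReal.rpow_le_rpow hle hr.le) _).trans (le_of_eq ?_)))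
  · have hx : l < c x ^ b := hx
    rw [Set.mem_ofPred_eq, Real.enorm_eq_ofReal (hc0 x)]
    refine ENNReal.ofReal_le_ofReal ?_
    calc l ^ (1 / b) ≤ (c x ^ b) ^ (1 / b) := Real.rpow_le_rpow hl.le hx.le (by positivity)
      _ = c x := by rw [← Real.rpow_mul (hc0 x), mul_one_div_cancel hb.ne', Real.rpow_one]
  · rw [← ENNReal.ofReal_inv_of_pos hl', ENNReal.ofReal_rpow_of_nonneg (by positivity) hr.le,
      ENNReal.ofReal_rpow_of_nonneg hε hr.le, ← ENNReal.ofReal_mul (by positivity),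
      Real.inv_rpow hl'.le, ← Real.rpow_mul hl.le, Real.div_rpow (by positivity) hl.le,
      ← Real.rpow_mul hε, mul_div_cancel₀ _ hb.ne', one_div_mul_eq_div, inv_mul_eq_div]

/-- If the critical exponent exceeds `b + 1`, mild solutions are unique among all continuous paths
in the critical space. -/
theorem eq_of_isMildSolution_of_add_one_lt (hK : HeatBounds n α A) (hn : 0 < n) (hα : 0 < α)
    (hb : 0 < b) (hκ : κ = 1 ∨ κ = -1) (hbr : b + 1 < critExponent n α b)
    (hU : IsMildSolution α b κ φ U) (hV : IsMildSolution α b κ φ V)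
    (hUc : ContinuousInLp (Set.Ici 0) (critExponent n α b) U)
    (hVc : ContinuousInLp (Set.Ici 0) (critExponent n α b) V) {t : ℝ} (ht : 0 ≤ t) :
    U t = V t := by
  set r := critExponent n α b with hr
  have hA := hK.pos
  have hr1 : 1 < r := by linarith
  have hr0 : 0 < r := by linarith
  have hr1' : (1 : ℝ≥0∞) ≤ ENNReal.ofReal r := by simpa using ENNReal.ofReal_le_ofReal hr1.le
  have hn' : (0 : ℝ) < n := by exact_mod_cast hn
  have hν : 0 < n / (2 * α) := by positivity
  have hrν : r = n / (2 * α) * b := by rw [hr, critExponent]; ring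
  set ν := n / (2 * α) with hνd
  have hm : 1 < r / (b + 1) := by rwa [one_lt_div (by linarith)]
  -- η is the exponent of weak L^r. Multiplying by c^b, which lies in weak L^{r/b}, lowers it to ρ,
  -- and heat smoothing integrated in time restores the difference b/r = 1/ν.
  set η := 1 - 1 / r with hη
  have hη1 : η < 1 := by rw [hη]; linarith [one_div_pos.2 hr0]
  -- This is where b + 1 < r is needed: (r - 1)/b > 1.
  have hqη : 1 < r / b * η := by
    have : r / b * η = (r - 1) / b := by rw [hη]; field_simp
    rw [this, one_lt_div hb]
    linarith
  set ρ := η - 1 / (r / b) with hρ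
  have hρ1 : ρ < 1 := by
    have : 0 < 1 / (r / b) := by positivity
    linarith
  have hcrit : ρ + 1 / ν = η := by
    rw [hρ, hrν]
    field_simp
    ring
  set C₁ := A / (1 - ρ) * (1 + 1 / (ν * (1 - ρ) - 1)) with hC₁
  set C₂ := A / (1 - η) with hC₂
  set D := (b + 1) * 2 ^ b * (1 + 1 / (r / b * η - 1)) with hD
  have hD0 : 0 ≤ D := by
    have : 0 < r / b * η - 1 := by linarith
    positivity
  have hC₂0 : 0 ≤ C₂ := div_nonneg hA.le (by linarith)
  obtain ⟨ε, hε, hε'⟩ : ∃ ε : ℝ, 0 < ε ∧ C₁ * D * (4 * ε) ^ b ≤ 1 / 4 := by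
    have hc : Continuous fun ε : ℝ => C₁ * D * (4 * ε) ^ b :=
      continuous_const.mul ((continuous_const.mul continuous_id).rpow_const fun _ => Or.inr hb.le)
    have h1 := (hc.tendsto 0).mono_left (nhdsWithin_le_nhds (s := Set.Ioi 0))
    simp only [mul_zero, Real.zero_rpow hb.ne'] at h1
    have h2 := h1.eventually (gt_mem_nhds (by norm_num : (0 : ℝ) < 1 / 4))
    obtain ⟨R, hR1, hR2⟩ := (h2.and self_mem_nhdsWithin).exists
    exact ⟨R, hR2, hR1.le⟩
  have h00 : U 0 = V 0 := AEEqFun.ext (hU.1.trans hV.1.symm)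
  refine hUc.eq_of_local hVc hr1.le h00 (fun T hT heq => ?_) ht
  -- Both solutions are close in L^r to U T just after T, hence to a bounded g. The bound M of g may
  -- depend on T and on ε; it is compensated afterwards by taking δ₃ small.
  obtain ⟨g, hg, hgm⟩ := (hUc.1 T hT).exists_boundedContinuous_eLpNorm_sub_le
    ENNReal.ofReal_ne_top (ε := ENNReal.ofReal ε) (by simpa using hε)
  set M := ‖g‖ with hM
  have hnear : ∀ W : ℝ → (EuclideanSpace ℝ (Fin n) →ₘ[volume] 𝕜), W T = U T →
      ContinuousInLp (Set.Ici 0) r W → ∃ δ > 0, ∀ s ∈ Set.Ioo 0 δ,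
        eLpNorm (⇑(W (T + s)) - ⇑g) (ENNReal.ofReal r) volume ≤ ENNReal.ofReal (2 * ε) := by
    intro W hWT hW
    have ha : Tendsto (fun s : ℝ => T + s) (𝓝[>] 0) (𝓝[Set.Ici 0] T) := by
      refine tendsto_nhdsWithin_iff.2 ⟨?_, ?_⟩
      · have : Tendsto (fun s : ℝ => T + s) (𝓝 0) (𝓝 T) := by
          simpa using (tendsto_const_nhds (x := T)).add (tendsto_id (α := ℝ) (x := 𝓝 0))
        exact this.mono_left nhdsWithin_le_nhds
      · filter_upwards [self_mem_nhdsWithin] with s hs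
        exact add_nonneg hT (le_of_lt hs)
    have h1 := (ENNReal.tendsto_nhds_zero.1 ((hW.2 T hT).comp ha)) (ENNReal.ofReal ε)
      (by simpa using hε)
    obtain ⟨δ, hδ, h2⟩ := mem_nhdsGT_iff_exists_Ioo_subset.1 h1
    refine ⟨δ, hδ, fun s hs => ?_⟩
    have h3 := h2 hs
    simp only [Set.mem_ofPred_eq, Function.comp_apply, eLpNorm_coe_sub, hWT] at h3
    have e : ⇑(W (T + s)) - ⇑g = (⇑(W (T + s)) - ⇑(U T)) + (⇑(U T) - ⇑g) := by abel
    rw [e, two_mul, ENNReal.ofReal_add hε.le hε.le]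
    exact (eLpNorm_add_le ((W (T + s)).aestronglyMeasurable.sub (U T).aestronglyMeasurable)
      ((U T).aestronglyMeasurable.sub hgm.1) hr1').trans (add_le_add h3 hg)
  obtain ⟨δ₁, hδ₁, H₁⟩ := hnear U rfl hUc
  obtain ⟨δ₂, hδ₂, H₂⟩ := hnear V (heq T ⟨hT, le_rfl⟩).symm hVc
  obtain ⟨δ₃, hδ₃, H₃⟩ : ∃ δ : ℝ, 0 < δ ∧ C₂ * δ * ((b + 1) * (4 * M) ^ b) ≤ 1 / 4 := by
    have hc : Continuous fun δ : ℝ => C₂ * δ * ((b + 1) * (4 * M) ^ b) := by fun_prop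
    have h1 := (hc.tendsto 0).mono_left (nhdsWithin_le_nhds (s := Set.Ioi 0))
    simp only [mul_zero, zero_mul] at h1
    have h2 := h1.eventually (gt_mem_nhds (by norm_num : (0 : ℝ) < 1 / 4))
    obtain ⟨R, hR1, hR2⟩ := (h2.and self_mem_nhdsWithin).exists
    exact ⟨R, hR2, hR1.le⟩
  set δ := min (min δ₁ δ₂) δ₃ with hδ
  have hlt : ∀ s ∈ Set.Ioo 0 δ, s ∈ Set.Ioo 0 δ₁ ∧ s ∈ Set.Ioo 0 δ₂ ∧ s ≤ δ₃ := fun s hs =>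
    ⟨⟨hs.1, hs.2.trans_le ((min_le_left _ _).trans (min_le_left _ _))⟩,
      ⟨hs.1, hs.2.trans_le ((min_le_left _ _).trans (min_le_right _ _))⟩,
      hs.2.le.trans (min_le_right _ _)⟩
  have hUi := hUc.mono Set.Ioi_subset_Ici_self
  have hVi := hVc.mono Set.Ioi_subset_Ici_self
  have hsrc := fun {w : ℝ → EuclideanSpace ℝ (Fin n) → 𝕜} (hw : IsLpPath r w) =>
    isLpPath_powerNonlinearity hκ hb hr1.le hw
  have hG := (hsrc (hUi.isLpPath_shift hT)).sub hm.le (hsrc (hVi.isLpPath_shift hT))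
  have hU0 := hsrc (hUi.isLpPath_shift le_rfl)
  have hV0 := hsrc (hVi.isLpPath_shift le_rfl)
  simp only [zero_add] at hU0 hV0
  set w : ℝ → EuclideanSpace ℝ (Fin n) → ℝ≥0∞ := fun s x =>
    ‖(⇑(U (T + s)) - ⇑(V (T + s))) x‖ₑ with hw
  have hwm : ∀ s, Measurable (w s) := fun s =>
    ((U (T + s)).measurable.sub (V (T + s)).measurable).enorm
  -- Each step halves the weak bound: a quarter comes from the small critical coefficient and a
  -- quarter from the short time interval.
  have key : ∀ k : ℕ, ∀ s ∈ Set.Ioo 0 δ, HasWeakBound volume (4 * ε * (1 / 2) ^ k) η (w s) := by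
    intro k
    induction k with
    | zero =>
      intro s hs
      obtain ⟨hs₁, hs₂, -⟩ := hlt s hs
      rw [pow_zero, mul_one]
      have hum := (U (T + s)).aestronglyMeasurable
      have hvm := (V (T + s)).aestronglyMeasurable
      refine hasWeakBound_of_eLpNorm_le hr1 (hum.sub hvm) (by positivity) ?_
      have e : ⇑(U (T + s)) - ⇑(V (T + s)) = (⇑(U (T + s)) - ⇑g) - (⇑(V (T + s)) - ⇑g) := by abel
      rw [e]
      refine (eLpNorm_sub_le (hum.sub hgm.1) (hvm.sub hgm.1) hr1').trans
        ((add_le_add (H₁ s hs₁) (H₂ s hs₂)).trans (le_of_eq ?_))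
      rw [← ENNReal.ofReal_add (by positivity) (by positivity)]
      congr 1
      ring
    | succ k ih =>
      intro s hs
      set N := 4 * ε * (1 / 2) ^ k with hN
      have hN0 : 0 ≤ N := by positivity
      have hdu := hU.sub_eq_duhamel hK hm.le hV hU0 hV0 hT heq hs.1
      have hbd := hK.hasWeakBound_duhamel hm hG (ρ := ρ) (η := η) (N₁ := D * (4 * ε) ^ b * N)
        (N₂ := (b + 1) * (4 * M) ^ b * N) hs.1 (by positivity) (by positivity) hρ1 hη1 hν hcrit
        fun τ hτ => ?_
      · refine (hbd.mono ?_).congr_ae ?_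
        · calc _ = C₁ * D * (4 * ε) ^ b * N + C₂ * s * ((b + 1) * (4 * M) ^ b) * N := by
                rw [hC₁, hC₂]; ring
            _ ≤ 1 / 4 * N + 1 / 4 * N := by
                refine add_le_add (mul_le_mul_of_nonneg_right hε' hN0)
                  (mul_le_mul_of_nonneg_right (le_trans ?_ H₃) hN0)
                have := (hlt s hs).2.2
                gcongr
            _ = _ := by rw [hN, pow_succ]; ring
        · filter_upwards [hdu] with x hx
          simp only [hw, hx]
      · have hτδ : τ ∈ Set.Ioo 0 δ := ⟨hτ.1, hτ.2.trans hs.2⟩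
        obtain ⟨hτ₁, hτ₂, -⟩ := hlt τ hτδ
        have hum : Measurable (⇑(U (T + τ))) := (U (T + τ)).measurable
        have hvm : Measurable (⇑(V (T + τ))) := (V (T + τ)).measurable
        have hgm' : Measurable (⇑g) := g.continuous.measurable
        set c : EuclideanSpace ℝ (Fin n) → ℝ := fun x =>
          ‖U (T + τ) x - g x‖ + ‖V (T + τ) x - g x‖ with hc
        have hcm : Measurable c := (hum.sub hgm').norm.add (hvm.sub hgm').norm
        have hc0 : ∀ x, 0 ≤ c x := fun x => by positivity
        have hcn : eLpNorm c (ENNReal.ofReal r) volume ≤ ENNReal.ofReal (4 * ε) := by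
          refine (eLpNorm_add_le (f := fun x => ‖U (T + τ) x - g x‖)
            (g := fun x => ‖V (T + τ) x - g x‖) (hum.sub hgm').norm.aestronglyMeasurable
            (hvm.sub hgm').norm.aestronglyMeasurable hr1').trans ?_
          rw [eLpNorm_norm, eLpNorm_norm]
          refine (add_le_add (H₁ τ hτ₁) (H₂ τ hτ₂)).trans (le_of_eq ?_)
          rw [← ENNReal.ofReal_add (by positivity) (by positivity)]
          congr 1
          ring
        have hw1 := ((ih τ hτδ).mul (hwm τ) hN0 (hcm.pow_const b)
          (fun x => Real.rpow_nonneg (hc0 x) b) (ε := (4 * ε) ^ b) (q := r / b) (by positivity)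
          (by positivity) hqη fun l hl => measure_lt_rpow_le hcm.aestronglyMeasurable hc0 hr0 hb
            (by positivity) hcn hl).const_mul (C := (b + 1) * 2 ^ b) (by positivity)
        have hw2 := (ih τ hτδ).const_mul (C := (b + 1) * (4 * M) ^ b) (by positivity)
        refine ⟨_, _, ?_, ?_, fun x => ?_, hw1.mono (le_of_eq ?_), hw2⟩
        · exact (((hwm τ).mul (hcm.pow_const b).ennreal_ofReal)).const_mul _
        · exact (hwm τ).const_mul _
        · have h1 := norm_powerNonlinearity_sub_le_of_norm_le hκ hb (z := U (T + τ) x)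
            (w := V (T + τ) x) (g.norm_coe_le_norm x)
          rw [← ofReal_norm]
          refine (ENNReal.ofReal_le_ofReal h1).trans (le_of_eq ?_)
          have hcb : 0 ≤ c x ^ b := Real.rpow_nonneg (hc0 x) b
          rw [ENNReal.ofReal_add (by positivity) (by positivity),
            ENNReal.ofReal_mul (by positivity), ENNReal.ofReal_mul hcb,
            ENNReal.ofReal_mul (p := (b + 1) * (4 * ‖g‖) ^ b) (by positivity)]
          simp only [hw, Pi.sub_apply, ofReal_norm]
          rw [mul_comm (ENNReal.ofReal (_ ^ b))]
        · rw [hD]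
          ring
  refine ⟨δ, lt_min (lt_min hδ₁ hδ₂) hδ₃, fun s hs => ?_⟩
  have hz := HasWeakBound.ae_eq_zero (fun k => key k s hs) (hwm s)
  refine AEEqFun.ext ?_
  filter_upwards [hz] with x hx
  simpa [hw, sub_eq_zero] using hx

end CriticalUniqueness

/-! ### The weighted classes in terms of pointwise bounds in time. -/

section WeightedClasses

variable {n : ℕ} {α b p : ℝ} {q : ℝ≥0∞} {𝕜 : Type*} [RCLike 𝕜]
  {U : ℝ → (EuclideanSpace ℝ (Fin n) →ₘ[volume] 𝕜)}

theorem IsLpPath.continuousInLp (h : IsLpPath p fun t => ⇑(U t)) :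
    ContinuousInLp (Set.Ioi 0) p U := by
  refine ⟨fun t ht => h.memLp t ht, fun t ht => ?_⟩
  simp only [eLpNorm_coe_sub]
  exact (h.tendsto t ht).mono_left nhdsWithin_le_nhds

theorem InWeighted.exists_eLpNorm_le (h : InWeighted q p U) : ∃ M : ℝ, ∀ t, 0 < t →
    eLpNorm (U t) (ENNReal.ofReal p) volume ≤ ENNReal.ofReal (M * t ^ (-(q⁻¹).toReal)) := by
  refine ⟨(⨆ t ∈ Set.Ioi (0 : ℝ), weightedNorm q p U t).toReal, fun t ht => ?_⟩
  rw [← ofReal_rpow_mul_le_iff ht, ENNReal.ofReal_toReal h.2.ne]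
  exact le_iSup₂_of_le t ht le_rfl

end WeightedClasses

/-! ### The theorem. -/

theorem theorem6p1 {𝕜 : Type*} [RCLike 𝕜] (n : ℕ) (α b p : ℝ) (q : ℝ≥0∞)
    (hα : 0 < α) (hb : 0 < b)
    (hadm : IsGeneralizedAdmissible n α q p (critExponent n α b))
    (hp : b + 1 < p) (hp' : p < critExponent n α b * (b + 1))
    (χ : EuclideanSpace ℝ (Fin n) → ℝ) (hχ : IsLittlewoodPaleyBump χ) :
    ∃ ε : ℝ, 0 < ε ∧
      ∀ κ : ℝ, (κ = 1 ∨ κ = -1) →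
      ∀ φ : EuclideanSpace ℝ (Fin n) → 𝕜,
        MemLp φ (ENNReal.ofReal (critExponent n α b)) volume →
        besovNorm χ (-(2 * α / b - n / p)) p φ ≤ ENNReal.ofReal ε →
        ∃ u : ℝ → (EuclideanSpace ℝ (Fin n) →ₘ[volume] 𝕜),
          (IsMildSolution α b κ φ u ∧
            ContinuousInLp (Set.Ici 0) (critExponent n α b) u ∧ InWeighted q p u) ∧
          (∀ v : ℝ → (EuclideanSpace ℝ (Fin n) →ₘ[volume] 𝕜),
            IsMildSolution α b κ φ v →
            ContinuousInLp (Set.Ici 0) (critExponent n α b) v → InWeighted q p v →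
            ∀ t : ℝ, 0 ≤ t → v t = u t) ∧
          (critExponent n α b < p → InWeightedDot q p u) := by
  obtain ⟨hq, hr1, hrp, -⟩ := hadm
  -- In dimension 0 the critical exponent would be 0, contradicting r₀ > 1.
  have hn : 0 < n := by
    rcases Nat.eq_zero_or_pos n with rfl | hn
    · simp only [critExponent, Nat.cast_zero, zero_mul, zero_div] at hr1
      linarith
    · exact hn
  have hp1 : 1 ≤ p := by linarith
  have hq0 : (q⁻¹).toReal = n / (2 * α) * (1 / critExponent n α b - 1 / p) := by
    rw [hq, ENNReal.toReal_ofReal]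
    exact mul_nonneg (by positivity)
      (sub_nonneg.2 (one_div_le_one_div_of_le (by linarith) hrp))
  rcases hrp.lt_or_eq with hlt | heq
  -- For p > r₀ the contraction is run with P = p and the weight 1/q itself.
  · have h : SubcriticalExponent n α b p (q⁻¹).toReal :=
      ⟨hn, hα, hb, hr1, hp, hlt, hp', hq0⟩
    obtain ⟨ε, R, hε, hR, H⟩ := h.exists_isSmallSolution_of_besovNorm 𝕜 hχ hp1 le_rfl rfl
    refine ⟨ε, hε, fun κ hκ φ hφ hbes => ?_⟩
    obtain ⟨u, hu⟩ := H κ hκ φ hφ hbes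
    have hw : InWeighted q p u := by
      refine ⟨hu.ball.path.continuousInLp, lt_of_le_of_lt ?_ (ENNReal.ofReal_lt_top (r := R))⟩
      exact iSup₂_le fun t ht => (ofReal_rpow_mul_le_iff ht).2 (hu.ball.bound t ht)
    refine ⟨u, ⟨hu.mild, hu.continuousInLp, hw⟩, fun v hv hvc hvw t ht => ?_,
      fun _ => ⟨hw, hu.tendsto⟩⟩
    obtain ⟨M, hM⟩ := hvw.exists_eLpNorm_le
    refine h.eq_of_isMildSolution hχ hκ hφ hv hu.mild hvc hu.continuousInLp hvw.1 hw.1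
      (M := max M R) (fun t ht => (hM t ht).trans (ENNReal.ofReal_le_ofReal ?_))
      (fun t ht => (hu.ball.bound t ht).trans (ENNReal.ofReal_le_ofReal ?_)) ht
    · exact mul_le_mul_of_nonneg_right (le_max_left _ _) (Real.rpow_nonneg ht.le _)
    · exact mul_le_mul_of_nonneg_right (le_max_right _ _) (Real.rpow_nonneg ht.le _)
  -- For p = r₀ the weight is trivial and smoothing from L^{p/(b+1)} to L^p would be singular of
  -- order 1. The solution is built with an auxiliary P > p, whose weighted class plays no role in
  -- uniqueness, and b + 1 < p = r₀ allows the weak-space argument.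
  · obtain ⟨P, hP, hP'⟩ := exists_between hp'
    have h : SubcriticalExponent n α b P (n / (2 * α) * (1 / critExponent n α b - 1 / P)) :=
      ⟨hn, hα, hb, hr1, hp.trans hP, heq.trans_lt hP, hP', rfl⟩
    obtain ⟨A, hK⟩ := hχ.exists_heatBounds hn hα
    obtain ⟨ε, R, hε, hR, H⟩ := h.exists_isSmallSolution_of_besovNorm 𝕜 hχ hp1 hP.le rfl
    refine ⟨ε, hε, fun κ hκ φ hφ hbes => ?_⟩
    obtain ⟨u, hu⟩ := H κ hκ φ hφ hbes
    refine ⟨u, ⟨hu.mild, hu.continuousInLp, ?_, ?_⟩, fun v hv hvc _ t ht =>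
      eq_of_isMildSolution_of_add_one_lt hK hn hα hb hκ (hp.trans_eq heq.symm) hv hu.mild hvc
        hu.continuousInLp ht, fun h => absurd heq h.ne⟩
    · rw [← heq]
      exact hu.continuousInLp.mono Set.Ioi_subset_Ici_self
    · obtain ⟨B, hB, hBb⟩ := hu.bounded
      refine lt_of_le_of_lt (iSup₂_le fun t ht => ?_) hB.lt_top
      rw [heq, sub_self, mul_zero] at hq0
      simp only [weightedNorm, hq0, Real.rpow_zero, ENNReal.ofReal_one, one_mul]
      rw [← heq]
      exact hBb t ht
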